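/- Let $T^1=\mathbb R/\mathbb Z$ and let $I\subset(0,+\infty)$ be an interval with non-empty interior; derivatives are in the sense of distributions on $I\times T^1$, and $M(T^1)$ denotes the bounded signed measures on $T^1$. A triple $(P,Q,\lambda)$ with $P,Q\in L^\infty_{loc}(I,H^1(T^1))$, $P_t,Q_t\in L^\infty_{loc}(I,L^2(T^1))$, $\lambda\in L^\infty_{loc}(I,W^{1,1}(T^1))$, $\lambda_t\in L^\infty_{loc}(I,L^1(T^1))$ is an **$H^1$-$W^{1,1}$ weak solution to the Gowdy equations** if $$P_{tt}-P_{\theta\theta}+\tfrac1t P_t=e^{2P}(Q_t^2-Q_\theta^2),\qquad Q_{tt}-Q_{\theta\theta}+\tfrac1tQ_t=-2(P_tQ_t-P_\theta Q_\theta),$$ $$\lambda_{tt}-\lambda_{\theta\theta}=-P_t^2+P_\theta^2+e^{2P}(-Q_t^2+Q_\theta^2)$$ hold in the sense of distributions and the constraint equations $$\tfrac1t\lambda_t=P_t^2+P_\theta^2+e^{2P}(Q_t^2+Q_\theta^2),\qquad \tfrac1t\lambda_\theta=2P_tP_\theta+2e^{2P}Q_tQ_\theta$$ hold almost everywhere.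 Set $\mu=\lambda+P$. A triple $(P,Q,\mu)$ with $P,Q$ as above, $\mu\in L^\infty_{loc}(I,BV(T^1))$ and $\mu_t\in L^\infty_{loc}(I,M(T^1))$ is an **$H^1$-$BV$ solution to Gowdy's evolution equations** if the first two equations above and $\mu_{tt}-\mu_{\theta\theta}+\tfrac1tP_t=-P_t^2+P_\theta^2$ hold in the sense of distributions. **Theorem.** (i) Let $(P^n,Q^n,\lambda^n)$ be a sequence of $H^1$-$W^{1,1}$ weak solutions to the Gowdy equations, let $\mu^n=\lambda^n+P^n$, and assume the energy bound $$\limsup_{n\to\infty}\big\|(P^n,Q^n,P^n_t,Q^n_t,P^n_\theta,Q^n_\theta)\big\|_{L^\infty([a,b],L^2(T^1))}<+\infty\qquad\text{for every compact }[a,b]\subset I.$$ Then there are a subsequence (still indexed by $n$), constants $c_n\in\mathbb R$, and an $H^1$-$BV$ solution $(P^\infty,Q^\infty,\mu^\infty)$ to Gowdy's evolution equations such that, for every compact $[a,b]\subset I$, $P^n\to P^\infty$ and $Q^n\to Q^\infty$ weakly in $H^1([a,b]\times T^1)$ and uniformly on $[a,b]\times T^1$ (up to null sets), while $\mu^n-c_n\to\mu^\infty$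 almost everywhere and in $L^1([a,b]\times T^1)$, and $\mu^n_t\to\mu^\infty_t$, $\mu^n_\theta\to\mu^\infty_\theta$ weakly-star in the sense of measures on $[a,b]\times T^1$. If the integrals of $\mu^n$ over $[a,b]\times T^1$ are bounded in $n$ for some $[a,b]\subset I$ with $a<b$, one can take $c_n=0$ for all $n$. Moreover, there are a constant $\kappa\in\mathbb R$ and a scalar field $\phi\in L^\infty_{loc}(I,BV(T^1))$, with $\phi_t\in L^\infty_{loc}(I,M(T^1))$, such that $\phi_{tt}-\phi_{\theta\theta}=0$ and, in place of the constraint equations, $$\tfrac1t\mu^\infty_t=\tfrac1tP^\infty_t+(P^\infty_t)^2+(P^\infty_\theta)^2+e^{2P^\infty}\big((Q^\infty_t)^2+(Q^\infty_\theta)^2\big)+\tfrac1t\phi_t,$$ $$\tfrac1t\mu^\infty_\theta=\tfrac1tP^\infty_\theta+2P^\infty_tP^\infty_\theta+2e^{2P^\infty}Q^\infty_tQ^\infty_\theta+\tfrac1t(\phi_\theta+\kappa),$$ in the sense of distributions. Here, for almost every $t\in I$, $$\kappa=-2t\int_{T^1}\big(P^\infty_tP^\infty_\theta+e^{2P^\infty}Q^\infty_tQ^\infty_\theta\big)(t,\theta)\,d\theta,$$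 so that $\kappa=0$ exactly when the limit satisfies the zero-momentum condition that this integral vanishes. (ii) The constraint equations are in general lost in the limit: on every such $I$ there is a sequence satisfying all the assumptions of (i) and converging as in (i) (without extraction, and with $c_n=0$) to a limit $(P^\infty,Q^\infty,\mu^\infty)$ for which the two equations above with $\phi=0$, $\kappa=0$ do not both hold. -/

import Mathlib

open MeasureTheory Filter Topology
open scoped ENNReal NNReal ContDiff

namespace Gowdy

/-- The one-torus `T¹ = ℝ / ℤ`, with its Lebesgue measure of total mass one. -/
abbrev Torus : Type := UnitAddCircle

/-- The space-time `J × T¹` over a set of times `J`. -/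
def cyl (J : Set ℝ) : Set (ℝ × Torus) := J ×ˢ Set.univ

/-- Classical time derivative of a function on `ℝ × T¹`. -/
noncomputable def partialT (ψ : ℝ × Torus → ℝ) (p : ℝ × Torus) : ℝ :=
  deriv (fun s : ℝ => ψ (s, p.2)) p.1

/-- Classical space derivative of a function on `ℝ × T¹`. -/
noncomputable def partialX (ψ : ℝ × Torus → ℝ) (p : ℝ × Torus) : ℝ :=
  deriv (fun x : ℝ => ψ (p.1, p.2 + (x : Torus))) 0

/-- The flat wave operator `ψ_tt - ψ_θθ` on smooth functions. -/
noncomputable def box (ψ : ℝ × Torus → ℝ) (p : ℝ × Torus) : ℝ :=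
  partialT (partialT ψ) p - partialX (partialX ψ) p

/-- Test functions: smooth functions on `ℝ × T¹` (their lift to `ℝ × ℝ` is smooth) with compact
support in `interior I × T¹`. -/
structure IsTestFunction (I : Set ℝ) (ψ : ℝ × Torus → ℝ) : Prop where
  smooth : ContDiff ℝ ∞ (fun q : ℝ × ℝ => ψ (q.1, (q.2 : Torus)))
  support : ∃ a b : ℝ, Set.Icc a b ⊆ interior I ∧
    ∀ t : ℝ, t ∉ Set.Icc a b → ∀ θ : Torus, ψ (t, θ) = 0

/-- `f ∈ L^∞_loc(I, L^p(T¹))`: on each compact interval of times contained in `I`, the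
`L^p(T¹)` norm of `f(t, ·)` is essentially bounded. -/
def LocBddLp (I : Set ℝ) (p : ℝ≥0∞) (f : ℝ × Torus → ℝ) : Prop :=
  AEStronglyMeasurable f (volume.restrict (cyl I)) ∧
  ∀ a b : ℝ, Set.Icc a b ⊆ I → ∃ C : ℝ≥0, ∀ᵐ t ∂(volume.restrict (Set.Icc a b)),
    eLpNorm (fun θ : Torus => f (t, θ)) p volume ≤ (C : ℝ≥0∞)

/-- `f ∈ L^∞_loc(I, W^{1,p}(T¹))` with `f_t ∈ L^∞_loc(I, L^p(T¹))`. The field is stored together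
with (representatives of) its distributional derivatives `dt` and `dx` on `I × T¹`, which are
determined by `val` up to a null set. -/
structure SobolevField (I : Set ℝ) (p : ℝ≥0∞) where
  val : ℝ × Torus → ℝ
  dt : ℝ × Torus → ℝ
  dx : ℝ × Torus → ℝ
  val_bdd : LocBddLp I p val
  dt_bdd : LocBddLp I p dt
  dx_bdd : LocBddLp I p dx
  weak_dt : ∀ ψ, IsTestFunction I ψ →
    ∫ z in cyl I, val z * partialT ψ z = - ∫ z in cyl I, dt z * ψ z
  weak_dx : ∀ ψ, IsTestFunction I ψ →
    ∫ z in cyl I, val z * partialX ψ z = - ∫ z in cyl I, dx z * ψ z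

/-- `f ∈ L^∞_loc(I, H¹(T¹))` with `f_t ∈ L^∞_loc(I, L²(T¹))`. -/
abbrev H1Field (I : Set ℝ) := SobolevField I 2

/-- `f ∈ L^∞_loc(I, W^{1,1}(T¹))` with `f_t ∈ L^∞_loc(I, L¹(T¹))`. -/
abbrev W11Field (I : Set ℝ) := SobolevField I 1

/-- `m ∈ L^∞_loc(I, M(T¹))`: a family of bounded signed measures on `T¹`, weakly-star measurable
in time, whose total variation is essentially bounded on each compact interval of times
contained in `I`. -/
def LocBddMeasure (I : Set ℝ) (m : ℝ → SignedMeasure Torus) : Prop :=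
  (∀ g : C(Torus, ℝ), AEMeasurable (fun t : ℝ => ∫ᵛ θ, g θ ∂<•(m t)) (volume.restrict I)) ∧
  ∀ a b : ℝ, Set.Icc a b ⊆ I → ∃ C : ℝ≥0, ∀ᵐ t ∂(volume.restrict (Set.Icc a b)),
    (m t).variation Set.univ ≤ (C : ℝ≥0∞)

/-- The space-time integral `∫_J ∫_{T¹} ψ(t, θ) dm_t(θ) dt`. -/
noncomputable def pairing (J : Set ℝ) (m : ℝ → SignedMeasure Torus) (ψ : ℝ × Torus → ℝ) : ℝ :=
  ∫ t in J, ∫ᵛ θ, ψ (t, θ) ∂<•(m t)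

/-- `f ∈ L^∞_loc(I, BV(T¹))` with `f_t ∈ L^∞_loc(I, M(T¹))`: the distributional derivatives
`dt` and `dx` on `I × T¹` are bounded measures on `T¹` at almost every time. -/
structure BVField (I : Set ℝ) where
  val : ℝ × Torus → ℝ
  dt : ℝ → SignedMeasure Torus
  dx : ℝ → SignedMeasure Torus
  val_bdd : LocBddLp I 1 val
  dt_bdd : LocBddMeasure I dt
  dx_bdd : LocBddMeasure I dx
  weak_dt : ∀ ψ, IsTestFunction I ψ →
    ∫ z in cyl I, val z * partialT ψ z = - pairing I dt ψ
  weak_dx : ∀ ψ, IsTestFunction I ψ →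
    ∫ z in cyl I, val z * partialX ψ z = - pairing I dx ψ

/-- `f_tt - f_θθ = s` on `I × T¹` in the sense of distributions. -/
def WaveEq (I : Set ℝ) (f s : ℝ × Torus → ℝ) : Prop :=
  ∀ ψ, IsTestFunction I ψ → ∫ z in cyl I, f z * box ψ z = ∫ z in cyl I, s z * ψ z

/-- `P_t² + P_θ² + e^{2P} (Q_t² + Q_θ²)`. -/
noncomputable def energyDensity {I : Set ℝ} (P Q : H1Field I) (z : ℝ × Torus) : ℝ :=
  P.dt z ^ 2 + P.dx z ^ 2 + Real.exp (2 * P.val z) * (Q.dt z ^ 2 + Q.dx z ^ 2)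

/-- `P_t P_θ + e^{2P} Q_t Q_θ`. -/
noncomputable def momentumDensity {I : Set ℝ} (P Q : H1Field I) (z : ℝ × Torus) : ℝ :=
  P.dt z * P.dx z + Real.exp (2 * P.val z) * (Q.dt z * Q.dx z)

/-- The essential Gowdy equations, in the sense of distributions:
`P_tt - P_θθ + P_t / t = e^{2P} (Q_t² - Q_θ²)` and
`Q_tt - Q_θθ + Q_t / t = -2 (P_t Q_t - P_θ Q_θ)`. -/
def EssentialEquations {I : Set ℝ} (P Q : H1Field I) : Prop :=
  WaveEq I P.val (fun z =>
    Real.exp (2 * P.val z) * (Q.dt z ^ 2 - Q.dx z ^ 2) - P.dt z / z.1) ∧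
  WaveEq I Q.val (fun z =>
    -2 * (P.dt z * Q.dt z - P.dx z * Q.dx z) - Q.dt z / z.1)

/-- `(P, Q, lam)` is an `H¹`-`W^{1,1}` weak solution to the full set of Gowdy equations: the
evolution equations hold in the sense of distributions, and the constraint equations
`lam_t / t = P_t² + P_θ² + e^{2P} (Q_t² + Q_θ²)` and
`lam_θ / t = 2 P_t P_θ + 2 e^{2P} Q_t Q_θ` hold almost everywhere. -/
structure IsGowdySolution {I : Set ℝ} (P Q : H1Field I) (lam : W11Field I) : Prop where
  essential : EssentialEquations P Q
  evolution : WaveEq I lam.val (fun z =>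
    -(P.dt z ^ 2) + P.dx z ^ 2 + Real.exp (2 * P.val z) * (-(Q.dt z ^ 2) + Q.dx z ^ 2))
  constraint_t : ∀ᵐ z ∂(volume.restrict (cyl I)), 1 / z.1 * lam.dt z = energyDensity P Q z
  constraint_x : ∀ᵐ z ∂(volume.restrict (cyl I)), 1 / z.1 * lam.dx z = 2 * momentumDensity P Q z

/-- `(P, Q, mu)` is an `H¹`-`BV` weak solution to Gowdy's evolution equations, the third one being
`mu_tt - mu_θθ + P_t / t = -P_t² + P_θ²`. -/
structure IsH1BVSolution {I : Set ℝ} (P Q : H1Field I) (mu : BVField I) : Prop where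
  essential : EssentialEquations P Q
  evolution : WaveEq I mu.val (fun z => -(P.dt z ^ 2) + P.dx z ^ 2 - P.dt z / z.1)

/-- The uniform energy bound on compact intervals of times `[a, b] ⊆ I`: the upper limit of the
`L^∞([a, b], L²(T¹))` norms of `Pⁿ, Qⁿ` and their first-order derivatives is finite. -/
def EnergyBound {I : Set ℝ} (P Q : ℕ → H1Field I) : Prop :=
  ∀ a b : ℝ, Set.Icc a b ⊆ I → ∃ C : ℝ≥0, ∀ᶠ n in atTop,
    ∀ f ∈ [(P n).val, (Q n).val, (P n).dt, (Q n).dt, (P n).dx, (Q n).dx],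
      ∀ᵐ t ∂(volume.restrict (Set.Icc a b)),
        eLpNorm (fun θ : Torus => f (t, θ)) 2 volume ≤ (C : ℝ≥0∞)

/-- Weak convergence in `L²(J × T¹)`. -/
def WeakL2 (J : Set ℝ) (f : ℕ → ℝ × Torus → ℝ) (g : ℝ × Torus → ℝ) : Prop :=
  ∀ h : ℝ × Torus → ℝ, MemLp h 2 (volume.restrict (cyl J)) →
    Tendsto (fun n => ∫ z in cyl J, f n z * h z) atTop (𝓝 (∫ z in cyl J, g z * h z))

/-- Convergence in `L^p(J × T¹)`. -/
def StrongLp (J : Set ℝ) (p : ℝ≥0∞) (f : ℕ → ℝ × Torus → ℝ) (g : ℝ × Torus → ℝ) : Prop :=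
  Tendsto (fun n => eLpNorm (fun z => f n z - g z) p (volume.restrict (cyl J))) atTop (𝓝 0)

/-- Weak-star convergence in the sense of measures on `J × T¹`. -/
def WeakStarMeasure (J : Set ℝ) (f : ℕ → ℝ × Torus → ℝ) (m : ℝ → SignedMeasure Torus) : Prop :=
  ∀ ψ : ℝ × Torus → ℝ, Continuous ψ →
    Tendsto (fun n => ∫ z in cyl J, f n z * ψ z) atTop (𝓝 (pairing J m ψ))

/-- Local convergence in time of `H¹` fields: weakly in `H¹([a, b] × T¹)` and uniformly on
`[a, b] × T¹`, for every compact interval `[a, b] ⊆ I`. -/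
def H1Converges {I : Set ℝ} (F : ℕ → H1Field I) (G : H1Field I) : Prop :=
  ∀ a b : ℝ, Set.Icc a b ⊆ I →
    WeakL2 (Set.Icc a b) (fun n => (F n).val) G.val ∧
    WeakL2 (Set.Icc a b) (fun n => (F n).dt) G.dt ∧
    WeakL2 (Set.Icc a b) (fun n => (F n).dx) G.dx ∧
    StrongLp (Set.Icc a b) ⊤ (fun n => (F n).val) G.val

/-- Convergence of the functions `muⁿ - cₙ`, where `muⁿ = lamⁿ + Pⁿ` and the `cₙ` are constants,
to a `BV` field: almost everywhere and in `L¹([a, b] × T¹)`, with weak-star convergence of the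
first-order derivatives in the sense of measures on `[a, b] × T¹`, for every `[a, b] ⊆ I`. -/
def MuConverges {I : Set ℝ} (P : ℕ → H1Field I) (lam : ℕ → W11Field I) (c : ℕ → ℝ)
    (mu : BVField I) : Prop :=
  (∀ᵐ z ∂(volume.restrict (cyl I)),
    Tendsto (fun n => (lam n).val z + (P n).val z - c n) atTop (𝓝 (mu.val z))) ∧
  ∀ a b : ℝ, Set.Icc a b ⊆ I →
    StrongLp (Set.Icc a b) 1 (fun n z => (lam n).val z + (P n).val z - c n) mu.val ∧
    WeakStarMeasure (Set.Icc a b) (fun n z => (lam n).dt z + (P n).dt z) mu.dt ∧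
    WeakStarMeasure (Set.Icc a b) (fun n z => (lam n).dx z + (P n).dx z) mu.dx

/-- The space-time averages of `muⁿ = lamⁿ + Pⁿ` over some `[a, b] × T¹` are bounded. -/
def BoundedAverages {I : Set ℝ} (P : ℕ → H1Field I) (lam : ℕ → W11Field I) : Prop :=
  ∃ a b : ℝ, a < b ∧ Set.Icc a b ⊆ I ∧ ∃ M : ℝ, ∀ n,
    |∫ z in cyl (Set.Icc a b), ((lam n).val z + (P n).val z)| ≤ M

/-- The constraint equations for `mu`, with additional source terms `S₀`, `S₁`, in the sense of
distributions on `I × T¹`: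
`mu_t / t = P_t / t + P_t² + P_θ² + e^{2P} (Q_t² + Q_θ²) + S₀` and
`mu_θ / t = P_θ / t + 2 P_t P_θ + 2 e^{2P} Q_t Q_θ + S₁`. -/
def ConstraintsWithSources {I : Set ℝ} (P Q : H1Field I) (mu : BVField I)
    (S₀ S₁ : (ℝ × Torus → ℝ) → ℝ) : Prop :=
  ∀ ψ, IsTestFunction I ψ →
    pairing I mu.dt (fun z => 1 / z.1 * ψ z) =
      (∫ z in cyl I, (1 / z.1 * P.dt z + energyDensity P Q z) * ψ z) + S₀ ψ ∧
    pairing I mu.dx (fun z => 1 / z.1 * ψ z) =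
      (∫ z in cyl I, (1 / z.1 * P.dx z + 2 * momentumDensity P Q z) * ψ z) + S₁ ψ

/-- The constraint equations for `mu = lam + P`, without additional terms. -/
def Constraints {I : Set ℝ} (P Q : H1Field I) (mu : BVField I) : Prop :=
  ConstraintsWithSources P Q mu (fun _ => 0) (fun _ => 0)

/-- The constraint equations with the additional terms `φ_t / t` and `(φ_θ + κ) / t`. -/
def DefectConstraints {I : Set ℝ} (P Q : H1Field I) (mu φ : BVField I) (κ : ℝ) : Prop :=
  ConstraintsWithSources P Q mu
    (fun ψ => pairing I φ.dt (fun z => 1 / z.1 * ψ z))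
    (fun ψ => pairing I φ.dx (fun z => 1 / z.1 * ψ z) + ∫ z in cyl I, κ / z.1 * ψ z)

end Gowdy

/-!
# Weak limits of solutions of the Gowdy equations

**Products along characteristics.** A function with an integrable weak derivative along the lines
`θ = y + c t` is absolutely continuous on almost all of them (`WeakDir.lineAC`). For `c = ±1`, the
wave equations for `P` and `Q` are transport equations for `P_t - c P_θ` and `Q_t - c Q_θ` with
integrable sources (`waveEq_iff_weakDir`), so that along almost every characteristic the classical
product and chain rules apply to these functions, although products such as `P_t Q_t` have no
integrable derivatives in general. This replaces any regularisation of the solutions.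

**Null forms pass to the limit.** Sequences bounded in energy converge weakly in `H¹` and uniformly,
after extraction (`UH1.exists_limit`): each Fourier mode in space is controlled through its time
derivative and the high modes are uniformly small. Products of derivatives require more.
The Jacobian identity `integral_jacobian` puts the equation for `Q` in the divergence form
`(e^{2P} Q_t)_t - (e^{2P} Q_θ)_θ + e^{2P} Q_t / t = 0` (`waveEq_iff_divergence`), each term of which is
a product of a uniform and a weak limit. Tested with a multiple of `Q`, it expresses
`e^{2P} (Q_t² - Q_θ²)` through such products (`integral_nullQ`), hence this null form converges
(`tendsto_nullQ`), and the limit satisfies the equations for `P` and `Q` (`limit_essential`). The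
equation for `P`, tested with a multiple of `P`, then gives the convergence of `P_t² - P_θ²`
(`tendsto_nullP`).

**Defect measures are transported.** For `c = ±1` the null energy
`E_c = t ((P_t - c P_θ)² + e^{2P} (Q_t - c Q_θ)²)` satisfies
`(∂_t + c ∂_θ) E_c = -(P_t² - P_θ²) - e^{2P} (Q_t² - Q_θ²)` (`weakDir_nullEnergy`). The energies are
not continuous under weak convergence, but their sources are, by the above. The defect of `E_c` is
therefore a measure transported without source along the lines `θ = y + c t`, i.e. it is given by one
measure on the circle (`exists_defect`).

**The constraint equations.** By the constraints for `λⁿ`, the half sum and the half difference of the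
null energies are `λ_t` and `-λ_θ`, so `μⁿ_t` and `μⁿ_θ` converge to the expected expressions
corrected by the half sum and the half difference of two transported measures. These corrections are
the derivatives of a solution `φ` of the homogeneous wave equation (`wave`), except that `φ_θ` must
have zero mean on the circle: the mean of the correction is the constant `κ` (`waveMean`), which is
computed by integrating the equation for `μ_θ` in space (`waveMean_eq`). The compactness of `μⁿ - cₙ`
in `L¹` follows from the bounds on its derivatives (`exists_strong_limit`).

**Loss of the constraints.** For `Q = 0` and `P = a(t) cos (2 π k θ)`, where `a` is a rescaled Bessel
function, `λ` is explicit. The energy `e = a'² + (2 π k)² a²` is nonincreasing and `t² e` is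
nondecreasing, so, normalised to `e = 1` at some time, these solutions are bounded in energy and tend
uniformly to zero as `k → ∞`, while the mean of `λ_t`, which equals `t e / 2`, stays bounded below on
compact intervals of later times (`exists_loss_of_constraints`).
-/

namespace Gowdy

open scoped Real
open Set (Icc Ioi univ)

variable {I : Set ℝ}

/-! ### Fourier series on the torus -/

open AddCircle in
lemma haar_eq_volume : (haarAddCircle : Measure Torus) = volume := by
  rw [volume_eq_smul_haarAddCircle]; simp

instance : IsProbabilityMeasure (volume : Measure Torus) := by
  rw [← haar_eq_volume]; infer_instance

lemma fourierCoeff_eq (f : Torus → ℂ) (k : ℤ) :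
    fourierCoeff f k = ∫ θ, fourier (-k) θ * f θ := by
  rw [fourierCoeff, haar_eq_volume]; rfl

lemma integrable_continuousMap_mul (g : C(Torus, ℂ)) {f : Torus → ℂ} (hf : Integrable f) :
    Integrable (fun θ => g θ * f θ) :=
  hf.bdd_mul (c := ‖g‖) g.continuous.aestronglyMeasurable
    (Eventually.of_forall fun θ => g.norm_coe_le_norm θ)

/-- The Fourier coefficients determine an integrable function. -/
lemma ae_eq_zero_of_fourierCoeff {f : Torus → ℂ} (hf : Integrable f)
    (h : ∀ k, fourierCoeff f k = 0) : f =ᵐ[volume] 0 := by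
  -- the functional `g ↦ ∫ g f` vanishes on the span of the monomials, hence on `C(T¹)`
  have key : ∀ g : C(Torus, ℂ), ∫ θ, g θ * f θ = 0 := by
    let ℓ : C(Torus, ℂ) →L[ℂ] ℂ := LinearMap.mkContinuous
      { toFun := fun g => ∫ θ, g θ * f θ
        map_add' := fun g₁ g₂ => by
          simp only [ContinuousMap.add_apply, add_mul]
          exact integral_add (integrable_continuousMap_mul g₁ hf)
            (integrable_continuousMap_mul g₂ hf)
        map_smul' := fun c g => by
          simp only [ContinuousMap.smul_apply, smul_eq_mul, mul_assoc, RingHom.id_apply]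
          rw [integral_const_mul] }
      (∫ θ, ‖f θ‖) (fun g => by
        simp only [LinearMap.coe_mk, AddHom.coe_mk]
        calc ‖∫ θ, g θ * f θ‖ ≤ ∫ θ, ‖g‖ * ‖f θ‖ := by
              refine norm_integral_le_of_norm_le (hf.norm.const_mul _)
                (Eventually.of_forall fun θ => ?_)
              rw [norm_mul]
              exact mul_le_mul_of_nonneg_right (g.norm_coe_le_norm θ) (norm_nonneg _)
          _ = _ := by rw [integral_const_mul, mul_comm])
    have hker : Submodule.span ℂ (Set.range (fourier (T := (1 : ℝ)))) ≤ LinearMap.ker ℓ.toLinearMap := by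
      rw [Submodule.span_le]
      rintro _ ⟨k, rfl⟩
      have := h (-k)
      rw [fourierCoeff_eq, neg_neg] at this
      exact this
    have hcl : IsClosed (LinearMap.ker ℓ.toLinearMap : Set C(Torus, ℂ)) := ℓ.isClosed_ker
    have := Submodule.topologicalClosure_minimal _ hker hcl
    rw [span_fourier_closure_eq_top] at this
    intro g
    exact this (Submodule.mem_top (x := g))
  apply ae_eq_zero_of_forall_setIntegral_isClosed_eq_zero hf
  intro s hs
  -- indicators of closed sets are bounded limits of continuous functions
  have hpos : ∀ n : ℕ, (0 : ℝ) < 1 / (n + 1) := fun n => Nat.one_div_pos_of_nat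
  have hlim := thickenedIndicator_tendsto_indicator_closure hpos
    tendsto_one_div_add_atTop_nhds_zero_nat s
  rw [tendsto_pi_nhds] at hlim
  let G : ℕ → C(Torus, ℂ) := fun n =>
    ⟨fun θ => ((thickenedIndicator (hpos n) s θ : ℝ≥0) : ℂ), by fun_prop⟩
  have h1 : Tendsto (fun n => ∫ θ, G n θ * f θ) atTop (𝓝 (∫ θ in s, f θ)) := by
    rw [← integral_indicator hs.measurableSet]
    refine tendsto_integral_of_dominated_convergence (fun θ => ‖f θ‖)
      (fun n => (integrable_continuousMap_mul (G n) hf).aestronglyMeasurable) hf.norm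
      (fun n => Eventually.of_forall fun θ => ?_) (Eventually.of_forall fun θ => ?_)
    · rw [norm_mul]
      refine mul_le_of_le_one_left (norm_nonneg _) ?_
      simpa [G] using thickenedIndicator_le_one (hpos n) s θ
    · have h2 : Tendsto (fun n => ((thickenedIndicator (hpos n) s θ : ℝ≥0) : ℂ)) atTop
          (𝓝 (((closure s).indicator (fun _ => (1 : ℝ≥0)) θ : ℝ≥0) : ℂ)) := by
        exact ((Complex.continuous_ofReal.comp NNReal.continuous_coe).tendsto _).comp (hlim θ)
      rw [hs.closure_eq] at h2
      have h3 := h2.mul_const (f θ)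
      have h4 : s.indicator f θ = ((s.indicator (fun _ => (1 : ℝ≥0)) θ : ℝ≥0) : ℂ) * f θ := by
        by_cases hθ : θ ∈ s <;> simp [hθ]
      rw [h4]
      exact h3
  simp only [key] at h1
  exact tendsto_nhds_unique h1 tendsto_const_nhds |>.symm ▸ rfl

lemma ae_eq_of_fourierCoeff {f g : Torus → ℂ} (hf : Integrable f) (hg : Integrable g)
    (h : ∀ k, fourierCoeff f k = fourierCoeff g k) : f =ᵐ[volume] g := by
  have : f - g =ᵐ[volume] 0 := by
    apply ae_eq_zero_of_fourierCoeff (hf.sub hg)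
    intro k
    have h1 := h k
    rw [fourierCoeff_eq, fourierCoeff_eq] at h1
    rw [fourierCoeff_eq]
    simp only [Pi.sub_apply, mul_sub]
    rw [integral_sub (integrable_continuousMap_mul _ hf) (integrable_continuousMap_mul _ hg), h1,
      sub_self]
  filter_upwards [this] with θ hθ
  simpa [sub_eq_zero] using hθ

lemma hasSum_inner_fourierCoeff {f g : Torus → ℂ} (hf : MemLp f 2) (hg : MemLp g 2) :
    HasSum (fun k => (starRingEnd ℂ) (fourierCoeff f k) * fourierCoeff g k)
      (∫ θ, (starRingEnd ℂ) (f θ) * g θ) := by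
  have hf' := hf.haarAddCircle
  have hg' := hg.haarAddCircle
  have h := (fourierBasis (T := (1 : ℝ))).hasSum_inner_mul_inner hf'.toLp hg'.toLp
  convert! h using 1
  · ext k
    rw [← inner_conj_symm (hf'.toLp), ← (fourierBasis (T := (1 : ℝ))).repr_apply_apply,
      ← (fourierBasis (T := (1 : ℝ))).repr_apply_apply, fourierBasis_repr, fourierBasis_repr,
      fourierCoeff_congr_ae hf'.coeFn_toLp, fourierCoeff_congr_ae hg'.coeFn_toLp]
  · rw [MeasureTheory.L2.inner_def, ← haar_eq_volume]
    apply integral_congr_ae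
    filter_upwards [hf'.coeFn_toLp, hg'.coeFn_toLp] with θ h1 h2
    rw [h1, h2, RCLike.inner_apply']

lemma hasSum_sq_fourierCoeff_of_memLp {f : Torus → ℂ} (hf : MemLp f 2) :
    HasSum (fun k => ‖fourierCoeff f k‖ ^ 2) (∫ θ, ‖f θ‖ ^ 2) := by
  have hf' := hf.haarAddCircle
  convert hasSum_sq_fourierCoeff hf'.toLp using 1
  · ext k
    rw [fourierCoeff_congr_ae hf'.coeFn_toLp]
  · rw [← haar_eq_volume]
    apply integral_congr_ae
    filter_upwards [hf'.coeFn_toLp] with θ h1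
    rw [h1]

/-- An integrable function with square summable Fourier coefficients is square integrable. -/
lemma memLp_two_of_summable {f : Torus → ℂ} (hf : Integrable f)
    (h : Summable fun k => ‖fourierCoeff f k‖ ^ 2) : MemLp f 2 := by
  have hmem : Memℓp (fun k => fourierCoeff f k) 2 := by
    apply memℓp_gen
    simpa using h
  let g := (fourierBasis (T := (1 : ℝ))).repr.symm ⟨_, hmem⟩
  have hg : MemLp (g : Torus → ℂ) 2 := (Lp.memLp g).of_haarAddCircle
  have hfg : f =ᵐ[volume] g := by
    refine ae_eq_of_fourierCoeff hf (hg.integrable (by norm_num)) fun k => ?_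
    rw [← fourierBasis_repr]
    simp [g]
  exact hg.ae_eq hfg.symm

/-- If the Fourier coefficients are summable, the error of the partial sums is bounded by the tail
of the series of the coefficients. -/
lemma ae_norm_sub_sum_fourier_le {f : Torus → ℂ} (hf : Integrable f)
    (h : Summable fun k => ‖fourierCoeff f k‖) :
    ∀ᵐ θ : Torus, ∀ s : Finset ℤ, ‖f θ - ∑ k ∈ s, fourierCoeff f k * fourier k θ‖
      ≤ ∑' k : {k // k ∉ s}, ‖fourierCoeff f k‖ := by
  have hs : Summable (fun k => fourierCoeff f k • (fourier k : C(Torus, ℂ))) := by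
    apply Summable.of_norm
    simpa [norm_smul, fourier_norm] using h
  let g : C(Torus, ℂ) := ∑' k, fourierCoeff f k • (fourier k : C(Torus, ℂ))
  have hgs : HasSum (fun k => fourierCoeff f k • (fourier k : C(Torus, ℂ))) g := hs.hasSum
  have hgi : ∀ g : C(Torus, ℂ), Integrable (fun θ => g θ) := fun g =>
    (integrable_continuousMap_mul g (integrable_const (1 : ℂ))).congr
      (Eventually.of_forall fun θ => by simp)
  have hcoef : ∀ m, fourierCoeff g m = fourierCoeff f m := by
    intro m
    let ℓ : C(Torus, ℂ) →L[ℂ] ℂ := LinearMap.mkContinuous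
      { toFun := fun g => ∫ θ, fourier (-m) θ * g θ
        map_add' := fun g₁ g₂ => by
          simp only [ContinuousMap.add_apply, mul_add]
          exact integral_add (integrable_continuousMap_mul _ (hgi g₁))
            (integrable_continuousMap_mul _ (hgi g₂))
        map_smul' := fun c g => by
          simp only [ContinuousMap.smul_apply, smul_eq_mul, RingHom.id_apply]
          rw [← integral_const_mul]
          congr 1; ext θ; ring }
      1 (fun g => by
        simp only [LinearMap.coe_mk, AddHom.coe_mk]
        calc ‖∫ θ, fourier (-m) θ * g θ‖ ≤ ∫ θ : Torus, ‖g‖ := by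
              refine norm_integral_le_of_norm_le (integrable_const _)
                (Eventually.of_forall fun θ => ?_)
              rw [norm_mul, fourier_apply, Circle.norm_coe, one_mul]
              exact g.norm_coe_le_norm θ
          _ = _ := by simp)
    have h1 := hgs.mapL ℓ
    have h2 : ∀ k, ℓ (fourierCoeff f k • (fourier k : C(Torus, ℂ)))
        = if k = m then fourierCoeff f m else 0 := by
      intro k
      have h3 : ℓ (fourier k) = fourierCoeff (fourier k : C(Torus, ℂ)) m :=
        (fourierCoeff_eq _ _).symm
      rw [map_smul, h3, fourierCoeff_fourier]
      by_cases hk : k = m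
      · subst hk; simp
      · have : ¬ m = k := fun h => hk h.symm
        simp [hk, this]
    simp only [h2] at h1
    have h4 : ℓ g = fourierCoeff g m := (fourierCoeff_eq _ _).symm
    rw [← h4]
    exact h1.unique (hasSum_ite_eq m _)
  have hfg : f =ᵐ[volume] g := ae_eq_of_fourierCoeff hf (hgi g) fun k => (hcoef k).symm
  filter_upwards [hfg] with θ hθ s
  have h5 : HasSum (fun k => fourierCoeff f k * fourier k θ) (f θ) := by
    rw [hθ]
    have := (ContinuousMap.evalCLM ℂ θ).hasSum hgs
    simpa using this
  have h6 : f θ - ∑ k ∈ s, fourierCoeff f k * fourier k θ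
      = ∑' k : {k // k ∉ s}, fourierCoeff f k * fourier k θ := by
    rw [← h5.tsum_eq, ← h5.summable.sum_add_tsum_subtype_compl s]; ring
  rw [h6]
  have h7 : ∀ k : ℤ, ‖fourierCoeff f k * fourier k θ‖ = ‖fourierCoeff f k‖ := fun k => by
    rw [norm_mul, fourier_apply, Circle.norm_coe, mul_one]
  have h8 : Summable fun k : {k // k ∉ s} => ‖fourierCoeff f k * fourier (k : ℤ) θ‖ := by
    simp only [h7]
    exact h.subtype _
  refine (norm_tsum_le_tsum_norm h8).trans ?_
  simp only [h7]
  exact le_rfl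

/-! ### Integration over cylinders -/

lemma restrict_cyl (J : Set ℝ) :
    (volume : Measure (ℝ × Torus)).restrict (cyl J) = (volume.restrict J).prod volume := by
  rw [cyl, Measure.volume_eq_prod, ← Measure.prod_restrict, Measure.restrict_univ]

lemma measurableSet_cyl {J : Set ℝ} (hJ : MeasurableSet J) : MeasurableSet (cyl J) :=
  hJ.prod MeasurableSet.univ

lemma cyl_mono {J K : Set ℝ} (h : J ⊆ K) : cyl J ⊆ cyl K := Set.prod_mono h subset_rfl

@[simp] lemma mem_cyl {J : Set ℝ} {z : ℝ × Torus} : z ∈ cyl J ↔ z.1 ∈ J := by simp [cyl]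

lemma setIntegral_cyl {E : Type*} [NormedAddCommGroup E] [NormedSpace ℝ E] {J : Set ℝ}
    {f : ℝ × Torus → E} (hf : IntegrableOn f (cyl J)) :
    ∫ z in cyl J, f z = ∫ t in J, ∫ θ, f (t, θ) := by
  rw [IntegrableOn, restrict_cyl] at hf
  rw [restrict_cyl, integral_prod _ hf]

lemma ae_slice {J : Set ℝ} {p : ℝ × Torus → Prop} (h : ∀ᵐ z ∂(volume.restrict (cyl J)), p z) :
    ∀ᵐ t ∂(volume.restrict J), ∀ᵐ θ : Torus, p (t, θ) := by
  rw [restrict_cyl] at h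
  exact Measure.ae_ae_of_ae_prod h

lemma ae_slice' {J : Set ℝ} {p : ℝ × Torus → Prop} (h : ∀ᵐ z ∂(volume.restrict (cyl J)), p z) :
    ∀ᵐ θ : Torus, ∀ᵐ t ∂(volume.restrict J), p (t, θ) := by
  rw [restrict_cyl] at h
  exact Measure.ae_ae_of_ae_prod ((Measure.measurePreserving_swap
    (μ := volume) (ν := volume.restrict J)).quasiMeasurePreserving.ae h)

lemma restrict_cyl_mono {J K : Set ℝ} (h : J ⊆ K) :
    (volume : Measure (ℝ × Torus)).restrict (cyl J) ≤ volume.restrict (cyl K) :=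
  Measure.restrict_mono (cyl_mono h) le_rfl

lemma setIntegral_cyl_eq_of_support {E : Type*} [NormedAddCommGroup E] [NormedSpace ℝ E]
    {I J : Set ℝ} (hI : MeasurableSet I) (h : J ⊆ I)
    {f : ℝ × Torus → E} (hf : ∀ t, t ∉ J → ∀ θ, f (t, θ) = 0) :
    ∫ z in cyl I, f z = ∫ z in cyl J, f z :=
  setIntegral_eq_of_subset_of_forall_sdiff_eq_zero (measurableSet_cyl hI) (cyl_mono h)
    fun z hz => hf z.1 (fun hz' => hz.2 (by simpa using hz')) z.2

lemma integrableOn_cyl_of_support {E : Type*} [NormedAddCommGroup E]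
    {I J : Set ℝ} (hJ : MeasurableSet J)
    {f : ℝ × Torus → E} (hf : ∀ t, t ∉ J → ∀ θ, f (t, θ) = 0) (hi : IntegrableOn f (cyl J)) :
    IntegrableOn f (cyl I) := by
  have : (cyl J).indicator f = f := by
    ext z
    by_cases hz : z ∈ cyl J
    · simp [hz]
    · rw [Set.indicator_of_notMem hz]
      exact (hf z.1 (by simpa using hz) z.2).symm
  rw [← this]
  exact ((integrable_indicator_iff (measurableSet_cyl hJ)).2 hi).integrableOn

instance isFiniteMeasure_cyl_Icc (a b : ℝ) :
    IsFiniteMeasure ((volume : Measure (ℝ × Torus)).restrict (cyl (Icc a b))) := by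
  rw [restrict_cyl]; infer_instance

lemma isCompact_cyl_Icc (a b : ℝ) : IsCompact (cyl (Icc a b)) :=
  isCompact_Icc.prod isCompact_univ

/-- An interval is exhausted by an increasing sequence of compact intervals, each compact
subinterval being contained in one of them. -/
lemma exists_exhaustion (hI : I.OrdConnected) (hne : I.Nonempty) :
    ∃ a b : ℕ → ℝ, Antitone a ∧ Monotone b ∧ (∀ n, Icc (a n) (b n) ⊆ I) ∧
      (∀ x y, Icc x y ⊆ I → ∃ n, Icc x y ⊆ Icc (a n) (b n)) := by
  have := hI
  have : Nonempty I := hne.to_subtype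
  obtain ⟨b, hb, hb'⟩ := exists_seq_monotone_tendsto_atTop_atTop I
  obtain ⟨a, ha, ha'⟩ := exists_seq_antitone_tendsto_atTop_atBot I
  refine ⟨fun n => a n, fun n => b n, fun m n h => ha h, fun m n h => hb h,
    fun n => hI.out (a n).2 (b n).2, fun x y hxy => ?_⟩
  by_cases h : x ≤ y
  · have hx : x ∈ I := hxy ⟨le_rfl, h⟩
    have hy : y ∈ I := hxy ⟨h, le_rfl⟩
    have h1 := ha'.eventually (eventually_le_atBot (⟨x, hx⟩ : I))
    have h2 := hb'.eventually (eventually_ge_atTop (⟨y, hy⟩ : I))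
    obtain ⟨n, h3, h4⟩ := (h1.and h2).exists
    exact ⟨n, Set.Icc_subset_Icc h3 h4⟩
  · exact ⟨0, by rw [Set.Icc_eq_empty h]; exact Set.empty_subset _⟩

lemma ae_of_forall_Icc (hI : I.OrdConnected) {p : ℝ → Prop}
    (h : ∀ a b, Icc a b ⊆ I → ∀ᵐ t ∂volume.restrict (Icc a b), p t) :
    ∀ᵐ t ∂volume.restrict I, p t := by
  rcases I.eq_empty_or_nonempty with rfl | hne
  · simp
  obtain ⟨a, b, -, -, hab, hex⟩ := exists_exhaustion hI hne
  have hsub : I ⊆ ⋃ n, Icc (a n) (b n) := fun x hx => by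
    obtain ⟨n, hn⟩ := hex x x (by simpa using hx)
    exact Set.mem_iUnion.2 ⟨n, hn ⟨le_rfl, le_rfl⟩⟩
  exact ae_restrict_of_ae_restrict_of_subset hsub
    ((ae_restrict_iUnion_iff _ _).2 fun n => h _ _ (hab n))

lemma ae_cyl_of_forall_Icc (hI : I.OrdConnected) {p : ℝ × Torus → Prop}
    (h : ∀ a b, Icc a b ⊆ I → ∀ᵐ z ∂volume.restrict (cyl (Icc a b)), p z) :
    ∀ᵐ z ∂volume.restrict (cyl I), p z := by
  rcases I.eq_empty_or_nonempty with rfl | hne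
  · simp [cyl]
  obtain ⟨a, b, -, -, hab, hex⟩ := exists_exhaustion hI hne
  have hsub : cyl I ⊆ ⋃ n, cyl (Icc (a n) (b n)) := fun x hx => by
    obtain ⟨n, hn⟩ := hex x.1 x.1 (by simpa using hx)
    exact Set.mem_iUnion.2 ⟨n, by simpa using hn ⟨le_rfl, le_rfl⟩⟩
  exact ae_restrict_of_ae_restrict_of_subset hsub
    ((ae_restrict_iUnion_iff _ _).2 fun n => h _ _ (hab n))

lemma ae_restrict_interior (hI : I.OrdConnected) :
    (volume : Measure ℝ).restrict (interior I) = volume.restrict I := by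
  apply Measure.restrict_congr_set
  have h : volume (frontier I) = 0 := (convex_iff_ordConnected.2 hI).addHaar_frontier volume
  refine Filter.EventuallyLE.antisymm (Eventually.of_forall fun x hx => interior_subset hx) ?_
  filter_upwards [(measure_eq_zero_iff_ae_notMem).1 h] with x hx hxI
  by_contra hxi
  exact hx ⟨subset_closure hxI, hxi⟩

/-- A compact subset of the interior of an interval lies in a compact interval. -/
lemma exists_Icc_of_isCompact (hI : I.OrdConnected) {K : Set ℝ} (hK : IsCompact K)
    (h : K ⊆ interior I) : ∃ a b, Icc a b ⊆ interior I ∧ K ⊆ Icc a b := by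
  rcases K.eq_empty_or_nonempty with rfl | hne
  · exact ⟨1, 0, by simp, by simp⟩
  · have h1 := hK.sInf_mem hne
    have h2 := hK.sSup_mem hne
    exact ⟨sInf K, sSup K, hI.interior.out (h h1) (h h2),
      fun x hx => ⟨csInf_le hK.bddBelow hx, le_csSup hK.bddAbove hx⟩⟩

/-! ### Functions with locally bounded `L^p` norms in space -/

/-- A family of functions which is bounded in `L^∞_loc(I, L^p(T¹))`, uniformly with respect to
the index. -/
def UBdd {ι : Type} (I : Set ℝ) (p : ℝ≥0∞) (f : ι → ℝ × Torus → ℝ) : Prop :=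
  (∀ i, AEStronglyMeasurable (f i) (volume.restrict (cyl I))) ∧
  ∀ a b : ℝ, Icc a b ⊆ I → ∃ C : ℝ≥0, ∀ i, ∀ᵐ t ∂volume.restrict (Icc a b),
    eLpNorm (fun θ : Torus => f i (t, θ)) p volume ≤ (C : ℝ≥0∞)

lemma locBddLp_iff {p : ℝ≥0∞} {f : ℝ × Torus → ℝ} :
    LocBddLp I p f ↔ UBdd I p (fun _ : Unit => f) := by
  simp [LocBddLp, UBdd]

namespace UBdd

variable {ι : Type} {p q r : ℝ≥0∞} {f g : ι → ℝ × Torus → ℝ}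

lemma single (hf : UBdd I p f) (i : ι) : LocBddLp I p (f i) :=
  ⟨hf.1 i, fun a b hab => (hf.2 a b hab).imp fun _ h => h i⟩

lemma of_single {f : ℝ × Torus → ℝ} (hf : LocBddLp I p f) : UBdd I p (fun _ : ι => f) :=
  ⟨fun _ => hf.1, fun a b hab => (hf.2 a b hab).imp fun _ h _ => h⟩

lemma reindex {κ : Type} (hf : UBdd I p f) (k : κ → ι) : UBdd I p (fun i => f (k i)) :=
  ⟨fun _ => hf.1 _, fun a b hab => (hf.2 a b hab).imp fun _ h i => h (k i)⟩

lemma slice_aesm (hf : UBdd I p f) (i : ι) {a b : ℝ} (hab : Icc a b ⊆ I) :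
    ∀ᵐ t ∂volume.restrict (Icc a b),
      AEStronglyMeasurable (fun θ : Torus => f i (t, θ)) volume := by
  have h := (hf.1 i).mono_measure (restrict_cyl_mono hab)
  rw [restrict_cyl] at h
  exact h.prodMk_left

lemma mul [ENNReal.HolderTriple p q r] (hf : UBdd I p f) (hg : UBdd I q g) :
    UBdd I r (fun i z => f i z * g i z) := by
  refine ⟨fun i => (hf.1 i).mul (hg.1 i), fun a b hab => ?_⟩
  obtain ⟨C, hC⟩ := hf.2 a b hab
  obtain ⟨D, hD⟩ := hg.2 a b hab
  refine ⟨C * D, fun i => ?_⟩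
  filter_upwards [hC i, hD i, hf.slice_aesm i hab, hg.slice_aesm i hab] with t h1 h2 h3 h4
  push_cast
  exact (eLpNorm_smul_le_mul_eLpNorm h4 h3).trans (mul_le_mul' h1 h2)

lemma add (hp : 1 ≤ p) (hf : UBdd I p f) (hg : UBdd I p g) :
    UBdd I p (fun i z => f i z + g i z) := by
  refine ⟨fun i => (hf.1 i).add (hg.1 i), fun a b hab => ?_⟩
  obtain ⟨C, hC⟩ := hf.2 a b hab
  obtain ⟨D, hD⟩ := hg.2 a b hab
  refine ⟨C + D, fun i => ?_⟩
  filter_upwards [hC i, hD i, hf.slice_aesm i hab, hg.slice_aesm i hab] with t h1 h2 h3 h4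
  push_cast
  exact (eLpNorm_add_le h3 h4 hp).trans (add_le_add h1 h2)

lemma neg (hf : UBdd I p f) : UBdd I p (fun i z => -f i z) := by
  refine ⟨fun i => (hf.1 i).neg, fun a b hab => ?_⟩
  obtain ⟨C, hC⟩ := hf.2 a b hab
  refine ⟨C, fun i => ?_⟩
  filter_upwards [hC i] with t h1
  have := eLpNorm_neg (fun θ : Torus => f i (t, θ)) p volume
  exact this.trans_le h1

lemma sub (hp : 1 ≤ p) (hf : UBdd I p f) (hg : UBdd I p g) :
    UBdd I p (fun i z => f i z - g i z) := by
  simpa [sub_eq_add_neg] using hf.add hp hg.neg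

lemma mono_exponent (hpq : p ≤ q) (hf : UBdd I q f) : UBdd I p f := by
  refine ⟨hf.1, fun a b hab => ?_⟩
  obtain ⟨C, hC⟩ := hf.2 a b hab
  refine ⟨C, fun i => ?_⟩
  filter_upwards [hC i, hf.slice_aesm i hab] with t h1 h2
  exact (eLpNorm_le_eLpNorm_of_exponent_le hpq h2).trans h1

lemma of_time {φ : ℝ → ℝ} (hI : MeasurableSet I) (hφ : ContinuousOn φ I) :
    UBdd I ⊤ (fun (_ : ι) z => φ z.1) := by
  constructor
  · intro _
    rw [restrict_cyl]
    exact (hφ.aestronglyMeasurable hI).comp_fst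
  · intro a b hab
    obtain ⟨C, hC⟩ := isCompact_Icc.exists_bound_of_continuousOn (hφ.mono hab)
    refine ⟨C.toNNReal, fun _ => ?_⟩
    filter_upwards [ae_restrict_mem measurableSet_Icc] with t ht
    refine (eLpNormEssSup_le_of_ae_bound (C := C) (Eventually.of_forall fun θ => hC t ht)).trans ?_
    exact le_rfl

lemma const_mul (c : ℝ) (hf : UBdd I p f) : UBdd I p (fun i z => c * f i z) := by
  refine ⟨fun i => (hf.1 i).const_mul c, fun a b hab => ?_⟩
  obtain ⟨C, hC⟩ := hf.2 a b hab
  refine ⟨‖c‖₊ * C, fun i => ?_⟩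
  filter_upwards [hC i] with t h1
  have := eLpNorm_const_smul_le (c := c) (f := fun θ : Torus => f i (t, θ)) (p := p) (μ := volume)
  refine this.trans ?_
  push_cast
  exact mul_le_mul' le_rfl h1

lemma exp (hf : UBdd I ⊤ f) : UBdd I ⊤ (fun i z => Real.exp (f i z)) := by
  refine ⟨fun i => Real.continuous_exp.comp_aestronglyMeasurable (hf.1 i), fun a b hab => ?_⟩
  obtain ⟨C, hC⟩ := hf.2 a b hab
  refine ⟨(Real.exp C).toNNReal, fun i => ?_⟩
  filter_upwards [hC i] with t h1
  refine (eLpNormEssSup_le_of_ae_bound (C := Real.exp C) ?_)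
  filter_upwards [ae_le_eLpNormEssSup (f := fun θ : Torus => f i (t, θ)) (μ := volume)] with θ h2
  have h3 : ‖f i (t, θ)‖ₑ ≤ (C : ℝ≥0∞) := h2.trans h1
  have h4 : ‖f i (t, θ)‖ ≤ C := by
    rw [enorm_le_coe] at h3
    exact_mod_cast h3
  rw [Real.norm_eq_abs, Real.abs_exp]
  exact Real.exp_le_exp.2 ((le_abs_self _).trans h4)

/-- The norm in `L^p([a, b] × T¹)` is bounded, for finite `p`. -/
lemma eLpNorm_cyl_le (hp0 : p ≠ 0) (hp : p ≠ ⊤) (hf : UBdd I p f) {a b : ℝ}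
    (hab : Icc a b ⊆ I) :
    ∃ C : ℝ≥0, ∀ i, eLpNorm (f i) p (volume.restrict (cyl (Icc a b))) ≤ C := by
  obtain ⟨C, hC⟩ := hf.2 a b hab
  have hpos : 0 < p.toReal := ENNReal.toReal_pos hp0 hp
  have hfin : ((C : ℝ≥0∞) ^ p.toReal * volume (Icc a b)) ^ (1 / p.toReal) ≠ ⊤ := by
    apply ENNReal.rpow_ne_top_of_nonneg (by positivity)
    apply ENNReal.mul_ne_top
    · exact ENNReal.rpow_ne_top_of_nonneg hpos.le ENNReal.coe_ne_top
    · simp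
  refine ⟨(((C : ℝ≥0∞) ^ p.toReal * volume (Icc a b)) ^ (1 / p.toReal)).toNNReal, fun i => ?_⟩
  rw [ENNReal.coe_toNNReal hfin, eLpNorm_eq_lintegral_rpow_enorm_toReal hp0 hp]
  apply ENNReal.rpow_le_rpow _ (by positivity)
  have hm : AEMeasurable (fun z => ‖f i z‖ₑ ^ p.toReal)
      ((volume.restrict (Icc a b)).prod volume) := by
    have := ((hf.1 i).mono_measure (restrict_cyl_mono hab)).enorm
    rw [restrict_cyl] at this
    exact this.pow_const _
  rw [restrict_cyl, lintegral_prod _ hm]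
  calc ∫⁻ t in Icc a b, ∫⁻ θ : Torus, ‖f i (t, θ)‖ₑ ^ p.toReal
      ≤ ∫⁻ t in Icc a b, (C : ℝ≥0∞) ^ p.toReal := by
        apply lintegral_mono_ae
        filter_upwards [hC i] with t h
        rw [eLpNorm_eq_lintegral_rpow_enorm_toReal hp0 hp] at h
        have h2 := ENNReal.rpow_le_rpow h hpos.le
        rwa [← ENNReal.rpow_mul, one_div, inv_mul_cancel₀ hpos.ne', ENNReal.rpow_one] at h2
    _ = _ := by simp

lemma memLp_cyl (hp0 : p ≠ 0) (hp : p ≠ ⊤) (hf : UBdd I p f) {a b : ℝ}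
    (hab : Icc a b ⊆ I) (i : ι) : MemLp (f i) p (volume.restrict (cyl (Icc a b))) := by
  obtain ⟨C, hC⟩ := hf.eLpNorm_cyl_le hp0 hp hab
  exact ⟨(hf.1 i).mono_measure (restrict_cyl_mono hab), (hC i).trans_lt ENNReal.coe_lt_top⟩

lemma ae_norm_le_cyl (hf : UBdd I ⊤ f) {a b : ℝ} (hab : Icc a b ⊆ I) :
    ∃ C : ℝ≥0, ∀ i, ∀ᵐ z ∂volume.restrict (cyl (Icc a b)), ‖f i z‖ ≤ C := by
  obtain ⟨C, hC⟩ := hf.2 a b hab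
  refine ⟨C, fun i => ?_⟩
  have hm : AEStronglyMeasurable (f i) ((volume.restrict (Icc a b)).prod volume) := by
    have := ((hf.1 i).mono_measure (restrict_cyl_mono hab))
    rwa [restrict_cyl] at this
  rw [restrict_cyl]
  obtain ⟨f', hf', hff'⟩ := hm
  have hs : MeasurableSet {z : ℝ × Torus | ‖f' z‖ ≤ C} :=
    measurableSet_le hf'.norm.measurable measurable_const
  have h1 : ∀ᵐ z ∂((volume.restrict (Icc a b)).prod (volume : Measure Torus)),
      ‖f' z‖ ≤ C := by
    rw [Measure.ae_prod_iff_ae_ae hs]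
    filter_upwards [hC i, Measure.ae_ae_of_ae_prod hff'] with t h1 h2
    filter_upwards [ae_le_eLpNormEssSup (f := fun θ : Torus => f i (t, θ)) (μ := volume), h2]
      with θ h3 h4
    have h5 : ‖f i (t, θ)‖ₑ ≤ (C : ℝ≥0∞) := h3.trans h1
    rw [← h4]
    rw [enorm_le_coe] at h5
    exact_mod_cast h5
  filter_upwards [h1, hff'] with z h1 h2
  rwa [h2]

end UBdd

/-- A measurable function which is integrable on `[a, b] × T¹` for all compact `[a, b] ⊆ I`. -/
def LocInt (I : Set ℝ) (f : ℝ × Torus → ℝ) : Prop :=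
  AEStronglyMeasurable f (volume.restrict (cyl I)) ∧
    ∀ a b : ℝ, Icc a b ⊆ I → IntegrableOn f (cyl (Icc a b))

lemma LocBddLp.locInt {p : ℝ≥0∞} (hp : 1 ≤ p) {f : ℝ × Torus → ℝ}
    (hf : LocBddLp I p f) : LocInt I f := by
  refine ⟨hf.1, fun a b hab => ?_⟩
  have h := ((locBddLp_iff.1 hf).mono_exponent hp).memLp_cyl one_ne_zero ENNReal.one_ne_top hab ()
  exact memLp_one_iff_integrable.1 h

/-! ### Smooth functions and test functions on `ℝ × T¹` -/

/-- Smooth functions on `ℝ × T¹`, i.e. functions with a smooth lift to `ℝ × ℝ`. -/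
def SmoothFn (ψ : ℝ × Torus → ℝ) : Prop :=
  ContDiff ℝ ∞ (fun q : ℝ × ℝ => ψ (q.1, (q.2 : Torus)))

/-- The derivative `ψ_t + c ψ_θ` along the lines `θ = y + c t`. -/
noncomputable def lineD (c : ℝ) (ψ : ℝ × Torus → ℝ) (z : ℝ × Torus) : ℝ :=
  partialT ψ z + c * partialX ψ z

lemma continuous_of_lift {E : Type*} [TopologicalSpace E] {ψ : ℝ × Torus → E}
    (h : Continuous (fun q : ℝ × ℝ => ψ (q.1, (q.2 : Torus)))) : Continuous ψ := by
  have hq : IsOpenQuotientMap (Prod.map (id : ℝ → ℝ) ((↑) : ℝ → Torus)) :=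
    IsOpenQuotientMap.id.prodMap QuotientAddGroup.isOpenQuotientMap_mk
  exact hq.isQuotientMap.continuous_iff.2 h

lemma torus_forall {p : Torus → Prop} (h : ∀ x : ℝ, p (x : Torus)) (θ : Torus) : p θ :=
  QuotientAddGroup.induction_on θ h

namespace SmoothFn

variable {ψ χ : ℝ × Torus → ℝ}

lemma continuous (hψ : SmoothFn ψ) : Continuous ψ :=
  continuous_of_lift (ContDiff.continuous hψ)

lemma mul (hψ : SmoothFn ψ) (hχ : SmoothFn χ) : SmoothFn (fun z => ψ z * χ z) :=
  ContDiff.mul hψ hχ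

lemma add (hψ : SmoothFn ψ) (hχ : SmoothFn χ) : SmoothFn (fun z => ψ z + χ z) :=
  ContDiff.add hψ hχ

lemma const_mul (c : ℝ) (hψ : SmoothFn ψ) : SmoothFn (fun z => c * ψ z) :=
  ContDiff.mul contDiff_const hψ

lemma of_time {ρ : ℝ → ℝ} (hρ : ContDiff ℝ ∞ ρ) : SmoothFn (fun z => ρ z.1) :=
  hρ.comp contDiff_fst

lemma of_space {χ : Torus → ℝ} (hχ : ContDiff ℝ ∞ (fun x : ℝ => χ (x : Torus))) :
    SmoothFn (fun z => χ z.2) :=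
  hχ.comp contDiff_snd

lemma shear (c : ℝ) (hψ : SmoothFn ψ) : SmoothFn (fun z => ψ (z.1, z.2 + ((c * z.1 : ℝ) : Torus))) := by
  have : ContDiff ℝ ∞ (fun q : ℝ × ℝ => (q.1, q.2 + c * q.1)) := by fun_prop
  have h := ContDiff.comp hψ this
  unfold SmoothFn
  convert h using 2 with q
  simp

lemma hasFDerivAt (hψ : SmoothFn ψ) (q : ℝ × ℝ) :
    HasFDerivAt (fun q : ℝ × ℝ => ψ (q.1, (q.2 : Torus)))
      (fderiv ℝ (fun q : ℝ × ℝ => ψ (q.1, (q.2 : Torus))) q) q :=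
  (ContDiff.differentiable hψ (by simp) q).hasFDerivAt

lemma hasDerivAt_lift (hψ : SmoothFn ψ) (c d : ℝ) (t x : ℝ) :
    HasDerivAt (fun s : ℝ => ψ (t + d * s, ((x + c * s : ℝ) : Torus)))
      (fderiv ℝ (fun q : ℝ × ℝ => ψ (q.1, (q.2 : Torus))) (t, x) (d, c)) 0 := by
  have h1 : HasDerivAt (fun s : ℝ => (t + d * s, x + c * s)) (d, c) 0 := by
    have h2 : HasDerivAt (fun s : ℝ => t + d * s) d 0 := by
      simpa using ((hasDerivAt_id (0 : ℝ)).const_mul d).const_add t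
    have h3 : HasDerivAt (fun s : ℝ => x + c * s) c 0 := by
      simpa using ((hasDerivAt_id (0 : ℝ)).const_mul c).const_add x
    exact h2.prodMk h3
  have h4 := hψ.hasFDerivAt (t, x)
  have h5 : HasFDerivAt (fun q : ℝ × ℝ => ψ (q.1, (q.2 : Torus)))
      (fderiv ℝ (fun q : ℝ × ℝ => ψ (q.1, (q.2 : Torus))) (t, x)) (t + d * 0, x + c * 0) := by
    simpa using h4
  exact h5.comp_hasDerivAt (0 : ℝ) h1

lemma partialT_lift (hψ : SmoothFn ψ) (t x : ℝ) : partialT ψ (t, (x : Torus)) =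
    fderiv ℝ (fun q : ℝ × ℝ => ψ (q.1, (q.2 : Torus))) (t, x) (1, 0) := by
  have h := (hψ.hasDerivAt_lift 0 1 t x)
  simp only [zero_mul, add_zero, one_mul] at h
  have h2 : HasDerivAt (fun s : ℝ => ψ (s, (x : Torus)))
      (fderiv ℝ (fun q : ℝ × ℝ => ψ (q.1, (q.2 : Torus))) (t, x) (1, 0)) t := by
    have h3 := HasDerivAt.comp_sub_const (x := t) (a := t) (by simpa using h)
    simpa using h3
  exact h2.deriv

lemma partialX_lift (hψ : SmoothFn ψ) (t x : ℝ) : partialX ψ (t, (x : Torus)) =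
    fderiv ℝ (fun q : ℝ × ℝ => ψ (q.1, (q.2 : Torus))) (t, x) (0, 1) := by
  have h := (hψ.hasDerivAt_lift 1 0 t x)
  simp only [zero_mul, add_zero, one_mul, AddCircle.coe_add] at h
  exact h.deriv

lemma partialT_smooth (hψ : SmoothFn ψ) : SmoothFn (partialT ψ) := by
  unfold SmoothFn
  have : (fun q : ℝ × ℝ => partialT ψ (q.1, (q.2 : Torus))) =
      fun q => fderiv ℝ (fun q : ℝ × ℝ => ψ (q.1, (q.2 : Torus))) q (1, 0) := by
    ext q; exact hψ.partialT_lift q.1 q.2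
  rw [this]
  exact (ContDiff.fderiv_right (m := ∞) hψ (by simp)).clm_apply contDiff_const

lemma partialX_smooth (hψ : SmoothFn ψ) : SmoothFn (partialX ψ) := by
  unfold SmoothFn
  have : (fun q : ℝ × ℝ => partialX ψ (q.1, (q.2 : Torus))) =
      fun q => fderiv ℝ (fun q : ℝ × ℝ => ψ (q.1, (q.2 : Torus))) q (0, 1) := by
    ext q; exact hψ.partialX_lift q.1 q.2
  rw [this]
  exact (ContDiff.fderiv_right (m := ∞) hψ (by simp)).clm_apply contDiff_const

lemma lineD_smooth (c : ℝ) (hψ : SmoothFn ψ) : SmoothFn (lineD c ψ) :=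
  hψ.partialT_smooth.add (hψ.partialX_smooth.const_mul c)

lemma hasDerivAt_line (hψ : SmoothFn ψ) (c : ℝ) (y : Torus) (t : ℝ) :
    HasDerivAt (fun s : ℝ => ψ (s, y + ((c * s : ℝ) : Torus)))
      (lineD c ψ (t, y + ((c * t : ℝ) : Torus))) t := by
  induction y using QuotientAddGroup.induction_on with
  | H x =>
    have h := hψ.hasDerivAt_lift c 1 t (x + c * t)
    have h3 := HasDerivAt.comp_sub_const (x := t) (a := t) (by rw [sub_self]; exact h)
    have h4 : HasDerivAt (fun s : ℝ => ψ (s, ((x : ℝ) : Torus) + ((c * s : ℝ) : Torus)))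
      (fderiv ℝ (fun q : ℝ × ℝ => ψ (q.1, (q.2 : Torus))) (t, x + c * t) (1, c)) t := by
      convert! h3 using 1
      ext s
      have e1 : t + 1 * (s - t) = s := by ring
      have e2 : x + c * s = x + c * t + c * (s - t) := by ring
      rw [e1, ← AddCircle.coe_add, e2]
    convert h4 using 1
    rw [lineD]
    have e : ((x : ℝ) : Torus) + ((c * t : ℝ) : Torus) = ((x + c * t : ℝ) : Torus) := by
      rw [AddCircle.coe_add]
    have e2 : ((QuotientAddGroup.mk x : Torus)) + ((c * t : ℝ) : Torus)
      = ((x + c * t : ℝ) : Torus) := e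
    rw [e2, hψ.partialT_lift, hψ.partialX_lift]
    set L := fderiv ℝ (fun q : ℝ × ℝ => ψ (q.1, (q.2 : Torus))) (t, x + c * t)
    have e3 : ((1, c) : ℝ × ℝ) = (1, 0) + c • (0, 1) := by simp
    rw [e3, map_add, map_smul, smul_eq_mul]

lemma hasDerivAt_T (hψ : SmoothFn ψ) (t : ℝ) (θ : Torus) :
    HasDerivAt (fun s : ℝ => ψ (s, θ)) (partialT ψ (t, θ)) t := by
  have := hψ.hasDerivAt_line 0 θ t
  simpa [lineD] using this

lemma hasDerivAt_X (hψ : SmoothFn ψ) (t : ℝ) (θ : Torus) :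
    HasDerivAt (fun x : ℝ => ψ (t, θ + (x : Torus))) (partialX ψ (t, θ)) 0 := by
  induction θ using QuotientAddGroup.induction_on with
  | H x =>
    have h := (hψ.hasDerivAt_lift 1 0 t x)
    simp only [zero_mul, add_zero, one_mul, AddCircle.coe_add] at h
    have e := hψ.partialX_lift t x
    rw [← e] at h
    exact h

lemma partialT_add (hψ : SmoothFn ψ) (hχ : SmoothFn χ) (z : ℝ × Torus) :
    partialT (fun z => ψ z + χ z) z = partialT ψ z + partialT χ z :=
  ((hψ.hasDerivAt_T z.1 z.2).add (hχ.hasDerivAt_T z.1 z.2)).deriv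

lemma partialX_add (hψ : SmoothFn ψ) (hχ : SmoothFn χ) (z : ℝ × Torus) :
    partialX (fun z => ψ z + χ z) z = partialX ψ z + partialX χ z :=
  ((hψ.hasDerivAt_X z.1 z.2).add (hχ.hasDerivAt_X z.1 z.2)).deriv

lemma partialT_const_mul (c : ℝ) (hψ : SmoothFn ψ) (z : ℝ × Torus) :
    partialT (fun z => c * ψ z) z = c * partialT ψ z :=
  ((hψ.hasDerivAt_T z.1 z.2).const_mul c).deriv

lemma partialX_const_mul (c : ℝ) (hψ : SmoothFn ψ) (z : ℝ × Torus) :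
    partialX (fun z => c * ψ z) z = c * partialX ψ z :=
  ((hψ.hasDerivAt_X z.1 z.2).const_mul c).deriv

lemma partialT_partialX (hψ : SmoothFn ψ) (z : ℝ × Torus) :
    partialT (partialX ψ) z = partialX (partialT ψ) z := by
  obtain ⟨t, θ⟩ := z
  induction θ using QuotientAddGroup.induction_on with
  | H x =>
    set L := fun q : ℝ × ℝ => ψ (q.1, (q.2 : Torus)) with hL
    have e1 : (fun q : ℝ × ℝ => partialX ψ (q.1, (q.2 : Torus))) = fun q => fderiv ℝ L q (0, 1) := by
      ext q; exact hψ.partialX_lift q.1 q.2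
    have e2 : (fun q : ℝ × ℝ => partialT ψ (q.1, (q.2 : Torus))) = fun q => fderiv ℝ L q (1, 0) := by
      ext q; exact hψ.partialT_lift q.1 q.2
    have hd : DifferentiableAt ℝ (fderiv ℝ L) (t, x) :=
      (ContDiff.fderiv_right (m := 1) hψ (by norm_cast)).differentiable (by simp) _
    have h1 := hψ.partialX_smooth.partialT_lift t x
    have h2 := hψ.partialT_smooth.partialX_lift t x
    rw [e1] at h1
    rw [e2] at h2
    have h3 : ∀ v w : ℝ × ℝ, fderiv ℝ (fun q => fderiv ℝ L q v) (t, x) w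
        = fderiv ℝ (fderiv ℝ L) (t, x) w v := by
      intro v w
      rw [fderiv_clm_apply hd (differentiableAt_const v)]
      simp
    have h4 : IsSymmSndFDerivAt ℝ L (t, x) :=
      (ContDiff.contDiffAt hψ).isSymmSndFDerivAt (by simp; norm_cast)
    exact h1.trans (((h3 _ _).trans (h4.eq _ _)).trans ((h3 _ _).symm.trans h2.symm))

/-- The wave operator is the product of the derivatives along the two null directions. -/
lemma box_eq_lineD (hψ : SmoothFn ψ) {c : ℝ} (hc : c ^ 2 = 1) (z : ℝ × Torus) :
    box ψ z = lineD c (lineD (-c) ψ) z := by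
  have h1 : partialT (lineD (-c) ψ) z = partialT (partialT ψ) z + (-c) * partialT (partialX ψ) z := by
    have := partialT_add hψ.partialT_smooth (hψ.partialX_smooth.const_mul (-c)) z
    rw [partialT_const_mul _ hψ.partialX_smooth] at this
    exact this
  have h2 : partialX (lineD (-c) ψ) z = partialX (partialT ψ) z + (-c) * partialX (partialX ψ) z := by
    have := partialX_add hψ.partialT_smooth (hψ.partialX_smooth.const_mul (-c)) z
    rw [partialX_const_mul _ hψ.partialX_smooth] at this
    exact this
  rw [lineD, h1, h2, hψ.partialT_partialX, box]
  linear_combination partialX (partialX ψ) z * hc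

end SmoothFn

/-- Smooth functions of time with compact support in the interior of `I`. -/
def IsTimeTest (I : Set ℝ) (ρ : ℝ → ℝ) : Prop :=
  ContDiff ℝ ∞ ρ ∧ ∃ a b : ℝ, Icc a b ⊆ interior I ∧ ∀ t ∉ Icc a b, ρ t = 0

lemma exists_Icc_union (hI : I.OrdConnected) {a b c d : ℝ}
    (h1 : Icc a b ⊆ interior I) (h2 : Icc c d ⊆ interior I) :
    ∃ p q, Icc p q ⊆ interior I ∧ Icc a b ⊆ Icc p q ∧ Icc c d ⊆ Icc p q := by
  obtain ⟨p, q, h3, h4⟩ := exists_Icc_of_isCompact hI (isCompact_Icc.union isCompact_Icc)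
    (Set.union_subset h1 h2)
  exact ⟨p, q, h3, Set.subset_union_left.trans h4, Set.subset_union_right.trans h4⟩

namespace IsTestFunction

variable {ψ χ : ℝ × Torus → ℝ}

lemma smoothFn (hψ : IsTestFunction I ψ) : SmoothFn ψ := hψ.smooth

lemma mul_smooth (hψ : IsTestFunction I ψ) (hχ : SmoothFn χ) :
    IsTestFunction I (fun z => ψ z * χ z) := by
  refine ⟨hψ.smoothFn.mul hχ, ?_⟩
  obtain ⟨a, b, hab, h⟩ := hψ.support
  exact ⟨a, b, hab, fun t ht θ => by rw [h t ht θ, zero_mul]⟩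

lemma const_mul (c : ℝ) (hψ : IsTestFunction I ψ) : IsTestFunction I (fun z => c * ψ z) := by
  refine ⟨hψ.smoothFn.const_mul c, ?_⟩
  obtain ⟨a, b, hab, h⟩ := hψ.support
  exact ⟨a, b, hab, fun t ht θ => by rw [h t ht θ, mul_zero]⟩

lemma partialT_support {a b : ℝ} (h : ∀ t : ℝ, t ∉ Icc a b → ∀ θ : Torus, ψ (t, θ) = 0)
    {t : ℝ} (ht : t ∉ Icc a b) (θ : Torus) : partialT ψ (t, θ) = 0 := by
  have : (fun s : ℝ => ψ (s, θ)) =ᶠ[𝓝 t] fun _ => 0 := by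
    filter_upwards [isClosed_Icc.isOpen_compl.mem_nhds ht] with s hs
    exact h s hs θ
  rw [partialT, this.deriv_eq]
  simp

lemma partialX_support {a b : ℝ} (h : ∀ t : ℝ, t ∉ Icc a b → ∀ θ : Torus, ψ (t, θ) = 0)
    {t : ℝ} (ht : t ∉ Icc a b) (θ : Torus) : partialX ψ (t, θ) = 0 := by
  simp [partialX, h t ht]

lemma partialT (hψ : IsTestFunction I ψ) : IsTestFunction I (partialT ψ) := by
  refine ⟨hψ.smoothFn.partialT_smooth, ?_⟩
  obtain ⟨a, b, hab, h⟩ := hψ.support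
  exact ⟨a, b, hab, fun t ht θ => partialT_support h ht θ⟩

lemma partialX (hψ : IsTestFunction I ψ) : IsTestFunction I (partialX ψ) := by
  refine ⟨hψ.smoothFn.partialX_smooth, ?_⟩
  obtain ⟨a, b, hab, h⟩ := hψ.support
  exact ⟨a, b, hab, fun t ht θ => partialX_support h ht θ⟩

lemma lineD (hψ : IsTestFunction I ψ) (c : ℝ) : IsTestFunction I (lineD c ψ) := by
  refine ⟨hψ.smoothFn.lineD_smooth c, ?_⟩
  obtain ⟨a, b, hab, h⟩ := hψ.support
  exact ⟨a, b, hab, fun t ht θ => by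
    rw [Gowdy.lineD, partialT_support h ht θ, partialX_support h ht θ]; ring⟩

end IsTestFunction

lemma IsTimeTest.isTestFunction {ρ : ℝ → ℝ} (hρ : IsTimeTest I ρ) :
    IsTestFunction I (fun z => ρ z.1) := by
  refine ⟨SmoothFn.of_time hρ.1, ?_⟩
  obtain ⟨a, b, hab, h⟩ := hρ.2
  exact ⟨a, b, hab, fun t ht _ => h t ht⟩

/-- There is a nonnegative test function of time with integral one. -/
lemma exists_timeTest (hne : (interior I).Nonempty) :
    ∃ ρ : ℝ → ℝ, IsTimeTest I ρ ∧ (∀ t, 0 ≤ ρ t) ∧ ∫ t, ρ t = 1 := by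
  obtain ⟨x, hx⟩ := hne
  obtain ⟨r, hr, hball⟩ := Metric.nhds_basis_closedBall.mem_iff.1 (isOpen_interior.mem_nhds hx)
  let φ : ContDiffBump x := ⟨r / 2, r, by positivity, by linarith⟩
  refine ⟨φ.normed volume, ⟨φ.contDiff_normed, x - r, x + r, ?_, fun t ht => ?_⟩,
    fun t => φ.nonneg_normed t, φ.integral_normed⟩
  · rwa [← Real.closedBall_eq_Icc]
  · have : t ∉ tsupport (φ.normed volume) := by
      rw [φ.tsupport_normed_eq, Real.closedBall_eq_Icc]
      exact ht
    exact image_eq_zero_of_notMem_tsupport this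

lemma contDiff_fourier_re (k : ℤ) :
    ContDiff ℝ ∞ (fun x : ℝ => (fourier k (x : Torus)).re) := by
  simp only [fourier_coe_apply]
  refine Complex.reCLM.contDiff.comp (ContDiff.cexp ?_)
  have : ContDiff ℝ ∞ (fun x : ℝ => (x : ℂ)) := Complex.ofRealCLM.contDiff
  fun_prop

lemma contDiff_fourier_im (k : ℤ) :
    ContDiff ℝ ∞ (fun x : ℝ => (fourier k (x : Torus)).im) := by
  simp only [fourier_coe_apply]
  refine Complex.imCLM.contDiff.comp (ContDiff.cexp ?_)
  have : ContDiff ℝ ∞ (fun x : ℝ => (x : ℂ)) := Complex.ofRealCLM.contDiff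
  fun_prop

/-! ### Absolutely continuous functions on an interval of times -/

/-- A function `u` which agrees almost everywhere on `I` with a locally absolutely continuous
function whose derivative is `v` almost everywhere. -/
def LineAC1 (I : Set ℝ) (u v : ℝ → ℝ) : Prop :=
  ∃ F : ℝ → ℝ, (∀ᵐ t ∂volume.restrict I, u t = F t) ∧
    (∀ a b, a ≤ b → Icc a b ⊆ I → AbsolutelyContinuousOnInterval F a b) ∧
    ∀ᵐ t ∂volume.restrict I, HasDerivAt F (v t) t

/-- A primitive of a locally integrable function is locally absolutely continuous. -/
lemma absolutelyContinuousOnInterval_primitive (hI : I.OrdConnected) {v : ℝ → ℝ}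
    (hv : ∀ a b, Icc a b ⊆ I → IntegrableOn v (Icc a b)) {t₀ : ℝ} (ht₀ : t₀ ∈ I)
    {a b : ℝ} (hab : a ≤ b) (h : Icc a b ⊆ I) :
    AbsolutelyContinuousOnInterval (fun t => ∫ s in t₀..t, v s) a b := by
  have ha : min a t₀ ∈ I := by
    rcases min_choice a t₀ with h1 | h1 <;> rw [h1]
    exacts [h ⟨le_rfl, hab⟩, ht₀]
  have hb : max b t₀ ∈ I := by
    rcases max_choice b t₀ with h1 | h1 <;> rw [h1]
    exacts [h ⟨hab, le_rfl⟩, ht₀]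
  have hle : min a t₀ ≤ max b t₀ := (min_le_right _ _).trans (le_max_right _ _)
  have h1 : IntervalIntegrable v volume (min a t₀) (max b t₀) :=
    (intervalIntegrable_iff_integrableOn_Icc_of_le hle).2 (hv _ _ (hI.out ha hb))
  have h2 := h1.absolutelyContinuousOnInterval_intervalIntegral (c := t₀)
    (by rw [Set.uIcc_of_le hle]; exact ⟨min_le_right _ _, le_max_right _ _⟩)
  refine h2.mono ?_
  rw [Set.uIcc_of_le hle, Set.uIcc_of_le hab]
  exact Set.Icc_subset_Icc (min_le_left _ _) (le_max_left _ _)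

lemma ae_hasDerivAt_primitive (hI : I.OrdConnected) {v : ℝ → ℝ}
    (hv : ∀ a b, Icc a b ⊆ I → IntegrableOn v (Icc a b)) {t₀ : ℝ} (ht₀ : t₀ ∈ I) :
    ∀ᵐ t ∂volume.restrict I, HasDerivAt (fun t => ∫ s in t₀..t, v s) (v t) t := by
  refine ae_of_forall_Icc hI fun a b hab => ?_
  by_cases hle : a ≤ b
  swap
  · rw [Set.Icc_eq_empty hle]; simp
  have ha : min a t₀ ∈ I := by
    rcases min_choice a t₀ with h1 | h1 <;> rw [h1]
    exacts [hab ⟨le_rfl, hle⟩, ht₀]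
  have hb : max b t₀ ∈ I := by
    rcases max_choice b t₀ with h1 | h1 <;> rw [h1]
    exacts [hab ⟨hle, le_rfl⟩, ht₀]
  have hle' : min a t₀ ≤ max b t₀ := (min_le_right _ _).trans (le_max_right _ _)
  have h1 : IntervalIntegrable v volume (min a t₀) (max b t₀) :=
    (intervalIntegrable_iff_integrableOn_Icc_of_le hle').2 (hv _ _ (hI.out ha hb))
  rw [ae_restrict_iff' measurableSet_Icc]
  filter_upwards [h1.ae_hasDerivAt_integral] with t ht htab
  refine ht ?_ t₀ ?_
  · rw [Set.uIcc_of_le hle']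
    exact ⟨(min_le_left _ _).trans htab.1, htab.2.trans (le_max_left _ _)⟩
  · rw [Set.uIcc_of_le hle']; exact ⟨min_le_right _ _, le_max_right _ _⟩

lemma eq_zero_endpoints {ρ : ℝ → ℝ} (hρ : Continuous ρ) {a b : ℝ}
    (h : ∀ t ∉ Icc a b, ρ t = 0) : ρ a = 0 ∧ ρ b = 0 := by
  constructor
  · have h1 : Tendsto ρ (𝓝[<] a) (𝓝 (ρ a)) := hρ.continuousWithinAt
    refine tendsto_nhds_unique h1 (tendsto_const_nhds.congr' ?_)
    filter_upwards [self_mem_nhdsWithin] with t ht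
    exact (h t (fun h2 => not_le.2 ht h2.1)).symm
  · have h1 : Tendsto ρ (𝓝[>] b) (𝓝 (ρ b)) := hρ.continuousWithinAt
    refine tendsto_nhds_unique h1 (tendsto_const_nhds.congr' ?_)
    filter_upwards [self_mem_nhdsWithin] with t ht
    exact (h t (fun h2 => not_le.2 ht h2.2)).symm

/-- Integration by parts against a `C¹` function with compact support. -/
lemma integral_mul_deriv_of_absolutelyContinuous (hI : I.OrdConnected)
    {F v ρ : ℝ → ℝ}
    (hF : ∀ a b, a ≤ b → Icc a b ⊆ I → AbsolutelyContinuousOnInterval F a b)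
    (hd : ∀ᵐ t ∂volume.restrict I, HasDerivAt F (v t) t) (hρ : ContDiff ℝ 1 ρ) {a b : ℝ}
    (hab : Icc a b ⊆ I) (hsupp : ∀ t ∉ Icc a b, ρ t = 0) :
    ∫ t in I, F t * deriv ρ t = - ∫ t in I, v t * ρ t := by
  have hsupp' : ∀ t ∉ Icc a b, deriv ρ t = 0 := fun t ht => by
    have : ρ =ᶠ[𝓝 t] fun _ => 0 := by
      filter_upwards [isClosed_Icc.isOpen_compl.mem_nhds ht] with s hs
      exact hsupp s hs
    rw [this.deriv_eq]; simp
  rw [setIntegral_eq_of_subset_of_forall_sdiff_eq_zero hI.measurableSet hab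
      (fun t ht => by rw [hsupp' t ht.2, mul_zero]),
    setIntegral_eq_of_subset_of_forall_sdiff_eq_zero hI.measurableSet hab
      (fun t ht => by rw [hsupp t ht.2, mul_zero])]
  by_cases hle : a ≤ b
  swap
  · rw [Set.Icc_eq_empty hle]; simp
  obtain ⟨ha, hb⟩ := eq_zero_endpoints hρ.continuous hsupp
  have h1 := (hF a b hle hab).integral_mul_deriv_eq_deriv_mul
    (hρ.contDiffOn.absolutelyContinuousOnInterval)
  rw [ha, hb, mul_zero, mul_zero, sub_zero, zero_sub] at h1
  rw [integral_Icc_eq_integral_Ioc, integral_Icc_eq_integral_Ioc,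
    ← intervalIntegral.integral_of_le hle, ← intervalIntegral.integral_of_le hle, h1]
  congr 1
  apply intervalIntegral.integral_congr_ae
  rw [Set.uIoc_of_le hle]
  have h2 := ae_restrict_of_ae_restrict_of_subset (Set.Ioc_subset_Icc_self.trans hab) hd
  rw [ae_restrict_iff' measurableSet_Ioc] at h2
  filter_upwards [h2] with t ht htm
  rw [(ht htm).deriv]

/-- A function on an interval with a locally integrable weak derivative is, up to a constant, the
primitive of this derivative. -/
lemma exists_eq_add_primitive (hI : I.OrdConnected) {u v : ℝ → ℝ}
    (hu : ∀ a b, Icc a b ⊆ I → IntegrableOn u (Icc a b))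
    (hv : ∀ a b, Icc a b ⊆ I → IntegrableOn v (Icc a b)) {t₀ : ℝ} (ht₀ : t₀ ∈ interior I)
    (h : ∀ ρ, IsTimeTest I ρ → ∫ t in I, u t * deriv ρ t = - ∫ t in I, v t * ρ t) :
    ∃ c, ∀ᵐ t ∂volume.restrict I, u t = c + ∫ s in t₀..t, v s := by
  have ht₀' := interior_subset ht₀
  set V : ℝ → ℝ := fun t => ∫ s in t₀..t, v s with hV
  have hVac : ∀ a b, a ≤ b → Icc a b ⊆ I → AbsolutelyContinuousOnInterval V a b :=
    fun a b hab hI' => absolutelyContinuousOnInterval_primitive hI hv ht₀' hab hI'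
  have hVi : ∀ a b, Icc a b ⊆ I → IntegrableOn V (Icc a b) := fun a b hab => by
    by_cases hle : a ≤ b
    · have := (hVac a b hle hab).continuousOn
      rw [Set.uIcc_of_le hle] at this
      exact this.integrableOn_Icc
    · rw [Set.Icc_eq_empty hle]; simp
  have hVd := ae_hasDerivAt_primitive hI hv ht₀'
  set w : ℝ → ℝ := fun t => u t - V t with hw
  have hwi : ∀ a b, Icc a b ⊆ I → IntegrableOn w (Icc a b) :=
    fun a b hab => (hu a b hab).sub (hVi a b hab)
  have hmul : ∀ (f : ℝ → ℝ), (∀ a b, Icc a b ⊆ I → IntegrableOn f (Icc a b)) →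
      ∀ ρ : ℝ → ℝ, Continuous ρ → ∀ a b, Icc a b ⊆ I → (∀ t ∉ Icc a b, ρ t = 0) →
      IntegrableOn (fun t => f t * ρ t) I := by
    intro f hf ρ hρ a b hab hs
    have h1 : IntegrableOn (fun t => f t * ρ t) (Icc a b) :=
      (hf a b hab).mul_continuousOn hρ.continuousOn isCompact_Icc
    have h2 : (Icc a b).indicator (fun t => f t * ρ t) = fun t => f t * ρ t := by
      ext t
      by_cases ht : t ∈ Icc a b
      · simp only [ht, Set.indicator_of_mem]
      · rw [Set.indicator_of_notMem ht, hs t ht, mul_zero]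
    rw [← h2]
    exact ((integrable_indicator_iff measurableSet_Icc).2 h1).integrableOn
  have hwz : ∀ ρ, IsTimeTest I ρ → ∫ t in I, w t * deriv ρ t = 0 := by
    intro ρ hρ
    obtain ⟨hρc, a, b, hab, hs⟩ := hρ
    have hab' := hab.trans interior_subset
    have hs' : ∀ t ∉ Icc a b, deriv ρ t = 0 := fun t ht => by
      have : ρ =ᶠ[𝓝 t] fun _ => 0 := by
        filter_upwards [isClosed_Icc.isOpen_compl.mem_nhds ht] with s hs2
        exact hs s hs2
      rw [this.deriv_eq]; simp
    have hc : Continuous (deriv ρ) := hρc.continuous_deriv (by simp)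
    have h1 := h ρ ⟨hρc, a, b, hab, hs⟩
    have h2 := integral_mul_deriv_of_absolutelyContinuous hI hVac hVd (hρc.of_le (by simp)) hab' hs
    simp only [hw, sub_mul]
    rw [integral_sub (hmul u hu _ hc a b hab' hs') (hmul V hVi _ hc a b hab' hs'), h1, h2, sub_self]
  obtain ⟨ρ₀, hρ₀, -, hint⟩ := exists_timeTest ⟨t₀, ht₀⟩
  obtain ⟨hρ₀c, a₀, b₀, hab₀, hs₀⟩ := hρ₀
  set c : ℝ := ∫ t in I, w t * ρ₀ t with hc
  refine ⟨c, ?_⟩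
  have key : ∀ᵐ t, t ∈ interior I → w t - c = 0 := by
    apply isOpen_interior.ae_eq_zero_of_integral_contDiff_smul_eq_zero
    · apply LocallyIntegrableOn.sub
      · rw [locallyIntegrableOn_iff isOpen_interior.isLocallyClosed]
        intro K hK hKc
        obtain ⟨a, b, hab, hKab⟩ := exists_Icc_of_isCompact hI hKc hK
        exact (hwi a b (hab.trans interior_subset)).mono_set hKab
      · exact (locallyIntegrable_const c).locallyIntegrableOn _
    · intro g hg hgs hgi
      obtain ⟨a₁, b₁, hab₁, hs₁⟩ := exists_Icc_of_isCompact hI hgs.isCompact hgi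
      obtain ⟨a, b, hab, h1, h2⟩ := exists_Icc_union hI hab₀ hab₁
      have hgz : ∀ t ∉ Icc a b, g t = 0 := fun t ht =>
        image_eq_zero_of_notMem_tsupport fun h3 => ht (h2 (hs₁ h3))
      have hρz : ∀ t ∉ Icc a b, ρ₀ t = 0 := fun t ht => hs₀ t fun h3 => ht (h1 h3)
      have hle : a ≤ b := by
        by_contra hle
        have : ρ₀ = 0 := by
          ext t; exact hρz t (by rw [Set.Icc_eq_empty hle]; exact Set.notMem_empty t)
        rw [this] at hint; simp at hint
      set m : ℝ := ∫ t, g t with hm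
      -- the function `g - (∫ g) ρ₀` has zero mean, hence is the derivative of a test function
      set k : ℝ → ℝ := fun t => g t - m * ρ₀ t with hk
      have hkc : ContDiff ℝ ∞ k := hg.sub (contDiff_const.mul hρ₀c)
      have hkz : ∀ t ∉ Icc a b, k t = 0 := fun t ht => by simp [hk, hgz t ht, hρz t ht]
      set ρ : ℝ → ℝ := fun t => ∫ s in a..t, k s with hρ
      have hρd : ∀ t, HasDerivAt ρ (k t) t := fun t =>
        intervalIntegral.integral_hasDerivAt_right (hkc.continuous.intervalIntegrable _ _)
          hkc.continuous.stronglyMeasurable.stronglyMeasurableAtFilter hkc.continuous.continuousAt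
      have hρderiv : deriv ρ = k := funext fun t => (hρd t).deriv
      have hρsmooth : ContDiff ℝ ∞ ρ := by
        rw [contDiff_infty_iff_deriv, hρderiv]
        exact ⟨fun t => (hρd t).differentiableAt, hkc⟩
      have hgint : Integrable g := hg.continuous.integrable_of_hasCompactSupport hgs
      have hρ₀i : Integrable ρ₀ := by
        by_contra hni
        rw [integral_undef hni] at hint; simp at hint
      have hkint : ∫ t, k t = 0 := by
        rw [hk, integral_sub hgint (hρ₀i.const_mul m), integral_const_mul, hint]
        simp [hm]
      have hkab : ∀ t, b ≤ t → ∫ s in a..t, k s = 0 := by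
        intro t ht
        rw [intervalIntegral.integral_of_le (hle.trans ht), ← integral_Icc_eq_integral_Ioc,
          ← hkint]
        apply setIntegral_eq_integral_of_forall_compl_eq_zero
        intro s hs
        exact hkz s fun h3 => hs ⟨h3.1, h3.2.trans ht⟩
      have hρtest : IsTimeTest I ρ := by
        refine ⟨hρsmooth, a, b, hab, fun t ht => ?_⟩
        rcases lt_or_ge t a with h3 | h3
        · simp only [hρ]
          rw [intervalIntegral.integral_symm, intervalIntegral.integral_of_le h3.le,
            neg_eq_zero]
          have := (eq_zero_endpoints hkc.continuous hkz).1
          apply setIntegral_eq_zero_of_forall_eq_zero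
          intro s hs
          rcases hs.2.eq_or_lt with h4 | h4
          · rw [h4, this]
          · exact hkz s fun h5 => not_lt.2 h5.1 h4
        · rcases lt_or_ge b t with h4 | h4
          · exact hkab t h4.le
          · exact absurd ⟨h3, h4⟩ ht
      have h3 := hwz ρ hρtest
      rw [hρderiv] at h3
      have hab' := hab.trans interior_subset
      have hi1 := hmul w hwi g hg.continuous a b hab' hgz
      have hi2 := hmul w hwi ρ₀ hρ₀c.continuous a b hab' hρz
      have h4 : ∫ t in I, w t * g t = m * c := by
        have h5 : ∀ t, w t * k t = w t * g t - m * (w t * ρ₀ t) := fun t => by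
          simp only [hk]; ring
        simp only [h5] at h3
        rw [integral_sub hi1 (hi2.const_mul m), integral_const_mul] at h3
        rw [hc]; linarith
      have h5 : ∫ t in I, g t = m := by
        rw [hm]
        apply setIntegral_eq_integral_of_forall_compl_eq_zero
        intro t ht
        exact hgz t fun h6 => ht (hab' h6)
      have h6 : ∫ t, g t • (w t - c) = ∫ t in I, g t • (w t - c) := by
        symm
        apply setIntegral_eq_integral_of_forall_compl_eq_zero
        intro t ht
        rw [hgz t fun h6 => ht (hab' h6), zero_smul]
      rw [h6]
      have h7 : ∀ t, g t • (w t - c) = w t * g t - c * g t := fun t => by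
        simp only [smul_eq_mul]; ring
      simp only [h7]
      rw [integral_sub hi1 (hgint.integrableOn.const_mul c), integral_const_mul, h4, h5]
      ring
  rw [← ae_restrict_interior hI, ae_restrict_iff' isOpen_interior.measurableSet]
  filter_upwards [key] with t ht hti
  have := ht hti
  simp only [hw] at this
  linarith

namespace LineAC1

variable {u v u' v' : ℝ → ℝ}

lemma of_primitive (hI : I.OrdConnected)
    (hv : ∀ a b, Icc a b ⊆ I → IntegrableOn v (Icc a b)) {t₀ : ℝ} (ht₀ : t₀ ∈ I) {c : ℝ}
    (h : ∀ᵐ t ∂volume.restrict I, u t = c + ∫ s in t₀..t, v s) : LineAC1 I u v := by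
  refine ⟨fun t => c + ∫ s in t₀..t, v s, h, fun a b hab hab' => ?_, ?_⟩
  · have h1 : AbsolutelyContinuousOnInterval (fun _ : ℝ => c) a b :=
      contDiff_const.contDiffOn.absolutelyContinuousOnInterval
    exact h1.add (absolutelyContinuousOnInterval_primitive hI hv ht₀ hab hab')
  · filter_upwards [ae_hasDerivAt_primitive hI hv ht₀] with t ht
    exact ht.const_add c

lemma congr (h : LineAC1 I u v) (hv : ∀ᵐ t ∂volume.restrict I, v t = v' t) :
    LineAC1 I u v' := by
  obtain ⟨F, h1, h2, h3⟩ := h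
  refine ⟨F, h1, h2, ?_⟩
  filter_upwards [h3, hv] with t h4 h5
  rwa [← h5]

lemma of_contDiff (hu : ContDiff ℝ 1 u) : LineAC1 I u (deriv u) :=
  ⟨u, Eventually.of_forall fun _ => rfl, fun _ _ _ _ =>
    hu.contDiffOn.absolutelyContinuousOnInterval, Eventually.of_forall fun t =>
    (hu.differentiable (by simp) t).hasDerivAt⟩

lemma add (h : LineAC1 I u v) (h' : LineAC1 I u' v') :
    LineAC1 I (fun t => u t + u' t) (fun t => v t + v' t) := by
  obtain ⟨F, h1, h2, h3⟩ := h
  obtain ⟨F', h1', h2', h3'⟩ := h'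
  refine ⟨fun t => F t + F' t, ?_, fun a b hab hI => (h2 a b hab hI).add (h2' a b hab hI), ?_⟩
  · filter_upwards [h1, h1'] with t h4 h5
    rw [h4, h5]
  · filter_upwards [h3, h3'] with t h4 h5
    exact h4.add h5

lemma mul (h : LineAC1 I u v) (h' : LineAC1 I u' v') :
    LineAC1 I (fun t => u t * u' t) (fun t => v t * u' t + u t * v' t) := by
  obtain ⟨F, h1, h2, h3⟩ := h
  obtain ⟨F', h1', h2', h3'⟩ := h'
  refine ⟨fun t => F t * F' t, ?_, fun a b hab hI => (h2 a b hab hI).mul (h2' a b hab hI), ?_⟩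
  · filter_upwards [h1, h1'] with t h4 h5
    rw [h4, h5]
  · filter_upwards [h1, h1', h3, h3'] with t h4 h5 h6 h7
    rw [h4, h5]
    exact h6.mul h7

lemma const_mul (c : ℝ) (h : LineAC1 I u v) : LineAC1 I (fun t => c * u t) (fun t => c * v t) := by
  refine ((of_contDiff (u := fun _ => c) contDiff_const).mul h).congr (Eventually.of_forall ?_)
  intro t; simp

lemma exp (h : LineAC1 I u v) :
    LineAC1 I (fun t => Real.exp (u t)) (fun t => v t * Real.exp (u t)) := by
  obtain ⟨F, h1, h2, h3⟩ := h
  refine ⟨fun t => Real.exp (F t), ?_, fun a b hab hI => ?_, ?_⟩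
  · filter_upwards [h1] with t h4
    rw [h4]
  · obtain ⟨M, hM⟩ := (h2 a b hab hI).exists_bound
    -- on the range of `F` the exponential is Lipschitz
    have hlip : ∀ x y : ℝ, x ∈ Icc (-M) M → y ∈ Icc (-M) M →
        dist (Real.exp x) (Real.exp y) ≤ Real.exp M * dist x y := by
      intro x y hx hy
      rw [Real.dist_eq, Real.dist_eq]
      refine (convex_Icc (-M) M).norm_image_sub_le_of_norm_hasDerivWithin_le
        (f := Real.exp) (f' := Real.exp) (fun z _ => (Real.hasDerivAt_exp z).hasDerivWithinAt)
        (fun z hz => ?_) hy hx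
      rw [Real.norm_eq_abs, Real.abs_exp]
      exact Real.exp_le_exp.2 hz.2
    have h6 := (h2 a b hab hI)
    unfold AbsolutelyContinuousOnInterval at h6 ⊢
    have h7 := h6.const_mul (Real.exp M)
    rw [mul_zero] at h7
    refine squeeze_zero' (Eventually.of_forall fun E => Finset.sum_nonneg fun i _ => dist_nonneg)
      ?_ h7
    have h8 : ∀ᶠ E in AbsolutelyContinuousOnInterval.totalLengthFilter ⊓
        𝓟 (AbsolutelyContinuousOnInterval.disjWithin a b),
        E ∈ AbsolutelyContinuousOnInterval.disjWithin a b :=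
      mem_inf_of_right (mem_principal_self _)
    filter_upwards [h8] with E hE
    rw [Finset.mul_sum]
    refine Finset.sum_le_sum fun i hi => hlip _ _ ?_ ?_
    · exact abs_le.1 (hM _ (hE.1 i hi).1)
    · exact abs_le.1 (hM _ (hE.1 i hi).2)
  · filter_upwards [h1, h3] with t h4 h5
    rw [h4, mul_comm]
    exact h5.exp

end LineAC1

/-! ### Derivatives along lines -/

/-- `f_t + c f_θ = g` on `I × T¹` in the sense of distributions. -/
def WeakDir (I : Set ℝ) (c : ℝ) (f g : ℝ × Torus → ℝ) : Prop :=
  ∀ ψ, IsTestFunction I ψ → ∫ z in cyl I, f z * lineD c ψ z = - ∫ z in cyl I, g z * ψ z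

/-- On almost every line `θ = y + c t`, the function `f` is locally absolutely continuous with
derivative `g`. In contrast with `WeakDir`, products need no integrability assumption. -/
def LineAC (I : Set ℝ) (c : ℝ) (f g : ℝ × Torus → ℝ) : Prop :=
  ∀ᵐ y : Torus, LineAC1 I (fun t => f (t, y + ((c * t : ℝ) : Torus)))
    (fun t => g (t, y + ((c * t : ℝ) : Torus)))

/-- The change of variables `(t, y) ↦ (t, y + c t)`. -/
noncomputable def shear (c : ℝ) : (ℝ × Torus) ≃ₜ (ℝ × Torus) where
  toFun z := (z.1, z.2 + ((c * z.1 : ℝ) : Torus))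
  invFun z := (z.1, z.2 - ((c * z.1 : ℝ) : Torus))
  left_inv z := by simp
  right_inv z := by simp
  continuous_toFun := by
    have : Continuous (fun z : ℝ × Torus => ((c * z.1 : ℝ) : Torus)) :=
      (AddCircle.continuous_mk' 1).comp (by fun_prop)
    fun_prop
  continuous_invFun := by
    have : Continuous (fun z : ℝ × Torus => ((c * z.1 : ℝ) : Torus)) :=
      (AddCircle.continuous_mk' 1).comp (by fun_prop)
    fun_prop

lemma shear_apply (c : ℝ) (t : ℝ) (y : Torus) :
    shear c (t, y) = (t, y + ((c * t : ℝ) : Torus)) := rfl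

lemma measurePreserving_shear (c : ℝ) (J : Set ℝ) :
    MeasurePreserving (shear c) (volume.restrict (cyl J)) (volume.restrict (cyl J)) := by
  have h : MeasurePreserving (shear c) volume volume := by
    have hm : Measurable (Function.uncurry fun (t : ℝ) (y : Torus) => y + ((c * t : ℝ) : Torus)) :=
      (continuous_snd.comp (shear c).continuous).measurable
    exact (MeasurePreserving.id (volume : Measure ℝ)).skew_product (μc := (volume : Measure Torus))
      (μd := (volume : Measure Torus)) (g := fun t y => y + ((c * t : ℝ) : Torus)) hm
      (Eventually.of_forall fun t => (measurePreserving_add_right _ _).map_eq)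
  have h2 := h.restrict_preimage_emb (shear c).measurableEmbedding (cyl J)
  have h3 : shear c ⁻¹' cyl J = cyl J := by
    ext z; simp [shear]
  rwa [h3] at h2

lemma setIntegral_shear (c : ℝ) (J : Set ℝ) (f : ℝ × Torus → ℝ) :
    ∫ z in cyl J, f (shear c z) = ∫ z in cyl J, f z :=
  (measurePreserving_shear c J).integral_comp (shear c).measurableEmbedding f

lemma LocInt.shear {f : ℝ × Torus → ℝ} (hf : LocInt I f) (c : ℝ) :
    LocInt I (fun z => f (shear c z)) :=
  ⟨hf.1.comp_measurePreserving (measurePreserving_shear c I), fun a b hab =>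
    ((measurePreserving_shear c _).integrable_comp_emb (Gowdy.shear c).measurableEmbedding).2
      (hf.2 a b hab)⟩

lemma LocInt.integrableOn_mul {f ψ : ℝ × Torus → ℝ} (hf : LocInt I f)
    (hψ : Continuous ψ) {a b : ℝ} (hab : Icc a b ⊆ I)
    (hs : ∀ t ∉ Icc a b, ∀ θ, ψ (t, θ) = 0) : IntegrableOn (fun z => f z * ψ z) (cyl I) := by
  apply integrableOn_cyl_of_support measurableSet_Icc (J := Icc a b)
  · intro t ht θ; rw [hs t ht, mul_zero]
  · exact (hf.2 a b hab).mul_continuousOn hψ.continuousOn (isCompact_cyl_Icc a b)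

lemma LocInt.integrableOn_mul_test {f ψ : ℝ × Torus → ℝ} (hf : LocInt I f)
    (hψ : IsTestFunction I ψ) : IntegrableOn (fun z => f z * ψ z) (cyl I) := by
  obtain ⟨a, b, hab, hs⟩ := hψ.support
  exact hf.integrableOn_mul hψ.smoothFn.continuous (hab.trans interior_subset) hs

lemma lineD_shear {ψ : ℝ × Torus → ℝ} (hψ : SmoothFn ψ) (c t : ℝ) (y : Torus) :
    lineD c ψ (shear c (t, y)) = deriv (fun s => ψ (shear c (s, y))) t :=
  (hψ.hasDerivAt_line c y t).deriv.symm

lemma contDiff_line {ψ : ℝ × Torus → ℝ} (hψ : SmoothFn ψ) (c : ℝ) (y : Torus) :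
    ContDiff ℝ ∞ (fun s => ψ (shear c (s, y))) := by
  induction y using QuotientAddGroup.induction_on with
  | H x =>
    have h1 : ContDiff ℝ ∞ (fun s : ℝ => (s, x + c * s)) := by fun_prop
    have h := ContDiff.comp hψ h1
    convert! h using 1

lemma setIntegral_cyl_symm {J : Set ℝ} {f : ℝ × Torus → ℝ} (hf : IntegrableOn f (cyl J)) :
    ∫ z in cyl J, f z = ∫ θ : Torus, ∫ t in J, f (t, θ) := by
  rw [IntegrableOn, restrict_cyl] at hf
  rw [restrict_cyl, integral_prod_symm _ hf]

lemma LineAC.weakDir (hI : I.OrdConnected) {c : ℝ} {f g : ℝ × Torus → ℝ}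
    (h : LineAC I c f g) (hf : LocInt I f) (hg : LocInt I g) : WeakDir I c f g := by
  intro ψ hψ
  obtain ⟨a, b, hab, hs⟩ := hψ.support
  have hab' := hab.trans interior_subset
  rw [← setIntegral_shear c I (fun z => f z * lineD c ψ z),
    ← setIntegral_shear c I (fun z => g z * ψ z),
    setIntegral_cyl_symm, setIntegral_cyl_symm, ← integral_neg]
  · apply integral_congr_ae
    filter_upwards [h] with y hy
    obtain ⟨F, h1, h2, h3⟩ := hy
    have h4 := integral_mul_deriv_of_absolutelyContinuous hI h2 h3
      ((contDiff_line hψ.smoothFn c y).of_le (by simp)) hab' (fun t ht => hs t ht _)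
    refine Eq.trans ?_ h4
    apply integral_congr_ae
    filter_upwards [h1] with t h5
    rw [lineD_shear hψ.smoothFn, shear_apply, h5]
  · exact ((measurePreserving_shear c I).integrable_comp_emb (shear c).measurableEmbedding).2
      (hg.integrableOn_mul_test hψ)
  · exact ((measurePreserving_shear c I).integrable_comp_emb (shear c).measurableEmbedding).2
      (hf.integrableOn_mul_test (hψ.lineD c))

lemma LocInt.ae_integrableOn_line (hI : I.OrdConnected) {f : ℝ × Torus → ℝ}
    (hf : LocInt I f) :
    ∀ᵐ y : Torus, ∀ a b, Icc a b ⊆ I → IntegrableOn (fun t => f (t, y)) (Icc a b) := by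
  rcases I.eq_empty_or_nonempty with rfl | hne
  · refine Eventually.of_forall fun y a b hab => ?_
    rw [Set.subset_empty_iff.1 hab]; simp
  obtain ⟨a, b, -, -, hab, hex⟩ := exists_exhaustion hI hne
  have h1 : ∀ n, ∀ᵐ y : Torus, IntegrableOn (fun t => f (t, y)) (Icc (a n) (b n)) := by
    intro n
    have := hf.2 _ _ (hab n)
    rw [IntegrableOn, restrict_cyl] at this
    exact this.swap.prod_right_ae
  filter_upwards [ae_all_iff.2 h1] with y hy x x' hx
  obtain ⟨n, hn⟩ := hex x x' hx
  exact (hy n).mono_set hn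

lemma LocInt.ae_integrable_slice (hI : I.OrdConnected) {f : ℝ × Torus → ℝ}
    (hf : LocInt I f) :
    ∀ᵐ t ∂volume.restrict I, Integrable (fun y : Torus => f (t, y)) := by
  refine ae_of_forall_Icc hI fun a b hab => ?_
  have := hf.2 _ _ hab
  rw [IntegrableOn, restrict_cyl] at this
  exact this.prod_right_ae

lemma LocInt.integrableOn_slice_integral {f : ℝ × Torus → ℝ}
    (hf : LocInt I f) {χ : Torus → ℝ} (hχ : Continuous χ) {a b : ℝ} (hab : Icc a b ⊆ I) :
    IntegrableOn (fun t => ∫ y, f (t, y) * χ y) (Icc a b) := by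
  have h1 : IntegrableOn (fun z : ℝ × Torus => f z * χ z.2) (cyl (Icc a b)) :=
    (hf.2 a b hab).mul_continuousOn (by fun_prop) (isCompact_cyl_Icc a b)
  rw [IntegrableOn, restrict_cyl] at h1
  exact h1.integral_prod_left

/-- Integration in space commutes with taking primitives in time. -/
lemma LocInt.integral_primitive_mul (hI : I.OrdConnected) {f : ℝ × Torus → ℝ}
    (hf : LocInt I f) {χ : Torus → ℝ} (hχ : Continuous χ) {t₀ t : ℝ} (ht₀ : t₀ ∈ I) (ht : t ∈ I) :
    Integrable (fun y => ∫ s in t₀..t, f (s, y)) ∧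
    ∫ y, (∫ s in t₀..t, f (s, y)) * χ y = ∫ s in t₀..t, ∫ y, f (s, y) * χ y := by
  have key : ∀ {a b : ℝ}, Icc a b ⊆ I → a ≤ b →
      Integrable (fun y => ∫ s in a..b, f (s, y)) ∧
      ∫ y, (∫ s in a..b, f (s, y)) * χ y = ∫ s in a..b, ∫ y, f (s, y) * χ y := by
    intro a b hab hle
    have h0 := hf.2 a b hab
    have h1 : IntegrableOn (fun z : ℝ × Torus => f z * χ z.2) (cyl (Icc a b)) :=
      h0.mul_continuousOn (by fun_prop) (isCompact_cyl_Icc a b)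
    rw [IntegrableOn, restrict_cyl] at h0 h1
    constructor
    · simp only [intervalIntegral.integral_of_le hle, ← integral_Icc_eq_integral_Ioc]
      exact h0.integral_prod_right
    · simp only [intervalIntegral.integral_of_le hle, ← integral_Icc_eq_integral_Ioc,
        ← integral_mul_const]
      exact integral_integral_swap (f := fun y s => f (s, y) * χ y) h1.swap
  rcases le_total t₀ t with h | h
  · exact key (hI.out ht₀ ht) h
  · obtain ⟨h1, h2⟩ := key (hI.out ht ht₀) h
    constructor
    · simp only [intervalIntegral.integral_symm t t₀]
      exact h1.neg
    · simp only [intervalIntegral.integral_symm t t₀, neg_mul, integral_neg, h2]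

/-- The moments in space of a function with a weak derivative along lines are locally absolutely
continuous in time. -/
lemma WeakDir.moment (hI : I.OrdConnected) {c : ℝ} {f g : ℝ × Torus → ℝ}
    (h : WeakDir I c f g) (hf : LocInt I f) (hg : LocInt I g) {t₀ : ℝ} (ht₀ : t₀ ∈ interior I)
    {χ : Torus → ℝ} (hχ : ContDiff ℝ ∞ (fun x : ℝ => χ (x : Torus))) :
    ∃ k, ∀ᵐ t ∂volume.restrict I, ∫ y, f (shear c (t, y)) * χ y
      = k + ∫ s in t₀..t, ∫ y, g (shear c (s, y)) * χ y := by
  have hχc : Continuous χ := (SmoothFn.of_space hχ).continuous.comp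
    (Continuous.prodMk_right (0 : ℝ))
  refine exists_eq_add_primitive hI
    (fun a b hab => (hf.shear c).integrableOn_slice_integral hχc hab)
    (fun a b hab => (hg.shear c).integrableOn_slice_integral hχc hab) ht₀ fun ρ hρ => ?_
  set ψ : ℝ × Torus → ℝ := fun z => ρ z.1 * χ (z.2 + ((-c * z.1 : ℝ) : Torus)) with hψ
  have hψt : IsTestFunction I ψ :=
    hρ.isTestFunction.mul_smooth ((SmoothFn.of_space hχ).shear (-c))
  have hψs : ∀ t y, ψ (shear c (t, y)) = ρ t * χ y := by
    intro t y
    simp [hψ, shear_apply]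
  have hψd : ∀ t y, lineD c ψ (shear c (t, y)) = deriv ρ t * χ y := by
    intro t y
    rw [lineD_shear hψt.smoothFn]
    simp only [hψs]
    exact ((hρ.1.differentiable (by simp) t).hasDerivAt.mul_const _).deriv
  have h1 := h ψ hψt
  have hi1 := ((measurePreserving_shear c I).integrable_comp_emb (shear c).measurableEmbedding).2
      (hg.integrableOn_mul_test hψt)
  have hi2 := ((measurePreserving_shear c I).integrable_comp_emb (shear c).measurableEmbedding).2
      (hf.integrableOn_mul_test (hψt.lineD c))
  rw [← setIntegral_shear c I (fun z => f z * lineD c ψ z),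
    ← setIntegral_shear c I (fun z => g z * ψ z)] at h1
  have hi2' := setIntegral_cyl hi2
  have hi1' := setIntegral_cyl hi1
  simp only [Function.comp_apply] at hi1' hi2'
  rw [hi1', hi2'] at h1
  simp only [hψs, hψd] at h1
  have e : ∀ (f' : ℝ × Torus → ℝ) (r : ℝ → ℝ), (∫ t in I, (∫ y, f' (t, y) * χ y) * r t)
      = ∫ t in I, ∫ y, f' (t, y) * (r t * χ y) := by
    intro f' r
    congr 1; ext t
    rw [← integral_mul_const]
    congr 1; ext y; ring
  rw [e (fun z => f (shear c z)), e (fun z => g (shear c z)), h1]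

/-- A function with a weak derivative along the lines `θ = y + c t` is locally absolutely
continuous on almost all these lines. -/
lemma WeakDir.lineAC (hI : I.OrdConnected) (hne : (interior I).Nonempty)
    {c : ℝ} {f g : ℝ × Torus → ℝ} (h : WeakDir I c f g) (hf : LocInt I f) (hg : LocInt I g) :
    LineAC I c f g := by
  obtain ⟨t₀, ht₀⟩ := hne
  have ht₀' := interior_subset ht₀
  have hfs := hf.shear c
  have hgs := hg.shear c
  have hne0 : (volume.restrict I) ≠ 0 := by
    rw [← ae_restrict_interior hI, Ne, Measure.restrict_eq_zero]
    exact (isOpen_interior.measure_pos _ ⟨t₀, ht₀⟩).ne'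
  have hneBot : (ae (volume.restrict I)).NeBot := ae_neBot.2 hne0
  -- a measurable representative of `g`
  obtain ⟨g', hg'm, hgg'⟩ := hgs.1
  set G : ℝ × Torus → ℝ := fun z => ∫ s in t₀..z.1, g' (s, z.2) with hG
  have hGm : StronglyMeasurable G := by
    have h2 : StronglyMeasurable (fun p : (ℝ × Torus) × ℝ => g' (p.2, p.1.2)) :=
      hg'm.comp_measurable (by fun_prop)
    have hs1 : MeasurableSet {p : (ℝ × Torus) × ℝ | t₀ < p.2 ∧ p.2 ≤ p.1.1} :=
      (measurableSet_lt measurable_const measurable_snd).inter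
        (measurableSet_le measurable_snd (by fun_prop))
    have hs2 : MeasurableSet {p : (ℝ × Torus) × ℝ | p.1.1 < p.2 ∧ p.2 ≤ t₀} :=
      (measurableSet_lt (by fun_prop) measurable_snd).inter
        (measurableSet_le measurable_snd measurable_const)
    have h3 := ((h2.indicator hs1).integral_prod_right' (ν := (volume : Measure ℝ))).sub
      ((h2.indicator hs2).integral_prod_right' (ν := (volume : Measure ℝ)))
    convert! h3 using 1
    ext z
    simp only [hG, intervalIntegral, Pi.sub_apply]
    rw [← integral_indicator measurableSet_Ioc, ← integral_indicator measurableSet_Ioc]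
    congr 1
  have hgg'' := ae_slice' hgg'
  have hGeq : ∀ᵐ y : Torus, ∀ t ∈ I, G (t, y) = ∫ s in t₀..t, g (shear c (s, y)) := by
    filter_upwards [hgg''] with y hy t ht
    apply intervalIntegral.integral_congr_ae
    rw [ae_restrict_iff' hI.measurableSet] at hy
    filter_upwards [hy] with s hs hst
    refine (hs ?_).symm
    rcases le_total t₀ t with h1 | h1
    · rw [Set.uIoc_of_le h1] at hst
      exact hI.out ht₀' ht ⟨hst.1.le, hst.2⟩
    · rw [Set.uIoc_of_ge h1] at hst
      exact hI.out ht ht₀' ⟨hst.1.le, hst.2⟩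
  set W : ℝ → Torus → ℝ := fun t y => f (shear c (t, y)) - G (t, y) with hW
  have hGint : ∀ t ∈ I, Integrable (fun y => G (t, y)) := by
    intro t ht
    refine (hgs.integral_primitive_mul hI continuous_const (χ := fun _ => 1) ht₀' ht).1.congr ?_
    filter_upwards [hGeq] with y hy
    rw [hy t ht]
  have hmem : ∀ᵐ t ∂volume.restrict I, t ∈ I := ae_restrict_mem hI.measurableSet
  have hfint := hfs.ae_integrable_slice hI
  have hWint : ∀ᵐ t ∂volume.restrict I, Integrable (W t) := by
    filter_upwards [hmem, hfint] with t h1 h2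
    exact h2.sub (hGint t h1)
  have hmom : ∀ χ : Torus → ℝ, ContDiff ℝ ∞ (fun x : ℝ => χ (x : Torus)) →
      ∃ k, ∀ᵐ t ∂volume.restrict I, ∫ y, W t y * χ y = k := by
    intro χ hχ
    have hχc : Continuous χ := (SmoothFn.of_space hχ).continuous.comp
      (Continuous.prodMk_right (0 : ℝ))
    obtain ⟨k, hk⟩ := h.moment hI hf hg ht₀ hχ
    refine ⟨k, ?_⟩
    filter_upwards [hk, hmem, hfint] with t h1 h2 h3
    obtain ⟨h4, h5⟩ := hgs.integral_primitive_mul hI hχc ht₀' h2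
    obtain ⟨C, hC⟩ := isCompact_univ.exists_bound_of_continuousOn hχc.continuousOn
    have hbd : ∀ {F : Torus → ℝ}, Integrable F → Integrable (fun y => F y * χ y) := fun hF =>
      hF.mul_bdd (c := C) hχc.aestronglyMeasurable
        (Eventually.of_forall fun y => hC y (Set.mem_univ _))
    have h6 : ∫ y, G (t, y) * χ y = ∫ y, (∫ s in t₀..t, g (shear c (s, y))) * χ y := by
      apply integral_congr_ae
      filter_upwards [hGeq] with y hy
      rw [hy t h2]
    simp only [hW, sub_mul]
    rw [integral_sub (hbd h3) (hbd (hGint t h2)), h1, h6, h5]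
    ring
  choose kre hkre using fun k : ℤ => hmom (fun θ => (fourier k θ).re) (contDiff_fourier_re k)
  choose kim hkim using fun k : ℤ => hmom (fun θ => (fourier k θ).im) (contDiff_fourier_im k)
  -- all Fourier coefficients of `W t` are independent of the time `t`
  have hcoef : ∀ᵐ t ∂volume.restrict I, Integrable (W t) ∧
      ∀ k, fourierCoeff (fun y => (W t y : ℂ)) k = (kre (-k) : ℂ) + kim (-k) * Complex.I := by
    filter_upwards [hWint, ae_all_iff.2 hkre, ae_all_iff.2 hkim] with t h1 h2 h3
    refine ⟨h1, fun k => ?_⟩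
    rw [fourierCoeff_eq]
    have h4 : Integrable (fun y => fourier (-k) y * (W t y : ℂ)) :=
      integrable_continuousMap_mul _ h1.ofReal
    rw [← h2, ← h3]
    apply Complex.ext
    · rw [← RCLike.re_eq_complex_re, ← integral_re h4]
      simp [mul_comm]
    · rw [← RCLike.im_eq_complex_im, ← integral_im h4]
      simp [mul_comm]
  obtain ⟨t₁, ht₁, hc₁⟩ := hcoef.exists
  have hWeq : ∀ᵐ t ∂volume.restrict I, ∀ᵐ y, f (shear c (t, y)) = W t₁ y + G (t, y) := by
    filter_upwards [hcoef] with t ht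
    have := ae_eq_of_fourierCoeff ht.1.ofReal ht₁.ofReal (fun k => (ht.2 k).trans (hc₁ k).symm)
    filter_upwards [this] with y hy
    have hy' : W t y = W t₁ y := by exact_mod_cast hy
    rw [← hy']; simp [hW]
  have hWeq' : ∀ᵐ y : Torus, ∀ᵐ t ∂volume.restrict I, f (shear c (t, y)) = W t₁ y + G (t, y) := by
    obtain ⟨f', hf'm, hff'⟩ := hfs.1
    obtain ⟨w, hwm, hww⟩ := ht₁.aestronglyMeasurable
    have h1 : ∀ᵐ t ∂volume.restrict I, ∀ᵐ y, f' (t, y) = w y + G (t, y) := by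
      filter_upwards [hWeq, ae_slice hff'] with t h1 h2
      filter_upwards [h1, h2, hww] with y h3 h4 h5
      rw [← h4, ← h5, h3]
    have hs : MeasurableSet {z : ℝ × Torus | f' z = w z.2 + G z} :=
      measurableSet_eq_fun hf'm.measurable
        ((hwm.measurable.comp measurable_snd).add hGm.measurable)
    have h2 : ∀ᵐ z ∂volume.restrict (cyl I), f' z = w z.2 + G z := by
      rw [restrict_cyl]
      exact (Measure.ae_prod_iff_ae_ae hs).2 h1
    filter_upwards [ae_slice' h2, ae_slice' hff', hww] with y h3 h4 h5
    filter_upwards [h3, h4] with t h6 h7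
    rw [h7, h6, h5]
  filter_upwards [hWeq', hGeq, hgs.ae_integrableOn_line hI] with y h1 h2 h3
  refine LineAC1.of_primitive hI h3 ht₀' (c := W t₁ y) ?_
  filter_upwards [h1, hmem] with t h4 h5
  exact h4.trans (congrArg _ (h2 t h5))

/-! ### Fourier modes in space -/

/-- The Fourier coefficient of order `k` of the function `f(t, ·)`. -/
noncomputable def mode (k : ℤ) (f : ℝ × Torus → ℝ) (t : ℝ) : ℂ :=
  fourierCoeff (fun θ => (f (t, θ) : ℂ)) k

lemma mode_re {k : ℤ} {f : ℝ × Torus → ℝ} {t : ℝ} (hf : Integrable (fun θ => f (t, θ))) :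
    (mode k f t).re = ∫ θ, f (t, θ) * (fourier (-k) θ).re := by
  have h4 : Integrable (fun y => fourier (-k) y * (f (t, y) : ℂ)) :=
    integrable_continuousMap_mul _ hf.ofReal
  rw [mode, fourierCoeff_eq, ← RCLike.re_eq_complex_re, ← integral_re h4]
  simp [mul_comm]

lemma mode_im {k : ℤ} {f : ℝ × Torus → ℝ} {t : ℝ} (hf : Integrable (fun θ => f (t, θ))) :
    (mode k f t).im = ∫ θ, f (t, θ) * (fourier (-k) θ).im := by
  have h4 : Integrable (fun y => fourier (-k) y * (f (t, y) : ℂ)) :=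
    integrable_continuousMap_mul _ hf.ofReal
  rw [mode, fourierCoeff_eq, ← RCLike.im_eq_complex_im, ← integral_im h4]
  simp [mul_comm]

lemma norm_fourierCoeff_le (f : Torus → ℂ) (k : ℤ) : ‖fourierCoeff f k‖ ≤ ∫ θ, ‖f θ‖ := by
  rw [fourierCoeff_eq]
  refine (norm_integral_le_integral_norm _).trans (le_of_eq ?_)
  congr 1; ext θ
  rw [norm_mul, fourier_apply, Circle.norm_coe, one_mul]

/-- The square root of `∑_{k ∉ s, k ≠ 0} (2 π k)⁻²`. -/
noncomputable def fourierTail (s : Finset ℤ) : ℝ :=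
  √(∑' k : {k // k ∉ s}, (1 / (2 * π * ((k : ℤ) : ℝ))) ^ 2)

lemma summable_fourierTail :
    Summable fun k : ℤ => (1 / (2 * π * (k : ℝ))) ^ 2 := by
  have h : Summable fun k : ℤ => 1 / (k : ℝ) ^ 2 := by
    exact_mod_cast Real.summable_one_div_int_pow.2 (by norm_num : 1 < 2)
  refine (h.mul_left ((1 / (2 * π)) ^ 2)).congr fun k => ?_
  rw [div_pow, div_pow, mul_pow (2 * π), one_pow, div_mul_div_comm, one_mul]

lemma tendsto_fourierTail : Tendsto fourierTail atTop (𝓝 0) := by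
  have h := tendsto_tsum_compl_atTop_zero fun k : ℤ => (1 / (2 * π * (k : ℝ))) ^ 2
  have h2 := (Real.continuous_sqrt.tendsto 0).comp h
  rwa [Real.sqrt_zero] at h2

lemma fourierTail_nonneg (s : Finset ℤ) : 0 ≤ fourierTail s := Real.sqrt_nonneg _

lemma fourierTail_sq (s : Finset ℤ) :
    fourierTail s ^ 2 = ∑' k : {k // k ∉ s}, (1 / (2 * π * ((k : ℤ) : ℝ))) ^ 2 :=
  Real.sq_sqrt (tsum_nonneg fun _ => sq_nonneg _)

lemma norm_eq_of_derivative_coeff {u v : ℂ} {k : ℤ} (hk : k ≠ 0)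
    (h : v = 2 * π * Complex.I * k * u) : ‖u‖ = |1 / (2 * π * (k : ℝ))| * ‖v‖ := by
  have hk' : (k : ℝ) ≠ 0 := by exact_mod_cast hk
  rw [h]
  simp only [norm_mul, Complex.norm_real, Complex.norm_I, Complex.norm_intCast, Complex.norm_ofNat]
  rw [abs_div, abs_mul, abs_mul, abs_one, Real.norm_eq_abs, abs_of_pos (two_pos : (0:ℝ) < 2)]
  have : |(k : ℝ)| ≠ 0 := abs_ne_zero.2 hk'
  have h2 : |π| ≠ 0 := abs_ne_zero.2 Real.pi_ne_zero
  field_simp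

/-- A function on the torus with a square integrable derivative is approximated by its Fourier
sums, uniformly with respect to the norm of the derivative. -/
lemma fourier_approx {f g : Torus → ℝ} (hf : Integrable f) (hg : MemLp g 2)
    (h : ∀ k : ℤ, fourierCoeff (fun θ => (g θ : ℂ)) k
      = 2 * π * Complex.I * k * fourierCoeff (fun θ => (f θ : ℂ)) k) :
    ∀ᵐ θ : Torus, ∀ s : Finset ℤ, 0 ∈ s →
      |f θ - (∑ k ∈ s, fourierCoeff (fun θ => (f θ : ℂ)) k * fourier k θ).re|
        ≤ fourierTail s * (eLpNorm g 2 volume).toReal := by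
  have hgc : MemLp (fun θ => (g θ : ℂ)) 2 := hg.ofReal
  have hsq := hasSum_sq_fourierCoeff_of_memLp hgc
  set F : ℤ → ℂ := fourierCoeff (fun θ => (f θ : ℂ)) with hF
  set G : ℤ → ℂ := fourierCoeff (fun θ => (g θ : ℂ)) with hG
  set a : ℤ → ℝ := fun k => |1 / (2 * π * (k : ℝ))| with ha
  have ha2 : Summable fun k => a k ^ 2 := by
    simpa only [ha, sq_abs] using summable_fourierTail
  have hFG : ∀ k : ℤ, k ≠ 0 → ‖F k‖ = a k * ‖G k‖ := fun k hk =>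
    norm_eq_of_derivative_coeff hk (h k)
  have hsum0 : Summable fun k => a k * ‖G k‖ :=
    Summable.of_nonneg_of_le (fun k => by positivity)
      (fun k => (by nlinarith [sq_nonneg (a k - ‖G k‖), sq_nonneg (a k), sq_nonneg ‖G k‖] :
        a k * ‖G k‖ ≤ a k ^ 2 + ‖G k‖ ^ 2)) (ha2.add hsq.summable)
  have hsum : Summable fun k => ‖F k‖ := by
    refine hsum0.congr_cofinite ?_
    filter_upwards [(Set.finite_singleton (0 : ℤ)).compl_mem_cofinite] with k hk
    exact (hFG k hk).symm
  have hnorm : (eLpNorm g 2 volume).toReal ^ 2 = ∑' k, ‖G k‖ ^ 2 := by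
    rw [hsq.tsum_eq, hg.eLpNorm_eq_integral_rpow_norm two_ne_zero (by norm_num),
      ENNReal.toReal_ofReal (by positivity)]
    simp only [ENNReal.toReal_ofNat]
    rw [← Real.rpow_natCast, ← Real.rpow_mul (by positivity)]
    norm_num
  filter_upwards [ae_norm_sub_sum_fourier_le hf.ofReal hsum] with θ hθ s hs
  have h1 : |f θ - (∑ k ∈ s, F k * fourier k θ).re| ≤ ‖(f θ : ℂ) - ∑ k ∈ s, F k * fourier k θ‖ := by
    have := Complex.abs_re_le_norm ((f θ : ℂ) - ∑ k ∈ s, F k * fourier k θ)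
    simpa using this
  refine h1.trans ((hθ s).trans ?_)
  have h2 : ∀ k : {k // k ∉ s}, ‖F k‖ = a k * ‖G k‖ := fun k => hFG k fun h0 => k.2 (h0 ▸ hs)
  have h2' : ∑' k : {k // k ∉ s}, ‖F k‖ = ∑' k : {k // k ∉ s}, a k * ‖G k‖ := tsum_congr h2
  refine h2'.le.trans ?_
  refine abs_le_of_sq_le_sq' ?_ (mul_nonneg (fourierTail_nonneg s) ENNReal.toReal_nonneg) |>.2
  rw [mul_pow, fourierTail_sq, hnorm]
  have h3 := Real.inner_le_Lp_mul_Lq_tsum_of_nonneg (f := fun k : {k // k ∉ s} => a k)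
    (g := fun k : {k // k ∉ s} => ‖G k‖) (p := 2) (q := 2)
    (Real.HolderConjugate.two_two) (fun k => by positivity) (fun k => by positivity)
    (by simp only [Real.rpow_two]; exact ha2.subtype (fun k => k ∉ s))
    (by simp only [Real.rpow_two]; exact hsq.summable.subtype (fun k => k ∉ s))
  have h4 := h3
  simp only [Real.rpow_two] at h4
  have h5 : 0 ≤ ∑' k : {k // k ∉ s}, a k * ‖G k‖ := tsum_nonneg fun k => by positivity
  have h6 := pow_le_pow_left₀ h5 h4 2
  rw [mul_pow, ← Real.sqrt_eq_rpow, ← Real.sqrt_eq_rpow, Real.sq_sqrt (tsum_nonneg fun _ => sq_nonneg _),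
    Real.sq_sqrt (tsum_nonneg fun _ => sq_nonneg _)] at h6
  refine h6.trans ?_
  have h7 : ∑' k : {k // k ∉ s}, a k ^ 2
      = ∑' k : {k // k ∉ s}, (1 / (2 * π * ((k : ℤ) : ℝ))) ^ 2 := by
    simp only [ha, sq_abs]
  rw [h7]
  refine mul_le_mul_of_nonneg_left ?_ (tsum_nonneg fun _ => sq_nonneg _)
  exact hsq.summable.tsum_subtype_le _ _ fun _ => sq_nonneg _

/-! ### Modes of Sobolev functions -/

/-- The fundamental lemma of the calculus of variations. Endpoints of `I`, where test functions vanish,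
form a null set. -/
lemma ae_eq_zero_of_timeTest (hI : I.OrdConnected) {u : ℝ → ℝ}
    (hu : ∀ a b, Icc a b ⊆ I → IntegrableOn u (Icc a b))
    (h : ∀ ρ, IsTimeTest I ρ → ∫ t in I, u t * ρ t = 0) :
    ∀ᵐ t ∂volume.restrict I, u t = 0 := by
  rw [← ae_restrict_interior hI, ae_restrict_iff' isOpen_interior.measurableSet]
  apply isOpen_interior.ae_eq_zero_of_integral_contDiff_smul_eq_zero
  · rw [locallyIntegrableOn_iff isOpen_interior.isLocallyClosed]
    intro K hK hKc
    obtain ⟨a, b, hab, hKab⟩ := exists_Icc_of_isCompact hI hKc hK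
    exact (hu a b (hab.trans interior_subset)).mono_set hKab
  · intro g hg hgs hgi
    obtain ⟨a, b, hab, hs⟩ := exists_Icc_of_isCompact hI hgs.isCompact hgi
    have hgz : ∀ t ∉ Icc a b, g t = 0 := fun t ht =>
      image_eq_zero_of_notMem_tsupport fun h3 => ht (hs h3)
    have h6 : ∫ t, g t • u t = ∫ t in I, g t • u t := by
      symm
      apply setIntegral_eq_integral_of_forall_compl_eq_zero
      intro t ht
      rw [hgz t fun h6 => ht (interior_subset (hab h6)), zero_smul]
    rw [h6, ← h g ⟨hg, a, b, hab, hgz⟩]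
    congr 1; ext t; rw [smul_eq_mul, mul_comm]

/-- `f_θ = g` on `I × T¹` in the sense of distributions. -/
def WeakDX (I : Set ℝ) (f g : ℝ × Torus → ℝ) : Prop :=
  ∀ ψ, IsTestFunction I ψ → ∫ z in cyl I, f z * partialX ψ z = - ∫ z in cyl I, g z * ψ z

/-- A weak derivative in space on `I × T¹` is a weak derivative on the circle at almost every time;
the exceptional set of times depends on the test function. -/
lemma WeakDX.slice (hI : I.OrdConnected) {f g : ℝ × Torus → ℝ}
    (h : WeakDX I f g) (hf : LocInt I f) (hg : LocInt I g) {χ : Torus → ℝ}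
    (hχ : ContDiff ℝ ∞ (fun x : ℝ => χ (x : Torus))) {χ' : Torus → ℝ} (hχc' : Continuous χ')
    (hχ' : ∀ x : ℝ, HasDerivAt (fun x : ℝ => χ (x : Torus)) (χ' (x : Torus)) x) :
    ∀ᵐ t ∂volume.restrict I, (∫ y, f (t, y) * χ' y) + (∫ y, g (t, y) * χ y) = 0 := by
  have hχc : Continuous χ := (SmoothFn.of_space hχ).continuous.comp
    (Continuous.prodMk_right (0 : ℝ))
  refine ae_eq_zero_of_timeTest hI (fun a b hab =>
    (hf.integrableOn_slice_integral hχc' hab).add (hg.integrableOn_slice_integral hχc hab)) ?_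
  intro ρ hρ
  set ψ : ℝ × Torus → ℝ := fun z => ρ z.1 * χ z.2 with hψ
  have hψt : IsTestFunction I ψ := hρ.isTestFunction.mul_smooth (SmoothFn.of_space hχ)
  have hX : ∀ t y, partialX ψ (t, y) = ρ t * χ' y := by
    intro t y
    induction y using QuotientAddGroup.induction_on with
    | H x =>
      have h1 := (hψt.smoothFn.hasDerivAt_X t (x : Torus))
      have h2 : HasDerivAt (fun s : ℝ => ρ t * χ ((x : Torus) + (s : Torus)))
          (ρ t * χ' (x : Torus)) 0 := by
        have h3 : HasDerivAt (fun s : ℝ => χ ((x + s : ℝ) : Torus)) (χ' (x : Torus)) 0 := by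
          have := hχ' (x + 0)
          rw [add_zero] at this
          have h4 := HasDerivAt.comp_const_add (f := fun x : ℝ => χ (x : Torus)) x 0 (by simpa using this)
          simpa using! h4
        simp only [AddCircle.coe_add] at h3
        exact h3.const_mul _
      exact h1.unique h2
  have h1 := h ψ hψt
  have hi1 := hf.integrableOn_mul_test hψt.partialX
  have hi2 := hg.integrableOn_mul_test hψt
  have hs1 := setIntegral_cyl hi1
  have hs2 := setIntegral_cyl hi2
  rw [hs1, hs2] at h1
  simp only [hX] at h1
  simp only [hψ] at h1
  have e : ∀ (f' : ℝ × Torus → ℝ) (r : ℝ → ℝ) (χ : Torus → ℝ), (∫ t in I, (∫ y, f' (t, y) * χ y) * r t)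
      = ∫ t in I, ∫ y, f' (t, y) * (r t * χ y) := by
    intro f' r χ
    congr 1; ext t
    rw [← integral_mul_const]
    congr 1; ext y; ring
  have hi1' : IntegrableOn (fun t => (∫ y, f (t, y) * χ' y) * ρ t) I := by
    rw [IntegrableOn, restrict_cyl] at hi1
    refine hi1.integral_prod_left.congr (Eventually.of_forall fun t => ?_)
    simp only [hX, ← integral_mul_const]
    congr 1; ext y; ring
  have hi2' : IntegrableOn (fun t => (∫ y, g (t, y) * χ y) * ρ t) I := by
    rw [IntegrableOn, restrict_cyl] at hi2
    refine hi2.integral_prod_left.congr (Eventually.of_forall fun t => ?_)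
    simp only [hψ, ← integral_mul_const]
    congr 1; ext y; ring
  simp only [add_mul]
  rw [integral_add hi1' hi2', e, e, h1]
  ring

lemma hasDerivAt_fourier_re (k : ℤ) (x : ℝ) :
    HasDerivAt (fun x : ℝ => (fourier k (x : Torus)).re)
      (-(2 * π * k) * (fourier k (x : Torus)).im) x := by
  have h := hasDerivAt_fourier 1 k x
  have h2 := Complex.reCLM.hasFDerivAt.comp_hasDerivAt x h
  refine h2.congr_deriv ?_
  simp [Complex.mul_re, Complex.mul_im]

lemma hasDerivAt_fourier_im (k : ℤ) (x : ℝ) :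
    HasDerivAt (fun x : ℝ => (fourier k (x : Torus)).im)
      ((2 * π * k) * (fourier k (x : Torus)).re) x := by
  have h := hasDerivAt_fourier 1 k x
  have h2 := Complex.imCLM.hasFDerivAt.comp_hasDerivAt x h
  refine h2.congr_deriv ?_
  simp [Complex.mul_re, Complex.mul_im]

lemma continuous_fourier_re (k : ℤ) : Continuous fun θ : Torus => (fourier k θ).re :=
  Complex.continuous_re.comp (fourier k).continuous

lemma continuous_fourier_im (k : ℤ) : Continuous fun θ : Torus => (fourier k θ).im :=
  Complex.continuous_im.comp (fourier k).continuous

/-- The Fourier coefficients of a weak derivative in space. -/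
lemma WeakDX.mode_eq (hI : I.OrdConnected) {f g : ℝ × Torus → ℝ}
    (h : WeakDX I f g) (hf : LocInt I f) (hg : LocInt I g) :
    ∀ᵐ t ∂volume.restrict I, ∀ k : ℤ, mode k g t = 2 * π * Complex.I * k * mode k f t := by
  have h1 := fun k : ℤ => h.slice hI hf hg (χ := fun θ => (fourier k θ).re)
    (χ' := fun θ => -(2 * π * k) * (fourier k θ).im)
    (contDiff_fourier_re k) ((continuous_fourier_im k).const_mul _) (hasDerivAt_fourier_re k)
  have h2 := fun k : ℤ => h.slice hI hf hg (χ := fun θ => (fourier k θ).im)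
    (χ' := fun θ => (2 * π * k) * (fourier k θ).re)
    (contDiff_fourier_im k) ((continuous_fourier_re k).const_mul _) (hasDerivAt_fourier_im k)
  filter_upwards [ae_all_iff.2 h1, ae_all_iff.2 h2, hf.ae_integrable_slice hI,
    hg.ae_integrable_slice hI] with t h3 h4 h5 h6 k
  have h7 := h3 (-k)
  have h8 := h4 (-k)
  have e : ∀ (c : ℝ) (χ : Torus → ℝ), ∫ y, f (t, y) * (c * χ y) = c * ∫ y, f (t, y) * χ y := by
    intro c χ
    rw [← integral_const_mul]; congr 1; ext y; ring
  rw [e, ← mode_im h5, ← mode_re h6] at h7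
  rw [e, ← mode_re h5, ← mode_im h6] at h8
  push_cast at h7 h8
  apply Complex.ext
  · simp [Complex.mul_re, Complex.mul_im]; linarith
  · simp [Complex.mul_re, Complex.mul_im]; linarith

lemma shear_zero (z : ℝ × Torus) : shear 0 z = z := by
  obtain ⟨t, y⟩ := z
  simp [shear_apply]

/-- The Fourier coefficients of a function with a weak derivative in time are locally absolutely
continuous. -/
lemma WeakDir.mode_eq (hI : I.OrdConnected) {f g : ℝ × Torus → ℝ}
    (h : WeakDir I 0 f g) (hf : LocInt I f) (hg : LocInt I g) {t₀ : ℝ} (ht₀ : t₀ ∈ interior I)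
    (k : ℤ) :
    (∃ c, ∀ᵐ t ∂volume.restrict I, (mode k f t).re = c + ∫ s in t₀..t, (mode k g s).re) ∧
    (∃ c, ∀ᵐ t ∂volume.restrict I, (mode k f t).im = c + ∫ s in t₀..t, (mode k g s).im) := by
  have hsl := hg.ae_integrable_slice hI
  rw [ae_restrict_iff' hI.measurableSet] at hsl
  have huI : ∀ {t s : ℝ}, t ∈ I → s ∈ Set.uIoc t₀ t → s ∈ I := by
    intro t s ht hs
    rcases le_total t₀ t with h1 | h1
    · rw [Set.uIoc_of_le h1] at hs
      exact hI.out (interior_subset ht₀) ht ⟨hs.1.le, hs.2⟩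
    · rw [Set.uIoc_of_ge h1] at hs
      exact hI.out ht (interior_subset ht₀) ⟨hs.1.le, hs.2⟩
  constructor
  · obtain ⟨c, hc⟩ := h.moment hI hf hg ht₀ (contDiff_fourier_re (-k))
      (χ := fun θ => (fourier (-k) θ).re)
    refine ⟨c, ?_⟩
    filter_upwards [hc, hf.ae_integrable_slice hI, ae_restrict_mem hI.measurableSet] with t h1 h2 h3
    rw [mode_re h2]
    simp only [shear_zero] at h1
    rw [h1]
    congr 1
    apply intervalIntegral.integral_congr_ae
    filter_upwards [hsl] with s hs hst
    rw [mode_re (hs (huI h3 hst))]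
  · obtain ⟨c, hc⟩ := h.moment hI hf hg ht₀ (contDiff_fourier_im (-k))
      (χ := fun θ => (fourier (-k) θ).im)
    refine ⟨c, ?_⟩
    filter_upwards [hc, hf.ae_integrable_slice hI, ae_restrict_mem hI.measurableSet] with t h1 h2 h3
    rw [mode_im h2]
    simp only [shear_zero] at h1
    rw [h1]
    congr 1
    apply intervalIntegral.integral_congr_ae
    filter_upwards [hsl] with s hs hst
    rw [mode_im (hs (huI h3 hst))]

lemma LocInt.integrableOn_mode (hI : I.OrdConnected) {f : ℝ × Torus → ℝ}
    (hf : LocInt I f) (k : ℤ) {a b : ℝ} (hab : Icc a b ⊆ I) :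
    IntegrableOn (fun t => (mode k f t).re) (Icc a b) ∧
    IntegrableOn (fun t => (mode k f t).im) (Icc a b) := by
  have hsl := ae_restrict_of_ae_restrict_of_subset hab (hf.ae_integrable_slice hI)
  constructor
  · refine (hf.integrableOn_slice_integral (continuous_fourier_re (-k)) hab).congr ?_
    filter_upwards [hsl] with t ht
    rw [mode_re ht]
  · refine (hf.integrableOn_slice_integral (continuous_fourier_im (-k)) hab).congr ?_
    filter_upwards [hsl] with t ht
    rw [mode_im ht]

namespace SobolevField

variable {p : ℝ≥0∞}

lemma weakDX (F : SobolevField I p) : WeakDX I F.val F.dx := F.weak_dx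

lemma weakDir (hp : 1 ≤ p) (F : SobolevField I p) (c : ℝ) :
    WeakDir I c F.val (fun z => F.dt z + c * F.dx z) := by
  intro ψ hψ
  have hv := F.val_bdd.locInt hp
  have ht := F.dt_bdd.locInt hp
  have hx := F.dx_bdd.locInt hp
  have h1 := F.weak_dt ψ hψ
  have h2 := F.weak_dx ψ hψ
  have e1 : ∀ z, F.val z * lineD c ψ z = F.val z * partialT ψ z + c * (F.val z * partialX ψ z) :=
    fun z => by rw [lineD]; ring
  have e2 : ∀ z, (F.dt z + c * F.dx z) * ψ z = F.dt z * ψ z + c * (F.dx z * ψ z) :=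
    fun z => by ring
  simp only [e1, e2]
  rw [integral_add (hv.integrableOn_mul_test hψ.partialT)
      ((hv.integrableOn_mul_test hψ.partialX).const_mul c),
    integral_add (ht.integrableOn_mul_test hψ) ((hx.integrableOn_mul_test hψ).const_mul c),
    integral_const_mul, integral_const_mul, h1, h2]
  ring

end SobolevField

/-- A family bounded in `L^∞_loc(I, H¹(T¹))` is locally uniformly bounded. -/
lemma uBdd_top_of_weakDX {ι : Type} (hI : I.OrdConnected) {f g : ι → ℝ × Torus → ℝ}
    (hf : UBdd I 2 f) (hg : UBdd I 2 g) (h : ∀ i, WeakDX I (f i) (g i)) : UBdd I ⊤ f := by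
  refine ⟨hf.1, fun a b hab => ?_⟩
  obtain ⟨C, hC⟩ := hf.2 a b hab
  obtain ⟨D, hD⟩ := hg.2 a b hab
  set M : ℝ := C + fourierTail {0} * D with hM
  refine ⟨M.toNNReal, fun i => ?_⟩
  have hfl := (hf.single i).locInt one_le_two
  have hgl := (hg.single i).locInt one_le_two
  have hm := ae_restrict_of_ae_restrict_of_subset hab ((h i).mode_eq hI hfl hgl)
  have hsl := ae_restrict_of_ae_restrict_of_subset hab (hfl.ae_integrable_slice hI)
  filter_upwards [hm, hsl, hC i, hD i, hg.slice_aesm i hab, hf.slice_aesm i hab]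
    with t h1 h2 h3 h4 h5 h5'
  have h6 : MemLp (fun θ => g i (t, θ)) 2 := ⟨h5, h4.trans_lt ENNReal.coe_lt_top⟩
  refine (eLpNormEssSup_le_of_ae_bound (C := M) ?_)
  filter_upwards [fourier_approx h2 h6 h1] with θ hθ
  have h7 := hθ {0} (by simp)
  simp only [Finset.sum_singleton, fourier_zero, mul_one] at h7
  have h8 : |(fourierCoeff (fun θ => (f i (t, θ) : ℂ)) 0).re| ≤ C := by
    refine (Complex.abs_re_le_norm _).trans ((norm_fourierCoeff_le _ _).trans ?_)
    have h9 : eLpNorm (fun θ : Torus => f i (t, θ)) 1 volume ≤ C :=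
      (eLpNorm_le_eLpNorm_of_exponent_le one_le_two h5').trans h3
    have h10 : ∫ θ, ‖(f i (t, θ) : ℂ)‖ = (eLpNorm (fun θ : Torus => f i (t, θ)) 1 volume).toReal := by
      rw [eLpNorm_one_eq_lintegral_enorm, ← integral_norm_eq_lintegral_enorm h5']
      simp
    rw [h10]
    exact ENNReal.toReal_le_coe_of_le_coe h9
  have h11 : (eLpNorm (fun θ => g i (t, θ)) 2 volume).toReal ≤ D :=
    ENNReal.toReal_le_coe_of_le_coe h4
  have h12 := mul_le_mul_of_nonneg_left h11 (fourierTail_nonneg {0})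
  have h13 := abs_sub_abs_le_abs_sub (f i (t, θ)) (fourierCoeff (fun θ => (f i (t, θ) : ℂ)) 0).re
  rw [Real.norm_eq_abs]
  linarith

lemma H1Field.val_top (hI : I.OrdConnected) (F : H1Field I) : LocBddLp I ⊤ F.val :=
  locBddLp_iff.2 (uBdd_top_of_weakDX hI (locBddLp_iff.1 F.val_bdd) (locBddLp_iff.1 F.dx_bdd)
    fun _ => F.weakDX)

/-! ### Products along lines and first-order forms of wave equations -/

namespace LineAC

variable {c : ℝ} {f g f' g' : ℝ × Torus → ℝ}

lemma congr (h : LineAC I c f g) (hg : ∀ᵐ z ∂volume.restrict (cyl I), g z = g' z) :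
    LineAC I c f g' := by
  have h1 := ae_slice' ((measurePreserving_shear c I).quasiMeasurePreserving.ae hg)
  filter_upwards [h, h1] with y h2 h3
  exact h2.congr h3

lemma congr' (h : LineAC I c f g) (hg : ∀ᵐ t ∂volume.restrict I, ∀ θ, g (t, θ) = g' (t, θ)) :
    LineAC I c f g' := by
  filter_upwards [h] with y h2
  refine h2.congr ?_
  filter_upwards [hg] with t ht using ht _

lemma add (h : LineAC I c f g) (h' : LineAC I c f' g') :
    LineAC I c (fun z => f z + f' z) (fun z => g z + g' z) := by
  filter_upwards [h, h'] with y h1 h2 using h1.add h2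

lemma mul (h : LineAC I c f g) (h' : LineAC I c f' g') :
    LineAC I c (fun z => f z * f' z) (fun z => g z * f' z + f z * g' z) := by
  filter_upwards [h, h'] with y h1 h2 using h1.mul h2

lemma const_mul (a : ℝ) (h : LineAC I c f g) :
    LineAC I c (fun z => a * f z) (fun z => a * g z) := by
  filter_upwards [h] with y h1 using h1.const_mul a

lemma exp (h : LineAC I c f g) :
    LineAC I c (fun z => Real.exp (f z)) (fun z => g z * Real.exp (f z)) := by
  filter_upwards [h] with y h1 using h1.exp

lemma time (I : Set ℝ) (c : ℝ) : LineAC I c (fun z => z.1) (fun _ => 1) := by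
  filter_upwards with y
  exact (LineAC1.of_contDiff contDiff_id).congr (by simp)

lemma of_smooth {ψ : ℝ × Torus → ℝ} (hψ : SmoothFn ψ) : LineAC I c ψ (lineD c ψ) := by
  filter_upwards with y
  refine (LineAC1.of_contDiff ((contDiff_line hψ c y).of_le (by norm_num))).congr ?_
  filter_upwards with t
  exact (lineD_shear hψ c t y).symm

end LineAC

lemma ae_time_mem (hI : I.OrdConnected) : ∀ᵐ t ∂volume.restrict I, t ∈ I :=
  ae_restrict_mem hI.measurableSet

lemma SobolevField.lineAC (hI : I.OrdConnected) (hne : (interior I).Nonempty)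
    {p : ℝ≥0∞} (hp : 1 ≤ p) (F : SobolevField I p) (c : ℝ) :
    LineAC I c F.val (fun z => F.dt z + c * F.dx z) := by
  refine (F.weakDir hp c).lineAC hI hne (F.val_bdd.locInt hp) (LocBddLp.locInt hp ?_)
  exact locBddLp_iff.2 ((locBddLp_iff.1 F.dt_bdd).add hp ((locBddLp_iff.1 F.dx_bdd).const_mul c))

/-- A wave equation is a transport equation for one of the null derivatives `f_t - c f_θ`. -/
lemma waveEq_iff_weakDir {p : ℝ≥0∞} (hp : 1 ≤ p) (F : SobolevField I p)
    {s : ℝ × Torus → ℝ} {c : ℝ} (hc : c ^ 2 = 1) :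
    WaveEq I F.val s ↔ WeakDir I c (fun z => F.dt z - c * F.dx z) s := by
  have key : ∀ ψ, IsTestFunction I ψ → ∫ z in cyl I, (F.dt z - c * F.dx z) * lineD c ψ z
      = - ∫ z in cyl I, F.val z * box ψ z := by
    intro ψ hψ
    have h1 := F.weakDir hp (-c) _ (hψ.lineD c)
    have h2 : ∀ z, box ψ z = lineD (-c) (lineD c ψ) z := fun z => by
      simpa using hψ.smoothFn.box_eq_lineD (c := -c) (by simpa using hc) z
    simp only [h2]
    rw [h1, neg_neg]
    simp only [neg_mul, sub_eq_add_neg]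
  constructor
  · intro h ψ hψ
    rw [key ψ hψ, h ψ hψ]
  · intro h ψ hψ
    have := h ψ hψ
    rw [key ψ hψ] at this
    linarith

/-! ### Families of fields bounded in energy -/

lemma UBdd.congr {ι : Type} {p : ℝ≥0∞} {f g : ι → ℝ × Torus → ℝ} (hf : UBdd I p f)
    (h : ∀ i z, f i z = g i z) : UBdd I p g := by
  have : f = g := funext fun i => funext (h i)
  exact this ▸ hf

lemma UBdd.locInt {ι : Type} {p : ℝ≥0∞} {f : ι → ℝ × Torus → ℝ} (hp : 1 ≤ p)
    (hf : UBdd I p f) (i : ι) : LocInt I (f i) := (hf.single i).locInt hp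

/-- A family of `H¹` fields whose `H¹` energies are bounded uniformly on compact intervals of
times. -/
structure UH1 {ι : Type} {I : Set ℝ} (P : ι → H1Field I) : Prop where
  val : UBdd I 2 (fun i => (P i).val)
  dt : UBdd I 2 (fun i => (P i).dt)
  dx : UBdd I 2 (fun i => (P i).dx)

/-- `e^{2P} (Q_t² - Q_θ²)`. -/
noncomputable def nullQ {I : Set ℝ} (P Q : H1Field I) (z : ℝ × Torus) : ℝ :=
  Real.exp (2 * P.val z) * (Q.dt z ^ 2 - Q.dx z ^ 2)

/-- `P_t² - P_θ²`. -/
noncomputable def nullP {I : Set ℝ} (P : H1Field I) (z : ℝ × Torus) : ℝ :=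
  P.dt z ^ 2 - P.dx z ^ 2

section Bounds

variable {ι : Type} {P Q : ι → H1Field I}

lemma UH1.single (P : H1Field I) : UH1 (fun _ : ι => P) :=
  ⟨UBdd.of_single P.val_bdd, UBdd.of_single P.dt_bdd, UBdd.of_single P.dx_bdd⟩

lemma UH1.reindex {κ : Type} (h : UH1 P) (k : κ → ι) : UH1 (fun i => P (k i)) :=
  ⟨h.val.reindex k, h.dt.reindex k, h.dx.reindex k⟩

lemma UH1.top (hI : I.OrdConnected) (h : UH1 P) : UBdd I ⊤ (fun i => (P i).val) :=
  uBdd_top_of_weakDX hI h.val h.dx fun i => (P i).weakDX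

lemma UH1.exp (hI : I.OrdConnected) (h : UH1 P) (a : ℝ) :
    UBdd I ⊤ (fun i z => Real.exp (a * (P i).val z)) := ((h.top hI).const_mul a).exp

lemma UBdd.inv_time (hI : I.OrdConnected) (hpos : I ⊆ Ioi 0) :
    UBdd I ⊤ (fun (_ : ι) z => 1 / z.1) :=
  UBdd.of_time (φ := fun t => 1 / t) hI.measurableSet
    (continuousOn_const.div continuousOn_id fun _ ht => (hpos ht).ne')

lemma UBdd.time (hI : I.OrdConnected) : UBdd I ⊤ (fun (_ : ι) (z : ℝ × Torus) => z.1) :=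
  UBdd.of_time (φ := fun t => t) hI.measurableSet continuousOn_id

lemma UH1.exp_dt (hI : I.OrdConnected) (h : UH1 P) (h' : UH1 Q) (a : ℝ) :
    UBdd I 2 (fun i z => Real.exp (a * (P i).val z) * (Q i).dt z) := (h.exp hI a).mul h'.dt

lemma UH1.exp_dx (hI : I.OrdConnected) (h : UH1 P) (h' : UH1 Q) (a : ℝ) :
    UBdd I 2 (fun i z => Real.exp (a * (P i).val z) * (Q i).dx z) := (h.exp hI a).mul h'.dx

lemma UBdd.div_time (hI : I.OrdConnected) (hpos : I ⊆ Ioi 0) {p : ℝ≥0∞}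
    {f : ι → ℝ × Torus → ℝ} (hf : UBdd I p f) : UBdd I p (fun i z => f i z / z.1) :=
  ((UBdd.inv_time hI hpos).mul hf).congr fun i z => by ring

lemma UH1.nullP (h : UH1 P) : UBdd I 1 (fun i => nullP (P i)) :=
  ((h.dt.mul h.dt).sub le_rfl (h.dx.mul h.dx)).congr fun i z => by simp only [Gowdy.nullP]; ring

lemma UH1.nullQ (hI : I.OrdConnected) (h : UH1 P) (h' : UH1 Q) :
    UBdd I 1 (fun i => nullQ (P i) (Q i)) :=
  ((h.exp hI 2).mul ((h'.dt.mul h'.dt).sub (p := 1) le_rfl (h'.dx.mul h'.dx))).congr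
    fun i z => by simp only [Gowdy.nullQ]; ring

lemma UH1.energyDensity (hI : I.OrdConnected) (h : UH1 P) (h' : UH1 Q) :
    UBdd I 1 (fun i => energyDensity (P i) (Q i)) :=
  (((h.dt.mul h.dt).add (p := 1) le_rfl (h.dx.mul h.dx)).add le_rfl
    ((h.exp hI 2).mul ((h'.dt.mul h'.dt).add (p := 1) le_rfl (h'.dx.mul h'.dx)))).congr
    fun i z => by simp only [Gowdy.energyDensity]; ring

lemma UH1.momentumDensity (hI : I.OrdConnected) (h : UH1 P) (h' : UH1 Q) :
    UBdd I 1 (fun i => momentumDensity (P i) (Q i)) :=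
  ((h.dt.mul h.dx).add (p := 1) le_rfl ((h.exp hI 2).mul (h'.dt.mul (r := 1) h'.dx))).congr
    fun i z => by simp only [Gowdy.momentumDensity]

lemma UH1.sourceQ (hI : I.OrdConnected) (hpos : I ⊆ Ioi 0) (h : UH1 P) (h' : UH1 Q) :
    UBdd I 1 (fun i z => -2 * ((P i).dt z * (Q i).dt z - (P i).dx z * (Q i).dx z)
      - (Q i).dt z / z.1) :=
  (((h.dt.mul h'.dt).sub (p := 1) le_rfl (h.dx.mul h'.dx)).const_mul (-2)).sub le_rfl
    ((h'.dt.mono_exponent one_le_two).div_time hI hpos)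

lemma UH1.sourceP (hI : I.OrdConnected) (hpos : I ⊆ Ioi 0) (h : UH1 P) (h' : UH1 Q) :
    UBdd I 1 (fun i z => Gowdy.nullQ (P i) (Q i) z - (P i).dt z / z.1) :=
  (h.nullQ hI h').sub le_rfl ((h.dt.mono_exponent one_le_two).div_time hI hpos)

lemma UH1.null (h : UH1 P) (c : ℝ) :
    UBdd I 2 (fun i z => (P i).dt z - c * (P i).dx z) :=
  h.dt.sub one_le_two (h.dx.const_mul c)

end Bounds

/-! ### The Jacobian identity -/

open scoped Manifold in
lemma exists_timeCutoff (hI : I.OrdConnected) {a b : ℝ}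
    (hab : Icc a b ⊆ interior I) :
    ∃ ρ : ℝ → ℝ, IsTimeTest I ρ ∧ (∀ t ∈ Icc a b, ρ =ᶠ[𝓝 t] fun _ => 1) ∧
      ∀ t, ρ t ∈ Icc (0 : ℝ) 1 := by
  obtain ⟨L, hL, h1, h2⟩ := exists_compact_between isCompact_Icc isOpen_interior hab
  obtain ⟨p, q, h3, h4⟩ := exists_Icc_of_isCompact hI hL h2
  obtain ⟨f, hf1, hf2, hf3⟩ := exists_contMDiffMap_one_nhds_of_subset_interior (𝓘(ℝ, ℝ))
    (n := (⊤ : ℕ∞)) isClosed_Icc h1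
  refine ⟨f, ⟨contMDiff_iff_contDiff.1 f.contMDiff, p, q, h3, fun t ht => hf2 t fun h => ht (h4 h)⟩,
    fun t ht => ?_, hf3⟩
  exact (hf1.filter_mono (nhds_le_nhdsSet ht) :)

/-- The derivative of an absolutely continuous function with compact support has vanishing integral:
this is integration by parts against a cutoff which is one on the support. -/
lemma LineAC1.setIntegral_eq_zero (hI : I.OrdConnected) {u v : ℝ → ℝ}
    (h : LineAC1 I u v) {a b : ℝ} (hab : Icc a b ⊆ interior I)
    (hu : ∀ t ∉ Icc a b, u t = 0) : ∫ t in Icc a b, v t = 0 := by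
  obtain ⟨F, h1, h2, h3⟩ := h
  have hv : ∀ᵐ t ∂volume.restrict I, t ∉ Icc a b → v t = 0 := by
    rw [← ae_restrict_interior hI] at h1 h3 ⊢
    rw [ae_restrict_iff' isOpen_interior.measurableSet] at h1 h3 ⊢
    have hF : ∀ t ∈ interior I, t ∉ Icc a b → F t = 0 := by
      intro t ht ht'
      have hopen : IsOpen (interior I ∩ (Icc a b)ᶜ) := isOpen_interior.inter isClosed_Icc.isOpen_compl
      have hc : ContinuousOn F (interior I ∩ (Icc a b)ᶜ) := by
        rintro s ⟨hs, -⟩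
        obtain ⟨x, y, hs1, hs2⟩ := mem_nhds_iff_exists_Ioo_subset.1 (isOpen_interior.mem_nhds hs)
        obtain ⟨p, hp⟩ := exists_between hs1.1
        obtain ⟨q, hq⟩ := exists_between hs1.2
        have := (h2 p q (hp.2.trans hq.1).le fun z hz =>
          interior_subset (hs2 ⟨hp.1.trans_le hz.1, hz.2.trans_lt hq.2⟩)).continuousOn
        rw [Set.uIcc_of_le (hp.2.trans hq.1).le] at this
        exact (this.continuousAt (Icc_mem_nhds hp.2 hq.1)).continuousWithinAt
      have h4 : F =ᵐ[volume.restrict (interior I ∩ (Icc a b)ᶜ)] fun _ => 0 := by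
        rw [Filter.EventuallyEq, ae_restrict_iff' hopen.measurableSet]
        filter_upwards [h1] with s hs hs'
        rw [← hs hs'.1, hu s hs'.2]
      exact MeasureTheory.Measure.eqOn_open_of_ae_eq h4 hopen hc continuousOn_const ⟨ht, ht'⟩
    filter_upwards [h3] with t h4 ht ht'
    have h5 : F =ᶠ[𝓝 t] fun _ => 0 := by
      filter_upwards [isOpen_interior.mem_nhds ht, isClosed_Icc.isOpen_compl.mem_nhds ht'] with s hs hs'
      exact hF s hs hs'
    exact (h4 ht).unique ((hasDerivAt_const t (0 : ℝ)).congr_of_eventuallyEq h5)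
  obtain ⟨ρ, ⟨hρ, p, q, hpq, hs⟩, h1', -⟩ := exists_timeCutoff hI hab
  have h4 := integral_mul_deriv_of_absolutelyContinuous hI h2 h3 (hρ.of_le (by norm_num))
    (hpq.trans interior_subset) hs
  have h5 : ∫ t in I, F t * deriv ρ t = 0 := by
    rw [← integral_zero ℝ ℝ]
    apply integral_congr_ae
    filter_upwards [h1] with t ht
    by_cases h : t ∈ Icc a b
    · rw [(h1' t h).deriv_eq]; simp
    · rw [← ht, hu t h, zero_mul]
  have h6 : ∫ t in I, v t * ρ t = ∫ t in Icc a b, v t := by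
    rw [setIntegral_eq_of_subset_of_ae_sdiff_eq_zero hI.measurableSet.nullMeasurableSet
      (hab.trans interior_subset)]
    · apply setIntegral_congr_fun measurableSet_Icc
      intro t ht
      simp [(h1' t ht).self_of_nhds]
    · rw [ae_restrict_iff' hI.measurableSet] at hv
      filter_upwards [hv] with t ht ht'
      simp [ht ht'.1 ht'.2]
  rw [← h6]
  linarith

lemma WeakDir.lineAC1_mode (hI : I.OrdConnected) (hne : (interior I).Nonempty)
    {f g : ℝ × Torus → ℝ} (h : WeakDir I 0 f g) (hf : LocInt I f) (hg : LocInt I g) (k : ℤ) :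
    LineAC1 I (fun t => (mode k f t).re) (fun t => (mode k g t).re) ∧
    LineAC1 I (fun t => (mode k f t).im) (fun t => (mode k g t).im) := by
  obtain ⟨t₀, ht₀⟩ := hne
  obtain ⟨⟨c, hc⟩, d, hd⟩ := h.mode_eq hI hf hg ht₀ k
  exact ⟨LineAC1.of_primitive hI (fun a b hab => (hg.integrableOn_mode hI k hab).1)
      (interior_subset ht₀) hc,
    LineAC1.of_primitive hI (fun a b hab => (hg.integrableOn_mode hI k hab).2)
      (interior_subset ht₀) hd⟩

lemma mode_eq_zero {k : ℤ} {f : ℝ × Torus → ℝ} {t : ℝ} (h : ∀ θ, f (t, θ) = 0) :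
    mode k f t = 0 := by
  simp [mode, h, fourierCoeff]

lemma LocBddLp.ae_memLp_slice (hI : I.OrdConnected) {p : ℝ≥0∞} {f : ℝ × Torus → ℝ}
    (hf : LocBddLp I p f) : ∀ᵐ t ∂volume.restrict I, MemLp (fun θ => f (t, θ)) p := by
  refine ae_of_forall_Icc hI fun a b hab => ?_
  obtain ⟨C, hC⟩ := hf.2 a b hab
  filter_upwards [hC, (locBddLp_iff.1 hf).slice_aesm () hab] with t h1 h2
  exact ⟨h2, h1.trans_lt ENNReal.coe_lt_top⟩

/-- For `H¹` functions, `f_t h_θ - f_θ h_t` has vanishing integral when `h` vanishes outside a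
compact interval of times. Mode by mode, the spatial integral is the time derivative of a multiple
of `Im (conj f̂ₖ ĥₖ)`. -/
lemma integral_jacobian (hI : I.OrdConnected) (hne : (interior I).Nonempty)
    {f ft fx h ht hx : ℝ × Torus → ℝ} (hf : LocBddLp I 2 f) (hft : LocBddLp I 2 ft)
    (hfx : LocBddLp I 2 fx) (hh : LocBddLp I 2 h) (hht : LocBddLp I 2 ht) (hhx : LocBddLp I 2 hx)
    (hf0 : WeakDir I 0 f ft) (hf1 : WeakDX I f fx) (hh0 : WeakDir I 0 h ht) (hh1 : WeakDX I h hx)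
    {a b : ℝ} (hab : Icc a b ⊆ interior I)
    (sh : ∀ t ∉ Icc a b, ∀ θ, h (t, θ) = 0) (sht : ∀ t ∉ Icc a b, ∀ θ, ht (t, θ) = 0)
    (shx : ∀ t ∉ Icc a b, ∀ θ, hx (t, θ) = 0) :
    ∫ z in cyl I, ft z * hx z = ∫ z in cyl I, fx z * ht z := by
  have hab' := hab.trans interior_subset
  have i12 : (1 : ℝ≥0∞) ≤ 2 := one_le_two
  have hint : ∀ {u v : ℝ × Torus → ℝ}, LocBddLp I 2 u → LocBddLp I 2 v →
      IntegrableOn (fun z => u z * v z) (cyl (Icc a b)) := fun hu hv =>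
    (((locBddLp_iff.1 hu).mul (r := 1) (locBddLp_iff.1 hv)).locInt le_rfl ()).2 a b hab'
  rw [setIntegral_cyl_eq_of_support hI.measurableSet hab' (f := fun z => ft z * hx z)
      (fun t ht' θ => by simp [shx t ht' θ]),
    setIntegral_cyl_eq_of_support hI.measurableSet hab' (f := fun z => fx z * ht z)
      (fun t ht' θ => by simp [sht t ht' θ]), ← sub_eq_zero,
    ← integral_sub (hint hft hhx) (hint hfx hht),
    setIntegral_cyl (f := fun z => ft z * hx z - fx z * ht z) ((hint hft hhx).sub (hint hfx hht))]
  -- `d k` is the derivative of `-2 π k (Re f̂ₖ Im ĥₖ - Im f̂ₖ Re ĥₖ)`, which has compact support in time.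
  set d : ℤ → ℝ → ℝ := fun k t => -(2 * π * k) *
    (((mode k ft t).re * (mode k h t).im + (mode k f t).re * (mode k ht t).im)
      + (-1) * ((mode k ft t).im * (mode k h t).re + (mode k f t).im * (mode k ht t).re)) with hd
  have hd0 : ∀ k, ∫ t in Icc a b, d k t = 0 := by
    intro k
    have h1 := hf0.lineAC1_mode hI hne (hf.locInt i12) (hft.locInt i12) k
    have h2 := hh0.lineAC1_mode hI hne (hh.locInt i12) (hht.locInt i12) k
    refine (((h1.1.mul h2.2).add ((h1.2.mul h2.1).const_mul (-1))).const_mul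
      (-(2 * π * k))).setIntegral_eq_zero hI hab ?_
    intro t ht'
    simp [mode_eq_zero (sh t ht')]
  -- Since `ĥx = 2 π i k ĥ`, it is also the contribution of the mode `k` to the spatial integral.
  have hmodes : ∀ᵐ t ∂volume.restrict (Icc a b), ∀ k, d k t =
      ((starRingEnd ℂ) (mode k ft t) * mode k hx t - (starRingEnd ℂ) (mode k fx t) * mode k ht t).re := by
    filter_upwards [ae_restrict_of_ae_restrict_of_subset hab'
        (hf1.mode_eq hI (hf.locInt i12) (hfx.locInt i12)),
      ae_restrict_of_ae_restrict_of_subset hab'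
        (hh1.mode_eq hI (hh.locInt i12) (hhx.locInt i12))] with t h1 h2 k
    rw [h1, h2]
    simp [hd, Complex.mul_re, Complex.mul_im]
    ring
  have hmem : ∀ {u : ℝ × Torus → ℝ}, LocBddLp I 2 u → ∀ᵐ t ∂volume.restrict (Icc a b),
      MemLp (fun θ => u (t, θ)) 2 := fun hu =>
    ae_restrict_of_ae_restrict_of_subset hab' (hu.ae_memLp_slice hI)
  have hsq : ∀ {u : ℝ × Torus → ℝ}, LocBddLp I 2 u → ∀ᵐ t ∂volume.restrict (Icc a b),
      HasSum (fun k => ‖mode k u t‖ ^ 2) (∫ θ, u (t, θ) * u (t, θ)) := fun hu => by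
    filter_upwards [hmem hu] with t h1
    have h2 := hasSum_sq_fourierCoeff_of_memLp h1.ofReal
    simp only [Complex.norm_real, Real.norm_eq_abs, sq_abs, RCLike.ofReal_eq_complex_ofReal] at h2
    simpa only [mode, sq] using h2
  -- Parseval's identity and summation over `k`; the squared norms of the modes are the majorant.
  have hsum := hasSum_integral_of_dominated_convergence (μ := volume.restrict (Icc a b))
    (F := d) (f := fun t => ∫ θ, (ft (t, θ) * hx (t, θ) - fx (t, θ) * ht (t, θ)))
    (fun k t => (‖mode k ft t‖ ^ 2 + ‖mode k hx t‖ ^ 2) + (‖mode k fx t‖ ^ 2 + ‖mode k ht t‖ ^ 2))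
    ?_ ?_ ?_ ?_ ?_
  · simp only [hd0] at hsum
    exact hsum.unique hasSum_zero
  · intro k
    have m := fun {u} (hu : LocBddLp I 2 u) => (hu.locInt i12).integrableOn_mode hI k hab'
    exact ((((m hft).1.1.mul (m hh).2.1).add ((m hf).1.1.mul (m hht).2.1)).add
      ((((m hft).2.1.mul (m hh).1.1).add ((m hf).2.1.mul (m hht).1.1)).const_mul _)).const_mul _
  · intro k
    filter_upwards [hmodes] with t h1
    rw [h1, Real.norm_eq_abs]
    refine (Complex.abs_re_le_norm _).trans ((norm_sub_le _ _).trans (add_le_add ?_ ?_)) <;>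
    · rw [norm_mul, RCLike.norm_conj]
      nlinarith [sq_nonneg (‖mode k ft t‖ - ‖mode k hx t‖), sq_nonneg (‖mode k fx t‖ - ‖mode k ht t‖),
        sq_nonneg ‖mode k ft t‖, sq_nonneg ‖mode k hx t‖, sq_nonneg ‖mode k fx t‖,
        sq_nonneg ‖mode k ht t‖]
  · filter_upwards [hsq hft, hsq hhx, hsq hfx, hsq hht] with t h1 h2 h3 h4
    exact ((h1.add h2).add (h3.add h4)).summable
  · have hi : ∀ {u : ℝ × Torus → ℝ}, LocBddLp I 2 u →
        IntegrableOn (fun t => ∫ θ, u (t, θ) * u (t, θ)) (Icc a b) := fun hu => by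
      have := hint hu hu
      rw [IntegrableOn, restrict_cyl] at this
      exact this.integral_prod_left
    refine (((hi hft).add (hi hhx)).add ((hi hfx).add (hi hht))).congr ?_
    filter_upwards [hsq hft, hsq hhx, hsq hfx, hsq hht] with t h1 h2 h3 h4
    exact ((h1.add h2).add (h3.add h4)).tsum_eq.symm
  · filter_upwards [hmodes, hmem hft, hmem hhx, hmem hfx, hmem hht] with t h0 h1 h2 h3 h4
    have h5 := (hasSum_inner_fourierCoeff h1.ofReal h2.ofReal).sub
      (hasSum_inner_fourierCoeff h3.ofReal h4.ofReal)
    have h6 := Complex.reCLM.hasSum h5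
    have h7 : ∫ θ, (ft (t, θ) * hx (t, θ) - fx (t, θ) * ht (t, θ)) =
        (∫ θ, ft (t, θ) * hx (t, θ)) - ∫ θ, fx (t, θ) * ht (t, θ) :=
      integral_sub (h1.integrable_mul h2) (h3.integrable_mul h4)
    simp only [Complex.coe_algebraMap, Complex.conj_ofReal, ← Complex.ofReal_mul,
      integral_complex_ofReal, Complex.reCLM_apply, Complex.sub_re, Complex.ofReal_re] at h6
    rw [h7]
    refine h6.congr_fun fun k => ?_
    simp [h0 k, mode]

/-! ### Identities satisfied by weak solutions -/

lemma UBdd.of_continuous {ι : Type} {ψ : ℝ × Torus → ℝ} (hψ : Continuous ψ) :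
    UBdd I ⊤ (fun (_ : ι) => ψ) := by
  refine ⟨fun _ => hψ.aestronglyMeasurable, fun a b _ => ?_⟩
  obtain ⟨C, hC⟩ := (isCompact_cyl_Icc a b).exists_bound_of_continuousOn hψ.continuousOn
  refine ⟨C.toNNReal, fun _ => ?_⟩
  filter_upwards [ae_restrict_mem measurableSet_Icc] with t ht
  refine (eLpNorm_le_of_ae_bound (C := C) (ae_of_all _ fun θ => hC (t, θ) ⟨ht, trivial⟩)).trans ?_
  simp [ENNReal.ofReal]

lemma WeakDir.weakDX {f g h : ℝ × Torus → ℝ} (hf : LocInt I f) (hg : LocInt I g)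
    (hh : LocInt I h) (h0 : WeakDir I 0 f g) (h1 : WeakDir I 1 f (fun z => g z + h z)) :
    WeakDX I f h := by
  intro ψ hψ
  have e0 := h0 ψ hψ
  have e1 := h1 ψ hψ
  simp only [Gowdy.lineD, zero_mul, add_zero, one_mul, mul_add, add_mul] at e0 e1
  rw [integral_add (hf.integrableOn_mul_test hψ.partialT) (hf.integrableOn_mul_test hψ.partialX),
    integral_add (hg.integrableOn_mul_test hψ) (hh.integrableOn_mul_test hψ)] at e1
  linarith

/-- `P_θ Q_t - P_t Q_θ`. -/
noncomputable def jac {I : Set ℝ} (P Q : H1Field I) (z : ℝ × Torus) : ℝ :=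
  P.dx z * Q.dt z - P.dt z * Q.dx z

/-- The energy density `t ((P_t - c P_θ)² + e^{2P} (Q_t - c Q_θ)²)`, for `c = ±1`. -/
noncomputable def nullEnergy {I : Set ℝ} (c : ℝ) (P Q : H1Field I) (z : ℝ × Torus) : ℝ :=
  z.1 * ((P.dt z - c * P.dx z) ^ 2 + Real.exp (2 * P.val z) * (Q.dt z - c * Q.dx z) ^ 2)

section Identities

variable (hI : I.OrdConnected) (hne : (interior I).Nonempty) {P Q : H1Field I}
  {ι : Type} {U V : ι → H1Field I}

lemma UH1.jac (h : UH1 U) (h' : UH1 V) : UBdd I 1 (fun i => jac (U i) (V i)) :=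
  (h.dx.mul h'.dt).sub (p := 1) le_rfl (h.dt.mul h'.dx)

lemma UH1.nullEnergy (hI : I.OrdConnected) (h : UH1 U) (h' : UH1 V) (c : ℝ) :
    UBdd I 1 (fun i => nullEnergy c (U i) (V i)) :=
  ((UBdd.time hI).mul (((h.null c).mul (h.null c)).add (p := 1) le_rfl
    ((h.exp hI 2).mul ((h'.null c).mul (r := 1) (h'.null c))))).congr
    fun i z => by simp only [Gowdy.nullEnergy]; ring

include hI hne in
/-- The Jacobian identity for `Q` and `e^{2P} ψ`: it turns the quadratic source of the equation for
`Q`, in its first-order form, into a divergence. -/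
lemma integral_exp_mul_jac {ψ : ℝ × Torus → ℝ} (hψ : IsTestFunction I ψ) :
    2 * ∫ z in cyl I, Real.exp (2 * P.val z) * jac P Q z * ψ z
      = ∫ z in cyl I, Real.exp (2 * P.val z) * (Q.dx z * partialT ψ z - Q.dt z * partialX ψ z) := by
  have uP : UH1 (fun _ : Unit => P) := UH1.single P
  have uQ : UH1 (fun _ : Unit => Q) := UH1.single Q
  have hs := hψ.smoothFn
  have b0 : UBdd I ⊤ (fun _ : Unit => ψ) := UBdd.of_continuous hs.continuous
  have bT : UBdd I ⊤ (fun _ : Unit => partialT ψ) := UBdd.of_continuous hs.partialT_smooth.continuous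
  have bX : UBdd I ⊤ (fun _ : Unit => partialX ψ) := UBdd.of_continuous hs.partialX_smooth.continuous
  have uh : UBdd I ⊤ (fun (_ : Unit) z => Real.exp (2 * P.val z) * ψ z) := (uP.exp hI 2).mul b0
  have ut : UBdd I 2 (fun (_ : Unit) z => 2 * (Real.exp (2 * P.val z) * P.dt z * ψ z)
      + Real.exp (2 * P.val z) * partialT ψ z) :=
    (((uP.exp_dt hI uP 2).mul b0).const_mul 2).add one_le_two
      (((uP.exp hI 2).mul (r := ⊤) bT).mono_exponent le_top)
  have ux : UBdd I 2 (fun (_ : Unit) z => 2 * (Real.exp (2 * P.val z) * P.dx z * ψ z)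
      + Real.exp (2 * P.val z) * partialX ψ z) :=
    (((uP.exp_dx hI uP 2).mul b0).const_mul 2).add one_le_two
      (((uP.exp hI 2).mul (r := ⊤) bX).mono_exponent le_top)
  have uh2 := uh.mono_exponent (p := 2) le_top
  have hL : ∀ c, LineAC I c (fun z => Real.exp (2 * P.val z) * ψ z)
      (fun z => (2 * (Real.exp (2 * P.val z) * P.dt z * ψ z) + Real.exp (2 * P.val z) * partialT ψ z)
        + c * (2 * (Real.exp (2 * P.val z) * P.dx z * ψ z)
          + Real.exp (2 * P.val z) * partialX ψ z)) := fun c =>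
    ((((P.lineAC hI hne one_le_two c).const_mul 2).exp).mul (LineAC.of_smooth hs)).congr
      (ae_of_all _ fun z => by simp only [lineD]; ring)
  have hW : ∀ c, WeakDir I c _ _ := fun c => (hL c).weakDir hI (uh.locInt le_top ())
    ((ut.add one_le_two (ux.const_mul c)).locInt one_le_two ())
  have hW0 : WeakDir I 0 (fun z => Real.exp (2 * P.val z) * ψ z) (fun z =>
      2 * (Real.exp (2 * P.val z) * P.dt z * ψ z) + Real.exp (2 * P.val z) * partialT ψ z) := by
    simpa only [zero_mul, add_zero] using hW 0
  have hWX := hW0.weakDX (uh.locInt le_top ()) (ut.locInt one_le_two ()) (ux.locInt one_le_two ())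
    (by simpa only [one_mul] using hW 1)
  obtain ⟨a, b, hab, hsupp⟩ := hψ.support
  have h1 := integral_jacobian hI hne Q.val_bdd Q.dt_bdd Q.dx_bdd (uh2.single ()) (ut.single ())
    (ux.single ()) (by simpa only [zero_mul, add_zero] using Q.weakDir one_le_two 0) Q.weakDX hW0
    hWX hab (fun t ht θ => by simp [hsupp t ht θ])
    (fun t ht θ => by simp [hsupp t ht θ, IsTestFunction.partialT_support hsupp ht])
    (fun t ht θ => by simp [hsupp t ht θ, IsTestFunction.partialX_support hsupp ht])
  have i1 : IntegrableOn (fun z => Real.exp (2 * P.val z) * jac P Q z * ψ z) (cyl I) :=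
    ((((uP.exp hI 2).mul (uP.jac uQ)).locInt le_rfl ()).integrableOn_mul_test hψ)
  have i2 : IntegrableOn (fun z => Real.exp (2 * P.val z) * Q.dx z * partialT ψ z) (cyl I) :=
    ((uP.exp_dx hI uQ 2).locInt one_le_two ()).integrableOn_mul_test hψ.partialT
  have i3 : IntegrableOn (fun z => Real.exp (2 * P.val z) * Q.dt z * partialX ψ z) (cyl I) :=
    ((uP.exp_dt hI uQ 2).locInt one_le_two ()).integrableOn_mul_test hψ.partialX
  have i4 : IntegrableOn (fun z => Real.exp (2 * P.val z) * (Q.dt z * P.dx z) * ψ z) (cyl I) :=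
    (((uP.exp hI 2).mul (uQ.dt.mul (r := 1) uP.dx)).locInt le_rfl ()).integrableOn_mul_test hψ
  have i5 : IntegrableOn (fun z => Real.exp (2 * P.val z) * (Q.dx z * P.dt z) * ψ z) (cyl I) :=
    (((uP.exp hI 2).mul (uQ.dx.mul (r := 1) uP.dt)).locInt le_rfl ()).integrableOn_mul_test hψ
  have e1 : ∫ z in cyl I, Q.dt z * (2 * (Real.exp (2 * P.val z) * P.dx z * ψ z)
      + Real.exp (2 * P.val z) * partialX ψ z)
      = 2 * (∫ z in cyl I, Real.exp (2 * P.val z) * (Q.dt z * P.dx z) * ψ z)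
        + ∫ z in cyl I, Real.exp (2 * P.val z) * Q.dt z * partialX ψ z := by
    rw [← integral_const_mul, ← integral_add (i4.const_mul 2) i3]
    congr 1; ext z; ring
  have e2 : ∫ z in cyl I, Q.dx z * (2 * (Real.exp (2 * P.val z) * P.dt z * ψ z)
      + Real.exp (2 * P.val z) * partialT ψ z)
      = 2 * (∫ z in cyl I, Real.exp (2 * P.val z) * (Q.dx z * P.dt z) * ψ z)
        + ∫ z in cyl I, Real.exp (2 * P.val z) * Q.dx z * partialT ψ z := by
    rw [← integral_const_mul, ← integral_add (i5.const_mul 2) i2]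
    congr 1; ext z; ring
  have e3 : ∫ z in cyl I, Real.exp (2 * P.val z) * jac P Q z * ψ z
      = (∫ z in cyl I, Real.exp (2 * P.val z) * (Q.dt z * P.dx z) * ψ z)
        - ∫ z in cyl I, Real.exp (2 * P.val z) * (Q.dx z * P.dt z) * ψ z := by
    rw [← integral_sub i4 i5]
    congr 1; ext z; simp only [jac]; ring
  have e4 : ∫ z in cyl I, Real.exp (2 * P.val z) * (Q.dx z * partialT ψ z - Q.dt z * partialX ψ z)
      = (∫ z in cyl I, Real.exp (2 * P.val z) * Q.dx z * partialT ψ z)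
        - ∫ z in cyl I, Real.exp (2 * P.val z) * Q.dt z * partialX ψ z := by
    rw [← integral_sub i2 i3]
    congr 1; ext z; ring
  rw [e1, e2] at h1
  rw [e3, e4]
  linarith

include hI hne in
lemma lineAC_null {s : ℝ × Torus → ℝ} {F : H1Field I} (h : WaveEq I F.val s)
    (hs : LocInt I s) {c : ℝ} (hc : c ^ 2 = 1) :
    LineAC I c (fun z => F.dt z - c * F.dx z) s :=
  ((waveEq_iff_weakDir one_le_two F hc).1 h).lineAC hI hne
    (((UH1.single (ι := Unit) F).null c).locInt one_le_two ()) hs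

variable (hpos : I ⊆ Ioi 0)

include hI hne hpos in
lemma lineAC_exp_mul_null (h : WaveEq I Q.val (fun z =>
      -2 * (P.dt z * Q.dt z - P.dx z * Q.dx z) - Q.dt z / z.1)) {c : ℝ} (hc : c ^ 2 = 1) :
    LineAC I c (fun z => Real.exp (2 * P.val z) * (Q.dt z - c * Q.dx z))
      (fun z => Real.exp (2 * P.val z) * (2 * c * jac P Q z - Q.dt z / z.1)) := by
  have uP : UH1 (fun _ : Unit => P) := UH1.single P
  have uQ : UH1 (fun _ : Unit => Q) := UH1.single Q
  refine (((P.lineAC hI hne one_le_two c).const_mul 2).exp.mul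
    (lineAC_null hI hne h ((uP.sourceQ hI hpos uQ).locInt le_rfl ()) hc)).congr ?_
  refine ae_of_all _ fun z => ?_
  simp only [jac]
  linear_combination (-2 * Real.exp (2 * P.val z) * P.dx z * Q.dx z) * hc

lemma UH1.exp_jac (hI : I.OrdConnected) (hpos : I ⊆ Ioi 0) (h : UH1 U) (h' : UH1 V) (c : ℝ) :
    UBdd I 1 (fun i z => Real.exp (2 * (U i).val z) *
      (2 * c * Gowdy.jac (U i) (V i) z - (V i).dt z / z.1)) :=
  (h.exp hI 2).mul (((h.jac h').const_mul (2 * c)).sub (p := 1) le_rfl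
    ((h'.dt.mono_exponent one_le_two).div_time hI hpos))

include hI hne hpos in
/-- The divergence form of the equation for `Q`. Multiplication by `e^{±2P}` takes place along the lines
`θ = y + t`, and the Jacobian identity accounts for the remaining source. -/
lemma waveEq_iff_divergence : WaveEq I Q.val (fun z =>
      -2 * (P.dt z * Q.dt z - P.dx z * Q.dx z) - Q.dt z / z.1) ↔
    ∀ ψ, IsTestFunction I ψ →
      ∫ z in cyl I, Real.exp (2 * P.val z) * (Q.dt z * partialT ψ z - Q.dx z * partialX ψ z)
        = ∫ z in cyl I, Real.exp (2 * P.val z) * Q.dt z / z.1 * ψ z := by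
  have uP : UH1 (fun _ : Unit => P) := UH1.single P
  have uQ : UH1 (fun _ : Unit => Q) := UH1.single Q
  have iW : LocInt I (fun z => Real.exp (2 * P.val z) * (Q.dt z - 1 * Q.dx z)) :=
    ((uP.exp hI 2).mul (uQ.null 1)).locInt one_le_two ()
  have iS := (uP.exp_jac hI hpos uQ 1).locInt le_rfl ()
  have key : ∀ ψ, IsTestFunction I ψ →
      ((∫ z in cyl I, Real.exp (2 * P.val z) * (Q.dt z - 1 * Q.dx z) * lineD 1 ψ z)
        + ∫ z in cyl I, Real.exp (2 * P.val z) * (2 * 1 * jac P Q z - Q.dt z / z.1) * ψ z)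
      = (∫ z in cyl I, Real.exp (2 * P.val z) * (Q.dt z * partialT ψ z - Q.dx z * partialX ψ z))
        - ∫ z in cyl I, Real.exp (2 * P.val z) * Q.dt z / z.1 * ψ z := by
    intro ψ hψ
    have i0 : IntegrableOn (fun z => Real.exp (2 * P.val z) * jac P Q z * ψ z) (cyl I) :=
      ((((uP.exp hI 2).mul (uP.jac uQ)).locInt le_rfl ()).integrableOn_mul_test hψ)
    have i1 : IntegrableOn (fun z => Real.exp (2 * P.val z) * Q.dt z / z.1 * ψ z) (cyl I) :=
      (((uP.exp_dt hI uQ 2).div_time hI hpos).locInt one_le_two ()).integrableOn_mul_test hψ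
    have j1 := ((uP.exp_dx hI uQ 2).locInt one_le_two ()).integrableOn_mul_test hψ.partialT
    have j2 := ((uP.exp_dt hI uQ 2).locInt one_le_two ()).integrableOn_mul_test hψ.partialX
    have j3 := ((uP.exp_dt hI uQ 2).locInt one_le_two ()).integrableOn_mul_test hψ.partialT
    have j4 := ((uP.exp_dx hI uQ 2).locInt one_le_two ()).integrableOn_mul_test hψ.partialX
    have hJ := integral_exp_mul_jac hI hne (P := P) (Q := Q) hψ
    have e1 : ∫ z in cyl I, Real.exp (2 * P.val z) * (2 * 1 * jac P Q z - Q.dt z / z.1) * ψ z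
        = 2 * (∫ z in cyl I, Real.exp (2 * P.val z) * jac P Q z * ψ z)
          - ∫ z in cyl I, Real.exp (2 * P.val z) * Q.dt z / z.1 * ψ z := by
      rw [← integral_const_mul, ← integral_sub (i0.const_mul 2) i1]
      congr 1; ext z; ring
    have e2 : ∫ z in cyl I, Real.exp (2 * P.val z) * (Q.dt z - 1 * Q.dx z) * lineD 1 ψ z
        = (∫ z in cyl I, Real.exp (2 * P.val z) * (Q.dt z * partialT ψ z - Q.dx z * partialX ψ z))
        - ∫ z in cyl I, Real.exp (2 * P.val z) *
          (Q.dx z * partialT ψ z - Q.dt z * partialX ψ z) := by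
      rw [← integral_sub]
      · congr 1; ext z; simp only [lineD]; ring
      · exact (j3.sub j4).congr (ae_of_all _ fun z => by simp only [Pi.sub_apply]; ring)
      · exact (j1.sub j2).congr (ae_of_all _ fun z => by simp only [Pi.sub_apply]; ring)
    rw [e1, e2, hJ]
    ring
  constructor
  · intro h ψ hψ
    have h1 := (lineAC_exp_mul_null hI hne hpos h (one_pow 2)).weakDir hI iW iS ψ hψ
    have h2 := key ψ hψ
    linarith
  · intro h
    rw [waveEq_iff_weakDir one_le_two Q (one_pow 2)]
    have h1 : WeakDir I 1 (fun z => Real.exp (2 * P.val z) * (Q.dt z - 1 * Q.dx z))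
        (fun z => Real.exp (2 * P.val z) * (2 * 1 * jac P Q z - Q.dt z / z.1)) := by
      intro ψ hψ
      have h2 := key ψ hψ
      have h3 := h ψ hψ
      linarith
    have h2 := ((P.lineAC hI hne one_le_two 1).const_mul (-2)).exp.mul (h1.lineAC hI hne iW iS)
    have ex : ∀ x : ℝ, Real.exp (-2 * x) * Real.exp (2 * x) = 1 := fun x => by
      rw [← Real.exp_add]; simp
    have h3 : LineAC I 1 (fun z => Q.dt z - 1 * Q.dx z)
        (fun z => -2 * (P.dt z * Q.dt z - P.dx z * Q.dx z) - Q.dt z / z.1) := by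
      convert h2 using 2 with z z
      · linear_combination (-(Q.dt z - 1 * Q.dx z)) * ex (P.val z)
      · simp only [jac]
        linear_combination (2 * (P.dt z * Q.dt z - P.dx z * Q.dx z) + Q.dt z / z.1) * ex (P.val z)
    exact h3.weakDir hI ((uQ.null 1).locInt one_le_two ()) ((uP.sourceQ hI hpos uQ).locInt le_rfl ())

include hI hne hpos in
/-- The equation for `Q`, tested with a multiple of `Q`. As `e^{2P} (Q_t² - Q_θ²)` is the product of
`Q_t ± Q_θ` and `e^{2P} (Q_t ∓ Q_θ)`, it is obtained from the derivative of `Q e^{2P} (Q_t - c Q_θ)`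
along the lines `θ = y + c t`. -/
lemma integral_nullQ (h : WaveEq I Q.val (fun z =>
      -2 * (P.dt z * Q.dt z - P.dx z * Q.dx z) - Q.dt z / z.1)) {ψ : ℝ × Torus → ℝ}
    (hψ : IsTestFunction I ψ) :
    ∫ z in cyl I, nullQ P Q z * ψ z
      = (∫ z in cyl I, Q.val z * (Real.exp (2 * P.val z) * Q.dt z) / z.1 * ψ z)
        - ∫ z in cyl I, Q.val z * (Real.exp (2 * P.val z) *
          (Q.dt z * partialT ψ z - Q.dx z * partialX ψ z)) := by
  have uP : UH1 (fun _ : Unit => P) := UH1.single P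
  have uQ : UH1 (fun _ : Unit => Q) := UH1.single Q
  have iW : ∀ c, LocInt I (fun z => Q.val z * (Real.exp (2 * P.val z) * (Q.dt z - c * Q.dx z))) :=
    fun c => ((uQ.top hI).mul ((uP.exp hI 2).mul (r := 2) (uQ.null c))).locInt one_le_two ()
  have iS : ∀ c, LocInt I (fun z => (Q.dt z + c * Q.dx z) *
      (Real.exp (2 * P.val z) * (Q.dt z - c * Q.dx z)) + Q.val z *
      (Real.exp (2 * P.val z) * (2 * c * jac P Q z - Q.dt z / z.1))) := fun c =>
    (((uQ.dt.add one_le_two (uQ.dx.const_mul c)).mul ((uP.exp hI 2).mul (r := 2) (uQ.null c))).add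
      (p := 1) le_rfl ((uQ.top hI).mul (uP.exp_jac hI hpos uQ c))).locInt le_rfl ()
  have key : ∀ c : ℝ, c ^ 2 = 1 → _ := fun c hc =>
    ((Q.lineAC hI hne one_le_two c).mul (lineAC_exp_mul_null hI hne hpos h hc)).weakDir hI
      (iW c) (iS c) ψ hψ
  -- In the sum of the identities for `c = 1` and `c = -1`, the Jacobians cancel.
  have k1 := key 1 (by norm_num)
  have k2 := key (-1) (by norm_num)
  have i1 := ((uP.nullQ hI uQ).locInt le_rfl ()).integrableOn_mul_test hψ
  have i2 := ((((uQ.top hI).mul (uP.exp_dt hI uQ 2)).div_time hI hpos).locInt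
    one_le_two ()).integrableOn_mul_test hψ
  have s1 : (∫ z in cyl I, Q.val z * (Real.exp (2 * P.val z) * (Q.dt z - 1 * Q.dx z)) * lineD 1 ψ z)
      + ∫ z in cyl I, Q.val z * (Real.exp (2 * P.val z) * (Q.dt z - (-1) * Q.dx z)) * lineD (-1) ψ z
      = 2 * ∫ z in cyl I, Q.val z * (Real.exp (2 * P.val z) *
          (Q.dt z * partialT ψ z - Q.dx z * partialX ψ z)) := by
    rw [← integral_const_mul, ← integral_add ((iW 1).integrableOn_mul_test (hψ.lineD 1))
      ((iW (-1)).integrableOn_mul_test (hψ.lineD (-1)))]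
    congr 1; ext z; simp only [lineD]; ring
  have s2 : (∫ z in cyl I, ((Q.dt z + 1 * Q.dx z) *
      (Real.exp (2 * P.val z) * (Q.dt z - 1 * Q.dx z)) + Q.val z *
      (Real.exp (2 * P.val z) * (2 * 1 * jac P Q z - Q.dt z / z.1))) * ψ z)
      + ∫ z in cyl I, ((Q.dt z + (-1) * Q.dx z) *
      (Real.exp (2 * P.val z) * (Q.dt z - (-1) * Q.dx z)) + Q.val z *
      (Real.exp (2 * P.val z) * (2 * (-1) * jac P Q z - Q.dt z / z.1))) * ψ z
      = 2 * ((∫ z in cyl I, nullQ P Q z * ψ z)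
        - ∫ z in cyl I, Q.val z * (Real.exp (2 * P.val z) * Q.dt z) / z.1 * ψ z) := by
    rw [← integral_sub i1 i2, ← integral_const_mul,
      ← integral_add ((iS 1).integrableOn_mul_test hψ) ((iS (-1)).integrableOn_mul_test hψ)]
    congr 1; ext z; simp only [nullQ]; ring
  linarith

include hI hne hpos in
/-- The equation for `P`, tested with a multiple of `P`: the derivative of `P (P_t - P_θ)` along the
lines `θ = y + t`. -/
lemma integral_nullP (h : WaveEq I P.val (fun z => nullQ P Q z - P.dt z / z.1))
    {ψ : ℝ × Torus → ℝ} (hψ : IsTestFunction I ψ) :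
    ∫ z in cyl I, nullP P z * ψ z
      = (∫ z in cyl I, P.val z * P.dt z / z.1 * ψ z)
        - (∫ z in cyl I, P.val z * (nullQ P Q z * ψ z))
        - ∫ z in cyl I, P.val z * (P.dt z - P.dx z) * lineD 1 ψ z := by
  have uP : UH1 (fun _ : Unit => P) := UH1.single P
  have uQ : UH1 (fun _ : Unit => Q) := UH1.single Q
  have uS := (uP.sourceP hI hpos uQ)
  have iA : LocInt I (fun z => P.val z * (P.dt z - 1 * P.dx z)) :=
    ((uP.top hI).mul (uP.null 1)).locInt one_le_two ()
  have iS : LocInt I (fun z => (P.dt z + 1 * P.dx z) * (P.dt z - 1 * P.dx z)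
      + P.val z * (nullQ P Q z - P.dt z / z.1)) :=
    (((uP.dt.add one_le_two (uP.dx.const_mul 1)).mul (uP.null 1)).add (p := 1) le_rfl
      ((uP.top hI).mul uS)).locInt le_rfl ()
  have key := ((P.lineAC hI hne one_le_two 1).mul
    (lineAC_null hI hne h (uS.locInt le_rfl ()) (one_pow 2))).weakDir hI iA iS ψ hψ
  have i1 := ((uP.nullP).locInt le_rfl ()).integrableOn_mul_test hψ
  have i2 := ((((uP.top hI).mul uP.dt).div_time hI hpos).locInt
    one_le_two ()).integrableOn_mul_test hψ
  have i3 := (((uP.top hI).mul (uP.nullQ hI uQ)).locInt le_rfl ()).integrableOn_mul_test hψ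
  have e : ∫ z in cyl I, ((P.dt z + 1 * P.dx z) * (P.dt z - 1 * P.dx z)
      + P.val z * (nullQ P Q z - P.dt z / z.1)) * ψ z
      = (∫ z in cyl I, nullP P z * ψ z) + (∫ z in cyl I, P.val z * (nullQ P Q z * ψ z))
        - ∫ z in cyl I, P.val z * P.dt z / z.1 * ψ z := by
    simp only [mul_assoc] at i3
    rw [← integral_add i1 i3, ← integral_sub
      (f := fun z => nullP P z * ψ z + P.val z * (nullQ P Q z * ψ z)) (i1.add i3) i2]
    congr 1; ext z; ring_nf; simp only [nullP]; ring
  simp only [one_mul] at key e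
  linarith

include hI hne hpos in
/-- The null components of the energy are transported along characteristics, up to sources which
are null forms. -/
lemma weakDir_nullEnergy (h : EssentialEquations P Q) {c : ℝ} (hc : c ^ 2 = 1) :
    WeakDir I c (nullEnergy c P Q) (fun z => -nullP P z - nullQ P Q z) := by
  have uP : UH1 (fun _ : Unit => P) := UH1.single P
  have uQ : UH1 (fun _ : Unit => Q) := UH1.single Q
  have hA := lineAC_null hI hne (F := P) (c := c) h.1
    ((uP.sourceP hI hpos uQ).locInt le_rfl ()) hc
  have hB := lineAC_null hI hne (F := Q) (c := c) h.2
    ((uP.sourceQ hI hpos uQ).locInt le_rfl ()) hc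
  have hE := (LineAC.time I c).mul ((hA.mul hA).add
    (((P.lineAC hI hne one_le_two c).const_mul 2).exp.mul (hB.mul hB)))
  have hE' : LineAC I c (nullEnergy c P Q) (fun z => -nullP P z - nullQ P Q z) := by
    have h1 : nullEnergy c P Q = fun z => z.1 * ((P.dt z - c * P.dx z) * (P.dt z - c * P.dx z)
        + Real.exp (2 * P.val z) * ((Q.dt z - c * Q.dx z) * (Q.dt z - c * Q.dx z))) := by
      ext z; simp only [nullEnergy]; ring
    rw [h1]
    refine hE.congr' ?_
    filter_upwards [ae_time_mem hI] with t ht θ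
    have ht0 : t ≠ 0 := (hpos ht).ne'
    simp only [nullP, nullQ]
    have h1 : t * (P.dt (t, θ) / t) = P.dt (t, θ) := mul_div_cancel₀ _ ht0
    have h2 : t * (Q.dt (t, θ) / t) = Q.dt (t, θ) := mul_div_cancel₀ _ ht0
    linear_combination (P.dx (t, θ) ^ 2 + Real.exp (2 * P.val (t, θ)) * (Q.dx (t, θ) ^ 2
        + 2 * t * (P.dt (t, θ) - c * P.dx (t, θ)) * Q.dx (t, θ) ^ 2
        - 4 * t * (Q.dt (t, θ) - c * Q.dx (t, θ)) * P.dx (t, θ) * Q.dx (t, θ))) * hc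
      - 2 * (P.dt (t, θ) - c * P.dx (t, θ)) * h1
      - 2 * Real.exp (2 * P.val (t, θ)) * (Q.dt (t, θ) - c * Q.dx (t, θ)) * h2
  exact hE'.weakDir hI ((uP.nullEnergy hI uQ c).locInt le_rfl ())
    ((uP.nullP.neg.sub le_rfl (uP.nullQ hI uQ)).locInt le_rfl ())

end Identities

/-! ### Weak compactness -/

/-- Sequential weak compactness of bounded sets in `L²`: the Banach-Alaoglu theorem in the dual of the
separable space `L²`, which is identified with `L²`. -/
lemma exists_subseq_weak_L2 {α : Type*} [MeasurableSpace α] {μ : Measure α} [SFinite μ]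
    [MeasurableSpace.CountablyGenerated α] {F : ℕ → α → ℝ} (hF : ∀ n, MemLp (F n) 2 μ)
    {M : ℝ≥0} (hM : ∀ n, eLpNorm (F n) 2 μ ≤ M) :
    ∃ (k : ℕ → ℕ) (G : α → ℝ), StrictMono k ∧ MemLp G 2 μ ∧ ∀ h, MemLp h 2 μ →
      Tendsto (fun n => ∫ z, F (k n) z * h z ∂μ) atTop (𝓝 (∫ z, G z * h z ∂μ)) := by
  have : Fact ((2 : ℝ≥0∞) ≠ ⊤) := ⟨by norm_num⟩
  have : SecondCountableTopology (Lp ℝ 2 μ) := Lp.SecondCountableTopology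
  let e := InnerProductSpace.toDual ℝ (Lp ℝ 2 μ)
  let x : ℕ → WeakDual ℝ (Lp ℝ 2 μ) := fun n => WeakDual.toStrongDual.symm (e (hF n).toLp)
  have hx : ∀ n, x n ∈ WeakDual.toStrongDual ⁻¹' Metric.closedBall (0 : StrongDual ℝ (Lp ℝ 2 μ)) M := by
    intro n
    simp only [x, Set.mem_preimage, LinearEquiv.apply_symm_apply, mem_closedBall_zero_iff,
      LinearIsometryEquiv.norm_map, Lp.norm_toLp, e]
    exact ENNReal.toReal_le_coe_of_le_coe (hM n)
  obtain ⟨y, -, k, hk, hy⟩ := WeakDual.isSeqCompact_closedBall ℝ (Lp ℝ 2 μ) 0 M hx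
  refine ⟨k, (e.symm (WeakDual.toStrongDual y) : Lp ℝ 2 μ), hk, Lp.memLp _, fun h hh => ?_⟩
  have hinner : ∀ u v : Lp ℝ 2 μ, inner ℝ u v = ∫ z, u z * v z ∂μ := by
    intro u v
    rw [L2.inner_def]
    congr 1; ext z; simp [mul_comm]
  have h1 := (WeakDual.eval_continuous hh.toLp).tendsto y |>.comp hy
  have h2 : y hh.toLp = inner ℝ (e.symm (WeakDual.toStrongDual y)) hh.toLp := by
    have : e (e.symm (WeakDual.toStrongDual y)) hh.toLp = y hh.toLp := by
      rw [LinearIsometryEquiv.apply_symm_apply]; rfl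
    rw [← this]; simp [e]
  have h3 : ∀ n, x n hh.toLp = inner ℝ (hF n).toLp hh.toLp := fun n => by
    simp only [e, x]
    rfl
  have h4 : y hh.toLp = ∫ z, (e.symm (WeakDual.toStrongDual y) : Lp ℝ 2 μ) z * h z ∂μ := by
    rw [h2, hinner]
    apply integral_congr_ae
    filter_upwards [hh.coeFn_toLp] with z hz
    rw [hz]
  rw [← h4]
  refine h1.congr fun n => ?_
  change x (k n) hh.toLp = _
  rw [h3, hinner]
  apply integral_congr_ae
  filter_upwards [hh.coeFn_toLp, (hF (k n)).coeFn_toLp] with z hz hz'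
  rw [hz, hz']

/-- A weight in time, locally bounded below on `I`, which turns local `L²` bounds into a global
one. -/
lemma exists_weight {ι : Type} (hI : I.OrdConnected) (hne : I.Nonempty)
    {f : ι → ℝ × Torus → ℝ} (hf : ∀ i, AEStronglyMeasurable (f i) (volume.restrict (cyl I)))
    (hb : ∀ a b, Icc a b ⊆ I → ∃ C : ℝ≥0, ∀ i,
      eLpNorm (f i) 2 (volume.restrict (cyl (Icc a b))) ≤ C) :
    ∃ w : ℝ → ℝ, Measurable w ∧ (∀ t, 0 ≤ w t) ∧
      (∀ a b, Icc a b ⊆ I → ∃ c > 0, ∀ t ∈ Icc a b, c ≤ w t) ∧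
      ∀ i, eLpNorm (fun z => w z.1 * f i z) 2 (volume.restrict (cyl I)) ≤ 1 := by
  obtain ⟨a, b, -, -, hab, hex⟩ := exists_exhaustion hI hne
  choose C hC using fun m => hb (a m) (b m) (hab m)
  obtain ⟨δ, hδ, hδs⟩ := ENNReal.exists_pos_tsum_mul_lt_of_countable one_ne_zero
    (fun m : ℕ => (1 + (C m : ℝ≥0∞) ^ 2)) (fun m => by finiteness)
  set W : ℝ → ℝ≥0∞ := fun t => ∑' m, (Icc (a m) (b m)).indicator (fun _ => (δ m : ℝ≥0∞)) t
    with hW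
  have hWm : Measurable W :=
    Measurable.tsum fun m => measurable_const.indicator measurableSet_Icc
  have hW1 : ∀ t, W t ≤ 1 := by
    intro t
    refine (ENNReal.tsum_le_tsum fun m => ?_).trans hδs.le
    refine (Set.indicator_le_self _ _ _).trans ?_
    rw [add_mul, one_mul]
    exact le_self_add
  refine ⟨fun t => Real.sqrt (W t).toReal, hWm.ennreal_toReal.sqrt, fun t => Real.sqrt_nonneg _,
    fun x y hxy => ?_, fun i => ?_⟩
  · obtain ⟨m, hm⟩ := hex x y hxy
    refine ⟨Real.sqrt (δ m), Real.sqrt_pos.2 (by exact_mod_cast hδ m), fun t ht => ?_⟩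
    apply Real.sqrt_le_sqrt
    have h1 : (δ m : ℝ≥0∞) ≤ W t := by
      refine le_trans ?_ (ENNReal.le_tsum m)
      rw [Set.indicator_of_mem (hm ht)]
    have h2 := ENNReal.toReal_mono ((hW1 t).trans_lt ENNReal.one_lt_top).ne h1
    simpa using h2
  · have h2 : ∀ (g : ℝ × Torus → ℝ) (μ : Measure (ℝ × Torus)),
        eLpNorm g 2 μ ^ 2 = ∫⁻ z, ‖g z‖ₑ ^ 2 ∂μ := by
      intro g μ
      have := eLpNorm_nnreal_pow_eq_lintegral (f := g) (μ := μ) (p := 2) two_ne_zero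
      simpa using this
    have h3 : eLpNorm (fun z => Real.sqrt (W z.1).toReal * f i z) 2 (volume.restrict (cyl I)) ^ 2
        ≤ 1 := by
      rw [h2]
      calc ∫⁻ z in cyl I, ‖Real.sqrt (W z.1).toReal * f i z‖ₑ ^ 2
          = ∫⁻ z in cyl I, ∑' m, (cyl (Icc (a m) (b m))).indicator
              (fun z => (δ m : ℝ≥0∞) * ‖f i z‖ₑ ^ 2) z := by
            apply lintegral_congr
            intro z
            have e1 : ‖Real.sqrt (W z.1).toReal‖ₑ ^ 2 = W z.1 := by
              rw [← enorm_pow, Real.sq_sqrt ENNReal.toReal_nonneg,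
                Real.enorm_of_nonneg ENNReal.toReal_nonneg,
                ENNReal.ofReal_toReal ((hW1 _).trans_lt ENNReal.one_lt_top).ne]
            rw [enorm_mul, mul_pow, e1, hW, ← ENNReal.tsum_mul_right]
            congr 1; ext m
            by_cases h : z.1 ∈ Icc (a m) (b m)
            · rw [Set.indicator_of_mem h, Set.indicator_of_mem (show z ∈ cyl _ from ⟨h, trivial⟩)]
            · rw [Set.indicator_of_notMem h, zero_mul,
                Set.indicator_of_notMem (fun h' : z ∈ cyl _ => h h'.1)]
        _ = ∑' m, ∫⁻ z in cyl I, (cyl (Icc (a m) (b m))).indicator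
              (fun z => (δ m : ℝ≥0∞) * ‖f i z‖ₑ ^ 2) z :=
            lintegral_tsum fun m => (((hf i).enorm.pow_const 2).const_mul _).indicator
              (measurableSet_cyl measurableSet_Icc)
        _ ≤ ∑' m, (1 + (C m : ℝ≥0∞) ^ 2) * δ m := by
            refine ENNReal.tsum_le_tsum fun m => ?_
            rw [setLIntegral_indicator (measurableSet_cyl measurableSet_Icc),
              Set.inter_eq_left.2 (cyl_mono (hab m)), lintegral_const_mul'' _
                (((hf i).mono_measure (restrict_cyl_mono (hab m))).enorm.pow_const 2), ← h2, mul_comm]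
            gcongr
            exact (pow_le_pow_left' (hC m i) 2).trans le_add_self
        _ ≤ 1 := hδs.le
    by_contra hcon
    exact absurd h3 (not_le.2 (one_lt_pow₀ (not_le.1 hcon) two_ne_zero))

lemma eLpNorm_two_le_iff {α : Type*} [MeasurableSpace α] {μ : Measure α} {f : α → ℝ}
    (hf : MemLp f 2 μ) {C : ℝ≥0} : eLpNorm f 2 μ ≤ C ↔ ∫ x, f x ^ 2 ∂μ ≤ (C : ℝ) ^ 2 := by
  have h1 : eLpNorm f 2 μ ^ 2 = ENNReal.ofReal (∫ x, f x ^ 2 ∂μ) := by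
    have := eLpNorm_nnreal_pow_eq_lintegral (f := f) (μ := μ) (p := 2) two_ne_zero
    rw [ofReal_integral_eq_lintegral_ofReal hf.integrable_sq (ae_of_all _ fun x => sq_nonneg _)]
    simp only [ENNReal.coe_ofNat, NNReal.coe_ofNat, ENNReal.rpow_two] at this
    rw [this]
    congr 1; ext x
    rw [← enorm_pow, Real.enorm_of_nonneg (sq_nonneg _)]
  rw [← ENNReal.pow_le_pow_left_iff two_ne_zero, h1,
    ENNReal.ofReal_le_iff_le_toReal (by finiteness)]
  simp

lemma WeakL2.comp {J : Set ℝ} {f : ℕ → ℝ × Torus → ℝ} {g : ℝ × Torus → ℝ} (h : WeakL2 J f g)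
    {k : ℕ → ℕ} (hk : StrictMono k) : WeakL2 J (fun n => f (k n)) g :=
  fun u hu => (h u hu).comp hk.tendsto_atTop

lemma WeakL2.mono {J K : Set ℝ} (hJ : MeasurableSet J) (hJK : J ⊆ K) {f : ℕ → ℝ × Torus → ℝ}
    {g : ℝ × Torus → ℝ} (h : WeakL2 K f g) : WeakL2 J f g := by
  intro u hu
  have hu' : MemLp ((cyl J).indicator u) 2 (volume.restrict (cyl K)) := by
    rw [memLp_indicator_iff_restrict (measurableSet_cyl hJ), Measure.restrict_restrict
      (measurableSet_cyl hJ), Set.inter_eq_left.2 (cyl_mono hJK)]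
    exact hu
  have e : ∀ v : ℝ × Torus → ℝ, ∫ z in cyl K, v z * (cyl J).indicator u z
      = ∫ z in cyl J, v z * u z := by
    intro v
    have : (fun z => v z * (cyl J).indicator u z) = (cyl J).indicator (fun z => v z * u z) := by
      ext z; by_cases hz : z ∈ cyl J <;> simp [hz]
    rw [this, setIntegral_indicator (measurableSet_cyl hJ), Set.inter_eq_right.2 (cyl_mono hJK)]
  simpa only [e] using h _ hu'

/-- Essential bounds in time of the spatial `L²` norms pass to weak limits. -/
lemma WeakL2.slice_bound {a b : ℝ} {f : ℕ → ℝ × Torus → ℝ} {g : ℝ × Torus → ℝ}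
    (h : WeakL2 (Icc a b) f g) (hg : MemLp g 2 (volume.restrict (cyl (Icc a b))))
    (hf : ∀ n, MemLp (f n) 2 (volume.restrict (cyl (Icc a b)))) {C : ℝ≥0}
    (hC : ∀ n, ∀ᵐ t ∂volume.restrict (Icc a b),
      eLpNorm (fun θ : Torus => f n (t, θ)) 2 volume ≤ C) :
    ∀ᵐ t ∂volume.restrict (Icc a b), eLpNorm (fun θ : Torus => g (t, θ)) 2 volume ≤ C := by
  have hprod : ∀ {u : ℝ × Torus → ℝ}, MemLp u 2 (volume.restrict (cyl (Icc a b))) →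
      IntegrableOn (fun t => ∫ θ, u (t, θ) ^ 2) (Icc a b) := fun {u} hu => by
    have h1 : IntegrableOn (fun z => u z ^ 2) (cyl (Icc a b)) := hu.integrable_sq
    rw [IntegrableOn, restrict_cyl] at h1
    exact h1.integral_prod_left
  have hslice : ∀ {u : ℝ × Torus → ℝ}, MemLp u 2 (volume.restrict (cyl (Icc a b))) →
      ∀ᵐ t ∂volume.restrict (Icc a b), MemLp (fun θ => u (t, θ)) 2 := fun {u} hu => by
    have h1 : IntegrableOn (fun z => u z ^ 2) (cyl (Icc a b)) := hu.integrable_sq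
    have h2 := hu.1
    rw [IntegrableOn, restrict_cyl] at h1
    rw [restrict_cyl] at h2
    filter_upwards [h1.prod_right_ae, h2.prodMk_left] with t h3 h4
    exact (memLp_two_iff_integrable_sq h4).2 h3
  have key : (fun t => ∫ θ, g (t, θ) ^ 2) ≤ᵐ[volume.restrict (Icc a b)]
      fun _ => (C : ℝ) ^ 2 := by
    refine ae_le_of_forall_setIntegral_le (hprod hg) (integrable_const _) fun s hs _ => ?_
    have hsJ : MeasurableSet (s ∩ Icc a b) := hs.inter measurableSet_Icc
    have hsub := cyl_mono (Set.inter_subset_right (s := s) (t := Icc a b))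
    rw [Measure.restrict_restrict hs]
    have hW := h.mono hsJ Set.inter_subset_right g (hg.mono_measure (Measure.restrict_mono hsub le_rfl))
    have e1 : ∀ {u : ℝ × Torus → ℝ}, MemLp u 2 (volume.restrict (cyl (Icc a b))) →
        ∫ z in cyl (s ∩ Icc a b), u z ^ 2 = ∫ t in s ∩ Icc a b, ∫ θ, u (t, θ) ^ 2 :=
      fun {u} hu => setIntegral_cyl (f := fun z => u z ^ 2) (hu.integrable_sq.mono_measure (Measure.restrict_mono hsub le_rfl))
    have hle : ∀ n, ∫ z in cyl (s ∩ Icc a b), f n z * g z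
        ≤ ((∫ t in s ∩ Icc a b, (C : ℝ) ^ 2) + ∫ z in cyl (s ∩ Icc a b), g z ^ 2) / 2 := by
      intro n
      have hfn := (hf n).mono_measure (Measure.restrict_mono hsub le_rfl)
      have hgn := hg.mono_measure (Measure.restrict_mono hsub le_rfl)
      have h1 : ∫ z in cyl (s ∩ Icc a b), f n z ^ 2 ≤ ∫ t in s ∩ Icc a b, (C : ℝ) ^ 2 := by
        rw [e1 (hf n)]
        refine integral_mono_ae ((hprod (hf n)).mono_set Set.inter_subset_right)
          (integrableOn_const (measure_ne_top_of_subset Set.inter_subset_right (by simp))) ?_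
        filter_upwards [ae_restrict_of_ae_restrict_of_subset Set.inter_subset_right (hC n),
          ae_restrict_of_ae_restrict_of_subset Set.inter_subset_right (hslice (hf n))] with t h1 h2
        exact (eLpNorm_two_le_iff h2).1 h1
      calc ∫ z in cyl (s ∩ Icc a b), f n z * g z
          ≤ ∫ z in cyl (s ∩ Icc a b), (f n z ^ 2 + g z ^ 2) / 2 :=
            integral_mono (hfn.integrable_mul hgn)
              ((hfn.integrable_sq.add hgn.integrable_sq).div_const 2)
              fun z => by dsimp only; nlinarith [sq_nonneg (f n z - g z)]
        _ = ((∫ z in cyl (s ∩ Icc a b), f n z ^ 2)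
              + ∫ z in cyl (s ∩ Icc a b), g z ^ 2) / 2 := by
            rw [integral_div, integral_add hfn.integrable_sq hgn.integrable_sq]
        _ ≤ _ := by linarith
    have h2 := le_of_tendsto' hW hle
    simp only [← sq] at h2
    rw [← e1 hg]
    linarith
  filter_upwards [key, hslice hg] with t h1 h2
  exact (eLpNorm_two_le_iff h2).2 h1

/-- Sequences bounded in `L^∞_loc(I, L²(T¹))` have weakly convergent subsequences. The weight makes a
single extraction sufficient for all compact intervals of times. -/
lemma UBdd.exists_weakL2 (hI : I.OrdConnected) (hne : I.Nonempty)
    {f : ℕ → ℝ × Torus → ℝ} (hf : UBdd I 2 f) :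
    ∃ (k : ℕ → ℕ) (g : ℝ × Torus → ℝ), StrictMono k ∧ LocBddLp I 2 g ∧
      ∀ a b, Icc a b ⊆ I → WeakL2 (Icc a b) (fun n => f (k n)) g := by
  obtain ⟨w, hw, hw0, hwc, hw1⟩ := exists_weight hI hne hf.1
    fun a b hab => hf.eLpNorm_cyl_le two_ne_zero (by norm_num) hab
  have hwm : Measurable (fun z : ℝ × Torus => w z.1) := hw.comp measurable_fst
  obtain ⟨k, G, hk, hG, hlim⟩ := exists_subseq_weak_L2 (F := fun n z => w z.1 * f n z) (M := 1)
    (fun n => ⟨hwm.aestronglyMeasurable.mul (hf.1 n), (hw1 n).trans_lt ENNReal.one_lt_top⟩)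
    (fun n => by simpa using hw1 n)
  have hmemJ : ∀ a b, Icc a b ⊆ I → ∀ u : ℝ × Torus → ℝ,
      MemLp u 2 (volume.restrict (cyl (Icc a b))) →
      MemLp (fun z => (w z.1)⁻¹ * u z) 2 (volume.restrict (cyl (Icc a b))) := by
    intro a b hab u hu
    obtain ⟨c, hc, hcw⟩ := hwc a b hab
    refine hu.of_le_mul (c := c⁻¹) (hwm.inv.aestronglyMeasurable.mul hu.1) ?_
    filter_upwards [ae_restrict_mem (measurableSet_cyl measurableSet_Icc)] with z hz
    rw [norm_mul, norm_inv, Real.norm_of_nonneg (hw0 _)]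
    gcongr
    exact hcw _ hz.1
  have hweak : ∀ a b, Icc a b ⊆ I →
      WeakL2 (Icc a b) (fun n => f (k n)) (fun z => (w z.1)⁻¹ * G z) := by
    intro a b hab h hh
    obtain ⟨c, hc, hcw⟩ := hwc a b hab
    have hm := measurableSet_cyl (measurableSet_Icc (a := a) (b := b))
    have h1 := hlim ((cyl (Icc a b)).indicator fun z => (w z.1)⁻¹ * h z) (by
      rw [memLp_indicator_iff_restrict hm, Measure.restrict_restrict hm,
        Set.inter_eq_left.2 (cyl_mono hab)]
      exact hmemJ a b hab h hh)
    have e : ∀ v : ℝ × Torus → ℝ, ∫ z in cyl I, v z *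
        (cyl (Icc a b)).indicator (fun z => (w z.1)⁻¹ * h z) z
        = ∫ z in cyl (Icc a b), v z * ((w z.1)⁻¹ * h z) := by
      intro v
      rw [← Set.inter_eq_right.2 (cyl_mono hab), ← setIntegral_indicator hm]
      congr 1; ext z; by_cases hz : z ∈ cyl (Icc a b) <;> simp [hz, Set.inter_eq_right.2 (cyl_mono hab)]
    simp only [e] at h1
    refine (h1.congr fun n => ?_).trans_eq ?_
    · refine setIntegral_congr_fun hm fun z hz => ?_
      have : w z.1 ≠ 0 := (hc.trans_le (hcw _ hz.1)).ne'
      field_simp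
    · congr 2; ext z; ring
  have hgm : AEStronglyMeasurable (fun z => (w z.1)⁻¹ * G z) (volume.restrict (cyl I)) :=
    hwm.inv.aestronglyMeasurable.mul hG.1
  refine ⟨k, _, hk, ⟨hgm, fun a b hab => ?_⟩, hweak⟩
  obtain ⟨C, hC⟩ := hf.2 a b hab
  exact ⟨C, (hweak a b hab).slice_bound
    (hmemJ a b hab G (hG.mono_measure (restrict_cyl_mono hab)))
    (fun n => hf.memLp_cyl two_ne_zero (by norm_num) hab _) fun n => hC _⟩

/-! ### Convergence of modes and strong convergence -/

/-- Weak convergence to zero of uniformly Lipschitz functions of time is uniform. -/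
lemma eventually_small_of_lipschitz {ι : Type} {l : Filter ι} {D L : ι → ℝ → ℝ} {a b : ℝ} {M : ℝ≥0}
    (hL : ∀ i, LipschitzOnWith M (L i) (Icc a b))
    (hD : ∀ i, ∀ᵐ t ∂volume.restrict (Icc a b), D i t = L i t)
    (hint : ∀ p q, Icc p q ⊆ Icc a b →
      Tendsto (fun i => ∫ t in Icc p q, D i t) l (𝓝 0)) {ε : ℝ} (hε : 0 < ε) :
    ∀ᶠ i in l, ∀ᵐ t ∂volume.restrict (Icc a b), |D i t| ≤ ε := by
  rcases le_or_gt b a with hba | hab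
  · have h0 : volume.restrict (Icc a b) = 0 := by
      rw [Measure.restrict_eq_zero, Real.volume_Icc, ENNReal.ofReal_eq_zero]; linarith
    simp [h0]
  obtain ⟨N, hN⟩ := exists_nat_gt (2 * M * (b - a) / ε)
  have hba : 0 < b - a := sub_pos.2 hab
  have hN0 : (0 : ℝ) < N := lt_of_le_of_lt (by positivity) hN
  set h : ℝ := (b - a) / N with hh
  have hpos : 0 < h := by positivity
  have hMh : M * h ≤ ε / 2 := by
    rw [hh, ← mul_div_assoc, div_le_iff₀ hN0]
    rw [div_lt_iff₀ hε] at hN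
    linarith
  have hNh : N * h = b - a := by rw [hh]; field_simp
  have hsub : ∀ j < N, Icc (a + j * h) (a + j * h + h) ⊆ Icc a b := by
    intro j hj
    have : ((j : ℝ) + 1) ≤ N := by exact_mod_cast hj
    apply Set.Icc_subset_Icc
    · have : 0 ≤ (j : ℝ) * h := by positivity
      linarith
    · nlinarith
  have hev : ∀ᶠ i in l, ∀ j ∈ Finset.range N,
      |∫ t in Icc (a + j * h) (a + j * h + h), D i t| ≤ h * (ε / 2) := by
    rw [Filter.eventually_all_finset]
    intro j hj
    have := (hint _ _ (hsub j (Finset.mem_range.1 hj))).abs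
    rw [abs_zero] at this
    exact this.eventually_le_const (by positivity)
  filter_upwards [hev] with i hi
  have hne : ∀ᵐ t ∂volume.restrict (Icc a b), t ≠ b :=
    ae_restrict_of_ae (Measure.ae_ne volume b)
  filter_upwards [hD i, hne, ae_restrict_mem measurableSet_Icc] with t ht htb htm
  rw [ht]
  have htb' : t < b := lt_of_le_of_ne htm.2 htb
  set j := ⌊(t - a) / h⌋₊ with hj
  have hj1 : (j : ℝ) * h ≤ t - a := by
    rw [← le_div_iff₀ hpos]
    exact Nat.floor_le (div_nonneg (by linarith [htm.1]) hpos.le)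
  have hj2 : t - a < (j + 1) * h := by
    rw [← div_lt_iff₀ hpos]; exact Nat.lt_floor_add_one _
  have hjN : j < N := by
    have : (j : ℝ) < N := by
      by_contra hcon
      have := mul_le_mul_of_nonneg_right (not_lt.1 hcon) hpos.le
      linarith
    exact_mod_cast this
  set K := Icc (a + j * h) (a + j * h + h) with hK
  have htK : t ∈ K := ⟨by linarith, by linarith⟩
  have hKm : volume.real K = h := by
    rw [hK, Real.volume_real_Icc_of_le (by linarith)]; ring
  have hcont : IntegrableOn (L i) K :=
    (((hL i).continuousOn).mono (hsub j hjN)).integrableOn_compact isCompact_Icc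
  have h1 : |∫ s in K, L i s| ≤ h * (ε / 2) := by
    have h2 := hi j (Finset.mem_range.2 hjN)
    rwa [integral_congr_ae (ae_restrict_of_ae_restrict_of_subset (hsub j hjN) (hD i))] at h2
  have h3 : h * L i t = (∫ s in K, L i s) - ∫ s in K, (L i s - L i t) := by
    rw [integral_sub hcont (integrableOn_const (by simp [hK])), setIntegral_const, hKm]
    simp
  have h4 : |∫ s in K, (L i s - L i t)| ≤ (M * h) * h := by
    have := norm_setIntegral_le_of_norm_le_const (μ := volume) (s := K)
      (f := fun s => L i s - L i t) (C := M * h) (by simp [hK]) (fun s hs => by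
        have e := (hL i).dist_le_mul s (hsub j hjN hs) t htm
        rw [Real.dist_eq, Real.dist_eq] at e
        refine e.trans (mul_le_mul_of_nonneg_left ?_ M.2)
        rw [abs_le]
        exact ⟨by linarith [hs.1, htK.2], by linarith [hs.2, htK.1]⟩)
    rwa [hKm] at this
  have h5 : h * |L i t| ≤ h * ε := by
    rw [← abs_of_pos hpos, ← abs_mul, abs_of_pos hpos, h3]
    calc _ ≤ |∫ s in K, L i s| + |∫ s in K, (L i s - L i t)| := abs_sub _ _
      _ ≤ h * (ε / 2) + (ε / 2) * h :=
        add_le_add h1 (h4.trans (mul_le_mul_of_nonneg_right hMh hpos.le))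
      _ = h * ε := by ring
  exact le_of_mul_le_mul_left h5 hpos

lemma LineAC1.exists_lipschitz {u v : ℝ → ℝ} (h : LineAC1 I u v) {a b : ℝ}
    (hab : Icc a b ⊆ I) {M : ℝ≥0}
    (hM : ∀ᵐ t ∂volume.restrict (Icc a b), |v t| ≤ M) :
    ∃ L : ℝ → ℝ, LipschitzOnWith M L (Icc a b) ∧
      ∀ᵐ t ∂volume.restrict (Icc a b), u t = L t := by
  obtain ⟨F, h1, h2, h3⟩ := h
  refine ⟨F, ?_, ae_restrict_of_ae_restrict_of_subset hab h1⟩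
  have key : ∀ s t, s ≤ t → s ∈ Icc a b → t ∈ Icc a b → |F t - F s| ≤ M * |t - s| := by
    intro s t hst hs ht
    have hsub : Icc s t ⊆ Icc a b := Set.Icc_subset_Icc hs.1 ht.2
    rw [← (h2 s t hst (hsub.trans hab)).integral_deriv_eq_sub]
    rw [← Real.norm_eq_abs]
    refine intervalIntegral.norm_integral_le_of_norm_le_const_ae ?_
    have h4 := ae_restrict_of_ae_restrict_of_subset (hsub.trans hab) h3
    have h5 := ae_restrict_of_ae_restrict_of_subset hsub hM
    rw [ae_restrict_iff' measurableSet_Icc] at h4 h5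
    filter_upwards [h4, h5] with r h6 h7 hr
    rw [Set.uIoc_of_le hst] at hr
    have hr' := Set.Ioc_subset_Icc_self hr
    rw [(h6 hr').deriv]
    exact h7 hr'
  refine LipschitzOnWith.of_dist_le_mul fun s hs t ht => ?_
  rw [Real.dist_eq, Real.dist_eq]
  rcases le_total s t with hst | hst
  · rw [abs_sub_comm, abs_sub_comm s]; exact key s t hst hs ht
  · exact key t s hst ht hs

lemma abs_le_of_average {L : ℝ → ℝ} {a b p q A : ℝ} {M : ℝ≥0}
    (hL : LipschitzOnWith M L (Icc a b)) (hpq : p < q) (hsub : Icc p q ⊆ Icc a b)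
    (hA : |∫ t in Icc p q, L t| ≤ A) {t : ℝ} (ht : t ∈ Icc a b) :
    |L t| ≤ A / (q - p) + M * (b - a) := by
  have hpos : 0 < q - p := sub_pos.2 hpq
  have hKm : volume.real (Icc p q) = q - p := Real.volume_real_Icc_of_le hpq.le
  have hcont : IntegrableOn L (Icc p q) :=
    ((hL.continuousOn).mono hsub).integrableOn_compact isCompact_Icc
  have h3 : (q - p) * L t = (∫ s in Icc p q, L s) - ∫ s in Icc p q, (L s - L t) := by
    rw [integral_sub hcont (integrableOn_const (by simp)), setIntegral_const, hKm]
    simp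
  have h4 : |∫ s in Icc p q, (L s - L t)| ≤ (M * (b - a)) * (q - p) := by
    have := norm_setIntegral_le_of_norm_le_const (μ := volume) (s := Icc p q)
      (f := fun s => L s - L t) (C := M * (b - a)) (by simp) (fun s hs => by
        have e := hL.dist_le_mul s (hsub hs) t ht
        have hs' := hsub hs
        rw [Real.dist_eq, Real.dist_eq] at e
        refine e.trans (mul_le_mul_of_nonneg_left ?_ M.2)
        rw [abs_le]
        exact ⟨by linarith [hs'.1, ht.2], by linarith [hs'.2, ht.1]⟩)
    rwa [hKm] at this
  have h5 : (q - p) * |L t| ≤ A + (M * (b - a)) * (q - p) := by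
    rw [← abs_of_pos hpos, ← abs_mul, abs_of_pos hpos, h3]
    exact (abs_sub _ _).trans (add_le_add hA h4)
  rw [div_add' _ _ _ hpos.ne', le_div_iff₀ hpos]
  linarith

lemma norm_mode_le {f : ℝ × Torus → ℝ} {t : ℝ} (hf : AEStronglyMeasurable (fun θ => f (t, θ)))
    {C : ℝ≥0} (h : eLpNorm (fun θ => f (t, θ)) 1 volume ≤ C) (k : ℤ) : ‖mode k f t‖ ≤ C := by
  refine (norm_fourierCoeff_le _ _).trans ?_
  have h10 : ∫ θ, ‖(f (t, θ) : ℂ)‖ = (eLpNorm (fun θ : Torus => f (t, θ)) 1 volume).toReal := by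
    rw [eLpNorm_one_eq_lintegral_enorm, ← integral_norm_eq_lintegral_enorm hf]
    simp
  rw [h10]
  exact ENNReal.toReal_le_coe_of_le_coe h

section Modes

variable {ι : Type} (hI : I.OrdConnected) (hne : (interior I).Nonempty)
  {w wt wx : ι → ℝ × Torus → ℝ}

include hI hne in
lemma exists_lipschitz_mode (hw : ∀ i, LocInt I (w i)) (hwt : UBdd I 1 wt)
    (hW : ∀ i, WeakDir I 0 (w i) (wt i)) {a b : ℝ} (hab : Icc a b ⊆ I) :
    ∃ M : ℝ≥0, ∀ k : ℤ, ∃ L L' : ι → ℝ → ℝ, ∀ i,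
      (LipschitzOnWith M (L i) (Icc a b) ∧
        ∀ᵐ t ∂volume.restrict (Icc a b), (mode k (w i) t).re = L i t) ∧
      (LipschitzOnWith M (L' i) (Icc a b) ∧
        ∀ᵐ t ∂volume.restrict (Icc a b), (mode k (w i) t).im = L' i t) := by
  obtain ⟨M, hM⟩ := hwt.2 a b hab
  refine ⟨M, fun k => ?_⟩
  have hb : ∀ i, ∀ᵐ t ∂volume.restrict (Icc a b), ‖mode k (wt i) t‖ ≤ M := fun i => by
    filter_upwards [hM i, hwt.slice_aesm i hab] with t h1 h2 using norm_mode_le h2 h1 k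
  have h1 := fun i => (hW i).lineAC1_mode hI hne (hw i) (hwt.locInt le_rfl i) k
  choose L hL using fun i => (h1 i).1.exists_lipschitz hab (M := M)
    ((hb i).mono fun t ht => (Complex.abs_re_le_norm _).trans ht)
  choose L' hL' using fun i => (h1 i).2.exists_lipschitz hab (M := M)
    ((hb i).mono fun t ht => (Complex.abs_im_le_norm _).trans ht)
  exact ⟨L, L', fun i => ⟨hL i, hL' i⟩⟩

lemma integral_mode (hI : I.OrdConnected) {f : ℝ × Torus → ℝ} (hf : LocInt I f) {a b : ℝ} (hab : Icc a b ⊆ I) (k : ℤ) :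
    (∫ t in Icc a b, (mode k f t).re = ∫ z in cyl (Icc a b), f z * (fourier (-k) z.2).re) ∧
    (∫ t in Icc a b, (mode k f t).im
      = ∫ z in cyl (Icc a b), f z * (fourier (-k) z.2).im) := by
  have hsl := ae_restrict_of_ae_restrict_of_subset hab (hf.ae_integrable_slice hI)
  have hi : ∀ {χ : Torus → ℝ}, Continuous χ →
      IntegrableOn (fun z => f z * χ z.2) (cyl (Icc a b)) := fun {χ} hχ =>
    (hf.2 a b hab).mul_continuousOn (hχ.comp continuous_snd).continuousOn (isCompact_cyl_Icc a b)
  constructor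
  · rw [setIntegral_cyl (hi (continuous_fourier_re (-k)))]
    exact integral_congr_ae (hsl.mono fun t ht => mode_re ht)
  · rw [setIntegral_cyl (hi (continuous_fourier_im (-k)))]
    exact integral_congr_ae (hsl.mono fun t ht => mode_im ht)

include hI hne in
lemma eventually_mode_le {l : Filter ι} (hw : ∀ i, LocInt I (w i)) (hwt : UBdd I 1 wt)
    (hW : ∀ i, WeakDir I 0 (w i) (wt i))
    (hconv : ∀ χ : Torus → ℝ, Continuous χ → ∀ p q, Icc p q ⊆ I →
      Tendsto (fun i => ∫ z in cyl (Icc p q), w i z * χ z.2) l (𝓝 0))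
    {a b : ℝ} (hab : Icc a b ⊆ I) (k : ℤ) {ε : ℝ} (hε : 0 < ε) :
    ∀ᶠ i in l, ∀ᵐ t ∂volume.restrict (Icc a b), ‖mode k (w i) t‖ ≤ ε := by
  obtain ⟨M, hM⟩ := exists_lipschitz_mode hI hne hw hwt hW hab
  obtain ⟨L, L', hL⟩ := hM k
  have h1 := eventually_small_of_lipschitz (l := l) (fun i => (hL i).1.1) (fun i => (hL i).1.2)
    (fun p q hpq => by
      simp only [fun i => (integral_mode hI (hw i) (hpq.trans hab) k).1]
      exact hconv _ (continuous_fourier_re (-k)) p q (hpq.trans hab)) (half_pos hε)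
  have h2 := eventually_small_of_lipschitz (l := l) (fun i => (hL i).2.1) (fun i => (hL i).2.2)
    (fun p q hpq => by
      simp only [fun i => (integral_mode hI (hw i) (hpq.trans hab) k).2]
      exact hconv _ (continuous_fourier_im (-k)) p q (hpq.trans hab)) (half_pos hε)
  filter_upwards [h1, h2] with i h3 h4
  filter_upwards [h3, h4] with t h5 h6
  exact (Complex.norm_le_abs_re_add_abs_im _).trans (by linarith)

include hI hne in
/-- Weak convergence to zero in `H¹` is uniform. -/
lemma tendsto_eLpNorm_top {l : Filter ι} (hw : UBdd I 2 w) (hwt : UBdd I 2 wt) (hwx : UBdd I 2 wx)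
    (hW : ∀ i, WeakDir I 0 (w i) (wt i)) (hX : ∀ i, WeakDX I (w i) (wx i))
    (hconv : ∀ χ : Torus → ℝ, Continuous χ → ∀ p q, Icc p q ⊆ I →
      Tendsto (fun i => ∫ z in cyl (Icc p q), w i z * χ z.2) l (𝓝 0))
    {a b : ℝ} (hab : Icc a b ⊆ I) :
    Tendsto (fun i => eLpNorm (w i) ⊤ (volume.restrict (cyl (Icc a b)))) l (𝓝 0) := by
  have hw1 := fun i => hw.locInt one_le_two i
  obtain ⟨D, hD⟩ := hwx.2 a b hab
  rw [ENNReal.tendsto_nhds_zero]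
  intro ε hε
  obtain ⟨δ, hδ0, hδ⟩ : ∃ δ : ℝ, 0 < δ ∧ ENNReal.ofReal δ ≤ ε := by
    rcases eq_or_ne ε ⊤ with rfl | h
    · exact ⟨1, one_pos, le_top⟩
    · exact ⟨ε.toReal, ENNReal.toReal_pos hε.ne' h, ENNReal.ofReal_toReal_le⟩
  have h1 : Tendsto (fun s => fourierTail s * D) atTop (𝓝 (0 * D)) :=
    tendsto_fourierTail.mul_const _
  rw [zero_mul] at h1
  obtain ⟨s, hs⟩ := ((h1.eventually_le_const (half_pos hδ0)).and
    (eventually_ge_atTop ({0} : Finset ℤ))).exists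
  have hs0 : (0 : ℤ) ∈ s := hs.2 (by simp)
  have hcard : (0 : ℝ) < s.card := by exact_mod_cast Finset.card_pos.2 ⟨0, hs0⟩
  have hev : ∀ᶠ i in l, ∀ k ∈ s, ∀ᵐ t ∂volume.restrict (Icc a b),
      ‖mode k (w i) t‖ ≤ δ / 2 / s.card := by
    rw [Filter.eventually_all_finset]
    intro k _
    exact eventually_mode_le hI hne hw1 (hwt.mono_exponent one_le_two) hW hconv hab k (by positivity)
  filter_upwards [hev] with i hi
  have hi' : ∀ᵐ t ∂volume.restrict (Icc a b), ∀ k ∈ s, ‖mode k (w i) t‖ ≤ δ / 2 / s.card := by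
    rw [Filter.eventually_all_finset]; exact hi
  have hm := ae_restrict_of_ae_restrict_of_subset hab
    ((hX i).mode_eq hI (hw1 i) (hwx.locInt one_le_two i))
  refine le_trans ?_ hδ
  refine eLpNorm_le_of_ae_bound (p := ⊤) (C := δ) ?_ |>.trans (by simp)
  have hsl := ae_restrict_of_ae_restrict_of_subset hab ((hw1 i).ae_integrable_slice hI)
  have key : ∀ᵐ t ∂volume.restrict (Icc a b), ∀ᵐ θ : Torus, ‖w i (t, θ)‖ ≤ δ := by
    filter_upwards [hi', hm, hsl, hD i, hwx.slice_aesm i hab] with t h2 h3 h4 h5 h6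
    filter_upwards [fourier_approx h4 ⟨h6, h5.trans_lt ENNReal.coe_lt_top⟩ h3] with θ h7
    have h8 := h7 s hs0
    have h9 : |(∑ k ∈ s, mode k (w i) t * fourier k θ).re| ≤ δ / 2 := by
      refine (Complex.abs_re_le_norm _).trans ((norm_sum_le _ _).trans ?_)
      calc ∑ k ∈ s, ‖mode k (w i) t * fourier k θ‖ ≤ ∑ k ∈ s, δ / 2 / s.card := by
            refine Finset.sum_le_sum fun k hk => ?_
            rw [norm_mul, fourier_apply, Circle.norm_coe, mul_one]
            exact h2 k hk
        _ = δ / 2 := by rw [Finset.sum_const, nsmul_eq_mul]; field_simp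
    have h10 : fourierTail s * (eLpNorm (fun θ => wx i (t, θ)) 2 volume).toReal ≤ δ / 2 :=
      (mul_le_mul_of_nonneg_left (ENNReal.toReal_le_coe_of_le_coe h5)
        (fourierTail_nonneg s)).trans hs.1
    have h11 := abs_sub_abs_le_abs_sub (w i (t, θ)) (∑ k ∈ s, mode k (w i) t * fourier k θ).re
    simp only [mode] at h9 h11
    rw [Real.norm_eq_abs]
    linarith
  have hmeas := ((hw.1 i).mono_measure (restrict_cyl_mono hab))
  rw [restrict_cyl] at hmeas ⊢
  obtain ⟨f', hf', hff'⟩ := hmeas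
  have h1 : ∀ᵐ z ∂((volume.restrict (Icc a b)).prod (volume : Measure Torus)), ‖f' z‖ ≤ δ := by
    rw [Measure.ae_prod_iff_ae_ae (measurableSet_le hf'.norm.measurable measurable_const)]
    filter_upwards [key, Measure.ae_ae_of_ae_prod hff'] with t h1 h2
    filter_upwards [h1, h2] with θ h3 h4
    rwa [← h4]
  filter_upwards [h1, hff'] with z h1 h2
  rwa [h2]

/-- If the Fourier coefficients of the derivative are bounded, which holds as soon as this derivative is
integrable, then the function is square integrable and its high modes are small. -/
lemma slice_sq_bound {f g : Torus → ℝ} (hf : Integrable f)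
    (h : ∀ k : ℤ, fourierCoeff (fun θ => (g θ : ℂ)) k
      = 2 * π * Complex.I * k * fourierCoeff (fun θ => (f θ : ℂ)) k) {C : ℝ}
    (hC : ∀ k : ℤ, ‖fourierCoeff (fun θ => (g θ : ℂ)) k‖ ≤ C) {s : Finset ℤ} (hs : 0 ∈ s) :
    MemLp f 2 ∧ ∫ θ, f θ ^ 2 ≤ (∑ k ∈ s, ‖fourierCoeff (fun θ => (f θ : ℂ)) k‖ ^ 2)
      + C ^ 2 * fourierTail s ^ 2 := by
  have hb : ∀ k : ℤ, k ≠ 0 → ‖fourierCoeff (fun θ => (f θ : ℂ)) k‖ ^ 2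
      ≤ C ^ 2 * (1 / (2 * π * (k : ℝ))) ^ 2 := by
    intro k hk
    rw [norm_eq_of_derivative_coeff hk (h k), mul_pow, sq_abs, mul_comm]
    gcongr
    exact hC k
  have hsum : Summable fun k : ℤ => ‖fourierCoeff (fun θ => (f θ : ℂ)) k‖ ^ 2 := by
    refine Summable.of_norm_bounded_eventually (summable_fourierTail.mul_left (C ^ 2)) ?_
    filter_upwards [(Set.finite_singleton (0 : ℤ)).compl_mem_cofinite] with k hk
    rw [Real.norm_of_nonneg (sq_nonneg _)]
    exact hb k hk
  have hmem := memLp_two_of_summable hf.ofReal hsum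
  have hre : MemLp f 2 := by simpa using hmem.re
  refine ⟨hre, ?_⟩
  have h1 := hasSum_sq_fourierCoeff_of_memLp hre.ofReal
  simp only [Complex.norm_real, Real.norm_eq_abs, sq_abs, RCLike.ofReal_eq_complex_ofReal] at h1
  rw [← h1.tsum_eq, ← hsum.sum_add_tsum_subtype_compl s]
  gcongr
  rw [fourierTail_sq, ← tsum_mul_left]
  exact (hsum.subtype _).tsum_le_tsum (fun k => hb k fun h0 => k.2 (h0 ▸ hs))
    ((summable_fourierTail.subtype fun k => k ∉ s).mul_left _)

include hI in
lemma ae_slice_sq_bound (hw : ∀ i, LocInt I (w i)) (hwx : UBdd I 1 wx)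
    (hX : ∀ i, WeakDX I (w i) (wx i)) {a b : ℝ} (hab : Icc a b ⊆ I) :
    ∃ C : ℝ≥0, ∀ i, ∀ᵐ t ∂volume.restrict (Icc a b), MemLp (fun θ => w i (t, θ)) 2 ∧
      ∀ s : Finset ℤ, 0 ∈ s →
      ∫ θ, w i (t, θ) ^ 2 ≤ (∑ k ∈ s, ‖mode k (w i) t‖ ^ 2) + (C : ℝ) ^ 2 * fourierTail s ^ 2 := by
  obtain ⟨C, hC⟩ := hwx.2 a b hab
  refine ⟨C, fun i => ?_⟩
  filter_upwards [hC i, hwx.slice_aesm i hab,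
    ae_restrict_of_ae_restrict_of_subset hab ((hX i).mode_eq hI (hw i) (hwx.locInt le_rfl i)),
    ae_restrict_of_ae_restrict_of_subset hab ((hw i).ae_integrable_slice hI)] with t h1 h2 h3 h4
  have h6 := fun (s : Finset ℤ) (hs : 0 ∈ s) =>
    slice_sq_bound h4 h3 (fun k => norm_mode_le h2 h1 k) hs
  exact ⟨(h6 {0} (by simp)).1, fun s hs => (h6 s hs).2⟩

include hI hne in
/-- Functions with bounded averages whose first derivatives are bounded in `L¹` are bounded
in `L²`. -/
lemma uBdd_two_of_average (hw : ∀ i, LocInt I (w i)) (hwt : UBdd I 1 wt) (hwx : UBdd I 1 wx)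
    (hW : ∀ i, WeakDir I 0 (w i) (wt i)) (hX : ∀ i, WeakDX I (w i) (wx i)) {p q A : ℝ}
    (hpq : p < q) (hsub : Icc p q ⊆ I) (hA : ∀ i, |∫ z in cyl (Icc p q), w i z| ≤ A) :
    UBdd I 2 w := by
  refine ⟨fun i => (hw i).1, fun a b hab => ?_⟩
  -- The bound is proved on an interval which also contains the interval of the averages.
  have hsub' : Icc (min a p) (max b q) ⊆ I ∨ ¬ a ≤ b := by
    by_cases h : a ≤ b
    · left
      apply hI.out
      · rcases min_choice a p with h' | h' <;> rw [h']
        exacts [hab ⟨le_rfl, h⟩, hsub ⟨le_rfl, hpq.le⟩]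
      · rcases max_choice b q with h' | h' <;> rw [h']
        exacts [hab ⟨h, le_rfl⟩, hsub ⟨hpq.le, le_rfl⟩]
    · exact Or.inr h
  rcases hsub' with hsub' | h
  swap
  · exact ⟨0, by simp [Set.Icc_eq_empty h]⟩
  obtain ⟨M, hM⟩ := exists_lipschitz_mode hI hne hw hwt hW hsub'
  obtain ⟨L, L', hL⟩ := hM 0
  obtain ⟨C, hC⟩ := ae_slice_sq_bound hI hw hwx hX hab
  have h1 : Icc p q ⊆ Icc (min a p) (max b q) :=
    Set.Icc_subset_Icc (min_le_right _ _) (le_max_right _ _)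
  have h2 : Icc a b ⊆ Icc (min a p) (max b q) :=
    Set.Icc_subset_Icc (min_le_left _ _) (le_max_left _ _)
  set B : ℝ := A / (q - p) + M * (max b q - min a p) with hB
  have hmode : ∀ i, ∀ᵐ t ∂volume.restrict (Icc a b), ‖mode 0 (w i) t‖ ≤ B := by
    intro i
    have h3 := (integral_mode hI (hw i) hsub 0).1
    simp only [neg_zero, fourier_zero, Complex.one_re, mul_one] at h3
    have h4 : |∫ t in Icc p q, L i t| ≤ A := by
      rw [← integral_congr_ae (ae_restrict_of_ae_restrict_of_subset h1 (hL i).1.2), h3]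
      exact hA i
    filter_upwards [ae_restrict_of_ae_restrict_of_subset h2 (hL i).1.2,
      ae_restrict_mem measurableSet_Icc,
      ae_restrict_of_ae_restrict_of_subset hab ((hw i).ae_integrable_slice hI)] with t h5 h6 h7
    have h8 := abs_le_of_average (hL i).1.1 hpq h1 h4 (h2 h6)
    have h9 : (mode 0 (w i) t).im = 0 := by rw [mode_im h7]; simp
    have h10 : mode 0 (w i) t = ((L i t : ℝ) : ℂ) := by
      apply Complex.ext
      · rw [h5]; simp
      · rw [h9]; simp
    rw [h10, Complex.norm_real]
    exact h8
  refine ⟨Real.toNNReal (Real.sqrt (B ^ 2 + (C : ℝ) ^ 2 * fourierTail {0} ^ 2)), fun i => ?_⟩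
  filter_upwards [hC i, hmode i] with t h3 h4
  rw [eLpNorm_two_le_iff h3.1, Real.coe_toNNReal _ (Real.sqrt_nonneg _),
    Real.sq_sqrt (by positivity)]
  refine (h3.2 {0} (by simp)).trans ?_
  rw [Finset.sum_singleton]
  gcongr

include hI hne in
/-- Weak convergence to zero, with first derivatives bounded in `L¹`, is strong in `L²`. By the bound on
the space derivatives, the modes of order `k` are `O(1 / k)`, hence high modes contribute little; low
modes converge uniformly in time. -/
lemma tendsto_eLpNorm_two {l : Filter ι} (hw : UBdd I 2 w) (hwt : UBdd I 1 wt) (hwx : UBdd I 1 wx)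
    (hW : ∀ i, WeakDir I 0 (w i) (wt i)) (hX : ∀ i, WeakDX I (w i) (wx i))
    (hconv : ∀ χ : Torus → ℝ, Continuous χ → ∀ p q, Icc p q ⊆ I →
      Tendsto (fun i => ∫ z in cyl (Icc p q), w i z * χ z.2) l (𝓝 0))
    {a b : ℝ} (hab : Icc a b ⊆ I) :
    Tendsto (fun i => eLpNorm (w i) 2 (volume.restrict (cyl (Icc a b)))) l (𝓝 0) := by
  have hw1 := fun i => hw.locInt one_le_two i
  obtain ⟨C, hC⟩ := ae_slice_sq_bound hI hw1 hwx hX hab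
  rw [ENNReal.tendsto_nhds_zero]
  intro ε hε
  obtain ⟨δ, hδ0, hδ⟩ : ∃ δ : ℝ≥0, 0 < δ ∧ (δ : ℝ≥0∞) ≤ ε := by
    obtain ⟨δ, h1, h2⟩ := ENNReal.lt_iff_exists_nnreal_btwn.1 hε
    exact ⟨δ, by exact_mod_cast h1, h2.le⟩
  set V : ℝ := volume.real (Icc a b) with hV
  have hV0 : 0 ≤ V := measureReal_nonneg
  -- `η` bounds the spatial square norms.
  set η : ℝ := (δ : ℝ) ^ 2 / (V + 1) with hη
  have hη0 : 0 < η := by positivity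
  have h1 : Tendsto (fun s => (C : ℝ) ^ 2 * fourierTail s ^ 2) atTop (𝓝 ((C : ℝ) ^ 2 * 0 ^ 2)) :=
    (tendsto_fourierTail.pow 2).const_mul _
  rw [zero_pow two_ne_zero, mul_zero] at h1
  obtain ⟨s, hs⟩ := ((h1.eventually_le_const (half_pos hη0)).and
    (eventually_ge_atTop ({0} : Finset ℤ))).exists
  have hs0 : (0 : ℤ) ∈ s := hs.2 (by simp)
  have hcard : (0 : ℝ) < s.card := by exact_mod_cast Finset.card_pos.2 ⟨0, hs0⟩
  have hev : ∀ᶠ i in l, ∀ k ∈ s, ∀ᵐ t ∂volume.restrict (Icc a b),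
      ‖mode k (w i) t‖ ≤ Real.sqrt (η / 2 / s.card) := by
    rw [Filter.eventually_all_finset]
    intro k _
    exact eventually_mode_le hI hne hw1 hwt hW hconv hab k (by positivity)
  filter_upwards [hev] with i hi
  have hi' : ∀ᵐ t ∂volume.restrict (Icc a b), ∀ k ∈ s,
      ‖mode k (w i) t‖ ≤ Real.sqrt (η / 2 / s.card) := by
    rw [Filter.eventually_all_finset]; exact hi
  refine le_trans ?_ hδ
  have hmem := hw.memLp_cyl two_ne_zero (by norm_num) hab i
  rw [eLpNorm_two_le_iff hmem, setIntegral_cyl (f := fun z => w i z ^ 2) hmem.integrable_sq]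
  calc ∫ t in Icc a b, ∫ θ, w i (t, θ) ^ 2 ≤ ∫ t in Icc a b, η := by
        refine integral_mono_of_nonneg (ae_of_all _ fun t => integral_nonneg fun θ => sq_nonneg _)
          (integrable_const _) ?_
        filter_upwards [hC i, hi'] with t h2 h3
        refine (h2.2 s hs0).trans ?_
        have h4 : ∑ k ∈ s, ‖mode k (w i) t‖ ^ 2 ≤ η / 2 := by
          calc ∑ k ∈ s, ‖mode k (w i) t‖ ^ 2 ≤ ∑ k ∈ s, η / 2 / s.card := by
                refine Finset.sum_le_sum fun k hk => ?_
                rw [← Real.sq_sqrt (show 0 ≤ η / 2 / s.card by positivity)]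
                exact pow_le_pow_left₀ (norm_nonneg _) (h3 k hk) 2
            _ = η / 2 := by rw [Finset.sum_const, nsmul_eq_mul]; field_simp
        linarith [hs.1]
    _ = V * η := by rw [setIntegral_const, smul_eq_mul]
    _ ≤ (δ : ℝ) ^ 2 := by
        rw [hη, ← mul_div_assoc, div_le_iff₀ (by positivity)]
        nlinarith [sq_nonneg (δ : ℝ)]

end Modes

/-! ### Families of signed measures -/

instance isFiniteMeasure_variation_signedMeasure {X : Type*} [MeasurableSpace X]
    (m : SignedMeasure X) : IsFiniteMeasure m.variation := by
  rw [← SignedMeasure.totalVariation_eq_variation]; infer_instance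

lemma integrable_signedMeasure {X : Type*} [TopologicalSpace X] [CompactSpace X] [MeasurableSpace X]
    [BorelSpace X] (m : SignedMeasure X) {g : X → ℝ} (hg : Continuous g) : m.Integrable g := by
  change Integrable g m.variation
  exact hg.integrable_of_hasCompactSupport (HasCompactSupport.of_compactSpace g)

lemma abs_integral_signedMeasure_le {m : SignedMeasure Torus} {g : Torus → ℝ} {K : ℝ} {C : ℝ≥0}
    (hg : ∀ θ, |g θ| ≤ K) (hm : m.variation univ ≤ C) : |∫ᵛ θ, g θ ∂<•m| ≤ K * C := by
  have hK : 0 ≤ K := (abs_nonneg _).trans (hg 0)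
  have h1 := VectorMeasure.norm_integral_le_of_norm_le_const (μ := m) (f := g) (C := K)
    (B := (ContinuousLinearMap.lsmul ℝ ℝ).flip) (ae_of_all _ hg)
  have h2 : ‖(ContinuousLinearMap.lsmul ℝ ℝ : ℝ →L[ℝ] ℝ →L[ℝ] ℝ).flip‖ ≤ 1 := by
    rw [ContinuousLinearMap.opNorm_flip]
    exact ContinuousLinearMap.opNorm_lsmul_le
  have h3 : m.variation.real univ ≤ C := ENNReal.toReal_le_coe_of_le_coe hm
  refine h1.trans ?_
  calc K * _ * m.variation.real univ ≤ K * 1 * C := by gcongr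
    _ = K * C := by ring

lemma integral_withDensityV {f : Torus → ℝ} (hf : Integrable f) {g : Torus → ℝ}
    (hg : Continuous g) : ∫ᵛ θ, g θ ∂<•((volume : Measure Torus).withDensityᵥ f) = ∫ θ, f θ * g θ := by
  have f1 := isFiniteMeasure_withDensity_ofReal hf.2
  have f2 := isFiniteMeasure_withDensity_ofReal hf.neg.2
  have hi : Integrable (fun θ => f θ * g θ) := hf.mul_bdd (c := ‖(⟨g, hg⟩ : C(Torus, ℝ))‖)
    hg.aestronglyMeasurable (ae_of_all _ fun θ => (⟨g, hg⟩ : C(Torus, ℝ)).norm_coe_le_norm θ)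
  have e : ∀ u : Torus → ℝ, Integrable u →
      ∫ θ, g θ ∂((volume : Measure Torus).withDensity fun x => ENNReal.ofReal (u x))
        = ∫ θ, max (u θ) 0 * g θ := by
    intro u hu
    rw [integral_withDensity_eq_integral_toReal_smul₀ hu.1.aemeasurable.ennreal_ofReal
      (ae_of_all _ fun _ => ENNReal.ofReal_lt_top)]
    simp [ENNReal.toReal_ofReal']
  have hp : ∀ u : Torus → ℝ, Integrable u → Integrable fun θ => max (u θ) 0 * g θ := fun u hu =>
    (hu.sup (integrable_zero _ _ _)).mul_bdd (c := ‖(⟨g, hg⟩ : C(Torus, ℝ))‖)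
    hg.aestronglyMeasurable (ae_of_all _ fun θ => (⟨g, hg⟩ : C(Torus, ℝ)).norm_coe_le_norm θ)
  rw [withDensityᵥ_eq_withDensity_pos_part_sub_withDensity_neg_part hf,
    VectorMeasure.integral_sub_vectorMeasure (integrable_signedMeasure _ hg)
      (integrable_signedMeasure _ hg), VectorMeasure.integral_toSignedMeasure,
    VectorMeasure.integral_toSignedMeasure, e f hf, e (fun θ => -f θ) hf.neg,
    ← integral_sub (hp f hf) (hp (fun θ => -f θ) hf.neg)]
  congr 1; ext θ
  rw [← sub_mul]
  congr 1
  rcases le_total (f θ) 0 with h | h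
  · rw [max_eq_right h, max_eq_left (by linarith)]; ring
  · rw [max_eq_left h, max_eq_right (by linarith)]; ring

namespace LocBddMeasure

variable {m m' : ℝ → SignedMeasure Torus}

/-- Measurability of the integral of a function of space-time: the function is approximated by
functions which are piecewise constant in time. -/
lemma aemeasurable_integral (h : LocBddMeasure I m) {ψ : ℝ × Torus → ℝ} (hψ : Continuous ψ) :
    AEMeasurable (fun t => ∫ᵛ θ, ψ (t, θ) ∂<•(m t)) (volume.restrict I) := by
  set F : ℕ → ℝ → ℝ := fun N t => ∫ᵛ θ, ψ ((⌊t * (N + 1)⌋ : ℝ) / (N + 1), θ) ∂<•(m t) with hF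
  have hFm : ∀ N, AEMeasurable (F N) (volume.restrict I) := by
    intro N
    have hg : ∀ j : ℤ, AEMeasurable (fun t => ∫ᵛ θ, ψ ((j : ℝ) / (N + 1), θ) ∂<•(m t))
        (volume.restrict I) := fun j =>
      h.1 ⟨fun θ => ψ ((j : ℝ) / (N + 1), θ), hψ.comp (by fun_prop)⟩
    choose G hG hG' using hg
    refine ⟨fun t => G ⌊t * (N + 1)⌋ t, ?_, ?_⟩
    · have h1 : Measurable (fun p : ℤ × ℝ => G p.1 p.2) :=
        measurable_from_prod_countable_right fun j => hG j
      exact h1.comp ((Int.measurable_floor.comp (measurable_id.mul_const _)).prodMk measurable_id)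
    · filter_upwards [ae_all_iff.2 hG'] with t ht
      exact ht _
  refine aemeasurable_of_tendsto_metrizable_ae atTop hFm (ae_of_all _ fun t => ?_)
  have hfl : Tendsto (fun N : ℕ => (⌊t * ((N : ℝ) + 1)⌋ : ℝ) / ((N : ℝ) + 1)) atTop (𝓝 t) := by
    rw [tendsto_iff_norm_sub_tendsto_zero]
    refine squeeze_zero (fun _ => norm_nonneg _) (fun N => ?_)
      (tendsto_one_div_add_atTop_nhds_zero_nat (𝕜 := ℝ))
    have hN : (0 : ℝ) < N + 1 := by positivity
    have h1 := Int.floor_le (t * ((N : ℝ) + 1))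
    have h2 := Int.lt_floor_add_one (t * ((N : ℝ) + 1))
    rw [Real.norm_eq_abs, div_sub' hN.ne', abs_div, abs_of_pos hN]
    gcongr
    rw [abs_le]
    constructor <;> linarith
  -- The approximations stay in a compact set of times, on which `ψ` is bounded.
  obtain ⟨K, hK⟩ := (isCompact_cyl_Icc (t - 1) (t + 1)).exists_bound_of_continuousOn hψ.continuousOn
  refine VectorMeasure.tendsto_integral_filter_of_norm_le_const ?_ ⟨K, ?_⟩ ?_
  · exact Eventually.of_forall fun N =>
      (hψ.comp (by fun_prop : Continuous fun θ : Torus => (_, θ))).aestronglyMeasurable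
  · filter_upwards [hfl (Icc_mem_nhds (sub_one_lt t) (lt_add_one t))] with N hN
    exact ae_of_all _ fun θ => hK (_, θ) ⟨hN, trivial⟩
  · exact ae_of_all _ fun θ => (hψ.tendsto (t, θ)).comp (hfl.prodMk_nhds tendsto_const_nhds)

lemma integrableOn (h : LocBddMeasure I m) {ψ : ℝ × Torus → ℝ} (hψ : Continuous ψ) {a b : ℝ}
    (hab : Icc a b ⊆ I) :
    IntegrableOn (fun t => ∫ᵛ θ, ψ (t, θ) ∂<•(m t)) (Icc a b) := by
  obtain ⟨C, hC⟩ := h.2 a b hab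
  obtain ⟨K, hK⟩ := (isCompact_cyl_Icc a b).exists_bound_of_continuousOn hψ.continuousOn
  refine Integrable.of_bound
    ((h.aemeasurable_integral hψ).mono_measure (Measure.restrict_mono hab le_rfl)).aestronglyMeasurable
    (K * C) ?_
  filter_upwards [hC, ae_restrict_mem measurableSet_Icc] with t h1 h2
  exact abs_integral_signedMeasure_le (fun θ => hK (t, θ) ⟨h2, trivial⟩) h1

lemma add (h : LocBddMeasure I m) (h' : LocBddMeasure I m') :
    LocBddMeasure I (fun t => m t + m' t) := by
  refine ⟨fun g => ?_, fun a b hab => ?_⟩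
  · have e : ∀ t, ∫ᵛ θ, g θ ∂<•(m t + m' t) = (∫ᵛ θ, g θ ∂<•(m t)) + ∫ᵛ θ, g θ ∂<•(m' t) :=
      fun t => VectorMeasure.integral_add_vectorMeasure (integrable_signedMeasure _ g.continuous)
        (integrable_signedMeasure _ g.continuous)
    simp only [e]
    exact (h.1 g).add (h'.1 g)
  · obtain ⟨C, hC⟩ := h.2 a b hab
    obtain ⟨D, hD⟩ := h'.2 a b hab
    refine ⟨C + D, ?_⟩
    filter_upwards [hC, hD] with t h1 h2
    push_cast
    exact (VectorMeasure.variation_add_le _).trans (add_le_add h1 h2)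

lemma const_smul (c : ℝ) (h : LocBddMeasure I m) : LocBddMeasure I (fun t => c • m t) := by
  refine ⟨fun g => ?_, fun a b hab => ?_⟩
  · simp only [VectorMeasure.integral_smul_vectorMeasure]
    exact (h.1 g).const_smul c
  · obtain ⟨C, hC⟩ := h.2 a b hab
    refine ⟨‖c‖₊ * C, ?_⟩
    filter_upwards [hC] with t h1
    rw [VectorMeasure.variation_smul]
    push_cast
    exact mul_le_mul_right h1 _

end LocBddMeasure

lemma pairing_congr_support {I J : Set ℝ} (hI : MeasurableSet I) (h : J ⊆ I)
    {m : ℝ → SignedMeasure Torus} {ψ : ℝ × Torus → ℝ} (hψ : ∀ t ∉ J, ∀ θ, ψ (t, θ) = 0) :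
    pairing I m ψ = pairing J m ψ := by
  refine setIntegral_eq_of_subset_of_forall_sdiff_eq_zero hI h fun t ht => ?_
  simp [hψ t ht.2]

lemma pairing_add_measure {m m' : ℝ → SignedMeasure Torus} (h : LocBddMeasure I m)
    (h' : LocBddMeasure I m') {a b : ℝ} (hab : Icc a b ⊆ I) {ψ : ℝ × Torus → ℝ}
    (hψ : Continuous ψ) : pairing (Icc a b) (fun t => m t + m' t) ψ
      = pairing (Icc a b) m ψ + pairing (Icc a b) m' ψ := by
  rw [pairing, pairing, pairing, ← integral_add (h.integrableOn hψ hab) (h'.integrableOn hψ hab)]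
  congr 1; ext t
  have hc : Continuous fun θ => ψ (t, θ) := hψ.comp (by fun_prop)
  exact VectorMeasure.integral_add_vectorMeasure (integrable_signedMeasure _ hc)
    (integrable_signedMeasure _ hc)

lemma pairing_const_smul {J : Set ℝ} {m : ℝ → SignedMeasure Torus} (c : ℝ) (ψ : ℝ × Torus → ℝ) :
    pairing J (fun t => c • m t) ψ = c * pairing J m ψ := by
  simp only [pairing, VectorMeasure.integral_smul_vectorMeasure, smul_eq_mul]
  exact integral_const_mul _ _

/-- The family of measures `f(t, θ) dθ`. -/
noncomputable def dens (f : ℝ × Torus → ℝ) (t : ℝ) : SignedMeasure Torus :=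
  volume.withDensityᵥ fun θ => f (t, θ)

lemma LocBddLp.dens (hI : I.OrdConnected) {f : ℝ × Torus → ℝ} (hf : LocBddLp I 1 f) :
    LocBddMeasure I (dens f) := by
  have hsl := (hf.locInt le_rfl).ae_integrable_slice hI
  refine ⟨fun g => ?_, fun a b hab => ?_⟩
  · have h1 : AEStronglyMeasurable (fun z : ℝ × Torus => f z * g z.2)
        ((volume.restrict I).prod volume) := by
      rw [← restrict_cyl]
      exact hf.1.mul (g.continuous.comp continuous_snd).aestronglyMeasurable
    refine (h1.integral_prod_right').aemeasurable.congr ?_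
    filter_upwards [hsl] with t ht
    exact (integral_withDensityV ht g.continuous).symm
  · obtain ⟨C, hC⟩ := hf.2 a b hab
    refine ⟨C, ?_⟩
    filter_upwards [hC, ae_restrict_of_ae_restrict_of_subset hab hsl] with t h1 h2
    rw [Gowdy.dens, Measure.variation_withDensityᵥ h2, withDensity_apply _ MeasurableSet.univ,
      Measure.restrict_univ, ← eLpNorm_one_eq_lintegral_enorm]
    exact h1

lemma pairing_dens (hI : I.OrdConnected) {f : ℝ × Torus → ℝ} (hf : LocInt I f)
    {a b : ℝ} (hab : Icc a b ⊆ I) {ψ : ℝ × Torus → ℝ} (hψ : Continuous ψ) :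
    pairing (Icc a b) (dens f) ψ = ∫ z in cyl (Icc a b), f z * ψ z := by
  rw [setIntegral_cyl (f := fun z => f z * ψ z)
    ((hf.2 a b hab).mul_continuousOn hψ.continuousOn (isCompact_cyl_Icc a b)), pairing]
  apply integral_congr_ae
  filter_upwards [ae_restrict_of_ae_restrict_of_subset hab (hf.ae_integrable_slice hI)] with t ht
  exact integral_withDensityV ht (hψ.comp (by fun_prop))

/-! ### Test functions determine weak-star limits -/

/-- Smooth functions are uniformly dense in the continuous functions on `[a, b] × T¹`
(Stone–Weierstrass). -/
lemma exists_smoothFn_near {ψ : ℝ × Torus → ℝ} (hψ : Continuous ψ) (a b : ℝ) {ε : ℝ} (hε : 0 < ε) :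
    ∃ χ, SmoothFn χ ∧ ∀ z ∈ cyl (Icc a b), |χ z - ψ z| ≤ ε := by
  have : CompactSpace (cyl (Icc a b)) := isCompact_iff_compactSpace.1 (isCompact_cyl_Icc a b)
  let A : Subalgebra ℝ C(cyl (Icc a b), ℝ) :=
    { carrier := {g | ∃ χ, SmoothFn χ ∧ ∀ z : cyl (Icc a b), g z = χ z}
      mul_mem' := by
        rintro g h ⟨χ, hχ, e⟩ ⟨χ', hχ', e'⟩
        exact ⟨_, hχ.mul hχ', fun z => by simp [e, e']⟩
      add_mem' := by
        rintro g h ⟨χ, hχ, e⟩ ⟨χ', hχ', e'⟩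
        exact ⟨_, hχ.add hχ', fun z => by simp [e, e']⟩
      algebraMap_mem' := fun r =>
        ⟨_, SmoothFn.of_time (ρ := fun _ => r) contDiff_const, fun z => by simp⟩ }
  have hmem : ∀ χ (hχ : SmoothFn χ),
      (⟨fun z : cyl (Icc a b) => χ z, hχ.continuous.comp continuous_subtype_val⟩ :
        C(cyl (Icc a b), ℝ)) ∈ A := fun χ hχ => ⟨χ, hχ, fun z => rfl⟩
  have hsep : A.SeparatesPoints := by
    intro z w hzw
    by_contra hcon
    have hall : ∀ χ, SmoothFn χ → χ z = χ w := by
      intro χ hχ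
      by_contra hne
      exact hcon ⟨_, ⟨_, hmem χ hχ, rfl⟩, hne⟩
    apply hzw
    have h1 := hall _ (SmoothFn.of_time (ρ := fun t => t) contDiff_id)
    have h2 := hall _ (SmoothFn.of_space (χ := fun θ => (fourier 1 θ).re) (contDiff_fourier_re 1))
    have h3 := hall _ (SmoothFn.of_space (χ := fun θ => (fourier 1 θ).im) (contDiff_fourier_im 1))
    have h4 : (fourier 1 (z : ℝ × Torus).2 : ℂ) = fourier 1 (w : ℝ × Torus).2 :=
      Complex.ext h2 h3
    rw [fourier_one, fourier_one] at h4
    exact Subtype.ext (Prod.ext h1 (AddCircle.injective_toCircle one_ne_zero (Circle.ext h4)))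
  obtain ⟨⟨g, χ, hχ, e⟩, hg⟩ :=
    ContinuousMap.exists_mem_subalgebra_near_continuous_of_separatesPoints A hsep
      (fun z : cyl (Icc a b) => ψ z) (hψ.comp continuous_subtype_val) ε hε
  refine ⟨χ, hχ, fun z hz => ?_⟩
  have := (hg ⟨z, hz⟩).le
  rwa [Real.norm_eq_abs, show ((⟨g, _⟩ : A) : cyl (Icc a b) → ℝ) ⟨z, hz⟩ = χ z from
    e ⟨z, hz⟩] at this

lemma abs_pairing_le {m : ℝ → SignedMeasure Torus} {a b : ℝ}
    {C : ℝ≥0} (hC : ∀ᵐ t ∂volume.restrict (Icc a b), (m t).variation univ ≤ C)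
    {ψ : ℝ × Torus → ℝ} {k : ℝ → ℝ} (hk : Continuous k)
    (h : ∀ t ∈ Icc a b, ∀ θ, |ψ (t, θ)| ≤ k t) :
    |pairing (Icc a b) m ψ| ≤ C * ∫ t in Icc a b, k t := by
  rw [← integral_const_mul]
  refine norm_integral_le_of_norm_le (f := fun t => ∫ᵛ θ, ψ (t, θ) ∂<•(m t))
    ((hk.const_mul _).integrableOn_Icc) ?_
  filter_upwards [hC, ae_restrict_mem measurableSet_Icc] with t h1 h2
  rw [mul_comm]
  exact abs_integral_signedMeasure_le (h t h2) h1

lemma pairing_sub {m : ℝ → SignedMeasure Torus} (h : LocBddMeasure I m) {a b : ℝ}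
    (hab : Icc a b ⊆ I) {ψ χ : ℝ × Torus → ℝ} (hψ : Continuous ψ) (hχ : Continuous χ) :
    pairing (Icc a b) m (fun z => ψ z - χ z)
      = pairing (Icc a b) m ψ - pairing (Icc a b) m χ := by
  rw [pairing, pairing, pairing, ← integral_sub (h.integrableOn hψ hab) (h.integrableOn hχ hab)]
  congr 1; ext t
  exact VectorMeasure.integral_fun_sub (integrable_signedMeasure _ (hψ.comp (by fun_prop)))
    (integrable_signedMeasure _ (hχ.comp (by fun_prop)))

/-- Convergence against test functions of a sequence bounded in `L^∞_loc(I, L¹)` extends to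
convergence against continuous functions on each `[a, b] × T¹`: by uniform density of smooth
functions, and because a time layer of width `δ` near `a` and `b` contributes at most `O(δ)`. -/
lemma weakStarMeasure_of_test (hI : I.OrdConnected) {f : ℕ → ℝ × Torus → ℝ}
    (hf : UBdd I 1 f) {m : ℝ → SignedMeasure Torus} (hm : LocBddMeasure I m)
    (h : ∀ ψ, IsTestFunction I ψ →
      Tendsto (fun n => ∫ z in cyl I, f n z * ψ z) atTop (𝓝 (pairing I m ψ)))
    {a b : ℝ} (hab : Icc a b ⊆ I) : WeakStarMeasure (Icc a b) f m := by
  obtain ⟨C₁, hC₁⟩ := hf.2 a b hab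
  obtain ⟨C₂, hC₂⟩ := hm.2 a b hab
  have hC₁' : ∀ n, ∀ᵐ t ∂volume.restrict (Icc a b),
      (dens (f n) t).variation univ ≤ C₁ := by
    intro n
    filter_upwards [hC₁ n, ae_restrict_of_ae_restrict_of_subset hab
      ((hf.locInt le_rfl n).ae_integrable_slice hI)] with t h1 h2
    rw [Gowdy.dens, Measure.variation_withDensityᵥ h2, withDensity_apply _ MeasurableSet.univ,
      Measure.restrict_univ, ← eLpNorm_one_eq_lintegral_enorm]
    exact h1
  set D : ℕ → (ℝ × Torus → ℝ) → ℝ := fun n ψ =>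
    (∫ z in cyl (Icc a b), f n z * ψ z) - pairing (Icc a b) m ψ with hD
  have hDle : ∀ n ψ (_ : Continuous ψ) (k : ℝ → ℝ) (_ : Continuous k)
      (_ : ∀ t ∈ Icc a b, ∀ θ, |ψ (t, θ)| ≤ k t),
      |D n ψ| ≤ (C₁ + C₂) * ∫ t in Icc a b, k t := by
    intro n ψ hψ k hk hle
    rw [hD]
    dsimp only
    rw [← pairing_dens hI (hf.locInt le_rfl n) hab hψ, add_mul]
    exact (abs_sub _ _).trans (add_le_add (abs_pairing_le (hC₁' n) hk hle)
      (abs_pairing_le hC₂ hk hle))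
  have hDsub : ∀ n ψ χ (_ : Continuous ψ) (_ : Continuous χ), D n ψ = D n χ + D n (fun z => ψ z - χ z) := by
    intro n ψ χ hψ hχ
    simp only [hD]
    rw [pairing_sub hm hab hψ hχ, ← pairing_dens hI (hf.locInt le_rfl n) hab hψ,
      ← pairing_dens hI (hf.locInt le_rfl n) hab hχ,
      ← pairing_dens hI (hf.locInt le_rfl n) hab (ψ := fun z => ψ z - χ z) (hψ.sub hχ),
      pairing_sub ((hf.single n).dens hI) hab hψ hχ]
    ring
  have hbound : ∀ ψ : ℝ × Torus → ℝ, Continuous ψ →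
      (∀ ε > 0, ∃ χ, Continuous χ ∧ Tendsto (fun n => D n χ) atTop (𝓝 0) ∧ ∃ k, Continuous k ∧
        (∀ t ∈ Icc a b, ∀ θ, |ψ (t, θ) - χ (t, θ)| ≤ k t) ∧ ∫ t in Icc a b, k t ≤ ε) →
      Tendsto (fun n => D n ψ) atTop (𝓝 0) := by
    intro ψ hψ H
    rw [Metric.tendsto_atTop]
    intro ε hε
    obtain ⟨χ, hχ, hχ0, k, hk, hle, hkε⟩ := H (ε / (2 * (C₁ + C₂ + 1))) (by positivity)
    obtain ⟨N, hN⟩ := Metric.tendsto_atTop.1 hχ0 (ε / 2) (by positivity)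
    refine ⟨N, fun n hn => ?_⟩
    have h1 := hN n hn
    rw [Real.dist_eq, sub_zero] at h1 ⊢
    rw [hDsub n ψ χ hψ hχ]
    have h2 := hDle n (fun z => ψ z - χ z) (hψ.sub hχ) k hk hle
    have h3 : ((C₁ : ℝ) + C₂) * ∫ t in Icc a b, k t ≤ ε / 2 := by
      calc ((C₁ : ℝ) + C₂) * ∫ t in Icc a b, k t
          ≤ (C₁ + C₂) * (ε / (2 * (C₁ + C₂ + 1))) := by gcongr
        _ ≤ (C₁ + C₂ + 1) * (ε / (2 * (C₁ + C₂ + 1))) :=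
            mul_le_mul_of_nonneg_right (by linarith) (by positivity)
        _ = ε / 2 := by field_simp
    calc _ ≤ |D n χ| + |D n fun z => ψ z - χ z| := abs_add_le _ _
      _ < ε := by linarith
  -- First, smooth functions: cut off in time.
  have hsmooth : ∀ χ, SmoothFn χ → Tendsto (fun n => D n χ) atTop (𝓝 0) := by
    intro χ hχ
    obtain ⟨K, hK⟩ := (isCompact_cyl_Icc a b).exists_bound_of_continuousOn hχ.continuous.continuousOn
    refine hbound χ hχ.continuous fun ε hε => ?_
    set δ : ℝ := ε / (2 * (|K| + 1)) with hδ
    have hδ0 : 0 < δ := by positivity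
    have hsub : Icc (a + δ) (b - δ) ⊆ interior (Icc a b) := by
      rw [interior_Icc]
      exact fun t ht => ⟨by linarith [ht.1], by linarith [ht.2]⟩
    obtain ⟨ρ, ⟨hρ, p, q, hpq, hsupp⟩, hρ1, hρI⟩ := exists_timeCutoff Set.ordConnected_Icc hsub
    have hpq' : Icc p q ⊆ Icc a b := hpq.trans interior_subset
    have hρt : IsTestFunction I (fun z => ρ z.1 * χ z) :=
      IsTestFunction.mul_smooth (ψ := fun z => ρ z.1)
        (IsTimeTest.isTestFunction ⟨hρ, p, q, hpq.trans (interior_mono hab), hsupp⟩) hχ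
    have hs : ∀ t ∉ Icc a b, ∀ θ, (ρ t * χ (t, θ)) = 0 := fun t ht θ => by
      rw [hsupp t fun h => ht (hpq' h), zero_mul]
    refine ⟨_, hρt.smoothFn.continuous, ?_, fun t => |K| * (1 - ρ t), ?_, ?_, ?_⟩
    · have h1 := (h _ hρt).sub_const (pairing I m fun z => ρ z.1 * χ z)
      rw [sub_self] at h1
      refine h1.congr fun n => ?_
      rw [hD]
      dsimp only
      rw [setIntegral_cyl_eq_of_support hI.measurableSet hab fun t ht θ => by
        change f n (t, θ) * (ρ t * χ (t, θ)) = 0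
        rw [hs t ht θ, mul_zero], pairing_congr_support hI.measurableSet hab hs]
    · exact continuous_const.mul (continuous_const.sub hρ.continuous)
    · intro t ht θ
      have e : χ (t, θ) - ρ t * χ (t, θ) = χ (t, θ) * (1 - ρ t) := by ring
      change |χ (t, θ) - ρ t * χ (t, θ)| ≤ _
      rw [e, abs_mul, abs_of_nonneg (sub_nonneg.2 (hρI t).2)]
      exact mul_le_mul_of_nonneg_right ((hK (t, θ) ⟨ht, trivial⟩).trans (le_abs_self K))
        (sub_nonneg.2 (hρI t).2)
    · rw [integral_const_mul]
      have h2 : ∫ t in Icc a b, (1 - ρ t) ≤ 2 * δ := by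
        have hsub2 : Icc a b \ Icc (a + δ) (b - δ) ⊆ Icc a (a + δ) ∪ Icc (b - δ) b := by
          rintro t ⟨⟨h1, h2⟩, h3⟩
          by_cases h4 : t ≤ a + δ
          · exact Or.inl ⟨h1, h4⟩
          · exact Or.inr ⟨by_contra fun h5 => h3 ⟨(not_le.1 h4).le, (not_le.1 h5).le⟩, h2⟩
        have h3 : ∫ t in Icc a b, (1 - ρ t)
            = ∫ t in Icc a b \ Icc (a + δ) (b - δ), (1 - ρ t) := by
          refine setIntegral_eq_of_subset_of_forall_sdiff_eq_zero measurableSet_Icc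
            Set.sdiff_subset fun t ht => ?_
          have ht' : t ∈ Icc (a + δ) (b - δ) := by
            by_contra h4; exact ht.2 ⟨ht.1, h4⟩
          rw [(hρ1 t ht').eq_of_nhds, sub_self]
        have hv : volume (Icc a (a + δ) ∪ Icc (b - δ) b) ≤ ENNReal.ofReal (2 * δ) := by
          refine (measure_union_le _ _).trans ?_
          rw [Real.volume_Icc, Real.volume_Icc, ← ENNReal.ofReal_add (by linarith) (by linarith)]
          exact ENNReal.ofReal_le_ofReal (by linarith)
        have hv' := (measure_mono hsub2).trans hv
        have h4 := norm_setIntegral_le_of_norm_le_const (μ := volume) (f := fun t => 1 - ρ t) (C := 1)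
          (s := Icc a b \ Icc (a + δ) (b - δ)) (hv'.trans_lt ENNReal.ofReal_lt_top)
          fun t _ => by
            rw [Real.norm_eq_abs, abs_le]
            constructor <;> linarith [(hρI t).1, (hρI t).2]
        rw [h3]
        refine (le_abs_self _).trans (h4.trans ?_)
        rw [one_mul]
        exact ENNReal.toReal_le_of_le_ofReal (by linarith) hv'
      calc |K| * ∫ t in Icc a b, (1 - ρ t) ≤ |K| * (2 * δ) := by gcongr
        _ ≤ (|K| + 1) * (2 * δ) := by gcongr; linarith
        _ = ε := by rw [hδ]; field_simp
  intro ψ hψ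
  have hfin : Tendsto (fun n => D n ψ) atTop (𝓝 0) := by
    refine hbound ψ hψ fun ε hε => ?_
    obtain ⟨χ, hχ, hle⟩ := exists_smoothFn_near hψ a b
      (ε := ε / (|b - a| + 1)) (by positivity)
    refine ⟨χ, hχ.continuous, hsmooth χ hχ, fun _ => ε / (|b - a| + 1), continuous_const,
      fun t ht θ => ?_, ?_⟩
    · rw [abs_sub_comm]
      exact hle (t, θ) ⟨ht, trivial⟩
    · rw [setIntegral_const, smul_eq_mul, Real.volume_real_Icc]
      calc max (b - a) 0 * (ε / (|b - a| + 1)) ≤ (|b - a| + 1) * (ε / (|b - a| + 1)) := by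
            gcongr
            exact max_le (by linarith [le_abs_self (b - a)]) (by positivity)
        _ = ε := by field_simp
  have := hfin.add_const (pairing (Icc a b) m ψ)
  simpa [hD] using this

/-! ### Weak and uniform limits -/

lemma uBdd_of_eventually {p : ℝ≥0∞} {f : ℕ → ℝ × Torus → ℝ}
    (h : ∀ n, LocBddLp I p (f n)) (h' : ∀ a b, Icc a b ⊆ I → ∃ C : ℝ≥0, ∀ᶠ n in atTop,
      ∀ᵐ t ∂volume.restrict (Icc a b), eLpNorm (fun θ : Torus => f n (t, θ)) p volume ≤ C) :
    UBdd I p f := by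
  refine ⟨fun n => (h n).1, fun a b hab => ?_⟩
  obtain ⟨C, hC⟩ := h' a b hab
  obtain ⟨N, hN⟩ := eventually_atTop.1 hC
  choose D hD using fun n => (h n).2 a b hab
  refine ⟨C + ∑ n ∈ Finset.range N, D n, fun n => ?_⟩
  rcases lt_or_ge n N with hn | hn
  · filter_upwards [hD n] with t ht
    refine ht.trans (ENNReal.coe_le_coe.2 (le_add_of_nonneg_of_le zero_le ?_))
    exact Finset.single_le_sum (fun _ _ => zero_le) (Finset.mem_range.2 hn)
  · filter_upwards [hN n hn] with t ht
    exact ht.trans (ENNReal.coe_le_coe.2 le_self_add)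

lemma EnergyBound.uH1 {P Q : ℕ → H1Field I} (h : EnergyBound P Q) : UH1 P ∧ UH1 Q := by
  have key : ∀ f : ℕ → ℝ × Torus → ℝ, (∀ n, LocBddLp I 2 (f n)) →
      (∀ n, f n ∈ [(P n).val, (Q n).val, (P n).dt, (Q n).dt, (P n).dx, (Q n).dx]) →
      UBdd I 2 f := by
    intro f hf hmem
    refine uBdd_of_eventually hf fun a b hab => ?_
    obtain ⟨C, hC⟩ := h a b hab
    exact ⟨C, hC.mono fun n hn => hn _ (hmem n)⟩
  exact ⟨⟨key _ (fun n => (P n).val_bdd) (by simp), key _ (fun n => (P n).dt_bdd) (by simp),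
    key _ (fun n => (P n).dx_bdd) (by simp)⟩, ⟨key _ (fun n => (Q n).val_bdd) (by simp),
    key _ (fun n => (Q n).dt_bdd) (by simp), key _ (fun n => (Q n).dx_bdd) (by simp)⟩⟩

/-- Local uniform convergence in time, up to null sets. -/
def UConv (I : Set ℝ) (f : ℕ → ℝ × Torus → ℝ) (g : ℝ × Torus → ℝ) : Prop :=
  ∀ a b, Icc a b ⊆ I → ∀ ε > 0, ∀ᶠ n in atTop,
    ∀ᵐ z ∂volume.restrict (cyl (Icc a b)), |f n z - g z| ≤ ε

section UConv

variable {f g : ℕ → ℝ × Torus → ℝ} {f' g' : ℝ × Torus → ℝ}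

lemma UConv.of_strongLp (h : ∀ a b, Icc a b ⊆ I → StrongLp (Icc a b) ⊤ f f') :
    UConv I f f' := by
  intro a b hab ε hε
  filter_upwards [(h a b hab).eventually_le_const (ENNReal.ofReal_pos.2 hε)] with n hn
  have h1 := ae_le_eLpNormEssSup (f := fun z => f n z - f' z)
    (μ := volume.restrict (cyl (Icc a b)))
  rw [eLpNorm_exponent_top] at hn
  filter_upwards [h1] with z hz
  have h2 := hz.trans hn
  rw [← ofReal_norm, ENNReal.ofReal_le_ofReal_iff hε.le] at h2
  exact h2

lemma UConv.mul (hf : UConv I f f') (hg : UConv I g g') (hfb : UBdd I ⊤ f)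
    (hgb : LocBddLp I ⊤ g') : UConv I (fun n z => f n z * g n z) (fun z => f' z * g' z) := by
  intro a b hab ε hε
  obtain ⟨C, hC⟩ := hfb.ae_norm_le_cyl hab
  obtain ⟨D, hD⟩ := (locBddLp_iff.1 hgb).ae_norm_le_cyl hab
  have hε' : 0 < ε / (C + D + 1) := by positivity
  filter_upwards [hf a b hab _ hε', hg a b hab _ hε'] with n h1 h2
  filter_upwards [h1, h2, hC n, hD ()] with z h1 h2 h3 h4
  have e : f n z * g n z - f' z * g' z = f n z * (g n z - g' z) + (f n z - f' z) * g' z := by ring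
  rw [e]
  refine (abs_add_le _ _).trans ?_
  rw [abs_mul, abs_mul]
  calc |f n z| * |g n z - g' z| + |f n z - f' z| * |g' z|
      ≤ C * (ε / (C + D + 1)) + ε / (C + D + 1) * D := by gcongr <;> assumption
    _ = ε * ((C + D) / (C + D + 1)) := by ring
    _ ≤ ε * 1 := by
        gcongr
        rw [div_le_one (by positivity)]
        linarith
    _ = ε := mul_one ε

lemma UConv.exp_mul (c : ℝ) (hf : UConv I f f') (hf' : LocBddLp I ⊤ f') :
    UConv I (fun n z => Real.exp (c * f n z)) (fun z => Real.exp (c * f' z)) := by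
  intro a b hab ε hε
  obtain ⟨C, hC⟩ := (locBddLp_iff.1 hf').ae_norm_le_cyl hab
  -- `exp (c ·)` is uniformly continuous on `[-C-1, C+1]`.
  have hu := isCompact_Icc (a := -(C : ℝ) - 1) (b := C + 1) |>.uniformContinuousOn_of_continuous
    (f := fun x => Real.exp (c * x)) (by fun_prop)
  obtain ⟨δ, hδ, H⟩ := Metric.uniformContinuousOn_iff.1 hu ε hε
  filter_upwards [hf a b hab (min (δ / 2) 1) (by positivity)] with n h1
  filter_upwards [h1, hC ()] with z h1 h2
  rw [Real.norm_eq_abs, abs_le] at h2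
  have h3 := abs_le.1 (h1.trans (min_le_right _ _))
  refine (H (f n z) ⟨by linarith, by linarith⟩ (f' z) ⟨by linarith, by linarith⟩ ?_).le
  rw [Real.dist_eq]
  exact (h1.trans (min_le_left _ _)).trans_lt (by linarith)

lemma LocBddLp.memLp_cyl_top (h : LocBddLp I ⊤ f') {a b : ℝ} (hab : Icc a b ⊆ I) :
    MemLp f' ⊤ (volume.restrict (cyl (Icc a b))) := by
  obtain ⟨D, hD⟩ := (locBddLp_iff.1 h).ae_norm_le_cyl hab
  exact memLp_top_of_bound (h.1.mono_measure (restrict_cyl_mono hab)) D (hD ())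

lemma LocBddLp.memLp_cyl {p : ℝ≥0∞} (hp0 : p ≠ 0) (hp : p ≠ ⊤) (h : LocBddLp I p f') {a b : ℝ}
    (hab : Icc a b ⊆ I) : MemLp f' p (volume.restrict (cyl (Icc a b))) :=
  (locBddLp_iff.1 h).memLp_cyl hp0 hp hab ()

/-- A small uniform factor against a sequence bounded in `L¹`. -/
lemma tendsto_integral_mul_of_uConv (hf : UConv I f f') (hfm : ∀ n, LocBddLp I ⊤ (f n))
    (hf' : LocBddLp I ⊤ f') {a b : ℝ} (hab : Icc a b ⊆ I) {C : ℝ}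
    (hg : ∀ n, IntegrableOn (g n) (cyl (Icc a b)))
    (hC : ∀ n, ∫ z in cyl (Icc a b), ‖g n z‖ ≤ C) :
    Tendsto (fun n => (∫ z in cyl (Icc a b), f n z * g n z)
      - ∫ z in cyl (Icc a b), f' z * g n z) atTop (𝓝 0) := by
  have hC0 : 0 ≤ C := (integral_nonneg fun _ => norm_nonneg _).trans (hC 0)
  have hi : ∀ u, LocBddLp I ⊤ u → ∀ n, IntegrableOn (fun z => u z * g n z) (cyl (Icc a b)) := by
    intro u hu n
    obtain ⟨D, hD⟩ := (locBddLp_iff.1 hu).ae_norm_le_cyl hab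
    exact (hg n).bdd_mul (c := D) (hu.1.mono_measure (restrict_cyl_mono hab)) (hD ())
  rw [Metric.tendsto_atTop]
  intro ε hε
  obtain ⟨N, hN⟩ := eventually_atTop.1 (hf a b hab (ε / (C + 1)) (by positivity))
  refine ⟨N, fun n hn => ?_⟩
  rw [Real.dist_eq, sub_zero, ← integral_sub (hi _ (hfm n) n) (hi _ hf' n),
    ← Real.norm_eq_abs]
  calc ‖∫ z in cyl (Icc a b), (f n z * g n z - f' z * g n z)‖
      ≤ ∫ z in cyl (Icc a b), ε / (C + 1) * ‖g n z‖ := by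
        refine norm_integral_le_of_norm_le ((hg n).norm.const_mul _) ?_
        filter_upwards [hN n hn] with z hz
        rw [← sub_mul, norm_mul]
        exact mul_le_mul_of_nonneg_right hz (norm_nonneg _)
    _ ≤ ε / (C + 1) * C := by
        rw [integral_const_mul]
        exact mul_le_mul_of_nonneg_left (hC n) (by positivity)
    _ < ε / (C + 1) * (C + 1) := by gcongr; linarith
    _ = ε := by field_simp

lemma integral_norm_le_of_eLpNorm {α : Type*} [MeasurableSpace α] {μ : Measure α} {u : α → ℝ}
    (hu : AEStronglyMeasurable u μ) {C : ℝ≥0∞} (hC : C ≠ ⊤) (h : eLpNorm u 1 μ ≤ C) :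
    ∫ z, ‖u z‖ ∂μ ≤ C.toReal := by
  rw [integral_norm_eq_lintegral_enorm hu, ← eLpNorm_one_eq_lintegral_enorm]
  exact ENNReal.toReal_mono hC h

/-- The product of a locally uniform and a weak limit. -/
lemma UConv.weakL2 (hf : UConv I f f') (hfb : UBdd I ⊤ f) (hf' : LocBddLp I ⊤ f')
    (hg : UBdd I 2 g) {a b : ℝ} (hab : Icc a b ⊆ I) (hW : WeakL2 (Icc a b) g g') :
    WeakL2 (Icc a b) (fun n z => f n z * g n z) (fun z => f' z * g' z) := by
  intro h hh
  obtain ⟨C, hC⟩ := hg.eLpNorm_cyl_le two_ne_zero ENNReal.ofNat_ne_top hab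
  have hgm : ∀ n, MemLp (g n) 2 (volume.restrict (cyl (Icc a b))) :=
    hg.memLp_cyl two_ne_zero ENNReal.ofNat_ne_top hab
  have hi : ∀ n, IntegrableOn (fun z => g n z * h z) (cyl (Icc a b)) :=
    fun n => (hgm n).integrable_mul hh
  have h1 := tendsto_integral_mul_of_uConv hf (fun n => hfb.single n) hf' hab hi
    (C := (C * eLpNorm h 2 (volume.restrict (cyl (Icc a b)))).toReal) fun n => by
      refine integral_norm_le_of_eLpNorm (hi n).1 (ENNReal.mul_ne_top (by simp) hh.2.ne) ?_
      have h0 : eLpNorm (fun z => g n z * h z) 1 (volume.restrict (cyl (Icc a b)))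
          ≤ eLpNorm (g n) 2 (volume.restrict (cyl (Icc a b)))
            * eLpNorm h 2 (volume.restrict (cyl (Icc a b))) :=
        eLpNorm_smul_le_mul_eLpNorm (𝕜 := ℝ) hh.1 (hgm n).1
      exact h0.trans (mul_le_mul_left (hC n) _)
  have h2 := hW (fun z => f' z * h z) (hh.mul (hf'.memLp_cyl_top hab))
  have h3 := h1.add h2
  rw [zero_add] at h3
  have e : ∀ u v : ℝ × Torus → ℝ, ∫ z in cyl (Icc a b), u z * v z * h z
      = ∫ z in cyl (Icc a b), v z * (u z * h z) := fun u v => by congr 1; ext z; ring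
  rw [e]
  refine h3.congr fun n => ?_
  have e2 : ∫ z in cyl (Icc a b), f' z * (g n z * h z)
      = ∫ z in cyl (Icc a b), g n z * (f' z * h z) := by congr 1; ext z; ring
  rw [e2, sub_add_cancel]
  congr 1; ext z; ring

lemma WeakL2.tendsto_cyl {J : Set ℝ} (hI : I.OrdConnected)
    (hJ : J ⊆ I) (hW : WeakL2 J f f') {h : ℝ × Torus → ℝ}
    (hh : MemLp h 2 (volume.restrict (cyl J)))
    (hs : ∀ t ∉ J, ∀ θ, h (t, θ) = 0) :
    Tendsto (fun n => ∫ z in cyl I, f n z * h z) atTop (𝓝 (∫ z in cyl I, f' z * h z)) := by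
  rw [setIntegral_cyl_eq_of_support hI.measurableSet hJ fun t ht θ => by rw [hs t ht θ, mul_zero]]
  refine (hW h hh).congr fun n => ?_
  rw [setIntegral_cyl_eq_of_support hI.measurableSet hJ fun t ht θ => by rw [hs t ht θ, mul_zero]]

lemma WeakL2.tendsto_test (hI : I.OrdConnected)
    (hW : ∀ a b, Icc a b ⊆ I → WeakL2 (Icc a b) f f') {ψ : ℝ × Torus → ℝ}
    (hψ : IsTestFunction I ψ) :
    Tendsto (fun n => ∫ z in cyl I, f n z * ψ z) atTop (𝓝 (∫ z in cyl I, f' z * ψ z)) := by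
  obtain ⟨a, b, hab, hs⟩ := hψ.support
  have hab' := hab.trans interior_subset
  refine (hW a b hab').tendsto_cyl hI hab' ?_ hs
  exact (locBddLp_iff.2 (UBdd.of_continuous (I := I) (ι := Unit) hψ.smoothFn.continuous)
    |>.memLp_cyl_top hab').mono_exponent le_top

end UConv

/-! ### Compactness of bounded sequences of fields -/

/-- The difference of two fields. -/
noncomputable def SobolevField.sub {I : Set ℝ} {p : ℝ≥0∞} (hp : 1 ≤ p) (F G : SobolevField I p) :
    SobolevField I p where
  val z := F.val z - G.val z
  dt z := F.dt z - G.dt z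
  dx z := F.dx z - G.dx z
  val_bdd := ((UBdd.of_single (ι := Unit) F.val_bdd).sub hp (UBdd.of_single G.val_bdd)).single ()
  dt_bdd := ((UBdd.of_single (ι := Unit) F.dt_bdd).sub hp (UBdd.of_single G.dt_bdd)).single ()
  dx_bdd := ((UBdd.of_single (ι := Unit) F.dx_bdd).sub hp (UBdd.of_single G.dx_bdd)).single ()
  weak_dt ψ hψ := by
    simp only [sub_mul]
    rw [integral_sub ((F.val_bdd.locInt hp).integrableOn_mul_test hψ.partialT)
        ((G.val_bdd.locInt hp).integrableOn_mul_test hψ.partialT),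
      integral_sub ((F.dt_bdd.locInt hp).integrableOn_mul_test hψ)
        ((G.dt_bdd.locInt hp).integrableOn_mul_test hψ), F.weak_dt ψ hψ, G.weak_dt ψ hψ]
    ring
  weak_dx ψ hψ := by
    simp only [sub_mul]
    rw [integral_sub ((F.val_bdd.locInt hp).integrableOn_mul_test hψ.partialX)
        ((G.val_bdd.locInt hp).integrableOn_mul_test hψ.partialX),
      integral_sub ((F.dx_bdd.locInt hp).integrableOn_mul_test hψ)
        ((G.dx_bdd.locInt hp).integrableOn_mul_test hψ), F.weak_dx ψ hψ, G.weak_dx ψ hψ]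
    ring

lemma SobolevField.weakDir_zero {p : ℝ≥0∞} (hp : 1 ≤ p) (F : SobolevField I p) :
    WeakDir I 0 F.val F.dt := by
  have := F.weakDir hp 0
  simpa using this

/-- Sequences bounded in `L^∞_loc(I, H¹)`, with time derivatives bounded in `L^∞_loc(I, L²)`, have
subsequences which converge weakly in `H¹` and uniformly. -/
lemma UH1.exists_limit (hI : I.OrdConnected) (hne : (interior I).Nonempty)
    {P : ℕ → H1Field I} (hP : UH1 P) :
    ∃ (k : ℕ → ℕ) (P' : H1Field I), StrictMono k ∧ H1Converges (fun n => P (k n)) P' := by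
  have hne' := hne.mono interior_subset
  obtain ⟨k₀, g₀, hk₀, hg₀, h₀⟩ := hP.val.exists_weakL2 hI hne'
  obtain ⟨k₁, g₁, hk₁, hg₁, h₁⟩ := (hP.dt.reindex k₀).exists_weakL2 hI hne'
  obtain ⟨k₂, g₂, hk₂, hg₂, h₂⟩ := (hP.dx.reindex (k₀ ∘ k₁)).exists_weakL2 hI hne'
  have c0 : ∀ a b, Icc a b ⊆ I →
      WeakL2 (Icc a b) (fun n => (P (k₀ (k₁ (k₂ n)))).val) g₀ :=
    fun a b hab => (h₀ a b hab).comp (hk₁.comp hk₂)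
  have c1 : ∀ a b, Icc a b ⊆ I →
      WeakL2 (Icc a b) (fun n => (P (k₀ (k₁ (k₂ n)))).dt) g₁ :=
    fun a b hab => (h₁ a b hab).comp hk₂
  have c2 : ∀ a b, Icc a b ⊆ I →
      WeakL2 (Icc a b) (fun n => (P (k₀ (k₁ (k₂ n)))).dx) g₂ := h₂
  let P' : H1Field I :=
    { val := g₀, dt := g₁, dx := g₂, val_bdd := hg₀, dt_bdd := hg₁, dx_bdd := hg₂
      weak_dt := fun ψ hψ => tendsto_nhds_unique (WeakL2.tendsto_test hI c0 hψ.partialT)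
        ((WeakL2.tendsto_test hI c1 hψ).neg.congr fun n => ((P _).weak_dt ψ hψ).symm)
      weak_dx := fun ψ hψ => tendsto_nhds_unique (WeakL2.tendsto_test hI c0 hψ.partialX)
        ((WeakL2.tendsto_test hI c2 hψ).neg.congr fun n => ((P _).weak_dx ψ hψ).symm) }
  refine ⟨fun n => k₀ (k₁ (k₂ n)), P', hk₀.comp (hk₁.comp hk₂), fun a b hab =>
    ⟨c0 a b hab, c1 a b hab, c2 a b hab, ?_⟩⟩
  have hU := hP.reindex fun n => k₀ (k₁ (k₂ n))
  refine tendsto_eLpNorm_top hI hne (w := fun n z => (P (k₀ (k₁ (k₂ n)))).val z - g₀ z)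
    (hU.val.sub one_le_two (UBdd.of_single hg₀)) (hU.dt.sub one_le_two (UBdd.of_single hg₁))
    (hU.dx.sub one_le_two (UBdd.of_single hg₂))
    (fun n => ((P _).sub one_le_two P').weakDir_zero one_le_two)
    (fun n => ((P _).sub one_le_two P').weakDX) (fun χ hχ p q hpq => ?_) hab
  have hχL : LocBddLp I ⊤ (fun z => χ z.2) :=
    locBddLp_iff.2 (UBdd.of_continuous (hχ.comp continuous_snd))
  have hlim := (c0 p q hpq _ ((hχL.memLp_cyl_top hpq).mono_exponent le_top)).sub_const
    (∫ z in cyl (Icc p q), g₀ z * χ z.2)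
  rw [sub_self] at hlim
  refine hlim.congr fun n => ?_
  simp only [sub_mul]
  have hi : ∀ u, LocBddLp I 2 u → IntegrableOn (fun z => u z * χ z.2) (cyl (Icc p q)) := by
    intro u hu
    exact ((hu.locInt one_le_two).2 p q hpq).mul_continuousOn
      (hχ.comp continuous_snd).continuousOn (isCompact_cyl_Icc p q)
  rw [integral_sub (hi _ (P _).val_bdd) (hi _ hg₀)]

/-- A field in `L^∞_loc(I, H¹)` with time derivative in `L^∞_loc(I, L²)` is, on each
`[a, b] × T¹`, a uniform limit of continuous functions, namely of its truncated Fourier series. -/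
lemma H1Field.exists_continuous_near (hI : I.OrdConnected)
    (hne : (interior I).Nonempty) (F : H1Field I) {a b : ℝ} (hab : Icc a b ⊆ I) {ε : ℝ}
    (hε : 0 < ε) : ∃ G : ℝ × Torus → ℝ, Continuous G ∧
      ∀ᵐ z ∂volume.restrict (cyl (Icc a b)), |F.val z - G z| ≤ ε := by
  have hv := F.val_bdd.locInt one_le_two
  rcases lt_or_ge b a with hba | hle
  · exact ⟨0, continuous_const, by simp [cyl, Set.Icc_eq_empty (not_le.2 hba)]⟩
  obtain ⟨D, hD⟩ := F.dx_bdd.2 a b hab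
  have h1 : Tendsto (fun s => fourierTail s * D) atTop (𝓝 (0 * D)) :=
    tendsto_fourierTail.mul_const _
  rw [zero_mul] at h1
  obtain ⟨s, hs⟩ := ((h1.eventually_le_const hε).and
    (eventually_ge_atTop ({0} : Finset ℤ))).exists
  have hs0 : (0 : ℤ) ∈ s := hs.2 (by simp)
  obtain ⟨M, hM⟩ := exists_lipschitz_mode hI hne (ι := Unit) (w := fun _ => F.val)
    (wt := fun _ => F.dt) (fun _ => hv)
    ((UBdd.of_single F.dt_bdd).mono_exponent one_le_two) (fun _ => F.weakDir_zero one_le_two) hab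
  choose L L' hL using hM
  let m : ℤ → ℝ → ℂ := fun k t => ⟨L k () (Set.projIcc a b hle t), L' k () (Set.projIcc a b hle t)⟩
  have hpr : Continuous fun t => (Set.projIcc a b hle t : ℝ) :=
    continuous_subtype_val.comp continuous_projIcc
  have hm : ∀ k, Continuous (m k) := by
    intro k
    have h2 := ((hL k ()).1.1.continuousOn).comp_continuous hpr fun t => (Set.projIcc a b hle t).2
    have h3 := ((hL k ()).2.1.continuousOn).comp_continuous hpr fun t => (Set.projIcc a b hle t).2
    exact Complex.equivRealProdCLM.symm.continuous.comp (h2.prodMk h3)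
  refine ⟨fun z => (∑ k ∈ s, m k z.1 * fourier k z.2).re, ?_, ?_⟩
  · exact Complex.continuous_re.comp (continuous_finsetSum _ fun k _ =>
      ((hm k).comp continuous_fst).mul ((fourier k).continuous.comp continuous_snd))
  have key : ∀ᵐ t ∂volume.restrict (Icc a b), ∀ᵐ θ : Torus,
      |F.val (t, θ) - (∑ k ∈ s, m k t * fourier k θ).re| ≤ ε := by
    have hre : ∀ᵐ t ∂volume.restrict (Icc a b), ∀ k, (mode k F.val t).re = L k () t :=
      ae_all_iff.2 fun k => (hL k ()).1.2
    have him : ∀ᵐ t ∂volume.restrict (Icc a b), ∀ k, (mode k F.val t).im = L' k () t :=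
      ae_all_iff.2 fun k => (hL k ()).2.2
    filter_upwards [hre, him, ae_restrict_mem measurableSet_Icc, hD,
      ae_restrict_of_ae_restrict_of_subset hab (hv.ae_integrable_slice hI),
      ae_restrict_of_ae_restrict_of_subset hab
        (F.weakDX.mode_eq hI hv (F.dx_bdd.locInt one_le_two)),
      ae_restrict_of_ae_restrict_of_subset hab (F.dx_bdd.ae_memLp_slice hI)] with t h2 h3 h4 h5 h6 h7 h8
    filter_upwards [fourier_approx h6 h8 h7] with θ h9
    have e : ∀ k, fourierCoeff (fun θ => (F.val (t, θ) : ℂ)) k = m k t := by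
      intro k
      have hp : (Set.projIcc a b hle t : ℝ) = t := by rw [Set.projIcc_of_mem hle h4]
      apply Complex.ext
      · simp only [m, hp]; exact h2 k
      · simp only [m, hp]; exact h3 k
    have h10 := h9 s hs0
    simp only [e] at h10
    refine h10.trans (le_trans ?_ hs.1)
    exact mul_le_mul_of_nonneg_left (ENNReal.toReal_le_coe_of_le_coe h5) (fourierTail_nonneg s)
  set G : ℝ × Torus → ℝ := fun z => (∑ k ∈ s, m k z.1 * fourier k z.2).re with hG
  have hGc : Continuous G := Complex.continuous_re.comp (continuous_finsetSum _ fun k _ =>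
      ((hm k).comp continuous_fst).mul ((fourier k).continuous.comp continuous_snd))
  have hmeas := ((hv.1.mono_measure (restrict_cyl_mono hab)).sub hGc.aestronglyMeasurable)
  rw [restrict_cyl] at hmeas ⊢
  obtain ⟨f', hf', hff'⟩ := hmeas
  have h1 : ∀ᵐ z ∂((volume.restrict (Icc a b)).prod (volume : Measure Torus)), ‖f' z‖ ≤ ε := by
    rw [Measure.ae_prod_iff_ae_ae (measurableSet_le hf'.norm.measurable measurable_const)]
    filter_upwards [key, Measure.ae_ae_of_ae_prod hff'] with t h1 h2
    filter_upwards [h1, h2] with θ h3 h4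
    rwa [← h4]
  filter_upwards [h1, hff'] with z h1 h2
  rw [← h2] at h1
  exact h1

/-! ### Passage to the limit in the essential equations -/

lemma pairing_dens_test (hI : I.OrdConnected) {f : ℝ × Torus → ℝ} (hf : LocInt I f)
    {ψ : ℝ × Torus → ℝ} (hψ : IsTestFunction I ψ) :
    pairing I (dens f) ψ = ∫ z in cyl I, f z * ψ z := by
  obtain ⟨a, b, hab, hs⟩ := hψ.support
  have hab' := hab.trans interior_subset
  rw [pairing_congr_support hI.measurableSet hab' hs,
    pairing_dens hI hf hab' hψ.smoothFn.continuous,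
    setIntegral_cyl_eq_of_support hI.measurableSet hab' fun t ht θ => by rw [hs t ht θ, mul_zero]]

lemma IsTestFunction.box {ψ : ℝ × Torus → ℝ} (hψ : IsTestFunction I ψ) :
    IsTestFunction I (box ψ) := by
  have e : Gowdy.box ψ = Gowdy.lineD 1 (Gowdy.lineD (-1) ψ) :=
    funext fun z => hψ.smoothFn.box_eq_lineD (one_pow 2) z
  rw [e]
  exact (hψ.lineD (-1)).lineD 1

lemma locBddLp_top_of_continuous {ψ : ℝ × Torus → ℝ} (hψ : Continuous ψ) :
    LocBddLp I ⊤ ψ := locBddLp_iff.2 (UBdd.of_continuous hψ)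

section Passage

variable (hI : I.OrdConnected)
  {P Q : ℕ → H1Field I} {P' Q' : H1Field I}

lemma H1Converges.uConv (h : H1Converges P P') : UConv I (fun n => (P n).val) P'.val :=
  .of_strongLp fun a b hab => (h a b hab).2.2.2

include hI

lemma tendsto_integral_weighted {a : ℕ → ℝ × Torus → ℝ} {a' : ℝ × Torus → ℝ} (ha : UConv I a a')
    (hab : UBdd I ⊤ a) (ha' : LocBddLp I ⊤ a') (hU : UH1 Q) (hQ : H1Converges Q Q')
    {h₀ h₁ : ℝ × Torus → ℝ} (hb₀ : LocBddLp I ⊤ h₀) (hb₁ : LocBddLp I ⊤ h₁) {p q : ℝ}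
    (hpq : Icc p q ⊆ I) (hs₀ : ∀ t ∉ Icc p q, ∀ θ, h₀ (t, θ) = 0)
    (hs₁ : ∀ t ∉ Icc p q, ∀ θ, h₁ (t, θ) = 0) :
    Tendsto (fun n => ∫ z in cyl I, a n z * ((Q n).dt z * h₀ z + (Q n).dx z * h₁ z)) atTop
      (𝓝 (∫ z in cyl I, a' z * (Q'.dt z * h₀ z + Q'.dx z * h₁ z))) := by
  have w₀ := (ha.weakL2 hab ha' hU.dt hpq (hQ p q hpq).2.1).tendsto_cyl hI hpq
    ((hb₀.memLp_cyl_top hpq).mono_exponent le_top) hs₀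
  have w₁ := (ha.weakL2 hab ha' hU.dx hpq (hQ p q hpq).2.2.1).tendsto_cyl hI hpq
    ((hb₁.memLp_cyl_top hpq).mono_exponent le_top) hs₁
  have hi : ∀ u v h : ℝ × Torus → ℝ, LocBddLp I ⊤ u → LocBddLp I 2 v → LocBddLp I ⊤ h →
      (∀ t ∉ Icc p q, ∀ θ, h (t, θ) = 0) → IntegrableOn (fun z => u z * v z * h z) (cyl I) := by
    intro u v h hu hv hh hs
    refine integrableOn_cyl_of_support measurableSet_Icc
      (fun t ht θ => by rw [hs t ht θ, mul_zero]) ?_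
    have h1 : MemLp (fun z => u z * v z) 2 (volume.restrict (cyl (Icc p q))) :=
      (hv.memLp_cyl two_ne_zero ENNReal.ofNat_ne_top hpq).mul (hu.memLp_cyl_top hpq)
    have h2 : MemLp h 2 (volume.restrict (cyl (Icc p q))) :=
      (hh.memLp_cyl_top hpq).mono_exponent le_top
    exact h1.integrable_mul h2
  have e : ∀ (u : ℝ × Torus → ℝ) (F : H1Field I), LocBddLp I ⊤ u →
      ∫ z in cyl I, u z * (F.dt z * h₀ z + F.dx z * h₁ z)
        = (∫ z in cyl I, u z * F.dt z * h₀ z) + ∫ z in cyl I, u z * F.dx z * h₁ z := by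
    intro u F hu
    rw [← integral_add (hi u _ _ hu F.dt_bdd hb₀ hs₀) (hi u _ _ hu F.dx_bdd hb₁ hs₁)]
    congr 1; ext z; ring
  rw [e a' Q' ha']
  exact (w₀.add w₁).congr fun n => (e (a n) (Q n) (hab.single n)).symm

lemma tendsto_weighted_test {a : ℕ → ℝ × Torus → ℝ} {a' : ℝ × Torus → ℝ} (ha : UConv I a a')
    (hab : UBdd I ⊤ a) (ha' : LocBddLp I ⊤ a') (hU : UH1 Q) (hQ : H1Converges Q Q')
    {ψ₀ ψ₁ : ℝ × Torus → ℝ} (h₀ : IsTestFunction I ψ₀) (h₁ : IsTestFunction I ψ₁) :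
    Tendsto (fun n => ∫ z in cyl I, a n z * ((Q n).dt z * ψ₀ z - (Q n).dx z * ψ₁ z)) atTop
      (𝓝 (∫ z in cyl I, a' z * (Q'.dt z * ψ₀ z - Q'.dx z * ψ₁ z))) := by
  obtain ⟨p₀, q₀, hpq₀, hs₀⟩ := h₀.support
  obtain ⟨p₁, q₁, hpq₁, hs₁⟩ := h₁.support
  obtain ⟨p, q, hpq, k₀, k₁⟩ := exists_Icc_union hI hpq₀ hpq₁
  have h := tendsto_integral_weighted hI ha hab ha' hU hQ
    (locBddLp_top_of_continuous h₀.smoothFn.continuous)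
    (locBddLp_top_of_continuous (h₁.const_mul (-1)).smoothFn.continuous)
    (hpq.trans interior_subset) (fun t ht θ => hs₀ t (fun h => ht (k₀ h)) θ)
    (fun t ht θ => by rw [hs₁ t (fun h => ht (k₁ h)) θ, mul_zero])
  have e : ∀ u v x y : ℝ, u * x + v * (-1 * y) = u * x - v * y := fun u v x y => by ring
  simpa only [e] using h

variable (hpos : I ⊆ Ioi 0)
include hpos

lemma tendsto_weighted_div_time {a : ℕ → ℝ × Torus → ℝ} {a' : ℝ × Torus → ℝ} (ha : UConv I a a')
    (hab : UBdd I ⊤ a) (ha' : LocBddLp I ⊤ a') (hU : UH1 Q) (hQ : H1Converges Q Q')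
    {ψ : ℝ × Torus → ℝ} (hψ : IsTestFunction I ψ) :
    Tendsto (fun n => ∫ z in cyl I, a n z * (Q n).dt z / z.1 * ψ z) atTop
      (𝓝 (∫ z in cyl I, a' z * Q'.dt z / z.1 * ψ z)) := by
  obtain ⟨p, q, hpq, hs⟩ := hψ.support
  have h := tendsto_integral_weighted hI ha hab ha' hU hQ (h₀ := fun z => ψ z / z.1)
    (h₁ := fun _ => 0) (locBddLp_iff.2
      (UBdd.div_time hI hpos (UBdd.of_continuous (ι := Unit) hψ.smoothFn.continuous)))
    (locBddLp_top_of_continuous continuous_const) (hpq.trans interior_subset)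
    (fun t ht θ => by rw [hs t ht θ, zero_div]) (fun _ _ _ => rfl)
  have e : ∀ a b s x y : ℝ, a * (b * (x / s) + y * 0) = a * b / s * x := fun a b s x y => by ring
  simpa only [e] using h

variable (hne : (interior I).Nonempty) (hUP : UH1 P) (hUQ : UH1 Q) (hP : H1Converges P P')
  (hQ : H1Converges Q Q')

omit hpos in
include hP in
lemma uConv_exp : UConv I (fun n z => Real.exp (2 * (P n).val z))
    (fun z => Real.exp (2 * P'.val z)) ∧ LocBddLp I ⊤ (fun z => Real.exp (2 * P'.val z)) :=
  ⟨hP.uConv.exp_mul 2 (P'.val_top hI), ((UH1.single (ι := Unit) P').exp hI 2).single ()⟩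

omit hpos in
include hUP hP hUQ hQ in
lemma uConv_mul_exp : UConv I (fun n z => (Q n).val z * Real.exp (2 * (P n).val z))
      (fun z => Q'.val z * Real.exp (2 * P'.val z)) ∧
    UBdd I ⊤ (fun n z => (Q n).val z * Real.exp (2 * (P n).val z)) ∧
    LocBddLp I ⊤ (fun z => Q'.val z * Real.exp (2 * P'.val z)) := by
  obtain ⟨h1, h2⟩ := uConv_exp hI hP
  refine ⟨hQ.uConv.mul h1 (hUQ.top hI) h2, (hUQ.top hI).mul (hUP.exp hI 2), ?_⟩
  exact (((UH1.single (ι := Unit) Q').top hI).mul ((UH1.single (ι := Unit) P').exp hI 2)).single ()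

include hne hUP hUQ hP hQ

lemma limit_waveEq_Q (h : ∀ n, EssentialEquations (P n) (Q n)) :
    WaveEq I Q'.val (fun z => -2 * (P'.dt z * Q'.dt z - P'.dx z * Q'.dx z) - Q'.dt z / z.1) := by
  obtain ⟨h1, h2⟩ := uConv_exp hI hP
  rw [waveEq_iff_divergence hI hne hpos]
  intro ψ hψ
  refine tendsto_nhds_unique
    (tendsto_weighted_test hI h1 (hUP.exp hI 2) h2 hUQ hQ hψ.partialT hψ.partialX)
    ((tendsto_weighted_div_time hI hpos h1 (hUP.exp hI 2) h2 hUQ hQ hψ).congr fun n => ?_)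
  exact ((waveEq_iff_divergence hI hne hpos).1 (h n).2 ψ hψ).symm

/-- The null form of the equation for `P` passes to the limit because the equation for `Q`, in
divergence form, expresses it through products of weak and uniform limits. -/
lemma tendsto_nullQ (h : ∀ n, EssentialEquations (P n) (Q n)) {ψ : ℝ × Torus → ℝ}
    (hψ : IsTestFunction I ψ) :
    Tendsto (fun n => ∫ z in cyl I, nullQ (P n) (Q n) z * ψ z) atTop
      (𝓝 (∫ z in cyl I, nullQ P' Q' z * ψ z)) := by
  obtain ⟨h1, h2, h3⟩ := uConv_mul_exp hI hUP hUQ hP hQ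
  have e : ∀ (F G : H1Field I), WaveEq I G.val
      (fun z => -2 * (F.dt z * G.dt z - F.dx z * G.dx z) - G.dt z / z.1) →
      ∫ z in cyl I, nullQ F G z * ψ z
        = (∫ z in cyl I, G.val z * Real.exp (2 * F.val z) * G.dt z / z.1 * ψ z)
          - ∫ z in cyl I, G.val z * Real.exp (2 * F.val z)
            * (G.dt z * partialT ψ z - G.dx z * partialX ψ z) := by
    intro F G hFG
    rw [integral_nullQ hI hne hpos hFG hψ]
    simp only [mul_assoc]
  rw [e P' Q' (limit_waveEq_Q hI hpos hne hUP hUQ hP hQ h)]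
  refine ((tendsto_weighted_div_time hI hpos h1 h2 h3 hUQ hQ hψ).sub
    (tendsto_weighted_test hI h1 h2 h3 hUQ hQ hψ.partialT hψ.partialX)).congr fun n => ?_
  exact (e _ _ (h n).2).symm

lemma limit_essential (h : ∀ n, EssentialEquations (P n) (Q n)) : EssentialEquations P' Q' := by
  refine ⟨fun ψ hψ => ?_, limit_waveEq_Q hI hpos hne hUP hUQ hP hQ h⟩
  have e : ∀ F G : H1Field I, ∫ z in cyl I,
      (Real.exp (2 * F.val z) * (G.dt z ^ 2 - G.dx z ^ 2) - F.dt z / z.1) * ψ z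
        = (∫ z in cyl I, nullQ F G z * ψ z) - ∫ z in cyl I, 1 * F.dt z / z.1 * ψ z := by
    intro F G
    simp only [sub_mul, one_mul]
    rw [← integral_sub]
    · rfl
    · exact (((UH1.single (ι := Unit) F).nullQ hI (UH1.single G)).locInt le_rfl
        ()).integrableOn_mul_test hψ
    · exact ((UBdd.div_time hI hpos (UH1.single (ι := Unit) F).dt).locInt one_le_two
        ()).integrableOn_mul_test hψ
  rw [e]
  refine tendsto_nhds_unique (WeakL2.tendsto_test hI (fun a b hab => (hP a b hab).1) hψ.box)
    (((tendsto_nullQ hI hpos hne hUP hUQ hP hQ h hψ).sub (tendsto_weighted_div_time hI hpos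
      (a := fun _ _ => 1) (a' := fun _ => 1)
      (fun a b hab ε hε => Eventually.of_forall fun n => ae_of_all _ fun z => by simpa using hε.le)
      (UBdd.of_continuous continuous_const) (locBddLp_top_of_continuous continuous_const)
      hUP hP hψ)).congr fun n => ?_)
  rw [(h n).1 ψ hψ, e]

end Passage

/-- A weak-star limit in the sense of measures, with a limit which is a function, may be tested
against uniform limits of continuous functions. -/
lemma tendsto_integral_of_near {f : ℕ → ℝ × Torus → ℝ} {f' G : ℝ × Torus → ℝ}
    (hf : UBdd I 1 f) (hf' : LocBddLp I 1 f') (hG : LocBddLp I ⊤ G) {a b : ℝ}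
    (hab : Icc a b ⊆ I)
    (hw : ∀ χ, Continuous χ → Tendsto (fun n => ∫ z in cyl (Icc a b), f n z * χ z) atTop
      (𝓝 (∫ z in cyl (Icc a b), f' z * χ z)))
    (hnear : ∀ ε > 0, ∃ χ, Continuous χ ∧
      ∀ᵐ z ∂volume.restrict (cyl (Icc a b)), |G z - χ z| ≤ ε) :
    Tendsto (fun n => ∫ z in cyl (Icc a b), f n z * G z) atTop
      (𝓝 (∫ z in cyl (Icc a b), f' z * G z)) := by
  obtain ⟨C, hC⟩ := hf.eLpNorm_cyl_le one_ne_zero ENNReal.one_ne_top hab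
  obtain ⟨D, hD⟩ := (locBddLp_iff.1 hf').eLpNorm_cyl_le one_ne_zero ENNReal.one_ne_top hab
  have key : ∀ (u : ℝ × Torus → ℝ) (K : ℝ≥0), LocBddLp I 1 u →
      eLpNorm u 1 (volume.restrict (cyl (Icc a b))) ≤ K → ∀ χ, Continuous χ → ∀ ε ≥ 0,
      (∀ᵐ z ∂volume.restrict (cyl (Icc a b)), |G z - χ z| ≤ ε) →
      |(∫ z in cyl (Icc a b), u z * G z) - ∫ z in cyl (Icc a b), u z * χ z| ≤ ε * K := by
    intro u K hu hK χ hχ ε hε hle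
    have hui := (hu.locInt le_rfl).2 a b hab
    obtain ⟨M, hM⟩ := (locBddLp_iff.1 hG).ae_norm_le_cyl hab
    rw [← integral_sub (hui.mul_bdd (c := M) (hG.1.mono_measure (restrict_cyl_mono hab)) (hM ()))
      (hui.mul_continuousOn hχ.continuousOn (isCompact_cyl_Icc a b)), ← Real.norm_eq_abs]
    calc ‖∫ z in cyl (Icc a b), (u z * G z - u z * χ z)‖
        ≤ ∫ z in cyl (Icc a b), ε * ‖u z‖ := by
          refine norm_integral_le_of_norm_le (hui.norm.const_mul _) ?_
          filter_upwards [hle] with z hz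
          rw [← mul_sub, norm_mul, mul_comm]
          exact mul_le_mul_of_nonneg_right hz (norm_nonneg _)
      _ ≤ ε * K := by
          rw [integral_const_mul]
          exact mul_le_mul_of_nonneg_left
            (integral_norm_le_of_eLpNorm hui.1 ENNReal.coe_ne_top hK) hε
  rw [Metric.tendsto_atTop]
  intro ε hε
  set δ : ℝ := ε / (2 * (C + D + 1)) with hδ
  have hδ0 : 0 < δ := by positivity
  obtain ⟨χ, hχ, hle⟩ := hnear δ hδ0
  obtain ⟨N, hN⟩ := Metric.tendsto_atTop.1 (hw χ hχ) (ε / 2) (by positivity)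
  refine ⟨N, fun n hn => ?_⟩
  have h1 := hN n hn
  have h2 := key _ C (hf.single n) (hC n) χ hχ δ hδ0.le hle
  have h3 := key _ D hf' (hD ()) χ hχ δ hδ0.le hle
  rw [Real.dist_eq] at h1 ⊢
  have h4 : δ * C + δ * D < ε / 2 := by
    have : δ * (C + D + 1) = ε / 2 := by rw [hδ]; field_simp
    linarith
  have := abs_lt.1 h1
  have := abs_le.1 h2
  have := abs_le.1 h3
  rw [abs_lt]
  constructor <;> linarith

section Passage

variable (hI : I.OrdConnected)
  {P Q : ℕ → H1Field I} {P' Q' : H1Field I} (hpos : I ⊆ Ioi 0)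
  (hne : (interior I).Nonempty) (hUP : UH1 P) (hUQ : UH1 Q) (hP : H1Converges P P')
  (hQ : H1Converges Q Q')
include hI hpos hne hUP hUQ hP hQ

/-- The null form of the equation for `μ` passes to the limit because the equation for `P`, tested with
a multiple of `P`, expresses it through products of weak and uniform limits, and through `P` times
the null form of `tendsto_nullQ`. -/
lemma tendsto_nullP (h : ∀ n, EssentialEquations (P n) (Q n)) {ψ : ℝ × Torus → ℝ}
    (hψ : IsTestFunction I ψ) :
    Tendsto (fun n => ∫ z in cyl I, nullP (P n) z * ψ z) atTop
      (𝓝 (∫ z in cyl I, nullP P' z * ψ z)) := by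
  have hess := limit_essential hI hpos hne hUP hUQ hP hQ h
  have hnull := hUP.nullQ hI hUQ
  have hnull' : LocBddLp I 1 (nullQ P' Q') :=
    ((UH1.single (ι := Unit) P').nullQ hI (UH1.single Q')).single ()
  obtain ⟨a, b, hab, hs⟩ := hψ.support
  have hab' := hab.trans interior_subset
  have hψL := locBddLp_top_of_continuous (I := I) hψ.smoothFn.continuous
  have hstar : ∀ χ, Continuous χ → Tendsto
      (fun n => ∫ z in cyl (Icc a b), nullQ (P n) (Q n) z * χ z) atTop
      (𝓝 (∫ z in cyl (Icc a b), nullQ P' Q' z * χ z)) := by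
    intro χ hχ
    rw [← pairing_dens hI (hnull'.locInt le_rfl) hab' hχ]
    refine weakStarMeasure_of_test hI hnull (hnull'.dens hI) (fun φ hφ => ?_) hab' χ hχ
    rw [pairing_dens_test hI (hnull'.locInt le_rfl) hφ]
    exact tendsto_nullQ hI hpos hne hUP hUQ hP hQ h hφ
  -- The cubic term: replace `Pⁿ` by its uniform limit, which is almost continuous.
  have hcubic : Tendsto (fun n => ∫ z in cyl I, (P n).val z * (nullQ (P n) (Q n) z * ψ z)) atTop
      (𝓝 (∫ z in cyl I, P'.val z * (nullQ P' Q' z * ψ z))) := by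
    have hsupp : ∀ u v : ℝ × Torus → ℝ, ∫ z in cyl I, u z * (v z * ψ z)
        = ∫ z in cyl (Icc a b), u z * (v z * ψ z) := fun u v =>
      setIntegral_cyl_eq_of_support hI.measurableSet hab' fun t ht θ => by
        rw [hs t ht θ, mul_zero, mul_zero]
    simp only [hsupp]
    obtain ⟨K, hK⟩ := (isCompact_cyl_Icc a b).exists_bound_of_continuousOn
      hψ.smoothFn.continuous.continuousOn
    have hg : UBdd I 1 fun n z => nullQ (P n) (Q n) z * ψ z :=
      hnull.mul (UBdd.of_continuous hψ.smoothFn.continuous)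
    obtain ⟨C, hC⟩ := hg.eLpNorm_cyl_le one_ne_zero ENNReal.one_ne_top hab'
    have h1 := tendsto_integral_mul_of_uConv hP.uConv (fun n => (P n).val_top hI) (P'.val_top hI)
      hab' (C := C) (fun n => (hg.locInt le_rfl n).2 a b hab') fun n =>
        integral_norm_le_of_eLpNorm ((hg.locInt le_rfl n).2 a b hab').1 ENNReal.coe_ne_top (hC n)
    have h2 := tendsto_integral_of_near hnull hnull' (G := fun z => P'.val z * ψ z)
      (((UBdd.of_single (ι := Unit) (P'.val_top hI)).mul (UBdd.of_single hψL)).single ()) hab' hstar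
      fun ε hε => by
        obtain ⟨χ, hχ, hle⟩ := P'.exists_continuous_near hI hne hab' (ε := ε / (|K| + 1))
          (by positivity)
        refine ⟨fun z => χ z * ψ z, hχ.mul hψ.smoothFn.continuous, ?_⟩
        filter_upwards [hle, ae_restrict_mem (measurableSet_cyl measurableSet_Icc)] with z h3 h4
        rw [← sub_mul, abs_mul]
        calc |P'.val z - χ z| * |ψ z| ≤ ε / (|K| + 1) * (|K| + 1) := by
              gcongr
              exact (hK z h4).trans ((le_abs_self K).trans (by linarith))
          _ = ε := by field_simp
    have e : ∀ u v : ℝ × Torus → ℝ, ∫ z in cyl (Icc a b), u z * (v z * ψ z)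
        = ∫ z in cyl (Icc a b), v z * (u z * ψ z) := fun u v => by
      congr 1; ext z; ring
    have h3 := h1.add h2
    rw [zero_add] at h3
    rw [e]
    refine h3.congr fun n => ?_
    rw [e P'.val, sub_add_cancel]
  have e2 : ∀ u v w x : ℝ, u * (v - w) * x = u * (v * x - w * x) := fun u v w x => by ring
  rw [integral_nullP hI hne hpos hess.1 hψ]
  simp only [e2]
  refine (((tendsto_weighted_div_time hI hpos hP.uConv (hUP.top hI) (P'.val_top hI) hUP hP hψ).sub
    hcubic).sub (tendsto_weighted_test hI hP.uConv (hUP.top hI) (P'.val_top hI) hUP hP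
      (hψ.lineD 1) (hψ.lineD 1))).congr fun n => ?_
  rw [integral_nullP hI hne hpos (h n).1 hψ]
  simp only [e2]

end Passage

/-! ### Strong compactness of bounded sequences in `W^{1,1}` -/

lemma UBdd.congr_ae {ι : Type} {p : ℝ≥0∞} {f g : ι → ℝ × Torus → ℝ}
    (hf : UBdd I p f) (h : ∀ i, f i =ᵐ[volume.restrict (cyl I)] g i) : UBdd I p g := by
  refine ⟨fun i => (hf.1 i).congr (h i), fun a b hab => ?_⟩
  obtain ⟨C, hC⟩ := hf.2 a b hab
  refine ⟨C, fun i => ?_⟩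
  filter_upwards [hC i, ae_restrict_of_ae_restrict_of_subset hab (ae_slice (h i))] with t h1 h2
  rwa [← eLpNorm_congr_ae h2]

/-- The sum of two fields. -/
noncomputable def SobolevField.add {I : Set ℝ} {p : ℝ≥0∞} (hp : 1 ≤ p) (F G : SobolevField I p) :
    SobolevField I p where
  val z := F.val z + G.val z
  dt z := F.dt z + G.dt z
  dx z := F.dx z + G.dx z
  val_bdd := ((UBdd.of_single (ι := Unit) F.val_bdd).add hp (UBdd.of_single G.val_bdd)).single ()
  dt_bdd := ((UBdd.of_single (ι := Unit) F.dt_bdd).add hp (UBdd.of_single G.dt_bdd)).single ()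
  dx_bdd := ((UBdd.of_single (ι := Unit) F.dx_bdd).add hp (UBdd.of_single G.dx_bdd)).single ()
  weak_dt ψ hψ := by
    simp only [add_mul]
    rw [integral_add ((F.val_bdd.locInt hp).integrableOn_mul_test hψ.partialT)
        ((G.val_bdd.locInt hp).integrableOn_mul_test hψ.partialT),
      integral_add ((F.dt_bdd.locInt hp).integrableOn_mul_test hψ)
        ((G.dt_bdd.locInt hp).integrableOn_mul_test hψ), F.weak_dt ψ hψ, G.weak_dt ψ hψ]
    ring
  weak_dx ψ hψ := by
    simp only [add_mul]
    rw [integral_add ((F.val_bdd.locInt hp).integrableOn_mul_test hψ.partialX)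
        ((G.val_bdd.locInt hp).integrableOn_mul_test hψ.partialX),
      integral_add ((F.dx_bdd.locInt hp).integrableOn_mul_test hψ)
        ((G.dx_bdd.locInt hp).integrableOn_mul_test hψ), F.weak_dx ψ hψ, G.weak_dx ψ hψ]
    ring

/-- An `H¹` field as a `W^{1,1}` field. -/
def SobolevField.toW11 {I : Set ℝ} (F : H1Field I) : W11Field I where
  val := F.val
  dt := F.dt
  dx := F.dx
  val_bdd := ((UBdd.of_single (ι := Unit) F.val_bdd).mono_exponent one_le_two).single ()
  dt_bdd := ((UBdd.of_single (ι := Unit) F.dt_bdd).mono_exponent one_le_two).single ()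
  dx_bdd := ((UBdd.of_single (ι := Unit) F.dx_bdd).mono_exponent one_le_two).single ()
  weak_dt := F.weak_dt
  weak_dx := F.weak_dx

lemma weakDir_const (hI : I.OrdConnected) (c a : ℝ) :
    WeakDir I a (fun _ => c) (fun _ => 0) := by
  have hL : ∀ u : ℝ, LocInt I (fun _ => u) := fun u =>
    (locBddLp_top_of_continuous continuous_const).locInt le_top
  refine LineAC.weakDir hI ?_ (hL c) (hL 0)
  refine (LineAC.of_smooth (SmoothFn.of_time (ρ := fun _ => c) contDiff_const)).congr'
    (ae_of_all _ fun t θ => ?_)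
  simp [lineD, partialT, partialX]

/-- The constant field. -/
def SobolevField.const {I : Set ℝ} (hI : I.OrdConnected) {p : ℝ≥0∞} (c : ℝ) : SobolevField I p where
  val _ := c
  dt _ := 0
  dx _ := 0
  val_bdd := ((UBdd.of_continuous (ι := Unit) continuous_const).mono_exponent le_top).single ()
  dt_bdd := ((UBdd.of_continuous (ι := Unit) continuous_const).mono_exponent le_top).single ()
  dx_bdd := ((UBdd.of_continuous (ι := Unit) continuous_const).mono_exponent le_top).single ()
  weak_dt ψ hψ := by simpa [lineD] using weakDir_const hI c 0 ψ hψ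
  weak_dx := by
    have hL : ∀ u : ℝ, LocInt I (fun _ => u) := fun u =>
      (locBddLp_top_of_continuous continuous_const).locInt le_top
    refine WeakDir.weakDX (hL c) (hL 0) (hL 0) (weakDir_const hI c 0) ?_
    simpa using weakDir_const hI c 1

/-- A sequence which converges in `L¹` locally in time has a subsequence which converges almost
everywhere. -/
lemma exists_subseq_ae (hI : I.OrdConnected) (hne : I.Nonempty)
    {f : ℕ → ℝ × Torus → ℝ} {g : ℝ × Torus → ℝ}
    (hf : ∀ n, AEStronglyMeasurable (f n) (volume.restrict (cyl I)))
    (hg : AEStronglyMeasurable g (volume.restrict (cyl I)))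
    (h : ∀ a b, Icc a b ⊆ I → StrongLp (Icc a b) 1 f g) :
    ∃ l : ℕ → ℕ, StrictMono l ∧ ∀ᵐ z ∂volume.restrict (cyl I),
      Tendsto (fun n => f (l n) z) atTop (𝓝 (g z)) := by
  obtain ⟨a, b, ha, hb, hJ, hex⟩ := exists_exhaustion hI hne
  obtain ⟨l, hl, hlj⟩ := Filter.extraction_forall_of_eventually
    (P := fun j n => eLpNorm (fun z => f n z - g z) 1
      (volume.restrict (cyl (Icc (a j) (b j)))) ≤ (2⁻¹ : ℝ≥0∞) ^ j) fun j =>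
    (h _ _ (hJ j)).eventually_le_const (ENNReal.pow_pos (by simp) j)
  refine ⟨l, hl, ae_cyl_of_forall_Icc hI fun x y hxy => ?_⟩
  obtain ⟨i, hi⟩ := hex x y hxy
  set μ := (volume : Measure (ℝ × Torus)).restrict (cyl (Icc x y)) with hμ
  have hle : ∀ j, ∫⁻ z, ‖f (l (j + i)) z - g z‖ₑ ∂μ ≤ (2⁻¹ : ℝ≥0∞) ^ j := by
    intro j
    rw [← eLpNorm_one_eq_lintegral_enorm]
    refine (eLpNorm_mono_measure _ (restrict_cyl_mono (hi.trans
      (Set.Icc_subset_Icc (ha (Nat.le_add_left i j)) (hb (Nat.le_add_left i j)))))).trans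
      ((hlj (j + i)).trans ?_)
    exact pow_le_pow_of_le_one zero_le (by simp) (Nat.le_add_right j i)
  have hm : ∀ n, AEMeasurable (fun z => ‖f n z - g z‖ₑ) μ := fun n =>
    (((hf n).sub hg).mono_measure (restrict_cyl_mono hxy)).enorm
  have hsum : ∫⁻ z, ∑' j, ‖f (l (j + i)) z - g z‖ₑ ∂μ ≠ ⊤ := by
    rw [lintegral_tsum fun j => hm _]
    refine ((ENNReal.tsum_le_tsum hle).trans_lt ?_).ne
    rw [ENNReal.tsum_geometric]
    simp
  have hae := ae_lt_top' (AEMeasurable.tsum fun j => hm (l (j + i))) hsum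
  filter_upwards [hae] with z hz
  have h1 := ENNReal.tendsto_atTop_zero_of_tsum_ne_top hz.ne
  rw [← tendsto_add_atTop_iff_nat i, tendsto_iff_edist_tendsto_0]
  simpa [edist_eq_enorm_sub] using h1

/-- A weak limit in `L²` is a strong limit when the sequence is a Cauchy sequence in norm. -/
lemma WeakL2.strong_of_cauchy {a b : ℝ} {f : ℕ → ℝ × Torus → ℝ} {g : ℝ × Torus → ℝ}
    (hf : ∀ n, MemLp (f n) 2 (volume.restrict (cyl (Icc a b))))
    (hg : MemLp g 2 (volume.restrict (cyl (Icc a b)))) (h : WeakL2 (Icc a b) f g)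
    (hc : Tendsto (fun i : ℕ × ℕ => eLpNorm (fun z => f i.1 z - f i.2 z) 2
      (volume.restrict (cyl (Icc a b)))) (atTop ×ˢ atTop) (𝓝 0)) :
    StrongLp (Icc a b) 2 f g := by
  rw [StrongLp, ENNReal.tendsto_nhds_zero]
  intro ε hε
  obtain ⟨δ, hδ0, hδ⟩ : ∃ δ : ℝ≥0, 0 < δ ∧ (δ : ℝ≥0∞) ≤ ε := by
    obtain ⟨δ, h1, h2⟩ := ENNReal.lt_iff_exists_nnreal_btwn.1 hε
    exact ⟨δ, by exact_mod_cast h1, h2.le⟩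
  have h1 := ENNReal.tendsto_nhds_zero.1 hc δ (by exact_mod_cast hδ0)
  rw [prod_atTop_atTop_eq] at h1
  obtain ⟨⟨N, N'⟩, hN⟩ := eventually_atTop.1 h1
  filter_upwards [eventually_ge_atTop N] with n hn
  refine le_trans ?_ hδ
  have hd : MemLp (fun z => f n z - g z) 2 (volume.restrict (cyl (Icc a b))) := (hf n).sub hg
  rw [eLpNorm_two_le_iff hd]
  set A := ∫ z in cyl (Icc a b), (f n z - g z) ^ 2 with hA
  -- `‖fₙ - g‖²` is the limit of `⟨fₙ - fₘ, fₙ - g⟩ ≤ (‖fₙ - fₘ‖² + ‖fₙ - g‖²) / 2`.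
  have hlim : Tendsto (fun m => ∫ z in cyl (Icc a b), (f n z - f m z) * (f n z - g z)) atTop
      (𝓝 A) := by
    have e : ∀ u, MemLp u 2 (volume.restrict (cyl (Icc a b))) →
        ∫ z in cyl (Icc a b), (f n z - u z) * (f n z - g z)
        = (∫ z in cyl (Icc a b), f n z * (f n z - g z))
          - ∫ z in cyl (Icc a b), u z * (f n z - g z) := by
      intro u hu
      have i1 : IntegrableOn (fun z => f n z * (f n z - g z)) (cyl (Icc a b)) :=
        (hf n).integrable_mul hd
      have i2 : IntegrableOn (fun z => u z * (f n z - g z)) (cyl (Icc a b)) :=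
        hu.integrable_mul hd
      rw [← integral_sub i1 i2]
      congr 1; ext z; ring
    have h2 := (h _ hd).const_sub (∫ z in cyl (Icc a b), f n z * (f n z - g z))
    rw [← e g hg] at h2
    simp only [hA, sq]
    exact h2.congr fun m => (e _ (hf m)).symm
  have hle : A ≤ ((δ : ℝ) ^ 2 + A) / 2 := by
    refine le_of_tendsto hlim ?_
    filter_upwards [eventually_ge_atTop N'] with m hm
    have hdm : MemLp (fun z => f n z - f m z) 2 (volume.restrict (cyl (Icc a b))) :=
      (hf n).sub (hf m)
    have h3 := (eLpNorm_two_le_iff hdm).1 (hN (n, m) ⟨hn, hm⟩)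
    have h4 : ∫ z in cyl (Icc a b), (f n z - f m z) * (f n z - g z)
        ≤ ∫ z in cyl (Icc a b), ((f n z - f m z) ^ 2 + (f n z - g z) ^ 2) / 2 := by
      refine integral_mono (hdm.integrable_mul hd)
        ((hdm.integrable_sq.add hd.integrable_sq).div_const 2) fun z => ?_
      have := sq_nonneg ((f n z - f m z) - (f n z - g z))
      nlinarith
    rw [integral_div, integral_add hdm.integrable_sq hd.integrable_sq] at h4
    linarith
  linarith

lemma StrongLp.one_of_two {a b : ℝ} {f : ℕ → ℝ × Torus → ℝ} {g : ℝ × Torus → ℝ}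
    (hf : ∀ n, MemLp (f n) 2 (volume.restrict (cyl (Icc a b))))
    (hg : MemLp g 2 (volume.restrict (cyl (Icc a b)))) (h : StrongLp (Icc a b) 2 f g) :
    StrongLp (Icc a b) 1 f g := by
  set μ := (volume : Measure (ℝ × Torus)).restrict (cyl (Icc a b))
  have h1 := ENNReal.Tendsto.mul_const h (b := μ univ ^ (1 / (1 : ℝ≥0∞).toReal
    - 1 / (2 : ℝ≥0∞).toReal)) (Or.inr (ENNReal.rpow_ne_top_of_nonneg (by norm_num)
      (measure_ne_top _ _)))
  rw [zero_mul] at h1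
  exact tendsto_of_tendsto_of_tendsto_of_le_of_le tendsto_const_nhds h1 (fun _ => zero_le)
    fun n => eLpNorm_le_eLpNorm_mul_rpow_measure_univ one_le_two ((hf n).sub hg).1

/-- Compactness in `L¹` of a sequence of `W^{1,1}` fields with bounded derivatives and bounded
averages. -/
lemma exists_strong_limit (hI : I.OrdConnected) (hne : (interior I).Nonempty)
    {M : ℕ → W11Field I} (ht : UBdd I 1 fun n => (M n).dt) (hx : UBdd I 1 fun n => (M n).dx)
    {p q A : ℝ} (hpq : p < q) (hsub : Icc p q ⊆ I)
    (hA : ∀ n, |∫ z in cyl (Icc p q), (M n).val z| ≤ A) :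
    ∃ (k : ℕ → ℕ) (g : ℝ × Torus → ℝ), StrictMono k ∧ LocBddLp I 2 g ∧
      (∀ᵐ z ∂volume.restrict (cyl I), Tendsto (fun n => (M (k n)).val z) atTop (𝓝 (g z))) ∧
      ∀ a b, Icc a b ⊆ I → StrongLp (Icc a b) 1 (fun n => (M (k n)).val) g := by
  have hv : ∀ n, LocInt I (M n).val := fun n => (M n).val_bdd.locInt le_rfl
  have hU : UBdd I 2 fun n => (M n).val :=
    uBdd_two_of_average hI hne hv ht hx (fun n => (M n).weakDir_zero le_rfl)
      (fun n => (M n).weakDX) hpq hsub hA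
  obtain ⟨k, g, hk, hg, hW⟩ := hU.exists_weakL2 hI (hne.mono interior_subset)
  have hmem : ∀ a b, Icc a b ⊆ I → ∀ n,
      MemLp (M (k n)).val 2 (volume.restrict (cyl (Icc a b))) := fun a b hab n =>
    hU.memLp_cyl two_ne_zero ENNReal.ofNat_ne_top hab (k n)
  have hstrong : ∀ a b, Icc a b ⊆ I → StrongLp (Icc a b) 1 (fun n => (M (k n)).val) g := by
    intro a b hab
    have hgm := hg.memLp_cyl two_ne_zero ENNReal.ofNat_ne_top hab
    refine StrongLp.one_of_two (hmem a b hab) hgm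
      ((hW a b hab).strong_of_cauchy (hmem a b hab) hgm ?_)
    refine tendsto_eLpNorm_two hI hne (ι := ℕ × ℕ)
      (w := fun i z => (M (k i.1)).val z - (M (k i.2)).val z)
      ((hU.reindex fun i : ℕ × ℕ => k i.1).sub one_le_two (hU.reindex fun i : ℕ × ℕ => k i.2))
      ((ht.reindex fun i : ℕ × ℕ => k i.1).sub le_rfl (ht.reindex fun i : ℕ × ℕ => k i.2))
      ((hx.reindex fun i : ℕ × ℕ => k i.1).sub le_rfl (hx.reindex fun i : ℕ × ℕ => k i.2))
      (fun i => ((M (k i.1)).sub le_rfl (M (k i.2))).weakDir_zero le_rfl)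
      (fun i => ((M (k i.1)).sub le_rfl (M (k i.2))).weakDX) (fun χ hχ r s hrs => ?_) hab
    have hχ2 : MemLp (fun z : ℝ × Torus => χ z.2) 2 (volume.restrict (cyl (Icc r s))) :=
      ((locBddLp_top_of_continuous (hχ.comp continuous_snd)).memLp_cyl_top hrs).mono_exponent le_top
    have h1 := hW r s hrs _ hχ2
    have h2 := (h1.comp tendsto_fst).sub (h1.comp (tendsto_snd (f := atTop (α := ℕ))))
    rw [sub_self] at h2
    refine h2.congr fun i => ?_
    simp only [Function.comp, sub_mul]
    rw [integral_sub]
    · exact (hmem r s hrs i.1).integrable_mul hχ2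
    · exact (hmem r s hrs i.2).integrable_mul hχ2
  obtain ⟨l, hl, hae⟩ := exists_subseq_ae hI (hne.mono interior_subset)
    (fun n => (M (k n)).val_bdd.1) hg.1 hstrong
  refine ⟨k ∘ l, g, hk.comp hl, hg, hae, fun a b hab => (hstrong a b hab).comp hl.tendsto_atTop⟩

/-! ### Defect measures -/

/-- Weak-star compactness of nonnegative functions bounded in `L¹(T¹)`, by the sequential
Banach–Alaoglu theorem and the Riesz representation theorem. -/
lemma exists_weak_limit_measure {h : ℕ → Torus → ℝ} (hi : ∀ n, Integrable (h n))
    (h0 : ∀ n, ∀ᵐ θ, 0 ≤ h n θ) {C : ℝ} (hC : ∀ n, ∫ θ, ‖h n θ‖ ≤ C) :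
    ∃ (k : ℕ → ℕ) (ν : Measure Torus), StrictMono k ∧ IsFiniteMeasure ν ∧
      ∀ g : Torus → ℝ, Continuous g →
        Tendsto (fun n => ∫ θ, h (k n) θ * g θ) atTop (𝓝 (∫ θ, g θ ∂ν)) := by
  have hint : ∀ n (g : C(Torus, ℝ)), Integrable fun θ => h n θ * g θ := fun n g =>
    (hi n).mul_bdd (c := ‖g‖) g.continuous.aestronglyMeasurable
      (ae_of_all _ fun θ => g.norm_coe_le_norm θ)
  let Λ : ℕ → C(Torus, ℝ) →L[ℝ] ℝ := fun n => LinearMap.mkContinuous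
    { toFun := fun g => ∫ θ, h n θ * g θ
      map_add' := fun g g' => by
        simp only [ContinuousMap.add_apply, mul_add]
        exact integral_add (hint n g) (hint n g')
      map_smul' := fun c g => by
        simp only [ContinuousMap.smul_apply, smul_eq_mul, RingHom.id_apply]
        rw [← integral_const_mul]
        congr 1; ext θ; ring } C fun g => by
      change ‖∫ θ, h n θ * g θ‖ ≤ _
      calc ‖∫ θ, h n θ * g θ‖ ≤ ∫ θ, ‖h n θ‖ * ‖g‖ := by
            refine norm_integral_le_of_norm_le ((hi n).norm.mul_const _) (ae_of_all _ fun θ => ?_)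
            rw [norm_mul]
            exact mul_le_mul_of_nonneg_left (g.norm_coe_le_norm θ) (norm_nonneg _)
        _ ≤ C * ‖g‖ := by
            rw [integral_mul_const]
            exact mul_le_mul_of_nonneg_right (hC n) (norm_nonneg _)
  have hC0 : 0 ≤ C := (integral_nonneg fun _ => norm_nonneg _).trans (hC 0)
  have hmem : ∀ n, WeakDual.toStrongDual.symm (Λ n) ∈
      WeakDual.toStrongDual ⁻¹' Metric.closedBall (0 : StrongDual ℝ C(Torus, ℝ)) C := by
    intro n
    simp only [Set.mem_preimage, LinearEquiv.apply_symm_apply]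
    exact (mem_closedBall_zero_iff (E := StrongDual ℝ C(Torus, ℝ))).2
      (LinearMap.mkContinuous_norm_le _ hC0 _)
  obtain ⟨y, -, k, hk, hy⟩ := WeakDual.isSeqCompact_closedBall ℝ C(Torus, ℝ) 0 C hmem
  have hlim : ∀ g : C(Torus, ℝ), Tendsto (fun n => ∫ θ, h (k n) θ * g θ) atTop (𝓝 (y g)) :=
    fun g => ((WeakDual.eval_continuous g).tendsto y).comp hy
  let Λ' : CompactlySupportedContinuousMap Torus ℝ →ₚ[ℝ] ℝ :=
    { toFun := fun g => y g.toContinuousMap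
      map_add' := fun g g' => map_add y g.toContinuousMap g'.toContinuousMap
      map_smul' := fun c g => map_smul y c g.toContinuousMap
      monotone' := fun g g' hgg' => by
        refine le_of_tendsto_of_tendsto' (hlim g.toContinuousMap) (hlim g'.toContinuousMap)
          fun n => integral_mono_ae (hint _ _) (hint _ _) ?_
        filter_upwards [h0 (k n)] with θ hθ
        exact mul_le_mul_of_nonneg_left (hgg' θ) hθ }
  refine ⟨k, RealRMK.rieszMeasure Λ', hk, inferInstance, fun g hg => ?_⟩
  let g' : CompactlySupportedContinuousMap Torus ℝ :=
    { toFun := g, continuous_toFun := hg,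
      hasCompactSupport' := HasCompactSupport.of_compactSpace _ }
  have h1 := RealRMK.integral_rieszMeasure Λ' g'
  change ∫ θ, g θ ∂_ = y ⟨g, hg⟩ at h1
  rw [h1]
  exact hlim ⟨g, hg⟩

lemma shear_symm_apply (c : ℝ) (z : ℝ × Torus) :
    (shear c).symm z = (z.1, z.2 - ((c * z.1 : ℝ) : Torus)) := rfl

/-- Integration by parts along the lines `θ = y + c t`, against a function `Ψ` which is only
differentiable along these lines. -/
lemma LineAC.integral_mul_eq (hI : I.OrdConnected) {c : ℝ} {f g Ψ D : ℝ × Torus → ℝ}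
    (h : LineAC I c f g) (hf : LocInt I f) (hg : LocInt I g) (hΨ : Continuous Ψ)
    (hD : Continuous D)
    (hd : ∀ t y, HasDerivAt (fun s => Ψ (shear c (s, y))) (D (shear c (t, y))) t) {a b : ℝ}
    (hab : Icc a b ⊆ I) (hs : ∀ t ∉ Icc a b, ∀ θ, Ψ (t, θ) = 0)
    (hsD : ∀ t ∉ Icc a b, ∀ θ, D (t, θ) = 0) :
    ∫ z in cyl I, f z * D z = - ∫ z in cyl I, g z * Ψ z := by
  rw [← setIntegral_shear c I (fun z => f z * D z),
    ← setIntegral_shear c I (fun z => g z * Ψ z),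
    setIntegral_cyl_symm, setIntegral_cyl_symm, ← integral_neg]
  · apply integral_congr_ae
    filter_upwards [h] with y hy
    obtain ⟨F, h1, h2, h3⟩ := hy
    have hde : deriv (fun s => Ψ (shear c (s, y))) = fun t => D (shear c (t, y)) :=
      funext fun t => (hd t y).deriv
    have hC1 : ContDiff ℝ 1 (fun s => Ψ (shear c (s, y))) := by
      rw [contDiff_one_iff_deriv]
      refine ⟨fun t => (hd t y).differentiableAt, ?_⟩
      rw [hde]
      exact hD.comp ((shear c).continuous.comp (by fun_prop))
    have h4 := integral_mul_deriv_of_absolutelyContinuous hI h2 h3 hC1 hab (fun t ht => hs t ht _)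
    rw [hde] at h4
    refine Eq.trans ?_ h4
    apply integral_congr_ae
    filter_upwards [h1] with t h5
    rw [shear_apply, h5]
  · exact ((measurePreserving_shear c I).integrable_comp_emb (shear c).measurableEmbedding).2
      (hg.integrableOn_mul hΨ hab hs)
  · exact ((measurePreserving_shear c I).integrable_comp_emb (shear c).measurableEmbedding).2
      (hf.integrableOn_mul hD hab hsD)

/-- The integral of a test function along the lines `θ = y + c t`. -/
noncomputable def lineIntegral (I : Set ℝ) (c : ℝ) (χ : ℝ × Torus → ℝ) (y : Torus) : ℝ :=
  ∫ t in I, χ (shear c (t, y))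

lemma lineIntegral_eq (hI : I.OrdConnected) (c : ℝ) {χ : ℝ × Torus → ℝ} {a b : ℝ}
    (hle : a ≤ b) (hab : Icc a b ⊆ I) (hs : ∀ t ∉ Icc a b, ∀ θ, χ (t, θ) = 0)
    (y : Torus) : lineIntegral I c χ y = ∫ t in a..b, χ (shear c (t, y)) := by
  rw [lineIntegral, setIntegral_eq_of_subset_of_forall_sdiff_eq_zero hI.measurableSet hab,
    integral_Icc_eq_integral_Ioc, intervalIntegral.integral_of_le hle]
  exact fun t ht => hs t ht.2 _

lemma continuous_lineIntegral (hI : I.OrdConnected) (c : ℝ) {χ : ℝ × Torus → ℝ}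
    (hχ : IsTestFunction I χ) : Continuous (lineIntegral I c χ) := by
  obtain ⟨a, b, hab, hs⟩ := hχ.support
  rcases le_or_gt a b with hle | hlt
  · rw [funext (lineIntegral_eq hI c hle (hab.trans interior_subset) hs)]
    refine intervalIntegral.continuous_parametric_intervalIntegral_of_continuous
      (f := fun y t => χ (shear c (t, y))) ?_ continuous_const
    exact hχ.smoothFn.continuous.comp ((shear c).continuous.comp (by fun_prop))
  · have : lineIntegral I c χ = fun _ => 0 := by
      funext y
      rw [lineIntegral]
      simp [shear_apply, hs _ (by simp [Set.Icc_eq_empty (not_le.2 hlt)])]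
    rw [this]
    exact continuous_const

/-- A test function is, up to a multiple of `ρ(t)` on each line `θ = y + c t`, a derivative along
these lines. -/
lemma exists_line_primitive (hI : I.OrdConnected) (c : ℝ) {χ : ℝ × Torus → ℝ}
    (hχ : IsTestFunction I χ) {ρ : ℝ → ℝ} (hρ : IsTimeTest I ρ) (hρ1 : ∫ t, ρ t = 1) :
    ∃ Ψ : ℝ × Torus → ℝ, Continuous Ψ ∧ ∃ a b, Icc a b ⊆ interior I ∧
      (∀ t ∉ Icc a b, ∀ θ, Ψ (t, θ) = 0) ∧
      (∀ t ∉ Icc a b, ∀ θ,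
        ρ t * lineIntegral I c χ ((shear c).symm (t, θ)).2 - χ (t, θ) = 0) ∧
      ∀ t y, HasDerivAt (fun s => Ψ (shear c (s, y)))
        (ρ t * lineIntegral I c χ y - χ (shear c (t, y))) t := by
  obtain ⟨a₀, b₀, hab₀, hs₀⟩ := hρ.2
  obtain ⟨a₁, b₁, hab₁, hs₁⟩ := hχ.support
  obtain ⟨a, b, hab, k₀, k₁⟩ := exists_Icc_union hI hab₀ hab₁
  have hρs : ∀ t ∉ Icc a b, ρ t = 0 := fun t ht => hs₀ t fun h => ht (k₀ h)
  have hχs : ∀ t ∉ Icc a b, ∀ θ, χ (t, θ) = 0 := fun t ht => hs₁ t fun h => ht (k₁ h)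
  have hle : a ≤ b := by
    by_contra hcon
    have : ρ = fun _ => 0 := funext fun t => hρs t (by simp [Set.Icc_eq_empty hcon])
    simp [this] at hρ1
  have hH := continuous_lineIntegral hI c hχ
  set G : Torus → ℝ → ℝ := fun y s => ρ s * lineIntegral I c χ y - χ (shear c (s, y)) with hG
  have hGc : Continuous (Function.uncurry G) :=
    ((hρ.1.continuous.comp continuous_snd).mul (hH.comp continuous_fst)).sub
      (hχ.smoothFn.continuous.comp ((shear c).continuous.comp (by fun_prop)))
  have hGy : ∀ y, Continuous (G y) := fun y => hGc.comp (by fun_prop : Continuous fun s => (y, s))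
  have hGs : ∀ y, ∀ t ∉ Icc a b, G y t = 0 := fun y t ht => by
    simp only [hG, hρs t ht, shear_apply, hχs t ht]; ring
  have htotal : ∀ y, ∫ s in a..b, G y s = 0 := by
    intro y
    have hρi : ∫ s in a..b, ρ s = 1 := by
      rw [intervalIntegral.integral_of_le hle, ← integral_Icc_eq_integral_Ioc, ← hρ1]
      exact setIntegral_eq_integral_of_forall_compl_eq_zero hρs
    simp only [hG]
    rw [intervalIntegral.integral_sub, intervalIntegral.integral_mul_const, hρi, one_mul,
      lineIntegral_eq hI c hle (hab.trans interior_subset) hχs, sub_self]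
    · exact (hρ.1.continuous.mul continuous_const).intervalIntegrable _ _
    · exact (hχ.smoothFn.continuous.comp
        ((shear c).continuous.comp (by fun_prop))).intervalIntegrable _ _
  have hzero : ∀ y, ∀ t ∉ Icc a b, ∫ s in a..t, G y s = 0 := by
    intro y t ht
    rcases lt_or_ge t a with h1 | h1
    · refine (intervalIntegral.integral_congr_ae (ae_of_all _ fun s hs => ?_)).trans
        intervalIntegral.integral_zero
      rw [Set.uIoc_of_ge h1.le] at hs
      rcases eq_or_lt_of_le hs.2 with rfl | h2
      · exact (eq_zero_endpoints (hGy y) (hGs y)).1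
      · exact hGs y s fun h => absurd h.1 (not_le.2 h2)
    · have h2 : b < t := by
        by_contra h3; exact ht ⟨h1, not_lt.1 h3⟩
      rw [← intervalIntegral.integral_add_adjacent_intervals
        ((hGy y).intervalIntegrable a b) ((hGy y).intervalIntegrable b t), htotal, zero_add]
      refine (intervalIntegral.integral_congr_ae (ae_of_all _ fun s hs => ?_)).trans
        intervalIntegral.integral_zero
      rw [Set.uIoc_of_le h2.le] at hs
      exact hGs y s fun h => absurd h.2 (not_le.2 hs.1)
  have hΨ₀ : Continuous fun z : ℝ × Torus => ∫ s in a..z.1, G z.2 s :=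
    intervalIntegral.continuous_parametric_intervalIntegral_of_continuous
      (f := fun z : ℝ × Torus => G z.2)
      (hGc.comp (by fun_prop : Continuous fun q : (ℝ × Torus) × ℝ => (q.1.2, q.2))) continuous_fst
  refine ⟨fun z => ∫ s in a..z.1, G ((shear c).symm z).2 s,
    hΨ₀.comp (f := fun z => ((shear c).symm z)) (shear c).symm.continuous, a, b, hab,
    fun t ht θ => hzero _ t ht, fun t ht θ => ?_, fun t y => ?_⟩
  · rw [hρs t ht, hχs t ht]; ring
  · have e : (fun s => ∫ r in a..(shear c (s, y)).1, G ((shear c).symm (shear c (s, y))).2 r)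
        = fun s => ∫ r in a..s, G y r := by
      funext s
      rw [(shear c).symm_apply_apply]
      rfl
    rw [e]
    exact intervalIntegral.integral_hasDerivAt_right ((hGy y).intervalIntegrable _ _)
      ((hGy y).stronglyMeasurableAtFilter _ _) (hGy y).continuousAt

/-- Integration along the lines `θ = y + c t` of a function on `I × T¹`, with weight `ρ` in time. -/
lemma integral_line_moment {c : ℝ} {E : ℝ × Torus → ℝ}
    (hE : LocInt I E) {ρ : ℝ → ℝ} (hρ : IsTimeTest I ρ) {H : Torus → ℝ} (hH : Continuous H) :
    Integrable (fun y => ∫ t in I, ρ t * E (shear c (t, y))) ∧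
      ∫ y, (∫ t in I, ρ t * E (shear c (t, y))) * H y
        = ∫ z in cyl I, E z * (ρ z.1 * H ((shear c).symm z).2) := by
  obtain ⟨a, b, hab, hs⟩ := hρ.2
  have hab' := hab.trans interior_subset
  have h1 := ((measurePreserving_shear c I).integrable_comp_emb (shear c).measurableEmbedding).2
    (hE.integrableOn_mul (ψ := fun z => ρ z.1) (hρ.1.continuous.comp continuous_fst) hab'
      fun t ht _ => hs t ht)
  have h2 := ((measurePreserving_shear c I).integrable_comp_emb (shear c).measurableEmbedding).2
    (hE.integrableOn_mul (ψ := fun z => ρ z.1 * H ((shear c).symm z).2)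
      ((hρ.1.continuous.comp continuous_fst).mul
        (hH.comp (continuous_snd.comp (shear c).symm.continuous))) hab'
      fun t ht _ => by rw [hs t ht, zero_mul])
  constructor
  · rw [restrict_cyl] at h1
    refine h1.integral_prod_right.congr (ae_of_all _ fun y => ?_)
    refine integral_congr_ae (ae_of_all _ fun t => ?_)
    simp only [Function.comp, shear_apply]
    ring
  · rw [← setIntegral_shear c I]
    refine Eq.trans ?_ (setIntegral_cyl_symm h2).symm
    refine integral_congr_ae (ae_of_all _ fun y => ?_)
    dsimp only
    rw [← integral_mul_const]
    refine integral_congr_ae (ae_of_all _ fun t => ?_)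
    simp only [Function.comp, (shear c).symm_apply_apply]
    rw [shear_apply]
    ring

/-- If `X E = N` and `X E' = N'` for the derivative `X = ∂_t + c ∂_θ`, then an integral of `E` is
determined by the moment of `E` in time, along lines, with weight `ρ`, and by `N`. -/
lemma integral_mul_test_eq (hI : I.OrdConnected) (hne : (interior I).Nonempty) {c : ℝ}
    {E N χ Ψ : ℝ × Torus → ℝ} (hE : LocInt I E) (hN : LocInt I N) (h : WeakDir I c E N)
    (hχ : IsTestFunction I χ) {ρ : ℝ → ℝ} (hρ : IsTimeTest I ρ) {a b : ℝ}
    (hab : Icc a b ⊆ interior I) (hΨ : Continuous Ψ)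
    (hs : ∀ t ∉ Icc a b, ∀ θ, Ψ (t, θ) = 0)
    (hs' : ∀ t ∉ Icc a b, ∀ θ,
        ρ t * lineIntegral I c χ ((shear c).symm (t, θ)).2 - χ (t, θ) = 0)
    (hd : ∀ t y, HasDerivAt (fun s => Ψ (shear c (s, y)))
        (ρ t * lineIntegral I c χ y - χ (shear c (t, y))) t) :
    ∫ z in cyl I, E z * χ z
      = (∫ y, (∫ t in I, ρ t * E (shear c (t, y))) * lineIntegral I c χ y)
        + ∫ z in cyl I, N z * Ψ z := by
  have hH := continuous_lineIntegral hI c hχ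
  have hc1 : Continuous fun z : ℝ × Torus => ρ z.1 * lineIntegral I c χ ((shear c).symm z).2 :=
    (hρ.1.continuous.comp continuous_fst).mul
      (hH.comp (continuous_snd.comp (shear c).symm.continuous))
  have h1 := (h.lineAC hI hne hE hN).integral_mul_eq hI hE hN hΨ
    (D := fun z => ρ z.1 * lineIntegral I c χ ((shear c).symm z).2 - χ z)
    (hc1.sub hχ.smoothFn.continuous) (fun t y => by
      rw [(shear c).symm_apply_apply]
      exact hd t y) (hab.trans interior_subset) hs hs'
  obtain ⟨a₀, b₀, hab₀, hs₀⟩ := hρ.2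
  simp only [mul_sub] at h1
  rw [integral_sub (hE.integrableOn_mul hc1 (hab₀.trans interior_subset)
    fun t ht θ => by rw [hs₀ t ht, zero_mul]) (hE.integrableOn_mul_test hχ)] at h1
  rw [(integral_line_moment hE hρ hH).2]
  linarith

/-- The defect measure of a sequence of nonnegative functions `E n` transported along the lines
`θ = y + c t`, with sources `N n` which converge in the sense of distributions: it is transported
without source, hence constant along these lines. -/
lemma exists_defect (hI : I.OrdConnected) (hne : (interior I).Nonempty) {c : ℝ}
    {E N : ℕ → ℝ × Torus → ℝ} {E' N' : ℝ × Torus → ℝ} (hE : UBdd I 1 E) (hN : UBdd I 1 N)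
    (hE' : LocBddLp I 1 E') (hN' : LocBddLp I 1 N') (h : ∀ n, WeakDir I c (E n) (N n))
    (h' : WeakDir I c E' N') (h0 : ∀ n, ∀ t ∈ I, ∀ θ, 0 ≤ E n (t, θ))
    (hlim : ∀ ψ, IsTestFunction I ψ →
      Tendsto (fun n => ∫ z in cyl I, N n z * ψ z) atTop (𝓝 (∫ z in cyl I, N' z * ψ z))) :
    ∃ (k : ℕ → ℕ) (η : SignedMeasure Torus), StrictMono k ∧ ∀ χ, IsTestFunction I χ →
      Tendsto (fun n => ∫ z in cyl I, E (k n) z * χ z) atTop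
        (𝓝 ((∫ z in cyl I, E' z * χ z) + ∫ᵛ y, lineIntegral I c χ y ∂<•η)) := by
  obtain ⟨ρ, hρ, hρ0, hρ1⟩ := exists_timeTest hne
  have hEl := fun n => hE.locInt le_rfl n
  have hEl' := hE'.locInt le_rfl
  have hNl' := hN'.locInt le_rfl
  obtain ⟨a₀, b₀, hab₀, hs₀⟩ := hρ.2
  have hab₀' := hab₀.trans interior_subset
  obtain ⟨K, hK⟩ := (isCompact_cyl_Icc a₀ b₀).exists_bound_of_continuousOn
    (f := fun z : ℝ × Torus => ρ z.1) (hρ.1.continuous.comp continuous_fst).continuousOn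
  obtain ⟨C, hC⟩ := hE.eLpNorm_cyl_le one_ne_zero ENNReal.one_ne_top hab₀'
  have hpos : ∀ n y, 0 ≤ ∫ t in I, ρ t * E n (shear c (t, y)) := fun n y =>
    setIntegral_nonneg hI.measurableSet fun t ht => mul_nonneg (hρ0 t) (h0 n t ht _)
  -- The moments of `E n` along lines are bounded in `L¹(T¹)`, and have a limit measure `ν`.
  obtain ⟨k, ν, hk, hν, hlimν⟩ := exists_weak_limit_measure
    (h := fun n y => ∫ t in I, ρ t * E n (shear c (t, y)))
    (fun n => (integral_line_moment (hEl n) hρ continuous_const (H := fun _ => 0)).1)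
    (fun n => ae_of_all _ (hpos n)) (C := K * C) (fun n => by
      have h1 := (integral_line_moment (c := c) (hEl n) hρ continuous_const (H := fun _ => 1)).2
      simp only [mul_one] at h1
      simp only [Real.norm_of_nonneg (hpos n _)]
      rw [h1, setIntegral_cyl_eq_of_support hI.measurableSet hab₀' fun t ht θ => by
        rw [hs₀ t ht, mul_zero]]
      have hi := (hEl n).2 a₀ b₀ hab₀'
      calc ∫ z in cyl (Icc a₀ b₀), E n z * ρ z.1
          ≤ ∫ z in cyl (Icc a₀ b₀), K * ‖E n z‖ := by
            refine setIntegral_mono_on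
              (hi.mul_continuousOn (hρ.1.continuous.comp continuous_fst).continuousOn
                (isCompact_cyl_Icc a₀ b₀)) (hi.norm.const_mul _)
              (measurableSet_cyl measurableSet_Icc) fun z hz => ?_
            refine (le_abs_self _).trans ?_
            rw [abs_mul, mul_comm]
            exact mul_le_mul_of_nonneg_right (hK z hz) (abs_nonneg _)
        _ ≤ K * C := by
            rw [integral_const_mul]
            rcases isEmpty_or_nonempty (cyl (Icc a₀ b₀)) with hem | ⟨⟨z, hz⟩⟩
            · exfalso
              have : ρ = fun _ => 0 := funext fun t => hs₀ t fun ht =>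
                hem.false ⟨(t, 0), ht, trivial⟩
              simp [this] at hρ1
            · exact mul_le_mul_of_nonneg_left
                (integral_norm_le_of_eLpNorm hi.1 ENNReal.coe_ne_top (hC n))
                ((norm_nonneg _).trans (hK z hz)))
  -- The defect compares `ν` with the moment of `E'`.
  have hmom' := integral_line_moment (c := c) hEl' hρ (continuous_const (y := (0 : ℝ)))
  refine ⟨k, ν.toSignedMeasure - (volume : Measure Torus).withDensityᵥ
    fun y => ∫ t in I, ρ t * E' (shear c (t, y)), hk, fun χ hχ => ?_⟩
  obtain ⟨Ψ, hΨ, a, b, hab, hs, hs', hd⟩ := exists_line_primitive hI c hχ hρ hρ1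
  have hH := continuous_lineIntegral hI c hχ
  rw [VectorMeasure.integral_sub_vectorMeasure (integrable_signedMeasure _ hH)
    (integrable_signedMeasure _ hH), VectorMeasure.integral_toSignedMeasure,
    integral_withDensityV hmom'.1 hH,
    integral_mul_test_eq hI hne hEl' hNl' h' hχ hρ hab hΨ hs hs' hd]
  -- The sources converge against `Ψ`, which is merely continuous, by the density lemma.
  have hstar : Tendsto (fun n => ∫ z in cyl I, N n z * Ψ z) atTop
      (𝓝 (∫ z in cyl I, N' z * Ψ z)) := by
    have hab' := hab.trans interior_subset
    have hcyl : ∀ u : ℝ × Torus → ℝ, ∫ z in cyl I, u z * Ψ z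
        = ∫ z in cyl (Icc a b), u z * Ψ z := fun u =>
      setIntegral_cyl_eq_of_support hI.measurableSet hab' fun t ht θ => by rw [hs t ht θ, mul_zero]
    simp only [hcyl]
    rw [← pairing_dens hI hNl' hab' hΨ]
    refine weakStarMeasure_of_test hI hN (hN'.dens hI) (fun φ hφ => ?_) hab' Ψ hΨ
    rw [pairing_dens_test hI hNl' hφ]
    exact hlim φ hφ
  have h1 := (hlimν _ hH).add (hstar.comp hk.tendsto_atTop)
  have e : ∀ x y w : ℝ, x + y + (w - x) = w + y := fun x y w => by ring
  rw [e]
  refine h1.congr fun n => ?_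
  exact (integral_mul_test_eq hI hne (hEl _) (hN.locInt le_rfl _) (h _) hχ hρ hab hΨ hs hs' hd).symm

/-! ### Transported measures and their potentials -/

/-- The measure `η` transported along the lines `θ = y + c t`. -/
noncomputable def transport (c : ℝ) (η : SignedMeasure Torus) (t : ℝ) : SignedMeasure Torus :=
  η.map (Homeomorph.addRight ((c * t : ℝ) : Torus))

lemma integral_transport (c : ℝ) (η : SignedMeasure Torus) (t : ℝ) (g : Torus → ℝ) :
    ∫ᵛ θ, g θ ∂<•(transport c η t) = ∫ᵛ y, g (y + ((c * t : ℝ) : Torus)) ∂<•η :=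
  VectorMeasure.integral_map_equiv
    (Homeomorph.addRight ((c * t : ℝ) : Torus)).toMeasurableEquiv g

lemma integral_signedMeasure_eq (η : SignedMeasure Torus) {g : Torus → ℝ} (hg : Measurable g)
    {K : ℝ} (hK : ∀ θ, ‖g θ‖ ≤ K) :
    ∫ᵛ y, g y ∂<•η = (∫ y, g y ∂η.toJordanDecomposition.posPart)
      - ∫ y, g y ∂η.toJordanDecomposition.negPart := by
  conv_lhs => rw [← η.toSignedMeasure_toJordanDecomposition]
  rw [JordanDecomposition.toSignedMeasure, VectorMeasure.integral_sub_vectorMeasure,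
    VectorMeasure.integral_toSignedMeasure, VectorMeasure.integral_toSignedMeasure]
  all_goals
    change Integrable g _
    exact Integrable.of_bound hg.aestronglyMeasurable K (ae_of_all _ hK)

lemma continuous_integral_transport (c : ℝ) (η : SignedMeasure Torus) {ψ : ℝ × Torus → ℝ}
    (hψ : Continuous ψ) : Continuous fun t => ∫ᵛ y, ψ (shear c (t, y)) ∂<•η := by
  have hc : Continuous fun z : ℝ × Torus => ψ (shear c z) := hψ.comp (shear c).continuous
  have e : ∀ t, ∫ᵛ y, ψ (shear c (t, y)) ∂<•η
      = (∫ y, ψ (shear c (t, y)) ∂η.toJordanDecomposition.posPart)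
        - ∫ y, ψ (shear c (t, y)) ∂η.toJordanDecomposition.negPart := fun t =>
    integral_signedMeasure_eq η (hc.comp (by fun_prop)).measurable
      (K := ‖(⟨fun y => ψ (shear c (t, y)), hc.comp (by fun_prop)⟩ : C(Torus, ℝ))‖)
      fun θ => (⟨fun y => ψ (shear c (t, y)), hc.comp (by fun_prop)⟩ : C(Torus, ℝ)).norm_coe_le_norm θ
  simp only [e]
  have h : ∀ μ : Measure Torus, IsFiniteMeasure μ →
      Continuous fun t => ∫ y, ψ (shear c (t, y)) ∂μ := by
    intro μ hμ
    have := continuous_parametric_integral_of_continuous (μ := μ) (s := univ)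
      (f := fun t y => ψ (shear c (t, y))) hc isCompact_univ
    simpa using this
  exact (h _ inferInstance).sub (h _ inferInstance)

lemma locBddMeasure_transport (c : ℝ) (η : SignedMeasure Torus) :
    LocBddMeasure I (transport c η) := by
  refine ⟨fun g => ?_, fun a b _ => ⟨(η.variation univ).toNNReal, ae_of_all _ fun t => ?_⟩⟩
  · simp only [integral_transport]
    exact (continuous_integral_transport c η (ψ := fun z => g z.2)
      (g.continuous.comp continuous_snd)).aemeasurable
  · rw [ENNReal.coe_toNNReal (measure_ne_top _ _)]
    refine (VectorMeasure.variation_map_le (μ := η) _).trans ?_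
    rw [Measure.map_apply (Homeomorph.addRight ((c * t : ℝ) : Torus)).continuous.measurable
      MeasurableSet.univ, Set.preimage_univ]

lemma pairing_transport (hI : I.OrdConnected) (c : ℝ) (η : SignedMeasure Torus)
    {χ : ℝ × Torus → ℝ} (hχ : IsTestFunction I χ) :
    pairing I (transport c η) χ = ∫ᵛ y, lineIntegral I c χ y ∂<•η := by
  obtain ⟨a, b, hab, hs⟩ := hχ.support
  have hab' := hab.trans interior_subset
  have hc : Continuous fun z : ℝ × Torus => χ (shear c z) :=
    hχ.smoothFn.continuous.comp (shear c).continuous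
  have hL := continuous_lineIntegral hI c hχ
  have hbd : ∀ g : Torus → ℝ, ∀ hg : Continuous g, ∀ θ, ‖g θ‖ ≤ ‖(⟨g, hg⟩ : C(Torus, ℝ))‖ :=
    fun g hg θ => (⟨g, hg⟩ : C(Torus, ℝ)).norm_coe_le_norm θ
  rw [pairing_congr_support hI.measurableSet hab' hs, pairing,
    integral_signedMeasure_eq η hL.measurable (hbd _ hL)]
  have e : ∀ t, ∫ᵛ θ, χ (t, θ) ∂<•(transport c η t)
      = (∫ y, χ (shear c (t, y)) ∂η.toJordanDecomposition.posPart)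
        - ∫ y, χ (shear c (t, y)) ∂η.toJordanDecomposition.negPart := fun t => by
    have hct : Continuous fun y => χ (shear c (t, y)) := hc.comp (by fun_prop)
    rw [integral_transport]
    exact integral_signedMeasure_eq η hct.measurable (hbd _ hct)
  simp only [e]
  have hsw : ∀ μ : Measure Torus, IsFiniteMeasure μ →
      IntegrableOn (fun t => ∫ y, χ (shear c (t, y)) ∂μ) (Icc a b) ∧
      ∫ t in Icc a b, ∫ y, χ (shear c (t, y)) ∂μ = ∫ y, lineIntegral I c χ y ∂μ := by
    intro μ hμ
    have hint : Integrable (fun z : ℝ × Torus => χ (shear c z))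
        ((volume.restrict (Icc a b)).prod μ) := by
      obtain ⟨K, hK⟩ := (isCompact_cyl_Icc a b).exists_bound_of_continuousOn hc.continuousOn
      refine Integrable.of_bound hc.aestronglyMeasurable K ?_
      rw [Measure.ae_prod_iff_ae_ae (measurableSet_le hc.norm.measurable measurable_const)]
      filter_upwards [ae_restrict_mem measurableSet_Icc] with t ht
      exact ae_of_all _ fun y => hK (t, y) ⟨ht, trivial⟩
    refine ⟨hint.integral_prod_left, (integral_integral_swap hint).trans ?_⟩
    refine integral_congr_ae (ae_of_all _ fun y => ?_)
    exact (setIntegral_eq_of_subset_of_forall_sdiff_eq_zero hI.measurableSet hab'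
      fun t ht => hs t ht.2 _).symm
  rw [integral_sub (hsw _ inferInstance).1 (hsw _ inferInstance).1, (hsw _ inferInstance).2,
    (hsw _ inferInstance).2]

/-- The sawtooth function: `1/2 - x` for `x ∈ (0, 1]`. Its derivative is `δ - 1`. -/
noncomputable def sawtooth (θ : Torus) : ℝ := 1 / 2 - (AddCircle.equivIoc 1 0 θ : ℝ)

lemma measurable_sawtooth : Measurable sawtooth :=
  measurable_const.sub (measurable_subtype_coe.comp (AddCircle.measurableEquivIoc 1 0).measurable)

lemma abs_sawtooth_le (θ : Torus) : ‖sawtooth θ‖ ≤ 1 / 2 := by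
  have h := (AddCircle.equivIoc 1 0 θ).2
  rw [Real.norm_eq_abs, sawtooth, abs_le]
  constructor <;> linarith [h.1, h.2]

lemma integral_sawtooth_mul {χ χ' : Torus → ℝ} (hχ' : Continuous χ')
    (h : ∀ x : ℝ, HasDerivAt (fun x : ℝ => χ (x : Torus)) (χ' (x : Torus)) x) :
    ∫ θ, sawtooth θ * χ' θ = (∫ θ, χ θ) - χ 0 := by
  have hcoe : Continuous fun x : ℝ => (x : Torus) := AddCircle.continuous_mk' 1
  rw [← UnitAddCircle.intervalIntegral_preimage 0, ← UnitAddCircle.intervalIntegral_preimage 0,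
    zero_add]
  have e : ∫ x in (0 : ℝ)..1, sawtooth (x : Torus) * χ' (x : Torus)
      = ∫ x in (0 : ℝ)..1, (1 / 2 - x) * χ' (x : Torus) := by
    refine intervalIntegral.integral_congr_ae (ae_of_all _ fun x hx => ?_)
    rw [Set.uIoc_of_le zero_le_one] at hx
    rw [sawtooth, AddCircle.equivIoc_coe_of_mem (by rwa [zero_add])]
  rw [e, intervalIntegral.integral_mul_deriv_eq_deriv_mul (u := fun x => 1 / 2 - x)
    (u' := fun _ => -1) (v := fun x : ℝ => χ (x : Torus))
    (fun x _ => (hasDerivAt_id' x).const_sub (1 / 2))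
    (fun x _ => h x) (by simp) ((hχ'.comp hcoe).intervalIntegrable _ _)]
  have h1 : ((1 : ℝ) : Torus) = 0 := by
    rw [AddCircle.coe_period]
  have h0 : ((0 : ℝ) : Torus) = 0 := rfl
  simp only [h1, h0, neg_one_mul, intervalIntegral.integral_neg]
  ring

/-- The potential of a signed measure: its derivative is `η - η(T¹)`. -/
noncomputable def potential (η : SignedMeasure Torus) (y : Torus) : ℝ :=
  ∫ᵛ z, sawtooth (y - z) ∂<•η

lemma measurable_sawtooth_sub (w : Torus) : Measurable fun z => sawtooth (w - z) :=
  measurable_sawtooth.comp (measurable_const.sub measurable_id)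

lemma potential_eq (η : SignedMeasure Torus) (y : Torus) :
    potential η y = (∫ z, sawtooth (y - z) ∂η.toJordanDecomposition.posPart)
      - ∫ z, sawtooth (y - z) ∂η.toJordanDecomposition.negPart :=
  integral_signedMeasure_eq η (measurable_sawtooth_sub y) fun _ => abs_sawtooth_le _

lemma measurable_potential (η : SignedMeasure Torus) : Measurable (potential η) := by
  have h : ∀ μ : Measure Torus, IsFiniteMeasure μ →
      Measurable fun y => ∫ z, sawtooth (y - z) ∂μ := fun μ hμ =>
    (StronglyMeasurable.integral_prod_right (f := fun y z => sawtooth (y - z))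
      (measurable_sawtooth.comp (measurable_fst.sub measurable_snd)).stronglyMeasurable).measurable
  rw [funext (potential_eq η)]
  exact (h _ inferInstance).sub (h _ inferInstance)

lemma abs_potential_le (η : SignedMeasure Torus) (y : Torus) :
    |potential η y| ≤ 1 / 2 * (η.variation univ).toNNReal :=
  abs_integral_signedMeasure_le (fun _ => abs_sawtooth_le _)
    (by rw [ENNReal.coe_toNNReal (measure_ne_top _ _)])

/-- The weak derivative of a translated potential: `potential η` is the convolution of `η` with the
sawtooth function. -/
lemma integral_potential_mul (η : SignedMeasure Torus) {χ χ' : Torus → ℝ} (hχ : Continuous χ)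
    (hχ' : Continuous χ')
    (h : ∀ x : ℝ, HasDerivAt (fun x : ℝ => χ (x : Torus)) (χ' (x : Torus)) x) (w : Torus) :
    ∫ θ, potential η (θ - w) * χ' θ
      = η univ * (∫ θ, χ θ) - ∫ᵛ y, χ (y + w) ∂<•η := by
  have hbd : ∀ g : Torus → ℝ, ∀ hg : Continuous g, ∀ θ, ‖g θ‖ ≤ ‖(⟨g, hg⟩ : C(Torus, ℝ))‖ :=
    fun g hg θ => (⟨g, hg⟩ : C(Torus, ℝ)).norm_coe_le_norm θ
  have hshift : ∀ z, ∫ θ, sawtooth (θ - w - z) * χ' θ = (∫ θ, χ θ) - χ (z + w) := by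
    intro z
    rw [← integral_add_right_eq_self _ (z + w), ← integral_add_right_eq_self χ (z + w)]
    have e : ∀ θ : Torus, θ + (z + w) - w - z = θ := fun θ => by abel
    simp only [e]
    have := integral_sawtooth_mul (χ := fun θ => χ (θ + (z + w))) (χ' := fun θ => χ' (θ + (z + w)))
      (hχ'.comp (continuous_id.add continuous_const)) (fun x => by
        revert x
        refine torus_forall (p := fun v => ∀ x : ℝ, HasDerivAt (fun x : ℝ => χ ((x : Torus) + v))
          (χ' ((x : Torus) + v)) x) (fun v x => ?_) (z + w)
        have h1 := h (x + v)
        simpa using h1.comp_add_const x v)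
    simpa using this
  have hμ : ∀ μ : Measure Torus, IsFiniteMeasure μ →
      Integrable (fun θ => (∫ z, sawtooth (θ - w - z) ∂μ) * χ' θ) ∧
      ∫ θ, (∫ z, sawtooth (θ - w - z) ∂μ) * χ' θ
        = μ.real univ * (∫ θ, χ θ) - ∫ z, χ (z + w) ∂μ := by
    intro μ hμ
    have hm : Measurable fun p : Torus × Torus => sawtooth (p.1 - w - p.2) * χ' p.1 :=
      (measurable_sawtooth.comp ((measurable_fst.sub measurable_const).sub measurable_snd)).mul
        (hχ'.measurable.comp measurable_fst)
    have hint : Integrable (fun p : Torus × Torus => sawtooth (p.1 - w - p.2) * χ' p.1)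
        ((volume : Measure Torus).prod μ) := by
      refine Integrable.of_bound hm.aestronglyMeasurable (1 / 2 * ‖(⟨χ', hχ'⟩ : C(Torus, ℝ))‖)
        (ae_of_all _ fun p => ?_)
      rw [norm_mul]
      exact mul_le_mul (abs_sawtooth_le _) (hbd χ' hχ' _) (norm_nonneg _) (by norm_num)
    have e : ∀ θ, (∫ z, sawtooth (θ - w - z) ∂μ) * χ' θ
        = ∫ z, sawtooth (θ - w - z) * χ' θ ∂μ := fun θ => (integral_mul_const _ _).symm
    simp only [e]
    refine ⟨hint.integral_prod_left, ?_⟩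
    have hcw : Continuous fun z => χ (z + w) := hχ.comp (continuous_id.add continuous_const)
    rw [integral_integral_swap hint]
    simp only [hshift]
    rw [integral_sub (integrable_const _) (Integrable.of_bound hcw.aestronglyMeasurable _
      (ae_of_all _ (hbd _ hcw))), integral_const, smul_eq_mul]
  have hcw : Continuous fun z => χ (z + w) := hχ.comp (continuous_id.add continuous_const)
  simp only [potential_eq, sub_mul]
  rw [integral_sub (hμ _ inferInstance).1 (hμ _ inferInstance).1, (hμ _ inferInstance).2,
    (hμ _ inferInstance).2, integral_signedMeasure_eq η hcw.measurable (hbd _ hcw)]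
  have hmass : η univ = η.toJordanDecomposition.posPart.real univ
      - η.toJordanDecomposition.negPart.real univ := by
    conv_lhs => rw [← η.toSignedMeasure_toJordanDecomposition]
    rw [JordanDecomposition.toSignedMeasure, sub_apply,
      Measure.toSignedMeasure_apply_measurable MeasurableSet.univ,
      Measure.toSignedMeasure_apply_measurable MeasurableSet.univ]
  rw [hmass]
  ring

/-! ### Solutions of the homogeneous wave equation with bounded measures as derivatives -/

section Waves

variable (hI : I.OrdConnected)

include hI

lemma pairing_add_test {m m' : ℝ → SignedMeasure Torus} (h : LocBddMeasure I m)
    (h' : LocBddMeasure I m') {ψ : ℝ × Torus → ℝ} (hψ : IsTestFunction I ψ) :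
    pairing I (fun t => m t + m' t) ψ = pairing I m ψ + pairing I m' ψ := by
  obtain ⟨a, b, hab, hs⟩ := hψ.support
  have hab' := hab.trans interior_subset
  rw [pairing_congr_support hI.measurableSet hab' hs, pairing_congr_support hI.measurableSet hab' hs,
    pairing_congr_support hI.measurableSet hab' hs,
    pairing_add_measure h h' hab' hψ.smoothFn.continuous]

/-- A left- or right-moving wave, with the profile `potential η`. -/
noncomputable def profileWave (c : ℝ) (η : SignedMeasure Torus) (z : ℝ × Torus) : ℝ :=
  potential η ((shear c).symm z).2

omit hI in
lemma locBddLp_profileWave (c : ℝ) (η : SignedMeasure Torus) :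
    LocBddLp I ⊤ (profileWave c η) := by
  refine ⟨((measurable_potential η).comp (measurable_snd.comp
    (shear c).symm.continuous.measurable)).aestronglyMeasurable, fun a b _ =>
    ⟨(1 / 2) * (η.variation univ).toNNReal, ae_of_all _ fun t => ?_⟩⟩
  refine (eLpNorm_le_of_ae_bound (C := 1 / 2 * (η.variation univ).toNNReal)
    (ae_of_all _ fun θ => abs_potential_le η _)).trans ?_
  simp only [ENNReal.toReal_top, inv_zero, ENNReal.rpow_zero, one_mul]
  exact ENNReal.ofReal_le_of_le_toReal (by simp; exact le_rfl)

lemma weakDir_profileWave (c : ℝ) (η : SignedMeasure Torus) :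
    WeakDir I c (profileWave c η) (fun _ => 0) := by
  refine LineAC.weakDir hI (ae_of_all _ fun y => ?_) ((locBddLp_profileWave c η).locInt le_top)
    ((locBddLp_top_of_continuous continuous_const).locInt le_top)
  have e : (fun t => profileWave c η (t, y + ((c * t : ℝ) : Torus))) = fun _ => potential η y := by
    funext t
    rw [← shear_apply, profileWave, (shear c).symm_apply_apply]
  rw [e]
  simpa using LineAC1.of_contDiff (I := I) (u := fun _ : ℝ => potential η y) contDiff_const

lemma profileWave_weak_dx (c : ℝ) (η : SignedMeasure Torus) {ψ : ℝ × Torus → ℝ}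
    (hψ : IsTestFunction I ψ) :
    ∫ z in cyl I, profileWave c η z * partialX ψ z
      = η univ * (∫ z in cyl I, ψ z) - pairing I (transport c η) ψ := by
  obtain ⟨a, b, hab, hs⟩ := hψ.support
  have hab' := hab.trans interior_subset
  have hV := (locBddLp_profileWave (I := I) c η).locInt le_top
  have hone : LocInt I (fun _ => (1 : ℝ)) :=
    (locBddLp_top_of_continuous continuous_const).locInt le_top
  have hi : IntegrableOn ψ (cyl (Icc a b)) :=
    hψ.smoothFn.continuous.continuousOn.integrableOn_compact (isCompact_cyl_Icc a b)
  rw [setIntegral_cyl_eq_of_support hI.measurableSet hab' fun t ht θ => by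
      rw [IsTestFunction.partialX_support hs ht, mul_zero],
    setIntegral_cyl_eq_of_support hI.measurableSet hab' hs,
    pairing_congr_support hI.measurableSet hab' hs,
    setIntegral_cyl (f := fun z => profileWave c η z * partialX ψ z) ((hV.2 a b hab').mul_continuousOn
      hψ.partialX.smoothFn.continuous.continuousOn (isCompact_cyl_Icc a b)),
    setIntegral_cyl hi, pairing, ← integral_const_mul, ← integral_sub]
  · refine integral_congr_ae (ae_of_all _ fun t => ?_)
    have hx : ∀ x : ℝ, HasDerivAt (fun x : ℝ => ψ (t, (x : Torus))) (partialX ψ (t, (x : Torus))) x := by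
      intro x
      have h1 : HasDerivAt (fun s : ℝ => ψ (t, (x : Torus) + (s : Torus)))
          (partialX ψ (t, (x : Torus))) (x - x) := by
        rw [sub_self]; exact hψ.smoothFn.hasDerivAt_X t (x : Torus)
      refine (h1.comp_sub_const x x).congr_of_eventuallyEq (Eventually.of_forall fun s => ?_)
      dsimp only
      rw [← AddCircle.coe_add, add_sub_cancel]
    simp only [profileWave, shear_symm_apply, integral_transport]
    exact integral_potential_mul η (χ := fun θ => ψ (t, θ)) (χ' := fun θ => partialX ψ (t, θ))
      (hψ.smoothFn.continuous.comp (by fun_prop))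
      (hψ.partialX.smoothFn.continuous.comp (by fun_prop)) hx _
  · rw [IntegrableOn, restrict_cyl] at hi
    exact hi.integral_prod_left.const_mul _
  · exact (locBddMeasure_transport (I := I) c η).integrableOn hψ.smoothFn.continuous hab'

lemma profileWave_weak_dt (c : ℝ) (η : SignedMeasure Torus) {ψ : ℝ × Torus → ℝ}
    (hψ : IsTestFunction I ψ) :
    ∫ z in cyl I, profileWave c η z * partialT ψ z
      = -c * ∫ z in cyl I, profileWave c η z * partialX ψ z := by
  have hV := (locBddLp_profileWave (I := I) c η).locInt le_top
  have h := weakDir_profileWave hI c η ψ hψ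
  have e : ∀ z, profileWave c η z * lineD c ψ z
      = profileWave c η z * partialT ψ z + c * (profileWave c η z * partialX ψ z) :=
    fun z => by rw [lineD]; ring
  simp only [e, zero_mul, integral_zero, neg_zero] at h
  rw [integral_add (hV.integrableOn_mul_test hψ.partialT)
    ((hV.integrableOn_mul_test hψ.partialX).const_mul c), integral_const_mul] at h
  linarith

lemma weakDir_time (c : ℝ) : WeakDir I c (fun z => z.1) (fun _ => 1) :=
  (LineAC.time I c).weakDir hI ((locBddLp_top_of_continuous continuous_fst).locInt le_top)
    ((locBddLp_top_of_continuous continuous_const).locInt le_top)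

omit hI in
lemma locInt_of_continuous {f : ℝ × Torus → ℝ} (hf : Continuous f) : LocInt I f :=
  (locBddLp_top_of_continuous hf).locInt le_top

lemma time_weak {ψ : ℝ × Torus → ℝ} (hψ : IsTestFunction I ψ) :
    ∫ z in cyl I, z.1 * partialT ψ z = -∫ z in cyl I, ψ z ∧
      ∫ z in cyl I, z.1 * partialX ψ z = 0 := by
  constructor
  · simpa [lineD] using weakDir_time hI 0 ψ hψ
  · have h : WeakDX I (fun z => z.1) (fun _ => 0) :=
      WeakDir.weakDX (locInt_of_continuous continuous_fst) (locInt_of_continuous continuous_const)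
        (locInt_of_continuous continuous_const) (weakDir_time hI 0)
        (by simpa using weakDir_time hI 1)
    simpa using h ψ hψ

/-- The time derivative of the wave defined by two transported measures. -/
noncomputable def waveDt (η₁ η₂ : SignedMeasure Torus) (t : ℝ) : SignedMeasure Torus :=
  (1 / 2 : ℝ) • transport 1 η₁ t + (1 / 2 : ℝ) • transport (-1) η₂ t

/-- The space derivative, up to a constant, of the wave defined by two transported measures. -/
noncomputable def waveDx (η₁ η₂ : SignedMeasure Torus) (t : ℝ) : SignedMeasure Torus :=
  (-1 / 2 : ℝ) • transport 1 η₁ t + (1 / 2 : ℝ) • transport (-1) η₂ t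

omit hI in
lemma locBddMeasure_waveDt (η₁ η₂ : SignedMeasure Torus) : LocBddMeasure I (waveDt η₁ η₂) :=
  ((locBddMeasure_transport 1 η₁).const_smul _).add ((locBddMeasure_transport (-1) η₂).const_smul _)

omit hI in
lemma locBddMeasure_waveDx (η₁ η₂ : SignedMeasure Torus) : LocBddMeasure I (waveDx η₁ η₂) :=
  ((locBddMeasure_transport 1 η₁).const_smul _).add ((locBddMeasure_transport (-1) η₂).const_smul _)

lemma pairing_waveDt (η₁ η₂ : SignedMeasure Torus) {ψ : ℝ × Torus → ℝ} (hψ : IsTestFunction I ψ) :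
    pairing I (waveDt η₁ η₂) ψ
      = 1 / 2 * pairing I (transport 1 η₁) ψ + 1 / 2 * pairing I (transport (-1) η₂) ψ := by
  rw [← pairing_const_smul, ← pairing_const_smul]
  exact pairing_add_test hI ((locBddMeasure_transport 1 η₁).const_smul _)
    ((locBddMeasure_transport (-1) η₂).const_smul _) hψ

lemma pairing_waveDx (η₁ η₂ : SignedMeasure Torus) {ψ : ℝ × Torus → ℝ} (hψ : IsTestFunction I ψ) :
    pairing I (waveDx η₁ η₂) ψ
      = -1 / 2 * pairing I (transport 1 η₁) ψ + 1 / 2 * pairing I (transport (-1) η₂) ψ := by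
  rw [← pairing_const_smul, ← pairing_const_smul]
  exact pairing_add_test hI ((locBddMeasure_transport 1 η₁).const_smul _)
    ((locBddMeasure_transport (-1) η₂).const_smul _) hψ

omit hI in
/-- Half the difference of the masses of the two transported measures: a wave on the torus can only
have derivatives with zero average in space, so this constant is subtracted from `waveDx`. -/
noncomputable def waveMean (η₁ η₂ : SignedMeasure Torus) : ℝ :=
  1 / 2 * (η₂ univ - η₁ univ)

/-- The values of the wave with derivatives `waveDt` and `waveDx - waveMean`. -/
noncomputable def waveVal (η₁ η₂ : SignedMeasure Torus) (z : ℝ × Torus) : ℝ :=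
  1 / 2 * profileWave (-1) η₂ z - 1 / 2 * profileWave 1 η₁ z
    + 1 / 2 * (η₁ univ + η₂ univ) * z.1

omit hI in
lemma integral_waveVal_mul (η₁ η₂ : SignedMeasure Torus) {ψ : ℝ × Torus → ℝ}
    (hψ : IsTestFunction I ψ) :
    ∫ z in cyl I, waveVal η₁ η₂ z * ψ z
      = 1 / 2 * (∫ z in cyl I, profileWave (-1) η₂ z * ψ z)
        - 1 / 2 * (∫ z in cyl I, profileWave 1 η₁ z * ψ z)
        + 1 / 2 * (η₁ univ + η₂ univ) * ∫ z in cyl I, z.1 * ψ z := by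
  have i1 := (((locBddLp_profileWave (I := I) (-1) η₂).locInt le_top).integrableOn_mul_test
    hψ).const_mul (1 / 2)
  have i2 := (((locBddLp_profileWave (I := I) 1 η₁).locInt le_top).integrableOn_mul_test
    hψ).const_mul (1 / 2)
  have i3 := ((locInt_of_continuous (I := I) continuous_fst).integrableOn_mul_test
    hψ).const_mul (1 / 2 * (η₁ univ + η₂ univ))
  rw [← integral_const_mul, ← integral_const_mul, ← integral_const_mul, ← integral_sub i1 i2]
  refine Eq.trans ?_ (integral_add (i1.sub i2) i3)
  refine integral_congr_ae (ae_of_all _ fun z => ?_)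
  simp only [waveVal]
  ring

/-- The solution `φ` of `φ_tt = φ_θθ` with `φ_t = waveDt` and `φ_θ = waveDx - waveMean`. -/
noncomputable def wave (η₁ η₂ : SignedMeasure Torus) : BVField I where
  val := waveVal η₁ η₂
  dt := waveDt η₁ η₂
  dx t := waveDx η₁ η₂ t + dens (fun _ => -waveMean η₁ η₂) t
  val_bdd := by
    have h1 := (UBdd.of_single (ι := Unit) (locBddLp_profileWave (I := I) (-1) η₂)).const_mul (1 / 2)
    have h2 := (UBdd.of_single (ι := Unit) (locBddLp_profileWave (I := I) 1 η₁)).const_mul (1 / 2)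
    have h3 := UBdd.of_continuous (ι := Unit) (I := I) (ψ := fun z =>
      1 / 2 * (η₁ univ + η₂ univ) * z.1) (by fun_prop)
    exact (((h1.sub le_top h2).add le_top h3).mono_exponent le_top).single ()
  dt_bdd := locBddMeasure_waveDt η₁ η₂
  dx_bdd := (locBddMeasure_waveDx η₁ η₂).add
    (LocBddLp.dens hI (locBddLp_iff.2 ((UBdd.of_continuous continuous_const).mono_exponent le_top)))
  weak_dt ψ hψ := by
    rw [integral_waveVal_mul _ _ hψ.partialT, (time_weak hI hψ).1, profileWave_weak_dt hI _ _ hψ,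
      profileWave_weak_dt hI _ _ hψ, profileWave_weak_dx hI _ _ hψ, profileWave_weak_dx hI _ _ hψ,
      pairing_waveDt hI _ _ hψ]
    ring
  weak_dx ψ hψ := by
    rw [pairing_add_test hI (locBddMeasure_waveDx η₁ η₂) (LocBddLp.dens hI (locBddLp_iff.2
      ((UBdd.of_continuous continuous_const).mono_exponent le_top))) hψ,
      pairing_dens_test hI (locInt_of_continuous continuous_const) hψ, integral_const_mul,
      pairing_waveDx hI _ _ hψ, integral_waveVal_mul _ _ hψ.partialX, (time_weak hI hψ).2,
      profileWave_weak_dx hI _ _ hψ, profileWave_weak_dx hI _ _ hψ, waveMean]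
    ring

lemma waveEq_wave (η₁ η₂ : SignedMeasure Torus) :
    WaveEq I (wave hI η₁ η₂).val (fun _ => 0) := by
  intro ψ hψ
  have hz : ∀ (c : ℝ) (hc : c ^ 2 = 1) (η : SignedMeasure Torus),
      ∫ z in cyl I, profileWave c η z * box ψ z = 0 := by
    intro c hc η
    rw [funext fun z => hψ.smoothFn.box_eq_lineD hc z]
    simpa using weakDir_profileWave hI c η _ (hψ.lineD (-c))
  have ht : ∫ z in cyl I, z.1 * box ψ z = 0 := by
    rw [funext fun z => hψ.smoothFn.box_eq_lineD (one_pow 2) z,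
      weakDir_time hI 1 _ (hψ.lineD (-1))]
    have := weakDir_const hI 1 (-1) ψ hψ
    simp only [one_mul, zero_mul, integral_zero, neg_zero] at this ⊢
    rw [this, neg_zero]
  rw [show (wave hI η₁ η₂).val = waveVal η₁ η₂ from rfl, integral_waveVal_mul _ _ hψ.box, ht,
    hz 1 (by norm_num), hz (-1) (by norm_num)]
  simp

omit hI in
lemma IsTestFunction.div_time (hpos : I ⊆ Ioi 0) {ψ : ℝ × Torus → ℝ}
    (hψ : IsTestFunction I ψ) : IsTestFunction I (fun z => 1 / z.1 * ψ z) := by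
  obtain ⟨a, b, hab, hs⟩ := hψ.support
  refine ⟨contDiff_iff_contDiffAt.2 fun q => ?_, a, b, hab, fun t ht θ => by
    change 1 / t * ψ (t, θ) = 0
    rw [hs t ht, mul_zero]⟩
  by_cases hq : q.1 ∈ Icc a b
  · have hq0 : q.1 ≠ 0 := (hpos (interior_subset (hab hq))).ne'
    exact (contDiffAt_const.div contDiffAt_fst hq0).mul hψ.smooth.contDiffAt
  · have hev : ∀ᶠ r : ℝ × ℝ in 𝓝 q, r.1 ∉ Icc a b :=
      continuousAt_fst.eventually (isClosed_Icc.isOpen_compl.mem_nhds hq)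
    refine (contDiffAt_const (c := (0 : ℝ))).congr_of_eventuallyEq ?_
    filter_upwards [hev] with r hr
    rw [hs r.1 hr, mul_zero]

end Waves

/-! ### The limit of a sequence of solutions -/

lemma StrongLp.tendsto_test (hI : I.OrdConnected) {f : ℕ → ℝ × Torus → ℝ}
    {g : ℝ × Torus → ℝ} (hf : ∀ n, LocInt I (f n)) (hg : LocInt I g)
    (h : ∀ a b, Icc a b ⊆ I → StrongLp (Icc a b) 1 f g) {ψ : ℝ × Torus → ℝ}
    (hψ : IsTestFunction I ψ) :
    Tendsto (fun n => ∫ z in cyl I, f n z * ψ z) atTop (𝓝 (∫ z in cyl I, g z * ψ z)) := by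
  obtain ⟨a, b, hab, hs⟩ := hψ.support
  have hab' := hab.trans interior_subset
  have hcyl : ∀ u : ℝ × Torus → ℝ, ∫ z in cyl I, u z * ψ z
      = ∫ z in cyl (Icc a b), u z * ψ z := fun u =>
    setIntegral_cyl_eq_of_support hI.measurableSet hab' fun t ht θ => by rw [hs t ht θ, mul_zero]
  simp only [hcyl]
  obtain ⟨K, hK⟩ := (isCompact_cyl_Icc a b).exists_bound_of_continuousOn
    hψ.smoothFn.continuous.continuousOn
  have hψc : ContinuousOn ψ (cyl (Icc a b)) := hψ.smoothFn.continuous.continuousOn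
  refine tendsto_integral_of_L1' _
    (((hg.2 a b hab').mul_continuousOn hψc (isCompact_cyl_Icc a b))).aestronglyMeasurable
    (Eventually.of_forall fun n =>
      ((hf n).2 a b hab').mul_continuousOn hψc (isCompact_cyl_Icc a b)) ?_
  have h1 := ENNReal.Tendsto.const_mul (h a b hab') (a := ENNReal.ofReal K) (Or.inr (by simp))
  rw [mul_zero] at h1
  refine tendsto_of_tendsto_of_tendsto_of_le_of_le tendsto_const_nhds h1 (fun _ => zero_le)
    fun n => eLpNorm_le_mul_eLpNorm_of_ae_le_mul ?_ 1
  filter_upwards [ae_restrict_mem (measurableSet_cyl measurableSet_Icc)] with z hz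
  simp only [Pi.sub_apply]
  rw [← sub_mul, norm_mul, mul_comm]
  exact mul_le_mul_of_nonneg_right (hK z hz) (norm_nonneg _)

/-- With the constraint equations, the right-hand side is `λ_t`. -/
lemma half_sum_nullEnergy (P Q : H1Field I) (z : ℝ × Torus) :
    z.1 * energyDensity P Q z
      = 1 / 2 * nullEnergy 1 P Q z + 1 / 2 * nullEnergy (-1) P Q z := by
  simp only [nullEnergy, energyDensity]; ring

/-- With the constraint equations, the right-hand side is `λ_θ`. -/
lemma half_diff_nullEnergy (P Q : H1Field I) (z : ℝ × Torus) :
    2 * z.1 * momentumDensity P Q z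
      = -1 / 2 * nullEnergy 1 P Q z + 1 / 2 * nullEnergy (-1) P Q z := by
  simp only [nullEnergy, momentumDensity]; ring

section Constraint

variable (hI : I.OrdConnected) (hpos : I ⊆ Ioi 0)
include hI hpos

lemma ae_cyl_pos : ∀ᵐ z ∂volume.restrict (cyl I), 0 < z.1 := by
  filter_upwards [ae_restrict_mem (measurableSet_cyl hI.measurableSet)] with z hz
  exact hpos hz.1

lemma IsGowdySolution.lam_dt {P Q : H1Field I} {lam : W11Field I} (h : IsGowdySolution P Q lam) :
    (fun z => z.1 * energyDensity P Q z) =ᵐ[volume.restrict (cyl I)] lam.dt := by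
  filter_upwards [h.constraint_t, ae_cyl_pos hI hpos] with z h1 h2
  rw [← h1]; field_simp

lemma IsGowdySolution.lam_dx {P Q : H1Field I} {lam : W11Field I} (h : IsGowdySolution P Q lam) :
    (fun z => 2 * z.1 * momentumDensity P Q z) =ᵐ[volume.restrict (cyl I)] lam.dx := by
  filter_upwards [h.constraint_x, ae_cyl_pos hI hpos] with z h1 h2
  have h3 : lam.dx z = z.1 * (1 / z.1 * lam.dx z) := by field_simp
  rw [h3, h1]; ring

end Constraint

lemma UH1.time_energy {ι : Type} (hI : I.OrdConnected) {P Q : ι → H1Field I}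
    (hP : UH1 P) (hQ : UH1 Q) : UBdd I 1 fun i z => z.1 * Gowdy.energyDensity (P i) (Q i) z :=
  (UBdd.time hI).mul (hP.energyDensity hI hQ)

lemma UH1.time_momentum {ι : Type} (hI : I.OrdConnected) {P Q : ι → H1Field I}
    (hP : UH1 P) (hQ : UH1 Q) : UBdd I 1 fun i z => 2 * z.1 * Gowdy.momentumDensity (P i) (Q i) z :=
  (((UBdd.time hI).const_mul 2).mul (hP.momentumDensity hI hQ)).congr fun _ _ => rfl

/-- The function `μ - c`, where `μ = λ + P`. -/
noncomputable def muField {I : Set ℝ} (hI : I.OrdConnected) (P : H1Field I) (lam : W11Field I)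
    (c : ℝ) : W11Field I :=
  (lam.add le_rfl P.toW11).sub le_rfl (SobolevField.const hI c)

lemma muField_derivatives (hI : I.OrdConnected) (P : H1Field I) (lam : W11Field I)
    (c : ℝ) (z : ℝ × Torus) : (muField hI P lam c).val z = lam.val z + P.val z - c ∧
      (muField hI P lam c).dt z = lam.dt z + P.dt z ∧
      (muField hI P lam c).dx z = lam.dx z + P.dx z :=
  ⟨rfl, sub_zero _, sub_zero _⟩

section Limit

variable (hI : I.OrdConnected) (hpos : I ⊆ Ioi 0)
  {P Q : ℕ → H1Field I} {lam : ℕ → W11Field I}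

include hI hpos

lemma uBdd_muField (hsol : ∀ n, IsGowdySolution (P n) (Q n) (lam n)) (hP : UH1 P) (hQ : UH1 Q) :
    UBdd I 1 (fun n z => (lam n).dt z + (P n).dt z) ∧
      UBdd I 1 (fun n z => (lam n).dx z + (P n).dx z) :=
  ⟨((hP.time_energy hI hQ).congr_ae fun n => (hsol n).lam_dt hI hpos).add le_rfl
      (hP.dt.mono_exponent one_le_two),
    ((hP.time_momentum hI hQ).congr_ae fun n => (hsol n).lam_dx hI hpos).add le_rfl
      (hP.dx.mono_exponent one_le_two)⟩

variable {P' Q' : H1Field I} {η₁ η₂ : SignedMeasure Torus}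
  (hsol : ∀ n, IsGowdySolution (P n) (Q n) (lam n)) (hP : UH1 P) (hQ : UH1 Q)
  (hPc : H1Converges P P')
  (h₁ : ∀ χ, IsTestFunction I χ →
      Tendsto (fun n => ∫ z in cyl I, nullEnergy 1 (P n) (Q n) z * χ z) atTop
        (𝓝 ((∫ z in cyl I, nullEnergy 1 P' Q' z * χ z) + ∫ᵛ y, lineIntegral I 1 χ y ∂<•η₁)))
  (h₂ : ∀ χ, IsTestFunction I χ →
      Tendsto (fun n => ∫ z in cyl I, nullEnergy (-1) (P n) (Q n) z * χ z) atTop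
        (𝓝 ((∫ z in cyl I, nullEnergy (-1) P' Q' z * χ z) + ∫ᵛ y, lineIntegral I (-1) χ y ∂<•η₂)))

/-- The time derivative of the limit of `μⁿ`: the contribution of the limits of `Pⁿ` and `Qⁿ`,
together with that of a wave carrying the defect measures. -/
noncomputable def muDt (P' Q' : H1Field I) (η₁ η₂ : SignedMeasure Torus) (t : ℝ) :
    SignedMeasure Torus :=
  dens (fun z => z.1 * energyDensity P' Q' z + P'.dt z) t + waveDt η₁ η₂ t

/-- The space derivative of the limit of `μⁿ`. -/
noncomputable def muDx (P' Q' : H1Field I) (η₁ η₂ : SignedMeasure Torus) (t : ℝ) :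
    SignedMeasure Torus :=
  dens (fun z => 2 * z.1 * momentumDensity P' Q' z + P'.dx z) t + waveDx η₁ η₂ t

omit hpos

lemma locBddLp_limit_dt (P' Q' : H1Field I) :
    LocBddLp I 1 (fun z => z.1 * energyDensity P' Q' z + P'.dt z) :=
  (((UH1.single (ι := Unit) P').time_energy hI (UH1.single Q')).add le_rfl
    ((UH1.single P').dt.mono_exponent one_le_two)).single ()

lemma locBddLp_limit_dx (P' Q' : H1Field I) :
    LocBddLp I 1 (fun z => 2 * z.1 * momentumDensity P' Q' z + P'.dx z) :=
  (((UH1.single (ι := Unit) P').time_momentum hI (UH1.single Q')).add le_rfl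
    ((UH1.single P').dx.mono_exponent one_le_two)).single ()

lemma locBddMeasure_muDt (P' Q' : H1Field I) : LocBddMeasure I (muDt P' Q' η₁ η₂) :=
  ((locBddLp_limit_dt hI P' Q').dens hI).add (locBddMeasure_waveDt η₁ η₂)

lemma locBddMeasure_muDx (P' Q' : H1Field I) : LocBddMeasure I (muDx P' Q' η₁ η₂) :=
  ((locBddLp_limit_dx hI P' Q').dens hI).add (locBddMeasure_waveDx η₁ η₂)

lemma pairing_muDt {ψ : ℝ × Torus → ℝ} (hψ : IsTestFunction I ψ) :
    pairing I (muDt P' Q' η₁ η₂) ψ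
      = (∫ z in cyl I, (z.1 * energyDensity P' Q' z + P'.dt z) * ψ z)
        + pairing I (waveDt η₁ η₂) ψ := by
  rw [← pairing_dens_test hI ((locBddLp_limit_dt hI P' Q').locInt le_rfl) hψ]
  exact pairing_add_test hI ((locBddLp_limit_dt hI P' Q').dens hI) (locBddMeasure_waveDt η₁ η₂) hψ

lemma pairing_muDx {ψ : ℝ × Torus → ℝ} (hψ : IsTestFunction I ψ) :
    pairing I (muDx P' Q' η₁ η₂) ψ
      = (∫ z in cyl I, (2 * z.1 * momentumDensity P' Q' z + P'.dx z) * ψ z)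
        + pairing I (waveDx η₁ η₂) ψ := by
  rw [← pairing_dens_test hI ((locBddLp_limit_dx hI P' Q').locInt le_rfl) hψ]
  exact pairing_add_test hI ((locBddLp_limit_dx hI P' Q').dens hI) (locBddMeasure_waveDx η₁ η₂) hψ

/-- Linear combinations of the two null energies, tested and split. -/
lemma integral_null_combination (F : H1Field I → H1Field I → ℝ × Torus → ℝ) {a₁ a₂ : ℝ}
    (hF : ∀ P Q z, F P Q z = a₁ * nullEnergy 1 P Q z + a₂ * nullEnergy (-1) P Q z)
    (U V : H1Field I) {u : ℝ × Torus → ℝ} (hu : LocInt I u) {ψ : ℝ × Torus → ℝ}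
    (hψ : IsTestFunction I ψ) :
    ∫ z in cyl I, (F U V z + u z) * ψ z
      = a₁ * (∫ z in cyl I, nullEnergy 1 U V z * ψ z)
        + a₂ * (∫ z in cyl I, nullEnergy (-1) U V z * ψ z) + ∫ z in cyl I, u z * ψ z := by
  have hE : ∀ c, IntegrableOn (fun z => nullEnergy c U V z * ψ z) (cyl I) := fun c =>
    (((UH1.single (ι := Unit) U).nullEnergy hI (UH1.single V) c).locInt le_rfl
      ()).integrableOn_mul_test hψ
  rw [← integral_const_mul, ← integral_const_mul,
    ← integral_add ((hE 1).const_mul a₁) ((hE (-1)).const_mul a₂)]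
  refine Eq.trans ?_ (integral_add (((hE 1).const_mul a₁).add ((hE (-1)).const_mul a₂))
    (hu.integrableOn_mul_test hψ))
  refine integral_congr_ae (ae_of_all _ fun z => ?_)
  simp only [hF]
  ring

include hpos hsol hPc h₁ h₂

lemma tendsto_mu_dt {ψ : ℝ × Torus → ℝ} (hψ : IsTestFunction I ψ) :
    Tendsto (fun n => ∫ z in cyl I, ((lam n).dt z + (P n).dt z) * ψ z) atTop
      (𝓝 (pairing I (muDt P' Q' η₁ η₂) ψ)) := by
  have hc := integral_null_combination hI (fun P Q z => z.1 * energyDensity P Q z)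
    half_sum_nullEnergy
  have h3 := WeakL2.tendsto_test hI (fun a b hab => (hPc a b hab).2.1) hψ
  have h4 := (((h₁ ψ hψ).const_mul (1 / 2)).add ((h₂ ψ hψ).const_mul (1 / 2))).add h3
  rw [pairing_muDt hI hψ, pairing_waveDt hI _ _ hψ, pairing_transport hI _ _ hψ,
    pairing_transport hI _ _ hψ, hc P' Q' (P'.dt_bdd.locInt one_le_two) hψ]
  refine Tendsto.congr (fun n => ?_) (h4.trans (le_of_eq (congrArg 𝓝 (by ring))))
  rw [← hc (P n) (Q n) ((P n).dt_bdd.locInt one_le_two) hψ]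
  refine integral_congr_ae ?_
  filter_upwards [(hsol n).lam_dt hI hpos] with z hz
  rw [← hz]

lemma tendsto_mu_dx {ψ : ℝ × Torus → ℝ} (hψ : IsTestFunction I ψ) :
    Tendsto (fun n => ∫ z in cyl I, ((lam n).dx z + (P n).dx z) * ψ z) atTop
      (𝓝 (pairing I (muDx P' Q' η₁ η₂) ψ)) := by
  have hc := integral_null_combination hI (fun P Q z => 2 * z.1 * momentumDensity P Q z)
    half_diff_nullEnergy
  have h3 := WeakL2.tendsto_test hI (fun a b hab => (hPc a b hab).2.2.1) hψ
  have h4 := (((h₁ ψ hψ).const_mul (-1 / 2)).add ((h₂ ψ hψ).const_mul (1 / 2))).add h3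
  rw [pairing_muDx hI hψ, pairing_waveDx hI _ _ hψ, pairing_transport hI _ _ hψ,
    pairing_transport hI _ _ hψ, hc P' Q' (P'.dx_bdd.locInt one_le_two) hψ]
  refine Tendsto.congr (fun n => ?_) (h4.trans (le_of_eq (congrArg 𝓝 (by ring))))
  rw [← hc (P n) (Q n) ((P n).dx_bdd.locInt one_le_two) hψ]
  refine integral_congr_ae ?_
  filter_upwards [(hsol n).lam_dx hI hpos] with z hz
  rw [← hz]

end Limit

/-! ### Convergent subsequences of solutions -/

section LimitEquations

variable (hI : I.OrdConnected) (hpos : I ⊆ Ioi 0)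
  {P Q : ℕ → H1Field I} {lam : ℕ → W11Field I} {P' Q' : H1Field I} {η₁ η₂ : SignedMeasure Torus}

include hI hpos

/-- The functions `μⁿ - cₙ` satisfy the evolution equation of `μ`. -/
lemma IsGowdySolution.waveEq_mu {P Q : H1Field I} {lam : W11Field I}
    (h : IsGowdySolution P Q lam) (c : ℝ) :
    WaveEq I (muField hI P lam c).val (fun z => -nullP P z - P.dt z / z.1) := by
  intro ψ hψ
  have hc : ∫ z in cyl I, c * box ψ z = 0 := by
    have h1 := weakDir_const hI c 1 _ (hψ.lineD (-1))
    simp only [zero_mul, integral_zero, neg_zero] at h1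
    simpa only [hψ.smoothFn.box_eq_lineD (c := 1) (by norm_num)] using h1
  have hN := (UH1.single (ι := Unit) P).nullP.locInt le_rfl ()
  have hNQ := ((UH1.single (ι := Unit) P).nullQ hI (UH1.single Q)).locInt le_rfl ()
  have hT := ((UH1.single (ι := Unit) P).dt.div_time hI hpos).locInt one_le_two ()
  have e1 : ∫ z in cyl I, (muField hI P lam c).val z * box ψ z
      = (∫ z in cyl I, lam.val z * box ψ z) + (∫ z in cyl I, P.val z * box ψ z)
        - ∫ z in cyl I, c * box ψ z := by
    have i1 := (lam.val_bdd.locInt le_rfl).integrableOn_mul_test hψ.box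
    have i2 := (P.val_bdd.locInt one_le_two).integrableOn_mul_test hψ.box
    have i3 := ((locInt_of_continuous (I := I) (continuous_const (y := c)))).integrableOn_mul_test
      hψ.box
    rw [← integral_add i1 i2]
    refine Eq.trans ?_ (integral_sub (i1.add i2) i3)
    refine integral_congr_ae (ae_of_all _ fun z => ?_)
    simp only [(muField_derivatives hI P lam c z).1]
    ring
  rw [e1, hc, h.evolution ψ hψ, h.essential.1 ψ hψ]
  have j1 : IntegrableOn (fun z => (-(P.dt z ^ 2) + P.dx z ^ 2
      + Real.exp (2 * P.val z) * (-(Q.dt z ^ 2) + Q.dx z ^ 2)) * ψ z) (cyl I) := by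
    refine ((hN.integrableOn_mul_test hψ).add (hNQ.integrableOn_mul_test hψ)).neg.congr
      (ae_of_all _ fun z => ?_)
    simp only [Pi.neg_apply, Pi.add_apply, nullP, nullQ]
    ring
  have j2 : IntegrableOn (fun z => (Real.exp (2 * P.val z) * (Q.dt z ^ 2 - Q.dx z ^ 2)
      - P.dt z / z.1) * ψ z) (cyl I) := by
    refine ((hNQ.integrableOn_mul_test hψ).sub (hT.integrableOn_mul_test hψ)).congr
      (ae_of_all _ fun z => ?_)
    simp only [Pi.sub_apply, nullQ]
    ring
  rw [sub_zero, ← integral_add j1 j2]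
  refine integral_congr_ae (ae_of_all _ fun z => ?_)
  simp only [nullP]
  ring

/-- The source of the evolution equation for `μ` contains no `Q`: it passes to the limit by
`tendsto_nullP`. -/
lemma tendsto_source_mu (hne : (interior I).Nonempty) (hUP : UH1 P) (hUQ : UH1 Q)
    (hP : H1Converges P P') (hQ : H1Converges Q Q') (h : ∀ n, EssentialEquations (P n) (Q n))
    {ψ : ℝ × Torus → ℝ} (hψ : IsTestFunction I ψ) :
    Tendsto (fun n => ∫ z in cyl I, (-nullP (P n) z - (P n).dt z / z.1) * ψ z) atTop
      (𝓝 (∫ z in cyl I, (-nullP P' z - P'.dt z / z.1) * ψ z)) := by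
  have h1 := (tendsto_nullP hI hpos hne hUP hUQ hP hQ h hψ).neg
  have h2 := tendsto_weighted_div_time hI hpos (a := fun _ _ => 1) (a' := fun _ => 1)
    (UConv.of_strongLp fun a b _ => by
      simp only [StrongLp, sub_self, eLpNorm_zero', tendsto_const_nhds]) (UBdd.of_continuous continuous_const)
    (locBddLp_top_of_continuous continuous_const) hUP hP hψ
  have e : ∀ F : H1Field I, ∫ z in cyl I, (-nullP F z - F.dt z / z.1) * ψ z
      = -(∫ z in cyl I, nullP F z * ψ z) - ∫ z in cyl I, 1 * F.dt z / z.1 * ψ z := fun F => by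
    have i1 := ((UH1.single (ι := Unit) F).nullP.locInt le_rfl ()).integrableOn_mul_test hψ
    have i2 := (((UH1.single (ι := Unit) F).dt.div_time hI hpos).locInt
      one_le_two ()).integrableOn_mul_test hψ
    simp only [one_mul]
    rw [← integral_neg]
    refine Eq.trans ?_ (integral_sub i1.neg i2)
    refine integral_congr_ae (ae_of_all _ fun z => ?_)
    simp only []
    ring
  simp only [e]
  exact h1.sub h2

/-- The sources of the transport equations for the null energies pass to the limit. -/
lemma tendsto_null_source (hne : (interior I).Nonempty) (hUP : UH1 P) (hUQ : UH1 Q)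
    (hP : H1Converges P P') (hQ : H1Converges Q Q') (h : ∀ n, EssentialEquations (P n) (Q n))
    {ψ : ℝ × Torus → ℝ} (hψ : IsTestFunction I ψ) :
    Tendsto (fun n => ∫ z in cyl I, (-nullP (P n) z - nullQ (P n) (Q n) z) * ψ z) atTop
      (𝓝 (∫ z in cyl I, (-nullP P' z - nullQ P' Q' z) * ψ z)) := by
  have h1 := (tendsto_nullP hI hpos hne hUP hUQ hP hQ h hψ).neg
  have h2 := tendsto_nullQ hI hpos hne hUP hUQ hP hQ h hψ
  have e : ∀ F G : H1Field I, ∫ z in cyl I, (-nullP F z - nullQ F G z) * ψ z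
      = -(∫ z in cyl I, nullP F z * ψ z) - ∫ z in cyl I, nullQ F G z * ψ z := fun F G => by
    have i1 := ((UH1.single (ι := Unit) F).nullP.locInt le_rfl ()).integrableOn_mul_test hψ
    have i2 := (((UH1.single (ι := Unit) F).nullQ hI (UH1.single G)).locInt
      le_rfl ()).integrableOn_mul_test hψ
    rw [← integral_neg]
    refine Eq.trans ?_ (integral_sub i1.neg i2)
    refine integral_congr_ae (ae_of_all _ fun z => ?_)
    simp only []
    ring
  simp only [e]
  exact h1.sub h2

/-- The limit of `μⁿ - cₙ` satisfies the evolution equation, and the constraint equations up to the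
derivatives of the wave carrying the defect measures. -/
lemma exists_limit_mu (hne : (interior I).Nonempty)
    (hsol : ∀ n, IsGowdySolution (P n) (Q n) (lam n)) (hUP : UH1 P) (hUQ : UH1 Q)
    (hP : H1Converges P P') (hQ : H1Converges Q Q')
    (h₁ : ∀ χ, IsTestFunction I χ →
        Tendsto (fun n => ∫ z in cyl I, nullEnergy 1 (P n) (Q n) z * χ z) atTop
          (𝓝 ((∫ z in cyl I, nullEnergy 1 P' Q' z * χ z) + ∫ᵛ y, lineIntegral I 1 χ y ∂<•η₁)))
    (h₂ : ∀ χ, IsTestFunction I χ →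
        Tendsto (fun n => ∫ z in cyl I, nullEnergy (-1) (P n) (Q n) z * χ z) atTop
          (𝓝 ((∫ z in cyl I, nullEnergy (-1) P' Q' z * χ z)
            + ∫ᵛ y, lineIntegral I (-1) χ y ∂<•η₂)))
    {c : ℕ → ℝ} {g : ℝ × Torus → ℝ} (hg : LocBddLp I 2 g)
    (hgs : ∀ a b, Icc a b ⊆ I →
      StrongLp (Icc a b) 1 (fun n => (muField hI (P n) (lam n) (c n)).val) g)
    (hae : ∀ᵐ z ∂volume.restrict (cyl I),
      Tendsto (fun n => (muField hI (P n) (lam n) (c n)).val z) atTop (𝓝 (g z))) :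
    ∃ mu : BVField I, mu.dt = muDt P' Q' η₁ η₂ ∧ mu.dx = muDx P' Q' η₁ η₂ ∧
      MuConverges P lam c mu ∧ IsH1BVSolution P' Q' mu := by
  have hloc : ∀ n, LocInt I (muField hI (P n) (lam n) (c n)).val := fun n =>
    (muField hI (P n) (lam n) (c n)).val_bdd.locInt le_rfl
  have hgl : LocInt I g := hg.locInt one_le_two
  have hess : ∀ n, EssentialEquations (P n) (Q n) := fun n => (hsol n).essential
  have hdt : ∀ ψ, IsTestFunction I ψ →
      Tendsto (fun n => ∫ z in cyl I, ((lam n).dt z + (P n).dt z) * ψ z) atTop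
        (𝓝 (pairing I (muDt P' Q' η₁ η₂) ψ)) := fun ψ hψ =>
    tendsto_mu_dt hI hpos hsol hP h₁ h₂ hψ
  have hdx : ∀ ψ, IsTestFunction I ψ →
      Tendsto (fun n => ∫ z in cyl I, ((lam n).dx z + (P n).dx z) * ψ z) atTop
        (𝓝 (pairing I (muDx P' Q' η₁ η₂) ψ)) := fun ψ hψ =>
    tendsto_mu_dx hI hpos hsol hP h₁ h₂ hψ
  -- The derivatives of `g` in the sense of distributions are the limits of those of `μⁿ - cₙ`.
  let mu : BVField I :=
    { val := g
      dt := muDt P' Q' η₁ η₂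
      dx := muDx P' Q' η₁ η₂
      val_bdd := ((UBdd.of_single (ι := Unit) hg).mono_exponent one_le_two).single ()
      dt_bdd := locBddMeasure_muDt hI P' Q'
      dx_bdd := locBddMeasure_muDx hI P' Q'
      weak_dt := fun ψ hψ => by
        refine tendsto_nhds_unique (StrongLp.tendsto_test hI hloc hgl hgs hψ.partialT)
          ((hdt ψ hψ).neg.congr fun n => ?_)
        rw [(muField hI (P n) (lam n) (c n)).weak_dt ψ hψ]
        simp only [(muField_derivatives hI (P n) (lam n) (c n) _).2.1]
      weak_dx := fun ψ hψ => by
        refine tendsto_nhds_unique (StrongLp.tendsto_test hI hloc hgl hgs hψ.partialX)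
          ((hdx ψ hψ).neg.congr fun n => ?_)
        rw [(muField hI (P n) (lam n) (c n)).weak_dx ψ hψ]
        simp only [(muField_derivatives hI (P n) (lam n) (c n) _).2.2] }
  have hb := uBdd_muField hI hpos hsol hUP hUQ
  refine ⟨mu, rfl, rfl, ⟨hae, fun a b hab => ⟨hgs a b hab,
    weakStarMeasure_of_test hI hb.1 mu.dt_bdd hdt hab,
    weakStarMeasure_of_test hI hb.2 mu.dx_bdd hdx hab⟩⟩,
    limit_essential hI hpos hne hUP hUQ hP hQ hess, fun ψ hψ => ?_⟩
  have h3 := tendsto_nhds_unique (StrongLp.tendsto_test hI hloc hgl hgs hψ.box)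
    ((tendsto_source_mu hI hpos hne hUP hUQ hP hQ hess hψ).congr fun n =>
      ((hsol n).waveEq_mu hI hpos (c n) ψ hψ).symm)
  refine h3.trans (integral_congr_ae (ae_of_all _ fun z => ?_))
  simp only [nullP]
  ring

/-- The constraint equations of the limit, up to the wave carrying the defect measures. The constant
`waveMean` subtracted in the space derivative of this wave reappears as `κ`. -/
lemma defectConstraints {mu : BVField I} (hdt : mu.dt = muDt P' Q' η₁ η₂)
    (hdx : mu.dx = muDx P' Q' η₁ η₂) :
    DefectConstraints P' Q' mu (wave hI η₁ η₂) (waveMean η₁ η₂) := by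
  intro ψ hψ
  have hψ' := hψ.div_time hpos
  constructor
  · rw [hdt, pairing_muDt hI hψ']
    congr 1
    refine integral_congr_ae ?_
    filter_upwards [ae_cyl_pos hI hpos] with z hz
    field_simp
    ring
  · have h1 : pairing I (wave hI η₁ η₂).dx (fun z => 1 / z.1 * ψ z)
        = pairing I (waveDx η₁ η₂) (fun z => 1 / z.1 * ψ z)
          + ∫ z in cyl I, -waveMean η₁ η₂ * (1 / z.1 * ψ z) := by
      have hc : LocBddLp I 1 (fun _ : ℝ × Torus => -waveMean η₁ η₂) :=
        ((UBdd.of_continuous (ι := Unit) continuous_const).mono_exponent le_top).single ()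
      rw [← pairing_dens_test hI (hc.locInt le_rfl) hψ']
      exact pairing_add_test hI (locBddMeasure_waveDx η₁ η₂) (hc.dens hI) hψ'
    have h2 : ∫ z in cyl I, waveMean η₁ η₂ / z.1 * ψ z
        = -∫ z in cyl I, -waveMean η₁ η₂ * (1 / z.1 * ψ z) := by
      rw [← integral_neg]
      refine integral_congr_ae (ae_of_all _ fun z => ?_)
      simp only []
      ring
    beta_reduce
    rw [hdx, pairing_muDx hI hψ', h1, h2, add_neg_cancel_right]
    congr 1
    refine integral_congr_ae ?_
    filter_upwards [ae_cyl_pos hI hpos] with z hz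
    field_simp
    ring

omit hpos

/-- Space derivatives have zero mean, at almost every time: for `μ_θ` this computes `κ`. -/
lemma waveMean_eq {mu : BVField I} (hdx : mu.dx = muDx P' Q' η₁ η₂) :
    ∀ᵐ t ∂volume.restrict I,
      waveMean η₁ η₂ = -(2 * t) * ∫ θ : Torus, momentumDensity P' Q' (t, θ) := by
  have hm : LocInt I (fun z => 2 * z.1 * momentumDensity P' Q' z) :=
    ((UH1.single (ι := Unit) P').time_momentum hI (UH1.single Q')).locInt le_rfl ()
  have hm' : LocInt I (momentumDensity P' Q') :=
    ((UH1.single (ι := Unit) P').momentumDensity hI (UH1.single Q')).locInt le_rfl ()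
  have hk : LocInt I (fun _ : ℝ × Torus => waveMean η₁ η₂) := locInt_of_continuous continuous_const
  have hf : LocInt I (fun z => 2 * z.1 * momentumDensity P' Q' z + waveMean η₁ η₂) :=
    ⟨hm.1.add hk.1, fun a b hab => (hm.2 a b hab).add (hk.2 a b hab)⟩
  have h0 := ae_eq_zero_of_timeTest hI
    (fun a b hab => hf.integrableOn_slice_integral (continuous_const (y := (1 : ℝ))) hab) ?_
  · filter_upwards [h0, hm'.ae_integrable_slice hI] with t ht hi
    simp only [mul_one] at ht
    rw [integral_add (hi.const_mul (2 * t)) (integrable_const _), integral_const_mul] at ht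
    simp only [integral_const, probReal_univ, one_smul] at ht
    linarith
  intro ρ hρ
  have hψ := hρ.isTestFunction
  have hX : ∀ z : ℝ × Torus, partialX (fun z : ℝ × Torus => ρ z.1) z = 0 := fun z => by
    simp [partialX]
  have e1 := mu.weak_dx _ hψ
  have e2 := P'.weak_dx _ hψ
  have e3 := (wave hI η₁ η₂).weak_dx _ hψ
  simp only [hX, mul_zero, integral_zero] at e1 e2 e3
  have hc : LocBddLp I 1 (fun _ : ℝ × Torus => -waveMean η₁ η₂) :=
    ((UBdd.of_continuous (ι := Unit) continuous_const).mono_exponent le_top).single ()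
  have e4 : pairing I (wave hI η₁ η₂).dx (fun z => ρ z.1)
      = pairing I (waveDx η₁ η₂) (fun z => ρ z.1) + ∫ z in cyl I, -waveMean η₁ η₂ * ρ z.1 := by
    rw [← pairing_dens_test hI (hc.locInt le_rfl) hψ]
    exact pairing_add_test hI (locBddMeasure_waveDx η₁ η₂) (hc.dens hI) hψ
  have i1 := hm.integrableOn_mul_test hψ
  have i2 := (P'.dx_bdd.locInt one_le_two).integrableOn_mul_test hψ
  have i3 := hk.integrableOn_mul_test hψ
  rw [hdx, pairing_muDx hI hψ] at e1
  simp only [add_mul] at e1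
  rw [integral_add i1 i2] at e1
  simp only [neg_mul] at e4
  rw [integral_neg] at e4
  have e5 : ∫ z in cyl I, (2 * z.1 * momentumDensity P' Q' z + waveMean η₁ η₂) * ρ z.1 = 0 := by
    simp only [add_mul]
    rw [integral_add i1 i3]
    linarith
  rw [setIntegral_cyl (hf.integrableOn_mul_test hψ)] at e5
  simpa only [mul_one, integral_mul_const] using e5

end LimitEquations

lemma H1Converges.comp {F : ℕ → H1Field I} {G : H1Field I} (h : H1Converges F G)
    {k : ℕ → ℕ} (hk : StrictMono k) : H1Converges (fun n => F (k n)) G := fun a b hab =>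
  ⟨(h a b hab).1.comp hk, (h a b hab).2.1.comp hk, (h a b hab).2.2.1.comp hk,
    (h a b hab).2.2.2.comp hk.tendsto_atTop⟩

lemma exists_Icc_subset (hne : (interior I).Nonempty) :
    ∃ a b, a < b ∧ Icc a b ⊆ I := by
  obtain ⟨t, ht⟩ := hne
  obtain ⟨ε, hε, h⟩ := Metric.isOpen_iff.1 isOpen_interior t ht
  refine ⟨t, t + ε / 2, by linarith, fun s hs => interior_subset (h ?_)⟩
  rw [Metric.mem_ball, Real.dist_eq, abs_lt]
  constructor <;> linarith [hs.1, hs.2]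

/-- The constants by which the functions `μⁿ` are normalised: none if some averages are bounded. -/
lemma exists_normalisation (hI : I.OrdConnected) (hne : (interior I).Nonempty)
    (P : ℕ → H1Field I) (lam : ℕ → W11Field I) :
    ∃ (c : ℕ → ℝ) (p q A : ℝ), (BoundedAverages P lam → ∀ n, c n = 0) ∧ p < q ∧
      Icc p q ⊆ I ∧
      ∀ n, |∫ z in cyl (Icc p q), (muField hI (P n) (lam n) (c n)).val z| ≤ A := by
  by_cases hB : BoundedAverages P lam
  · obtain ⟨p, q, hpq, hsub, A, hA⟩ := hB
    refine ⟨fun _ => 0, p, q, A, fun _ _ => rfl, hpq, hsub, fun n => ?_⟩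
    simpa only [(muField_derivatives hI (P n) (lam n) 0 _).1, sub_zero] using hA n
  · obtain ⟨p, q, hpq, hsub⟩ := exists_Icc_subset hne
    refine ⟨fun n => (∫ z in cyl (Icc p q), ((lam n).val z + (P n).val z)) / (q - p), p, q, 0,
      fun h => absurd h hB, hpq, hsub, fun n => ?_⟩
    have i1 := ((lam n).val_bdd.locInt le_rfl).2 p q hsub
    have i2 := ((P n).val_bdd.locInt one_le_two).2 p q hsub
    have hv : volume.real (cyl (Icc p q)) = q - p := by
      rw [cyl, Measure.real, Measure.volume_eq_prod, Measure.prod_prod]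
      simp [hpq.le]
    simp only [(muField_derivatives hI (P n) (lam n) _ _).1]
    have i3 : IntegrableOn (fun z => (lam n).val z + (P n).val z) (cyl (Icc p q)) := i1.add i2
    rw [integral_sub i3 (integrable_const _)]
    simp only [integral_const, measureReal_restrict_apply_univ, hv, smul_eq_mul]
    rw [mul_div_cancel₀ _ (by linarith : q - p ≠ 0)]
    simp

/-- Subsequences are extracted for the limits of `P` and `Q`, the limit of `μ - c`, and the defect
measures of the two null energies. -/
theorem exists_convergent_subsequence (hI : I.OrdConnected) (hpos : I ⊆ Ioi 0)
    (hne : (interior I).Nonempty) (P Q : ℕ → H1Field I) (lam : ℕ → W11Field I)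
    (hsol : ∀ n, IsGowdySolution (P n) (Q n) (lam n)) (hE : EnergyBound P Q) :
    ∃ (k : ℕ → ℕ) (c : ℕ → ℝ) (P' Q' : H1Field I) (mu φ : BVField I) (κ : ℝ),
      StrictMono k ∧
      (BoundedAverages P lam → ∀ n, c n = 0) ∧
      H1Converges (fun n => P (k n)) P' ∧
      H1Converges (fun n => Q (k n)) Q' ∧
      MuConverges (fun n => P (k n)) (fun n => lam (k n)) c mu ∧
      IsH1BVSolution P' Q' mu ∧
      DefectConstraints P' Q' mu φ κ ∧
      WaveEq I φ.val (fun _ => 0) ∧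
      (∀ᵐ t ∂volume.restrict I,
        κ = -(2 * t) * ∫ θ : Torus, momentumDensity P' Q' (t, θ)) := by
  obtain ⟨hUP, hUQ⟩ := hE.uH1
  obtain ⟨c, p, q, A, hc, hpq, hsub, hA⟩ := exists_normalisation hI hne P lam
  obtain ⟨k₁, P', hk₁, hP₁⟩ := hUP.exists_limit hI hne
  obtain ⟨k₂, Q', hk₂, hQ₂⟩ := (hUQ.reindex k₁).exists_limit hI hne
  have hb := uBdd_muField hI hpos hsol hUP hUQ
  obtain ⟨k₃, g, hk₃, hg, hae, hgs⟩ := exists_strong_limit hI hne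
    (M := fun n => muField hI (P (k₁ (k₂ n))) (lam (k₁ (k₂ n))) (c (k₁ (k₂ n))))
    ((hb.1.reindex fun n => k₁ (k₂ n)).congr fun _ z => (muField_derivatives hI _ _ _ z).2.1.symm)
    ((hb.2.reindex fun n => k₁ (k₂ n)).congr fun _ z => (muField_derivatives hI _ _ _ z).2.2.symm)
    hpq hsub (fun n => hA _)
  have hdefect : ∀ (l : ℕ → ℕ), H1Converges (fun n => P (l n)) P' →
      H1Converges (fun n => Q (l n)) Q' → ∀ d : ℝ, d ^ 2 = 1 →
      ∃ (k : ℕ → ℕ) (η : SignedMeasure Torus), StrictMono k ∧ ∀ χ, IsTestFunction I χ →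
        Tendsto (fun n => ∫ z in cyl I, nullEnergy d (P (l (k n))) (Q (l (k n))) z * χ z) atTop
          (𝓝 ((∫ z in cyl I, nullEnergy d P' Q' z * χ z)
            + ∫ᵛ y, lineIntegral I d χ y ∂<•η)) := fun l hPl hQl d hd => by
    have hUPl := hUP.reindex l
    have hUQl := hUQ.reindex l
    have hs : ∀ n, EssentialEquations (P (l n)) (Q (l n)) := fun n => (hsol _).essential
    have hs' := limit_essential hI hpos hne hUPl hUQl hPl hQl hs
    exact exists_defect hI hne (hUPl.nullEnergy hI hUQl d)
      (hUPl.nullP.neg.sub le_rfl (hUPl.nullQ hI hUQl))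
      (((UH1.single (ι := Unit) P').nullEnergy hI (UH1.single Q') d).single ())
      (((UH1.single (ι := Unit) P').nullP.neg.sub le_rfl
        ((UH1.single P').nullQ hI (UH1.single Q'))).single ())
      (fun n => weakDir_nullEnergy hI hne hpos (hs n) hd) (weakDir_nullEnergy hI hne hpos hs' hd)
      (fun n t ht θ => mul_nonneg (hpos ht).le (by positivity))
      (fun ψ hψ => tendsto_null_source hI hpos hne hUPl hUQl hPl hQl hs hψ)
  have hP₃ := (hP₁.comp hk₂).comp hk₃
  have hQ₃ := hQ₂.comp hk₃
  obtain ⟨k₄, η₁, hk₄, h₁⟩ := hdefect (fun n => k₁ (k₂ (k₃ n))) hP₃ hQ₃ 1 (by norm_num)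
  have hP₄ := hP₃.comp hk₄
  have hQ₄ := hQ₃.comp hk₄
  obtain ⟨k₅, η₂, hk₅, h₂⟩ := hdefect (fun n => k₁ (k₂ (k₃ (k₄ n)))) hP₄ hQ₄ (-1) (by norm_num)
  have hk₄₅ := hk₄.comp hk₅
  obtain ⟨mu, hdt, hdx, hmu, hbv⟩ := exists_limit_mu hI hpos hne
    (fun n => hsol (k₁ (k₂ (k₃ (k₄ (k₅ n)))))) (hUP.reindex _) (hUQ.reindex _) (hP₄.comp hk₅)
    (hQ₄.comp hk₅) (fun χ hχ => (h₁ χ hχ).comp hk₅.tendsto_atTop) h₂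
    (c := fun n => c (k₁ (k₂ (k₃ (k₄ (k₅ n)))))) hg
    (fun a b hab => (hgs a b hab).comp hk₄₅.tendsto_atTop)
    (hae.mono fun z hz => hz.comp hk₄₅.tendsto_atTop)
  exact ⟨fun n => k₁ (k₂ (k₃ (k₄ (k₅ n)))), fun n => c (k₁ (k₂ (k₃ (k₄ (k₅ n))))), P', Q', mu,
    wave hI η₁ η₂, waveMean η₁ η₂, hk₁.comp (hk₂.comp (hk₃.comp hk₄₅)), fun h n => hc h _,
    hP₄.comp hk₅, hQ₄.comp hk₅, hmu, hbv, defectConstraints hI hpos hdt hdx, waveEq_wave hI η₁ η₂,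
    waveMean_eq hI hdx⟩

/-! ### Oscillating solutions of the ordinary differential equation of a mode -/

/-- The integrals `∫₀^π sin^m s cos(x sin s + φ) ds`. For `m = 0` and `φ = 0` this is `π` times the
Bessel function of order zero; differentiation in `x` increases `m` by one and `φ` by `π / 2`. -/
noncomputable def besselMoment (m : ℕ) (φ x : ℝ) : ℝ :=
  ∫ s in (0 : ℝ)..Real.pi, Real.sin s ^ m * Real.cos (x * Real.sin s + φ)

lemma hasDerivAt_besselMoment (m : ℕ) (φ x : ℝ) :
    HasDerivAt (besselMoment m φ) (besselMoment (m + 1) (φ + π / 2) x) x := by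
  refine (intervalIntegral.hasDerivAt_integral_of_dominated_loc_of_deriv_le (μ := volume)
    (F := fun x s => Real.sin s ^ m * Real.cos (x * Real.sin s + φ))
    (F' := fun x s => Real.sin s ^ (m + 1) * Real.cos (x * Real.sin s + (φ + π / 2)))
    (s := univ) (bound := fun _ => 1) univ_mem
    (Eventually.of_forall fun y => ?_) ?_ ?_ (ae_of_all _ fun s _ y _ => ?_) ?_
    (ae_of_all _ fun s _ y _ => ?_)).2
  · exact (by fun_prop : Continuous fun s => Real.sin s ^ m
      * Real.cos (y * Real.sin s + φ)).aestronglyMeasurable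
  · exact (by fun_prop : Continuous fun s => Real.sin s ^ m
      * Real.cos (x * Real.sin s + φ)).intervalIntegrable _ _
  · exact (by fun_prop : Continuous fun s => Real.sin s ^ (m + 1)
      * Real.cos (x * Real.sin s + (φ + π / 2))).aestronglyMeasurable
  · rw [norm_mul, norm_pow, Real.norm_eq_abs, Real.norm_eq_abs]
    exact mul_le_one₀ (pow_le_one₀ (abs_nonneg _) (Real.abs_sin_le_one _)) (abs_nonneg _)
      (Real.abs_cos_le_one _)
  · exact intervalIntegrable_const
  · have h := (((hasDerivAt_id y).mul_const (Real.sin s)).add_const φ).cos.const_mul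
      (Real.sin s ^ m)
    refine h.congr_deriv ?_
    rw [← add_assoc, Real.cos_add_pi_div_two, id]
    ring

lemma contDiff_besselMoment (m : ℕ) (φ : ℝ) : ContDiff ℝ ∞ (besselMoment m φ) := by
  rw [contDiff_infty]
  intro n
  induction n generalizing m φ with
  | zero =>
    exact contDiff_zero.2 (continuous_iff_continuousAt.2 fun x =>
      (hasDerivAt_besselMoment m φ x).continuousAt)
  | succ n ih =>
    rw [show ((n + 1 : ℕ) : ℕ∞ω) = (n : ℕ∞ω) + 1 from rfl, contDiff_succ_iff_deriv]
    refine ⟨fun x => (hasDerivAt_besselMoment m φ x).differentiableAt, fun h => by simp at h, ?_⟩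
    rw [show deriv (besselMoment m φ) = besselMoment (m + 1) (φ + π / 2) from
      funext fun x => (hasDerivAt_besselMoment m φ x).deriv]
    exact ih _ _

/-- Bessel's equation of order zero. -/
lemma besselMoment_ode (x : ℝ) : x * deriv (deriv (besselMoment 0 0)) x
    + deriv (besselMoment 0 0) x + x * besselMoment 0 0 x = 0 := by
  have hd : ∀ m φ, deriv (besselMoment m φ) = besselMoment (m + 1) (φ + π / 2) := fun m φ =>
    funext fun x => (hasDerivAt_besselMoment m φ x).deriv
  simp only [hd, besselMoment]
  have i : ∀ (m : ℕ) (φ : ℝ), IntervalIntegrable (fun s => Real.sin s ^ m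
      * Real.cos (x * Real.sin s + φ)) volume 0 π := fun m φ =>
    (by fun_prop : Continuous fun s => Real.sin s ^ m
      * Real.cos (x * Real.sin s + φ)).intervalIntegrable _ _
  rw [← intervalIntegral.integral_const_mul, ← intervalIntegral.integral_const_mul,
    ← intervalIntegral.integral_add ((i _ _).const_mul _) (i _ _),
    ← intervalIntegral.integral_add (((i _ _).const_mul _).add (i _ _)) ((i _ _).const_mul _)]
  -- The integrand is the derivative of `cos s * sin (x * sin s)`, which vanishes at both ends.
  have h : ∀ s ∈ Set.uIcc 0 π, HasDerivAt
      (fun s => Real.cos s * Real.sin (x * Real.sin s))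
      (x * (Real.sin s ^ (0 + 1 + 1)
        * Real.cos (x * Real.sin s + (0 + π / 2 + π / 2)))
      + Real.sin s ^ (0 + 1) * Real.cos (x * Real.sin s + (0 + π / 2))
      + x * (Real.sin s ^ 0 * Real.cos (x * Real.sin s + 0))) s := fun s _ => by
    refine ((Real.hasDerivAt_cos s).mul (((Real.hasDerivAt_sin s).const_mul x).sin)).congr_deriv ?_
    rw [show x * Real.sin s + (0 + π / 2 + π / 2) = x * Real.sin s + π by ring,
      Real.cos_add_pi, zero_add (π / 2), Real.cos_add_pi_div_two, add_zero]
    linear_combination x * Real.cos (x * Real.sin s) * Real.sin_sq_add_cos_sq s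
  rw [intervalIntegral.integral_eq_sub_of_hasDerivAt h
    ((((i _ _).const_mul _).add (i _ _)).add ((i _ _).const_mul _))]
  simp

/-- A smooth solution of the ordinary differential equation satisfied by the Fourier coefficient of
frequency `w` of a solution of `P_tt - P_θθ + P_t / t = 0`. -/
structure IsMode (w : ℝ) (a : ℝ → ℝ) : Prop where
  smooth : ContDiff ℝ ∞ a
  ode : ∀ t, t * deriv (deriv a) t + deriv a t + t * w ^ 2 * a t = 0

/-- `a'² + w² a²`. For the solution `P = a(t) cos (2 π k θ)`, `Q = 0`, where `w = 2 π k`, the mean of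
`λ_t` over the circle is `t / 2` times this function. -/
noncomputable def modeEnergy (w : ℝ) (a : ℝ → ℝ) (t : ℝ) : ℝ := deriv a t ^ 2 + w ^ 2 * a t ^ 2

namespace IsMode

variable {w : ℝ} {a : ℝ → ℝ} (h : IsMode w a)
include h

lemma contDiff_deriv : ContDiff ℝ ∞ (deriv a) := (contDiff_infty_iff_deriv.1 h.smooth).2

lemma hasDerivAt (t : ℝ) : HasDerivAt a (deriv a t) t :=
  (h.smooth.differentiable (by simp) t).hasDerivAt

lemma hasDerivAt_deriv (t : ℝ) : HasDerivAt (deriv a) (deriv (deriv a) t) t :=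
  (h.contDiff_deriv.differentiable (by simp) t).hasDerivAt

lemma hasDerivAt_modeEnergy (t : ℝ) : HasDerivAt (modeEnergy w a)
    (2 * deriv a t * deriv (deriv a) t + w ^ 2 * (2 * a t * deriv a t)) t := by
  refine (((h.hasDerivAt_deriv t).pow 2).add (((h.hasDerivAt t).pow 2).const_mul
    (w ^ 2))).congr_deriv ?_
  ring

/-- The derivative of the energy is `-2 a'² / t`. -/
lemma antitoneOn_modeEnergy : AntitoneOn (modeEnergy w a) (Ioi 0) := by
  refine antitoneOn_of_deriv_nonpos (convex_Ioi 0)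
    (fun t _ => (h.hasDerivAt_modeEnergy t).continuousAt.continuousWithinAt)
    (fun t _ => (h.hasDerivAt_modeEnergy t).differentiableAt.differentiableWithinAt)
    fun t ht => ?_
  rw [interior_Ioi] at ht
  rw [(h.hasDerivAt_modeEnergy t).deriv]
  have h1 : 2 * deriv a t * deriv (deriv a) t + w ^ 2 * (2 * a t * deriv a t)
      = -(2 * deriv a t ^ 2) / t := by
    rw [eq_div_iff (ne_of_gt ht)]
    linear_combination 2 * deriv a t * h.ode t
  rw [h1]
  exact div_nonpos_of_nonpos_of_nonneg (by nlinarith [sq_nonneg (deriv a t)]) (le_of_lt ht)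

/-- The derivative is `2 t w² a²`: the energy decays at most like `t⁻²`. -/
lemma monotoneOn_sq_mul_modeEnergy :
    MonotoneOn (fun t => t ^ 2 * modeEnergy w a t) (Set.Ici 0) := by
  have hd : ∀ t, HasDerivAt (fun t => t ^ 2 * modeEnergy w a t) (2 * t * (w ^ 2 * a t ^ 2)) t :=
    fun t => by
      refine ((hasDerivAt_pow 2 t).mul (h.hasDerivAt_modeEnergy t)).congr_deriv ?_
      simp only [modeEnergy]
      push_cast
      linear_combination 2 * t * deriv a t * h.ode t
  refine monotoneOn_of_deriv_nonneg (convex_Ici 0)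
    (fun t _ => (hd t).continuousAt.continuousWithinAt)
    (fun t _ => (hd t).differentiableAt.differentiableWithinAt) fun t ht => ?_
  rw [interior_Ici] at ht
  rw [(hd t).deriv]
  have : 0 < t := ht
  positivity

lemma const_mul (c : ℝ) : IsMode w (fun t => c * a t) where
  smooth := contDiff_const.mul h.smooth
  ode t := by
    have h1 : deriv (fun t => c * a t) = fun t => c * deriv a t :=
      funext fun s => ((h.hasDerivAt s).const_mul c).deriv
    rw [h1, ((h.hasDerivAt_deriv t).const_mul c).deriv]
    linear_combination c * h.ode t

lemma modeEnergy_const_mul (c t : ℝ) :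
    modeEnergy w (fun t => c * a t) t = c ^ 2 * modeEnergy w a t := by
  simp only [modeEnergy, ((h.hasDerivAt t).const_mul c).deriv]
  ring

/-- A mode whose energy vanishes at a positive time vanishes at time zero. -/
lemma eq_zero_of_modeEnergy (hw : w ≠ 0) {t₀ : ℝ} (ht₀ : 0 < t₀) (h0 : modeEnergy w a t₀ = 0) :
    a 0 = 0 := by
  have hz : ∀ t ∈ Set.Ioo 0 t₀, a t = 0 := fun t ht => by
    have h1 := h.monotoneOn_sq_mul_modeEnergy (Set.mem_Ici.2 ht.1.le) (Set.mem_Ici.2 ht₀.le)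
      ht.2.le
    simp only [h0, mul_zero] at h1
    have h2 : modeEnergy w a t ≤ 0 := nonpos_of_mul_nonpos_right h1 (pow_pos ht.1 2)
    have h3 : w ^ 2 * a t ^ 2 ≤ 0 := by
      rw [modeEnergy] at h2
      nlinarith [sq_nonneg (deriv a t)]
    have h4 : a t ^ 2 ≤ 0 := nonpos_of_mul_nonpos_right h3 (by positivity)
    exact pow_eq_zero_iff two_ne_zero |>.1 (le_antisymm h4 (sq_nonneg _))
  have h1 : Tendsto a (𝓝[>] 0) (𝓝 (a 0)) :=
    h.smooth.continuous.continuousAt.tendsto.mono_left nhdsWithin_le_nhds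
  refine tendsto_nhds_unique h1 (tendsto_const_nhds.congr' ?_)
  filter_upwards [Ioo_mem_nhdsGT ht₀] with t ht
  exact (hz t ht).symm

end IsMode

/-- The rescaled Bessel function, normalised at a given time. -/
lemma exists_mode {w : ℝ} (hw : w ≠ 0) {t₀ : ℝ} (ht₀ : 0 < t₀) :
    ∃ a, IsMode w a ∧ modeEnergy w a t₀ = 1 := by
  have hb : IsMode w (fun t => besselMoment 0 0 (w * t)) := by
    have hs := contDiff_besselMoment 0 0
    have h1 : ∀ t, HasDerivAt (fun t => besselMoment 0 0 (w * t))
        (deriv (besselMoment 0 0) (w * t) * w) t := fun t =>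
      (((hs.differentiable (by simp) (w * t)).hasDerivAt).comp t
        ((hasDerivAt_id t).const_mul w)).congr_deriv (by simp)
    have h2 : ∀ t, HasDerivAt (fun t => deriv (besselMoment 0 0) (w * t) * w)
        (deriv (deriv (besselMoment 0 0)) (w * t) * w * w) t := fun t =>
      (((((contDiff_infty_iff_deriv.1 hs).2.differentiable (by simp)
        (w * t)).hasDerivAt).comp t ((hasDerivAt_id t).const_mul w)).mul_const w).congr_deriv
        (by simp)
    refine ⟨hs.comp (contDiff_const.mul contDiff_id), fun t => ?_⟩
    rw [show deriv (fun t => besselMoment 0 0 (w * t))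
      = fun t => deriv (besselMoment 0 0) (w * t) * w from funext fun t => (h1 t).deriv,
      (h2 t).deriv]
    linear_combination w * besselMoment_ode (w * t)
  have h0 : modeEnergy w (fun t => besselMoment 0 0 (w * t)) t₀ ≠ 0 := fun h => by
    have h1 := hb.eq_zero_of_modeEnergy hw ht₀ h
    simp [besselMoment, Real.pi_ne_zero] at h1
  have hp : 0 < modeEnergy w (fun t => besselMoment 0 0 (w * t)) t₀ :=
    lt_of_le_of_ne (by rw [modeEnergy]; positivity) (Ne.symm h0)
  refine ⟨_, hb.const_mul (Real.sqrt (modeEnergy w (fun t => besselMoment 0 0 (w * t)) t₀))⁻¹, ?_⟩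
  rw [hb.modeEnergy_const_mul, inv_pow, Real.sq_sqrt hp.le, inv_mul_cancel₀ h0]

/-- A bound of the energy which does not depend on the frequency. -/
lemma IsMode.modeEnergy_le {w : ℝ} {a : ℝ → ℝ} (h : IsMode w a) {t₀ p t : ℝ} (ht₀ : 0 < t₀)
    (h1 : modeEnergy w a t₀ = 1) (hp : 0 < p) (hpt : p ≤ t) :
    modeEnergy w a t ≤ 1 + t₀ ^ 2 / p ^ 2 := by
  have ht : 0 < t := hp.trans_le hpt
  have h0 : 0 ≤ t₀ ^ 2 / p ^ 2 := by positivity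
  rcases le_total t₀ t with hle | hle
  · have := h.antitoneOn_modeEnergy (Set.mem_Ioi.2 ht₀) (Set.mem_Ioi.2 ht) hle
    linarith
  · have h2 := h.monotoneOn_sq_mul_modeEnergy (Set.mem_Ici.2 ht.le) (Set.mem_Ici.2 ht₀.le) hle
    simp only [h1, mul_one] at h2
    have h3 : modeEnergy w a t ≤ t₀ ^ 2 / t ^ 2 := by
      rw [le_div_iff₀ (by positivity)]
      linarith
    have h4 : t₀ ^ 2 / t ^ 2 ≤ t₀ ^ 2 / p ^ 2 := by gcongr
    linarith

/-- A lower bound of the energy which does not depend on the frequency. -/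
lemma IsMode.le_modeEnergy {w : ℝ} {a : ℝ → ℝ} (h : IsMode w a) {t₀ t : ℝ} (ht₀ : 0 < t₀)
    (h1 : modeEnergy w a t₀ = 1) (ht : t₀ ≤ t) : t₀ ^ 2 ≤ t ^ 2 * modeEnergy w a t := by
  have h2 := h.monotoneOn_sq_mul_modeEnergy (Set.mem_Ici.2 ht₀.le)
    (Set.mem_Ici.2 (ht₀.le.trans ht)) ht
  simpa only [h1, mul_one] using h2

/-! ### Smooth fields and separated variables -/

lemma SmoothFn.locBddLp {p : ℝ≥0∞} {F : ℝ × Torus → ℝ} (hF : SmoothFn F) :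
    LocBddLp I p F :=
  ((UBdd.of_continuous (ι := Unit) hF.continuous).mono_exponent le_top).single ()

/-- A smooth function, with its classical derivatives. -/
noncomputable def SobolevField.ofSmooth {I : Set ℝ} (hI : I.OrdConnected) {p : ℝ≥0∞}
    {F : ℝ × Torus → ℝ} (hF : SmoothFn F) : SobolevField I p where
  val := F
  dt := partialT F
  dx := partialX F
  val_bdd := hF.locBddLp
  dt_bdd := hF.partialT_smooth.locBddLp
  dx_bdd := hF.partialX_smooth.locBddLp
  weak_dt ψ hψ := by
    simpa [lineD] using (LineAC.of_smooth hF).weakDir hI (c := 0)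
      (locInt_of_continuous hF.continuous)
      (locInt_of_continuous (hF.lineD_smooth 0).continuous) ψ hψ
  weak_dx := by
    have hc : ∀ c, WeakDir I c F (lineD c F) := fun c =>
      (LineAC.of_smooth hF).weakDir hI (locInt_of_continuous hF.continuous)
        (locInt_of_continuous (hF.lineD_smooth c).continuous)
    refine WeakDir.weakDX (locInt_of_continuous hF.continuous)
      (locInt_of_continuous hF.partialT_smooth.continuous)
      (locInt_of_continuous hF.partialX_smooth.continuous) ?_ ?_
    · have e : lineD 0 F = partialT F := funext fun z => by simp [lineD]
      exact e ▸ hc 0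
    · have e : lineD 1 F = fun z => partialT F z + partialX F z :=
        funext fun z => by simp [lineD]
      exact e ▸ hc 1

lemma SmoothFn.waveEq (hI : I.OrdConnected) {F s : ℝ × Torus → ℝ} (hF : SmoothFn F)
    (h : ∀ t ∈ I, ∀ θ, box F (t, θ) = s (t, θ)) : WaveEq I F s := by
  intro ψ hψ
  have hw : ∀ (c : ℝ) {G : ℝ × Torus → ℝ}, SmoothFn G → WeakDir I c G (lineD c G) := fun c G hG =>
    (LineAC.of_smooth hG).weakDir hI (locInt_of_continuous hG.continuous)
      (locInt_of_continuous (hG.lineD_smooth c).continuous)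
  simp only [hψ.smoothFn.box_eq_lineD (c := 1) (by norm_num)]
  rw [hw 1 hF _ (hψ.lineD (-1)), hw (-1) (hF.lineD_smooth 1) ψ hψ, neg_neg]
  refine setIntegral_congr_fun (measurableSet_cyl hI.measurableSet) fun z hz => ?_
  have h1 := hF.box_eq_lineD (c := -1) (by norm_num) z
  rw [neg_neg] at h1
  simp only [← h1]
  rw [← h z.1 hz.1 z.2]

lemma partialT_separated {B D : ℝ → ℝ} (hB : Differentiable ℝ B) (hD : Differentiable ℝ D)
    (χ : Torus → ℝ) : partialT (fun z => B z.1 + D z.1 * χ z.2)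
      = fun z => deriv B z.1 + deriv D z.1 * χ z.2 := by
  funext z
  exact ((hB z.1).hasDerivAt.add ((hD z.1).hasDerivAt.mul_const (χ z.2))).deriv

lemma partialX_separated (B D : ℝ → ℝ) {χ χ' : Torus → ℝ}
    (h : ∀ x : ℝ, HasDerivAt (fun x : ℝ => χ (x : Torus)) (χ' (x : Torus)) x) :
    partialX (fun z => B z.1 + D z.1 * χ z.2) = fun z => 0 + D z.1 * χ' z.2 := by
  funext ⟨t, θ⟩
  refine torus_forall (p := fun θ => partialX (fun z => B z.1 + D z.1 * χ z.2) (t, θ)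
    = 0 + D t * χ' θ) (fun x => ?_) θ
  have h1 : HasDerivAt (fun y : ℝ => χ ((x : Torus) + (y : Torus))) (χ' (x : Torus)) 0 := by
    have h2 := HasDerivAt.comp_const_add (f := fun x : ℝ => χ (x : Torus)) x 0
      (by simpa using h x)
    simpa using h2
  rw [zero_add]
  exact ((h1.const_mul (D t)).const_add (B t)).deriv

/-! ### A family of smooth solutions of the Gowdy equations -/

/-- The function `cos (2 π k θ)`. -/
noncomputable def cosine (k : ℤ) (θ : Torus) : ℝ := (fourier k θ).re

/-- The function `sin (2 π k θ)`. -/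
noncomputable def sine (k : ℤ) (θ : Torus) : ℝ := (fourier k θ).im

lemma cosine_sq_add_sine_sq (k : ℤ) (θ : Torus) : cosine k θ ^ 2 + sine k θ ^ 2 = 1 := by
  have h : ‖fourier k θ‖ = 1 := by rw [fourier_apply, Circle.norm_coe]
  have h1 := Complex.sq_norm (fourier k θ)
  rw [h, Complex.normSq_apply] at h1
  simp only [cosine, sine]
  linarith

lemma abs_cosine_le (k : ℤ) (θ : Torus) : |cosine k θ| ≤ 1 :=
  abs_le_one_iff_mul_self_le_one.2 (by
    nlinarith [cosine_sq_add_sine_sq k θ, sq_nonneg (sine k θ)])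

lemma abs_sine_le (k : ℤ) (θ : Torus) : |sine k θ| ≤ 1 :=
  abs_le_one_iff_mul_self_le_one.2 (by
    nlinarith [cosine_sq_add_sine_sq k θ, sq_nonneg (cosine k θ)])

lemma cosine_add_self (k : ℤ) (θ : Torus) :
    cosine (k + k) θ = cosine k θ ^ 2 - sine k θ ^ 2 := by
  simp only [cosine, sine, fourier_add, Complex.mul_re]
  ring

lemma sine_add_self (k : ℤ) (θ : Torus) : sine (k + k) θ = 2 * cosine k θ * sine k θ := by
  simp only [cosine, sine, fourier_add, Complex.mul_im]
  ring

lemma integral_cosine {k : ℤ} (hk : k ≠ 0) : ∫ θ, cosine k θ = 0 :=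
  integral_eq_zero_of_add_right_eq_neg (g := ((1 / 2 / k : ℝ) : Torus)) fun θ =>
    (congrArg Complex.re (fourier_add_half_inv_index hk one_pos θ)).trans (Complex.neg_re _)

lemma hasDerivAt_cosine (k : ℤ) (x : ℝ) : HasDerivAt (fun x : ℝ => cosine k (x : Torus))
    (-(2 * π * k) * sine k (x : Torus)) x := hasDerivAt_fourier_re k x

lemma hasDerivAt_sine (k : ℤ) (x : ℝ) :
    HasDerivAt (fun x : ℝ => -(2 * π * k) * sine k (x : Torus))
    (-(2 * π * k) * (2 * π * k * cosine k (x : Torus))) x :=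
  (hasDerivAt_fourier_im k x).const_mul _

section ModeSolution

variable (hI : I.OrdConnected) {k : ℤ} {a : ℝ → ℝ}
  (h : IsMode (2 * π * k) a)

include h

lemma IsMode.smoothFn : SmoothFn fun z => (0 : ℝ) + a z.1 * cosine k z.2 :=
  (SmoothFn.of_time contDiff_const).add
    ((SmoothFn.of_time h.smooth).mul (SmoothFn.of_space (contDiff_fourier_re k)))

/-- The mean value of `λ` over the circle, for the solution `P = a(t) cos (2 π k θ)`, `Q = 0`. -/
noncomputable def lamMean (w : ℝ) (a : ℝ → ℝ) (t : ℝ) : ℝ :=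
  1 / 2 * (t ^ 2 * modeEnergy w a t + t * a t * deriv a t)

/-- The amplitude of the oscillation of `λ`, for the solution `P = a(t) cos (2 π k θ)`, `Q = 0`. -/
noncomputable def lamAmplitude (a : ℝ → ℝ) (t : ℝ) : ℝ := 1 / 2 * (t * a t * deriv a t)

lemma IsMode.hasDerivAt_lamMean (t : ℝ) : HasDerivAt (lamMean (2 * π * k) a)
    (1 / 2 * t * modeEnergy (2 * π * k) a t) t := by
  refine ((((hasDerivAt_pow 2 t).mul (h.hasDerivAt_modeEnergy t)).add
    (((hasDerivAt_id t).mul (h.hasDerivAt t)).mul (h.hasDerivAt_deriv t))).const_mul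
      (1 / 2)).congr_deriv ?_
  simp only [modeEnergy, Pi.mul_apply, id]
  push_cast
  linear_combination (t * deriv a t + 1 / 2 * a t) * h.ode t

lemma IsMode.hasDerivAt_lamAmplitude (t : ℝ) : HasDerivAt (lamAmplitude a)
    (1 / 2 * t * (deriv a t ^ 2 - (2 * π * k) ^ 2 * a t ^ 2)) t := by
  refine ((((hasDerivAt_id t).mul (h.hasDerivAt t)).mul (h.hasDerivAt_deriv t)).const_mul
      (1 / 2)).congr_deriv ?_
  simp only [Pi.mul_apply, id]
  linear_combination (1 / 2 * a t) * h.ode t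

lemma IsMode.contDiff_lam :
    ContDiff ℝ ∞ (lamMean (2 * π * k) a) ∧ ContDiff ℝ ∞ (lamAmplitude a) := by
  have h1 := h.smooth
  have h2 := h.contDiff_deriv
  constructor
  · unfold lamMean modeEnergy
    fun_prop
  · unfold lamAmplitude
    fun_prop

lemma IsMode.smoothFn_lam : SmoothFn fun z =>
    lamMean (2 * π * k) a z.1 + lamAmplitude a z.1 * cosine (k + k) z.2 :=
  (SmoothFn.of_time h.contDiff_lam.1).add
    ((SmoothFn.of_time h.contDiff_lam.2).mul (SmoothFn.of_space (contDiff_fourier_re (k + k))))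

/-- The field `P = a(t) cos (2 π k θ)`. -/
noncomputable def IsMode.field : H1Field I := SobolevField.ofSmooth hI h.smoothFn

/-- The field `λ` associated with `P = a(t) cos (2 π k θ)` and `Q = 0`. -/
noncomputable def IsMode.lam : W11Field I := SobolevField.ofSmooth hI h.smoothFn_lam

lemma IsMode.field_val (z : ℝ × Torus) : (h.field hI).val z = a z.1 * cosine k z.2 := zero_add _

lemma IsMode.field_dt (z : ℝ × Torus) : (h.field hI).dt z = deriv a z.1 * cosine k z.2 := by
  refine (congrFun (partialT_separated (differentiable_const 0)
    (h.smooth.differentiable (by simp)) (cosine k)) z).trans ?_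
  simp

lemma IsMode.field_dx (z : ℝ × Torus) :
    (h.field hI).dx z = a z.1 * (-(2 * π * k) * sine k z.2) :=
  (congrFun (partialX_separated (χ := cosine k)
    (χ' := fun θ => -(2 * π * k) * sine k θ) (fun _ => 0) a (hasDerivAt_cosine k)) z).trans (zero_add _)

lemma IsMode.lam_dt (z : ℝ × Torus) : (h.lam hI).dt z
    = 1 / 2 * z.1 * modeEnergy (2 * π * k) a z.1
      + 1 / 2 * z.1 * (deriv a z.1 ^ 2 - (2 * π * k) ^ 2 * a z.1 ^ 2)
        * cosine (k + k) z.2 := by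
  refine (congrFun (partialT_separated (h.contDiff_lam.1.differentiable (by simp))
    (h.contDiff_lam.2.differentiable (by simp)) (cosine (k + k))) z).trans ?_
  rw [(h.hasDerivAt_lamMean z.1).deriv, (h.hasDerivAt_lamAmplitude z.1).deriv]

lemma IsMode.lam_dx (z : ℝ × Torus) : (h.lam hI).dx z
    = lamAmplitude a z.1 * (-(2 * π * (k + k : ℤ)) * sine (k + k) z.2) :=
  (congrFun (partialX_separated (χ := cosine (k + k))
    (χ' := fun θ => -(2 * π * (k + k : ℤ)) * sine (k + k) θ) _ _ (hasDerivAt_cosine (k + k))) z).trans (zero_add _)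

lemma IsMode.box_field (t : ℝ) (ht : 0 < t) (θ : Torus) :
    box (h.field hI).val (t, θ) = -(deriv a t * cosine k θ / t) := by
  have hd := h.smooth.differentiable (by simp)
  have e1 : partialT (h.field hI).val = fun z => 0 + deriv a z.1 * cosine k z.2 := by
    refine (partialT_separated (differentiable_const 0) hd (cosine k)).trans ?_
    simp
  have e2 : partialX (h.field hI).val = fun z => 0 + a z.1 * (-(2 * π * k) * sine k z.2) :=
    partialX_separated (χ := cosine k) (χ' := fun θ => -(2 * π * k) * sine k θ)
      (fun _ => 0) a (hasDerivAt_cosine k)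
  rw [box, e1, e2, partialT_separated (differentiable_const 0)
    (h.contDiff_deriv.differentiable (by simp)), partialX_separated
    (χ := fun θ => -(2 * π * k) * sine k θ)
    (χ' := fun θ => -(2 * π * k) * (2 * π * k * cosine k θ))
    (fun _ => 0) a (hasDerivAt_sine k)]
  simp only [deriv_const]
  field_simp
  linear_combination cosine k θ * h.ode t

lemma IsMode.box_lam (t : ℝ) (θ : Torus) : box (h.lam hI).val (t, θ)
    = -((deriv a t * cosine k θ) ^ 2) + (a t * (-(2 * π * k) * sine k θ)) ^ 2 := by
  have e1 : partialT (h.lam hI).val = fun z =>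
      (fun t => 1 / 2 * t * modeEnergy (2 * π * k) a t) z.1
      + (fun t => 1 / 2 * t * (deriv a t ^ 2 - (2 * π * k) ^ 2 * a t ^ 2)) z.1
        * cosine (k + k) z.2 := funext fun z => h.lam_dt hI z
  have e2 : partialX (h.lam hI).val = fun z => 0
      + lamAmplitude a z.1 * (-(2 * π * (k + k : ℤ)) * sine (k + k) z.2) :=
    partialX_separated (χ := cosine (k + k))
      (χ' := fun θ => -(2 * π * (k + k : ℤ)) * sine (k + k) θ) _ _
      (hasDerivAt_cosine (k + k))
  have d1 : ∀ t, HasDerivAt (fun t => 1 / 2 * t * modeEnergy (2 * π * k) a t)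
      (1 / 2 * ((2 * π * k) ^ 2 * a t ^ 2 - deriv a t ^ 2)) t := fun t => by
    refine (((hasDerivAt_id t).const_mul (1 / 2)).mul (h.hasDerivAt_modeEnergy t)).congr_deriv ?_
    simp only [modeEnergy, id]
    linear_combination deriv a t * h.ode t
  have d2 : ∀ t, HasDerivAt
      (fun t => 1 / 2 * t * (deriv a t ^ 2 - (2 * π * k) ^ 2 * a t ^ 2))
      (-(1 / 2) * (deriv a t ^ 2 + (2 * π * k) ^ 2 * a t ^ 2)
        - 2 * t * (2 * π * k) ^ 2 * a t * deriv a t) t := fun t => by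
    refine (((hasDerivAt_id t).const_mul (1 / 2)).mul (((h.hasDerivAt_deriv t).pow 2).sub
      (((h.hasDerivAt t).pow 2).const_mul ((2 * π * k) ^ 2)))).congr_deriv ?_
    simp only [id, Pi.sub_apply, Pi.pow_apply]
    push_cast
    linear_combination deriv a t * h.ode t
  rw [box, e1, e2, partialT_separated (fun t => (d1 t).differentiableAt)
    (fun t => (d2 t).differentiableAt), partialX_separated
    (χ := fun θ => -(2 * π * (k + k : ℤ)) * sine (k + k) θ)
    (χ' := fun θ => -(2 * π * (k + k : ℤ)) * (2 * π * (k + k : ℤ) * cosine (k + k) θ))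
    (fun _ => 0) (lamAmplitude a) (hasDerivAt_sine (k + k))]
  simp only [(d1 t).deriv, (d2 t).deriv, cosine_add_self, lamAmplitude]
  push_cast
  linear_combination (-1 / 2 * ((2 * π * k) ^ 2 * a t ^ 2 - deriv a t ^ 2))
    * cosine_sq_add_sine_sq k θ

lemma IsMode.isGowdySolution (hpos : I ⊆ Ioi 0) :
    IsGowdySolution (h.field hI) (SobolevField.const hI 0) (h.lam hI) where
  essential := by
    refine ⟨h.smoothFn.waveEq hI fun t ht θ => ?_, fun ψ hψ => ?_⟩
    · simp only [h.field_dt, SobolevField.const]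
      refine (h.box_field hI t (hpos ht) θ).trans ?_
      ring
    · simp [SobolevField.const]
  evolution := by
    refine h.smoothFn_lam.waveEq hI fun t _ θ => ?_
    simp only [h.field_dt, h.field_dx, SobolevField.const]
    refine (h.box_lam hI t θ).trans ?_
    ring
  constraint_t := by
    filter_upwards [ae_cyl_pos hI hpos] with z hz
    simp only [energyDensity, h.field_dt, h.field_dx, h.lam_dt, SobolevField.const,
      cosine_add_self, modeEnergy]
    field_simp
    linear_combination (-(deriv a z.1 ^ 2 + (2 * π * k) ^ 2 * a z.1 ^ 2))
      * cosine_sq_add_sine_sq k z.2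
  constraint_x := by
    filter_upwards [ae_cyl_pos hI hpos] with z hz
    simp only [momentumDensity, h.field_dt, h.field_dx, h.lam_dx, SobolevField.const,
      sine_add_self, lamAmplitude]
    push_cast
    field_simp
    ring

end ModeSolution

/-! ### Loss of the constraint equations in the limit -/

/-- Weak derivatives along lines of a function which vanishes almost everywhere vanish almost
everywhere. Fields carry their derivatives as data, hence this is needed for the limit `P' = 0`. -/
lemma WeakDir.ae_eq_zero (hI : I.OrdConnected) (hne : (interior I).Nonempty) {c : ℝ}
    {f g : ℝ × Torus → ℝ} (h : WeakDir I c f g) (hf : LocInt I f) (hg : LocInt I g)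
    (h0 : ∀ᵐ z ∂volume.restrict (cyl I), f z = 0) :
    ∀ᵐ z ∂volume.restrict (cyl I), g z = 0 := by
  have h1 := ae_slice' ((measurePreserving_shear c I).quasiMeasurePreserving.ae h0)
  have hg' := hg.shear c
  have h2 : ∀ᵐ y : Torus, ∀ᵐ t ∂volume.restrict I, g (shear c (t, y)) = 0 := by
    filter_upwards [h.lineAC hI hne hf hg, h1, hg'.ae_integrableOn_line hI] with y hy hy0 hgy
    obtain ⟨F, huF, hac, hd⟩ := hy
    refine ae_eq_zero_of_timeTest hI hgy fun ρ hρ => ?_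
    obtain ⟨a, b, hab, hs⟩ := hρ.2
    have h3 := integral_mul_deriv_of_absolutelyContinuous hI hac hd (hρ.1.of_le (by simp))
      (hab.trans interior_subset) hs
    have h4 : ∫ t in I, F t * deriv ρ t = 0 := by
      refine (integral_congr_ae ?_).trans (integral_zero' _ _)
      filter_upwards [huF, hy0] with t ht ht0
      rw [shear_apply] at ht0
      rw [← ht, ht0, zero_mul, Pi.zero_apply]
    simp only [shear_apply]
    linarith
  refine ae_cyl_of_forall_Icc hI fun a b hab => ?_
  have hi : IntegrableOn (fun z => ‖g (shear c z)‖) (cyl (Icc a b)) := (hg'.2 a b hab).norm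
  have h5 : ∫ z in cyl (Icc a b), ‖g z‖ = 0 := by
    rw [← setIntegral_shear c, setIntegral_cyl_symm hi]
    refine (integral_congr_ae ?_).trans (integral_zero' _ _)
    filter_upwards [h2] with y hy
    refine (integral_congr_ae ?_).trans (integral_zero' _ _)
    filter_upwards [ae_restrict_of_ae_restrict_of_subset hab hy] with t ht
    rw [ht, norm_zero, Pi.zero_apply]
  rw [integral_eq_zero_iff_of_nonneg (fun _ => norm_nonneg _) (hg.2 a b hab).norm] at h5
  filter_upwards [h5] with z hz
  simpa using hz

lemma H1Field.derivatives_ae_eq_zero (hI : I.OrdConnected)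
    (hne : (interior I).Nonempty) (F : H1Field I)
    (h0 : ∀ᵐ z ∂volume.restrict (cyl I), F.val z = 0) :
    ∀ᵐ z ∂volume.restrict (cyl I), F.dt z = 0 ∧ F.dx z = 0 := by
  have hl := F.val_bdd.locInt one_le_two
  have ht := F.dt_bdd.locInt one_le_two
  have hx := F.dx_bdd.locInt one_le_two
  have h1 : LocInt I (fun z => F.dt z + 1 * F.dx z) := by
    simp only [one_mul]
    exact ⟨ht.1.add hx.1, fun a b hab => (ht.2 a b hab).add (hx.2 a b hab)⟩
  filter_upwards [(F.weakDir_zero one_le_two).ae_eq_zero hI hne hl ht h0,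
    (F.weakDir one_le_two 1).ae_eq_zero hI hne hl h1 h0] with z hz hz'
  refine ⟨hz, ?_⟩
  linarith

/-- A uniform limit of functions tending uniformly to zero vanishes. -/
lemma H1Converges.ae_eq_zero (hI : I.OrdConnected) {F : ℕ → H1Field I} {G : H1Field I}
    (h : H1Converges F G)
    (h0 : ∀ a b, Icc a b ⊆ I → ∃ e : ℕ → ℝ, Tendsto e atTop (𝓝 0) ∧
      ∀ n, ∀ t ∈ Icc a b, ∀ θ, |(F n).val (t, θ)| ≤ e n) :
    ∀ᵐ z ∂volume.restrict (cyl I), G.val z = 0 := by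
  refine ae_cyl_of_forall_Icc hI fun a b hab => ?_
  obtain ⟨e, he, hb⟩ := h0 a b hab
  have hall : ∀ ε > 0, ∀ᵐ z ∂volume.restrict (cyl (Icc a b)), |G.val z| ≤ 2 * ε :=
    fun ε hε => by
      obtain ⟨n, hn, hn'⟩ := ((h.uConv a b hab ε hε).and (he.eventually_lt_const hε)).exists
      filter_upwards [hn, ae_restrict_mem (measurableSet_cyl measurableSet_Icc)] with z hz hzm
      have h1 := hb n z.1 hzm.1 z.2
      have h2 := abs_sub_abs_le_abs_sub (G.val z) ((F n).val z)
      rw [abs_sub_comm] at h2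
      linarith
  have hall' := ae_all_iff.2 fun m : ℕ => hall (1 / (m + 1)) Nat.one_div_pos_of_nat
  filter_upwards [hall'] with z hz
  have h3 : Tendsto (fun m : ℕ => 2 * (1 / ((m : ℝ) + 1))) atTop (𝓝 (2 * 0)) :=
    tendsto_one_div_add_atTop_nhds_zero_nat.const_mul 2
  rw [mul_zero] at h3
  exact abs_eq_zero.1 (le_antisymm (ge_of_tendsto' h3 hz) (abs_nonneg _))

lemma EnergyBound.comp {P Q : ℕ → H1Field I} (h : EnergyBound P Q) {k : ℕ → ℕ}
    (hk : StrictMono k) : EnergyBound (fun n => P (k n)) (fun n => Q (k n)) := fun a b hab => by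
  obtain ⟨C, hC⟩ := h a b hab
  exact ⟨C, hk.tendsto_atTop.eventually hC⟩

lemma eLpNorm_torus_le {f : Torus → ℝ} {C : ℝ≥0} (h : ∀ θ, |f θ| ≤ C) :
    eLpNorm f 2 volume ≤ C := by
  refine (eLpNorm_le_of_ae_bound (ae_of_all _ h)).trans ?_
  simp

section LossOfConstraints

variable (hI : I.OrdConnected) (hpos : I ⊆ Ioi 0) {a : ℕ → ℝ → ℝ}
  (ha : ∀ n : ℕ, IsMode (2 * π * ((n + 1 : ℕ) : ℤ)) (a n)) {t₀ : ℝ} (ht₀ : 0 < t₀)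
  (h1 : ∀ n : ℕ, modeEnergy (2 * π * ((n + 1 : ℕ) : ℤ)) (a n) t₀ = 1)

include hpos ha ht₀ h1

lemma exists_modeEnergy_le {p q : ℝ} (hpq : Icc p q ⊆ I) :
    ∃ K : ℝ, 0 ≤ K ∧ ∀ n : ℕ, ∀ t ∈ Icc p q,
      modeEnergy (2 * π * ((n + 1 : ℕ) : ℤ)) (a n) t ≤ K := by
  refine ⟨1 + t₀ ^ 2 / p ^ 2, by positivity, fun n t ht => ?_⟩
  exact (ha n).modeEnergy_le ht₀ (h1 n) (hpos (hpq (Set.left_mem_Icc.2 (ht.1.trans ht.2)))) ht.1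

lemma exists_mode_bounds {p q : ℝ} (hpq : Icc p q ⊆ I) :
    ∃ K : ℝ, 0 ≤ K ∧ ∀ n : ℕ, ∀ t ∈ Icc p q, |a n t| ≤ K / ((n : ℝ) + 1) ∧
      |deriv (a n) t| ≤ K ∧ |a n t * (2 * π * ((n + 1 : ℕ) : ℤ))| ≤ K := by
  obtain ⟨K, hK, h⟩ := exists_modeEnergy_le hpos ha ht₀ h1 hpq
  refine ⟨1 + K, by linarith, fun n t ht => ?_⟩
  have hE := h n t ht
  rw [modeEnergy] at hE
  have e1 : |a n t * (2 * π * ((n + 1 : ℕ) : ℤ))| ≤ 1 + K :=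
    abs_le_of_sq_le_sq (by nlinarith [sq_nonneg (deriv (a n) t)]) (by linarith)
  have e2 : |deriv (a n) t| ≤ 1 + K :=
    abs_le_of_sq_le_sq (by nlinarith [sq_nonneg (2 * π * ((n + 1 : ℕ) : ℤ) * a n t)])
      (by linarith)
  refine ⟨?_, e2, e1⟩
  have hn : (0 : ℝ) < (n : ℝ) + 1 := by positivity
  rw [le_div_iff₀ hn]
  refine le_trans ?_ e1
  rw [abs_mul]
  push_cast
  refine mul_le_mul_of_nonneg_left ?_ (abs_nonneg _)
  rw [abs_of_pos (by positivity)]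
  nlinarith [Real.pi_gt_three]

lemma energyBound_modes :
    EnergyBound (fun n => (ha n).field hI) (fun _ => SobolevField.const hI 0) := by
  intro p q hpq
  obtain ⟨K, hK, h⟩ := exists_mode_bounds hpos ha ht₀ h1 hpq
  lift K to ℝ≥0 using hK
  refine ⟨K, Eventually.of_forall fun n f hf => ?_⟩
  filter_upwards [ae_restrict_mem measurableSet_Icc] with t ht
  refine eLpNorm_torus_le fun θ => ?_
  obtain ⟨h2, h3, h4⟩ := h n t ht
  have h2' : |a n t| ≤ K := h2.trans (div_le_self K.2 (by
    have : (0 : ℝ) ≤ n := Nat.cast_nonneg n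
    linarith))
  have hc := abs_cosine_le ((n + 1 : ℕ) : ℤ) θ
  have hs := abs_sine_le ((n + 1 : ℕ) : ℤ) θ
  simp only [List.mem_cons, List.not_mem_nil, or_false] at hf
  rcases hf with rfl | rfl | rfl | rfl | rfl | rfl
  · rw [(ha n).field_val hI, abs_mul]
    exact (mul_le_of_le_one_right (abs_nonneg _) hc).trans h2'
  · simp [SobolevField.const]
  · rw [(ha n).field_dt hI, abs_mul]
    exact (mul_le_of_le_one_right (abs_nonneg _) hc).trans h3
  · simp [SobolevField.const]
  · rw [(ha n).field_dx hI, neg_mul, mul_neg, abs_neg, ← mul_assoc, abs_mul]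
    exact (mul_le_of_le_one_right (abs_nonneg _) hs).trans h4
  · simp [SobolevField.const]

/-- The averages of `μ` are bounded along these solutions, so that no constants need be subtracted. -/
lemma boundedAverages_modes (hne : (interior I).Nonempty) :
    BoundedAverages (fun n => (ha n).field hI) (fun n => (ha n).lam hI) := by
  obtain ⟨p, q, hpq, hsub⟩ := exists_Icc_subset hne
  obtain ⟨K, hK, h⟩ := exists_mode_bounds hpos ha ht₀ h1 hsub
  obtain ⟨K', hK', h'⟩ := exists_modeEnergy_le hpos ha ht₀ h1 hsub
  have hp : 0 < p := hpos (hsub (Set.left_mem_Icc.2 hpq.le))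
  refine ⟨p, q, hpq, hsub, (1 / 2 * (q ^ 2 * K' + q * K * K) + 1 / 2 * (q * K * K) + K)
    * volume.real (cyl (Icc p q)), fun n => ?_⟩
  have hv : volume (cyl (Icc p q)) < ⊤ := (isCompact_cyl_Icc p q).measure_lt_top
  rw [← Real.norm_eq_abs]
  refine norm_setIntegral_le_of_norm_le_const hv fun z hz => ?_
  obtain ⟨h2, h3, -⟩ := h n z.1 hz.1
  have h2' : |a n z.1| ≤ K := h2.trans (div_le_self hK (by
    have : (0 : ℝ) ≤ n := Nat.cast_nonneg n
    linarith))
  have hE := h' n z.1 hz.1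
  have hE0 : 0 ≤ modeEnergy (2 * π * ((n + 1 : ℕ) : ℤ)) (a n) z.1 := by
    rw [modeEnergy]; positivity
  have hz0 : 0 ≤ z.1 := hp.le.trans hz.1.1
  have hzq : z.1 ≤ q := hz.1.2
  have hq : 0 ≤ q := hz0.trans hzq
  have h4 : |z.1 * a n z.1 * deriv (a n) z.1| ≤ q * K * K := by
    rw [abs_mul, abs_mul, abs_of_nonneg hz0]
    gcongr
  have h5 : |z.1 ^ 2 * modeEnergy (2 * π * ((n + 1 : ℕ) : ℤ)) (a n) z.1| ≤ q ^ 2 * K' := by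
    rw [abs_of_nonneg (by positivity)]
    gcongr
  have hc := abs_cosine_le ((n + 1 : ℕ) : ℤ) z.2
  have hc' := abs_cosine_le (((n + 1 : ℕ) : ℤ) + ((n + 1 : ℕ) : ℤ)) z.2
  have hv : ((ha n).lam hI).val z = lamMean (2 * π * ((n + 1 : ℕ) : ℤ)) (a n) z.1
      + lamAmplitude (a n) z.1 * cosine (((n + 1 : ℕ) : ℤ) + ((n + 1 : ℕ) : ℤ)) z.2 := rfl
  rw [hv, (ha n).field_val hI, Real.norm_eq_abs]
  refine (abs_add_le _ _).trans (add_le_add ((abs_add_le _ _).trans (add_le_add ?_ ?_)) ?_)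
  · rw [lamMean, abs_mul, abs_of_pos (by norm_num : (0 : ℝ) < 1 / 2)]
    gcongr
    exact (abs_add_le _ _).trans (add_le_add h5 h4)
  · rw [abs_mul]
    refine (mul_le_of_le_one_right (abs_nonneg _) hc').trans ?_
    rw [lamAmplitude, abs_mul, abs_of_pos (by norm_num : (0 : ℝ) < 1 / 2)]
    gcongr
  · rw [abs_mul]
    exact (mul_le_of_le_one_right (abs_nonneg _) hc).trans h2'

omit hpos in
/-- The energy of the oscillations does not vanish in the limit. -/
lemma le_integral_modes {q : ℝ} {ρ : ℝ → ℝ} (hρ : Continuous ρ) (hρ0 : ∀ t, 0 ≤ ρ t)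
    (hρ1 : ∫ t in Icc t₀ q, ρ t = 1) (n : ℕ) :
    1 / 2 * (t₀ ^ 2 / q) ≤ ∫ z in cyl (Icc t₀ q),
      (((ha n).lam hI).dt z + ((ha n).field hI).dt z) * ρ z.1 := by
  have hm := (ha n).contDiff_deriv.continuous
  have hm0 := (ha n).smooth.continuous
  have hk : ((n + 1 : ℕ) : ℤ) ≠ 0 := by positivity
  have hkk : ((n + 1 : ℕ) : ℤ) + ((n + 1 : ℕ) : ℤ) ≠ 0 := by positivity
  have hcos : ∀ k : ℤ, Continuous (cosine k) := continuous_fourier_re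
  have hcont : Continuous fun z => (((ha n).lam hI).dt z + ((ha n).field hI).dt z) * ρ z.1 :=
    (((ha n).smoothFn_lam.partialT_smooth.continuous).add
      (ha n).smoothFn.partialT_smooth.continuous).mul (hρ.comp continuous_fst)
  rw [setIntegral_cyl (hcont.continuousOn.integrableOn_compact (isCompact_cyl_Icc t₀ q))]
  have hin : ∀ t, ∫ θ, (((ha n).lam hI).dt (t, θ) + ((ha n).field hI).dt (t, θ)) * ρ t
      = 1 / 2 * t * modeEnergy (2 * π * ((n + 1 : ℕ) : ℤ)) (a n) t * ρ t := fun t => by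
    simp only [(ha n).lam_dt hI, (ha n).field_dt hI]
    have i1 : ∀ (k : ℤ) (x : ℝ), Integrable fun θ => x * cosine k θ := fun k x =>
      (continuous_const.mul (hcos k)).integrable_of_hasCompactSupport
        (HasCompactSupport.of_compactSpace _)
    have i2 : ∀ (k : ℤ) (x y : ℝ), Integrable fun θ => x + y * cosine k θ := fun k x y =>
      (integrable_const x).add (i1 k y)
    rw [integral_mul_const, integral_add (i2 _ _ _) (i1 _ _),
      integral_add (integrable_const _) (i1 _ _), integral_const, integral_const_mul, integral_const_mul,
      integral_cosine hk, integral_cosine hkk]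
    simp
  simp only [hin]
  have hc2 : Continuous fun t =>
      1 / 2 * t * modeEnergy (2 * π * ((n + 1 : ℕ) : ℤ)) (a n) t * ρ t := by
    unfold modeEnergy
    fun_prop
  calc 1 / 2 * (t₀ ^ 2 / q) = ∫ t in Icc t₀ q, 1 / 2 * (t₀ ^ 2 / q) * ρ t := by
        rw [integral_const_mul, hρ1, mul_one]
    _ ≤ _ := by
        refine setIntegral_mono_on ((continuous_const.mul hρ).continuousOn.integrableOn_compact
          isCompact_Icc) (hc2.continuousOn.integrableOn_compact isCompact_Icc) measurableSet_Icc
          fun t ht => mul_le_mul_of_nonneg_right ?_ (hρ0 t)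
        have htp : 0 < t := ht₀.trans_le ht.1
        have h2 := (ha n).le_modeEnergy ht₀ (h1 n) ht.1
        have h3 : t₀ ^ 2 / q ≤ t₀ ^ 2 / t := by gcongr; exact ht.2
        have h4 : t₀ ^ 2 / t
            ≤ t * modeEnergy (2 * π * ((n + 1 : ℕ) : ℤ)) (a n) t := by
          rw [div_le_iff₀ htp]
          linarith
        rw [mul_assoc]
        linarith

end LossOfConstraints

/-- Oscillations of increasing frequency: along the solutions `Pⁿ = aₙ(t) cos (2 π (n + 1) θ)`,
`Qⁿ = 0`, normalised to have energy one at a given time, `Pⁿ` tends to zero while `λⁿ_t` does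
not. -/
theorem exists_loss_of_constraints (hI : I.OrdConnected) (hpos : I ⊆ Ioi 0)
    (hne : (interior I).Nonempty) :
    ∃ (P Q : ℕ → H1Field I) (lam : ℕ → W11Field I) (P' Q' : H1Field I) (mu : BVField I),
      (∀ n, IsGowdySolution (P n) (Q n) (lam n)) ∧
      EnergyBound P Q ∧
      H1Converges P P' ∧ H1Converges Q Q' ∧
      MuConverges P lam (fun _ => 0) mu ∧
      ¬ Constraints P' Q' mu := by
  obtain ⟨ρ, hρ, hρ0, hρ1⟩ := exists_timeTest hne
  obtain ⟨t₀, q, hsub, hs⟩ := hρ.2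
  have hsubI : Icc t₀ q ⊆ I := hsub.trans interior_subset
  have hρ1' : ∫ t in Icc t₀ q, ρ t = 1 := by
    rw [← hρ1]
    exact setIntegral_eq_integral_of_forall_compl_eq_zero hs
  have hle : t₀ ≤ q := by
    by_contra hlt
    rw [Set.Icc_eq_empty hlt, setIntegral_empty] at hρ1'
    exact zero_ne_one hρ1'
  have ht₀ : 0 < t₀ := hpos (hsubI (Set.left_mem_Icc.2 hle))
  have hw : ∀ n : ℕ, 2 * π * (((n + 1 : ℕ) : ℤ) : ℝ) ≠ 0 := fun n => by
    push_cast
    positivity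
  choose a ha h1 using fun n : ℕ => exists_mode (hw n) ht₀
  have hsol := fun n => (ha n).isGowdySolution hI hpos
  have hE := energyBound_modes hI hpos ha ht₀ h1
  obtain ⟨k, c, P', Q', mu, -, -, hk, hc, hP, hQ, hmu, -⟩ :=
    exists_convergent_subsequence hI hpos hne _ _ _ hsol hE
  obtain rfl : c = fun _ => 0 := funext (hc (boundedAverages_modes hI hpos ha ht₀ h1 hne))
  refine ⟨_, _, _, P', Q', mu, fun n => hsol (k n), hE.comp hk, hP, hQ, hmu, fun hcon => ?_⟩
  have hP0 : ∀ᵐ z ∂volume.restrict (cyl I), P'.val z = 0 := by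
    refine hP.ae_eq_zero hI fun p q hpq => ?_
    obtain ⟨K, -, h⟩ := exists_mode_bounds hpos ha ht₀ h1 hpq
    refine ⟨fun n => K / ((k n : ℝ) + 1), ?_, fun n t ht θ => ?_⟩
    · have h2 := (tendsto_one_div_add_atTop_nhds_zero_nat.const_mul K).comp hk.tendsto_atTop
      rw [mul_zero] at h2
      refine h2.congr fun n => ?_
      simp only [Function.comp]
      ring
    · rw [(ha (k n)).field_val hI, abs_mul]
      exact (mul_le_of_le_one_right (abs_nonneg _) (abs_cosine_le _ θ)).trans (h (k n) t ht).1
  have hQ0 : ∀ᵐ z ∂volume.restrict (cyl I), Q'.val z = 0 :=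
    hQ.ae_eq_zero hI fun p q _ => ⟨fun _ => 0, tendsto_const_nhds, fun n t _ θ => by
      simp [SobolevField.const]⟩
  -- The constraint equation for the limit, tested with `t ρ(t)`, has vanishing right-hand side.
  have hψ : IsTestFunction I (fun z => ρ z.1 * z.1) :=
    hρ.isTestFunction.mul_smooth (SmoothFn.of_time contDiff_id)
  have h2 := (hcon _ hψ).1
  have e1 : (fun z : ℝ × Torus => 1 / z.1 * (ρ z.1 * z.1)) = fun z => ρ z.1 := funext fun z => by
    by_cases hz : z.1 = 0
    · have : ρ z.1 = 0 := hs _ fun hm => by linarith [hm.1]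
      simp [this]
    · field_simp
  have e2 : ∫ z in cyl I, (1 / z.1 * P'.dt z + energyDensity P' Q' z) * (ρ z.1 * z.1) = 0 := by
    refine (integral_congr_ae ?_).trans (integral_zero' _ _)
    filter_upwards [P'.derivatives_ae_eq_zero hI hne hP0, Q'.derivatives_ae_eq_zero hI hne hQ0]
      with z hz hz'
    simp [energyDensity, hz.1, hz.2, hz'.1, hz'.2]
  rw [e1, e2, add_zero, pairing_congr_support hI.measurableSet hsubI fun t ht _ => hs t ht] at h2
  have h3 := (hmu.2 t₀ q hsubI).2.1 (fun z => ρ z.1) (hρ.1.continuous.comp continuous_fst)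
  rw [h2] at h3
  have h4 := ge_of_tendsto' h3 fun n =>
    le_integral_modes hI ha ht₀ h1 hρ.1.continuous hρ0 hρ1' (k n)
  have h5 : 0 < 1 / 2 * (t₀ ^ 2 / q) := by
    have := ht₀.trans_le hle
    positivity
  linarith

end Gowdy

theorem mainTheorem2 (I : Set ℝ) (hI : I.OrdConnected) (hpos : I ⊆ Set.Ioi 0)
    (hne : (interior I).Nonempty) :
    (∀ (P Q : ℕ → Gowdy.H1Field I) (lam : ℕ → Gowdy.W11Field I),
      (∀ n, Gowdy.IsGowdySolution (P n) (Q n) (lam n)) →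
      Gowdy.EnergyBound P Q →
      ∃ (k : ℕ → ℕ) (c : ℕ → ℝ) (P' Q' : Gowdy.H1Field I) (mu φ : Gowdy.BVField I) (κ : ℝ),
        StrictMono k ∧
        (Gowdy.BoundedAverages P lam → ∀ n, c n = 0) ∧
        Gowdy.H1Converges (fun n => P (k n)) P' ∧
        Gowdy.H1Converges (fun n => Q (k n)) Q' ∧
        Gowdy.MuConverges (fun n => P (k n)) (fun n => lam (k n)) c mu ∧
        Gowdy.IsH1BVSolution P' Q' mu ∧
        Gowdy.DefectConstraints P' Q' mu φ κ ∧
        Gowdy.WaveEq I φ.val (fun _ => 0) ∧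
        (∀ᵐ t ∂(MeasureTheory.volume.restrict I),
          κ = -(2 * t) * ∫ θ : Gowdy.Torus, Gowdy.momentumDensity P' Q' (t, θ))) ∧
    (∃ (P Q : ℕ → Gowdy.H1Field I) (lam : ℕ → Gowdy.W11Field I)
        (P' Q' : Gowdy.H1Field I) (mu : Gowdy.BVField I),
      (∀ n, Gowdy.IsGowdySolution (P n) (Q n) (lam n)) ∧
      Gowdy.EnergyBound P Q ∧
      Gowdy.H1Converges P P' ∧ Gowdy.H1Converges Q Q' ∧
      Gowdy.MuConverges P lam (fun _ => 0) mu ∧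
      ¬ Gowdy.Constraints P' Q' mu) := by
  exact ⟨fun P Q lam hsol hE =>
    Gowdy.exists_convergent_subsequence hI hpos hne P Q lam hsol hE,
    Gowdy.exists_loss_of_constraints hI hpos hne⟩
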